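/- Let $(M,\omega)$ be a finite-dimensional smooth symplectic manifold (Hausdorff, second countable, of dimension $2n$), let $\Lambda\subset TM$ be a smooth Lagrangian distribution and $H:M\to\mathbb R$ a smooth function. Let $\vec H$ be its Hamiltonian vector field, $\omega(\vec H,\cdot)=-dH$, and let $\varphi_t$ be the flow of $\vec H$. Call $\vec H$ monotone if the symmetric bilinear form $\langle V_1,V_2\rangle=\omega([\vec H,V_1],V_2)$ ($V_1,V_2$ sections of $\Lambda$) is positive definite on $\Lambda$. A canonical frame of a curve $J(t)$ of Lagrangian subspaces of a $2m$-dimensional symplectic vector space $(\mathcal V,\omega)$ is a smooth family of bases $e^1(t),\dots,e^m(t),f^1(t),\dots,f^m(t)$ of $\mathcal V$ with $e^i(t)\in J(t)$, $f^i=\dot e^i$, $\omega(e^i,e^j)=\omega(f^i,f^j)=0$, $\omega(f^i,e^j)=\delta_{ij}$. The curvature operators $R(t):J(t)\to J(t)$ of $J$ are defined by $\dot f^i(t)=-R(t)e^i(t)$; they do not depend on the canonical frame. The Jacobi curve at $\alpha\in M$ is $J_\alpha(t)=(d\varphi_t)^{-1}(\Lambda_{\varphi_t(\alpha)})\subset T_\alpha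 M$. Write $\vec H^\angle=\{v\in T_\alpha M:\omega(\vec H(\alpha),v)=0\}$. The reduced Jacobi curve $\tilde J_\alpha(t)$ is the image of $J_\alpha(t)\cap\vec H^\angle$ in the reduced symplectic space $\vec H^\angle/\mathbb R\vec H(\alpha)$. The reduced curvature $\tilde{\mathfrak R}_\alpha$ of $\vec H$ at $\alpha$ is the curvature operator of $\tilde J_\alpha$ at time $0$, and $\tilde{\mathfrak r}_\alpha=\operatorname{tr}\tilde{\mathfrak R}_\alpha$ is its trace. Theorem. Let $\vec H$ be monotone and let $c$ be a regular value of $H$ such that $\Sigma_c:=H^{-1}(c)$ is compact. Assume that $\varphi_t$ has no conjugate point on $\Sigma_c$, that is, for all $\alpha\in\Sigma_c$ and $t>0$ the subspaces $d\varphi_t(\Lambda_\alpha)$ and $\Lambda_{\varphi_t(\alpha)}$ of $T_{\varphi_t(\alpha)}M$ intersect transversely. Let $\mu$ be a finite Borel measure on $\Sigma_c$ which is invariant under $\varphi_t$. Then $\tilde{\mathfrak r}$ is $\mu$-integrable on $\Sigma_c$ and \[ \int_{\Sigma_c}\tilde{\mathfrak r}_\alpha\,d\mu(\alpha)\le 0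 . \] Moreover, equality holds only if $\tilde{\mathfrak r}\equiv 0$ on the support of $\mu$. -/

import Mathlib

open Set Filter MeasureTheory Bundle
open scoped Manifold ContDiff Topology

/-! ### Linear symplectic algebra and curves of Lagrangian subspaces -/

section Linear

variable {V : Type*} [AddCommGroup V] [Module ℝ V]

/-- `L` is a Lagrangian subspace of `(V, B)`: it is isotropic and of half the dimension. -/
def IsLagrangianSubspace (B : LinearMap.BilinForm ℝ V) (L : Submodule ℝ V) : Prop :=
  (∀ v ∈ L, ∀ w ∈ L, B v w = 0) ∧ 2 * Module.finrank ℝ L = Module.finrank ℝ V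

/-- A curve in a finite-dimensional vector space is smooth: all its (linear) coordinates are. -/
def IsSmoothCurve (γ : ℝ → V) : Prop :=
  ∀ l : Module.Dual ℝ V, ContDiff ℝ ∞ (fun t => l (γ t))

/-- The curve `γ` in a finite-dimensional vector space has velocity `γ'` at every time. -/
def HasVelocity (γ γ' : ℝ → V) : Prop :=
  ∀ (l : Module.Dual ℝ V) (t : ℝ), HasDerivAt (fun s => l (γ s)) (l (γ' t)) t

/-- `e₁,…,eₘ,f₁,…,fₘ` is a Darboux basis of `(V, B)`: a basis with
`B(eᵢ,eⱼ) = B(fᵢ,fⱼ) = 0` and `B(fᵢ,eⱼ) = δᵢⱼ`. -/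
structure IsDarbouxBasis (B : LinearMap.BilinForm ℝ V) {m : ℕ} (e f : Fin m → V) : Prop where
  linearIndependent : LinearIndependent ℝ (Sum.elim e f)
  span_eq_top : Submodule.span ℝ (range e ∪ range f) = ⊤
  e_e : ∀ i j, B (e i) (e j) = 0
  f_f : ∀ i j, B (f i) (f j) = 0
  f_e : ∀ i j, B (f i) (e j) = if i = j then 1 else 0

/-- A canonical frame of the curve `J` of Lagrangian subspaces of `(V, B)`: a smooth family of
Darboux bases `e(t), f(t)` with `eᵢ(t) ∈ J(t)` and `fᵢ = deᵢ/dt`. -/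
structure IsCanonicalFrame (B : LinearMap.BilinForm ℝ V) (J : ℝ → Submodule ℝ V) {m : ℕ}
    (e f : Fin m → ℝ → V) : Prop where
  smooth : ∀ i, IsSmoothCurve (e i)
  mem : ∀ i t, e i t ∈ J t
  velocity : ∀ i, HasVelocity (e i) (f i)
  darboux : ∀ t, IsDarbouxBasis B (fun i => e i t) (fun i => f i t)

/-- `R` is the family of curvature operators of the curve `J`: for some canonical frame the
structural equations `deᵢ/dt = fᵢ`, `dfᵢ/dt = - R(t) eᵢ(t)` hold. -/
def IsCurvatureOperator (B : LinearMap.BilinForm ℝ V) (J : ℝ → Submodule ℝ V)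
    (R : ∀ t, J t →ₗ[ℝ] J t) : Prop :=
  ∃ (m : ℕ) (e f : Fin m → ℝ → V) (h : IsCanonicalFrame B J e f),
    ∀ i, HasVelocity (f i) (fun t => -(R t ⟨e i t, h.mem i t⟩ : V))

open Classical in
/-- The curvature operators `R(t) : J(t) → J(t)` of the curve `J`. They do not depend on the
canonical frame; the value is `0` if there is no canonical frame. -/
noncomputable def curvatureOperator (B : LinearMap.BilinForm ℝ V) (J : ℝ → Submodule ℝ V) (t : ℝ) :
    J t →ₗ[ℝ] J t :=
  if h : ∃ R : ∀ t, J t →ₗ[ℝ] J t, IsCurvatureOperator B J R then h.choose t else 0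

/-- The skew-orthogonal complement of the vector `v`. -/
abbrev skewComplement (B : LinearMap.BilinForm ℝ V) (v : V) : Submodule ℝ V :=
  LinearMap.ker (B v)

/-- The line `ℝ v`, as a subspace of the skew-orthogonal complement of `v`. -/
abbrev lineInSkewComplement (B : LinearMap.BilinForm ℝ V) (v : V) :
    Submodule ℝ (skewComplement B v) :=
  (Submodule.span ℝ {v}).comap (skewComplement B v).subtype

/-- The symplectic reduction of `V` by `v`: the skew-orthogonal complement of `v` modulo `ℝ v`. -/
abbrev ReducedSpace (B : LinearMap.BilinForm ℝ V) (v : V) : Type _ :=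
  skewComplement B v ⧸ lineInSkewComplement B v

/-- The form induced by `B` on the symplectic reduction by `v`. -/
noncomputable def reducedForm (B : LinearMap.BilinForm ℝ V) (hB : B.IsAlt) (v : V) :
    LinearMap.BilinForm ℝ (ReducedSpace B v) :=
  (lineInSkewComplement B v).liftQ
    { toFun := fun w => (lineInSkewComplement B v).liftQ
        ((B w).comp (skewComplement B v).subtype) (by
          intro u hu
          obtain ⟨a, ha⟩ := Submodule.mem_span_singleton.1 (Submodule.mem_comap.1 hu)
          have hw : B v w = 0 := w.2
          have h : B w v = 0 := by
            rw [← LinearMap.IsAlt.neg hB v w, hw, neg_zero]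
          have hu' : (u : V) = a • v := ha.symm
          simp [hu', h])
      map_add' := by
        intro w w'
        ext u
        simp
      map_smul' := by
        intro a w
        ext u
        simp }
    (by
      intro u hu
      obtain ⟨a, ha⟩ := Submodule.mem_span_singleton.1 (Submodule.mem_comap.1 hu)
      have hu' : (u : V) = a • v := ha.symm
      rw [LinearMap.mem_ker]
      ext w
      have hw : B v w = 0 := w.2
      simp [hu', hw])

theorem reducedForm_mk (B : LinearMap.BilinForm ℝ V) (hB : B.IsAlt) (v : V)
    (w u : skewComplement B v) :
    reducedForm B hB v (Submodule.Quotient.mk w) (Submodule.Quotient.mk u) = B w u := rfl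

/-- The subspace of the symplectic reduction induced by `L`: the image of the intersection of `L`
with the skew-orthogonal complement of `v`. -/
def reducedSubspace (B : LinearMap.BilinForm ℝ V) (v : V) (L : Submodule ℝ V) :
    Submodule ℝ (ReducedSpace B v) :=
  (L.comap (skewComplement B v).subtype).map (lineInSkewComplement B v).mkQ

end Linear

/-! ### Symplectic manifolds, Lagrangian distributions and Hamiltonian flows -/

section Manifold

variable {E : Type*} [NormedAddCommGroup E] [NormedSpace ℝ E]
  {M : Type*} [TopologicalSpace M] [ChartedSpace E M] [IsManifold 𝓘(ℝ, E) ∞ M]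

/-- The vector field `X` is smooth at `x`. -/
def SmoothFieldAt (X : ∀ x : M, TangentSpace 𝓘(ℝ, E) x) (x : M) : Prop :=
  ContMDiffAt 𝓘(ℝ, E) 𝓘(ℝ, E).tangent ∞ (fun y => (⟨y, X y⟩ : TangentBundle 𝓘(ℝ, E) M)) x

/-- The derivative of the real function `g` at `x` in the direction `v`. -/
noncomputable def dirDeriv (g : M → ℝ) (x : M) (v : TangentSpace 𝓘(ℝ, E) x) : ℝ :=
  mfderiv 𝓘(ℝ, E) 𝓘(ℝ, ℝ) g x v

variable (E M) in
/-- A symplectic form on `M`: a smooth closed nondegenerate 2-form. Closedness is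
`dσ(X,Y,Z) = 0` for all vector fields, with `dσ` written by the invariant formula. -/
structure SymplecticForm where
  toFun : ∀ x : M, TangentSpace 𝓘(ℝ, E) x →L[ℝ] TangentSpace 𝓘(ℝ, E) x →L[ℝ] ℝ
  smooth : ContMDiff 𝓘(ℝ, E) (𝓘(ℝ, E).prod 𝓘(ℝ, E →L[ℝ] E →L[ℝ] ℝ)) ∞
    (fun x => TotalSpace.mk' (E →L[ℝ] E →L[ℝ] ℝ) x (toFun x))
  alternating : ∀ x v, toFun x v v = 0
  nondegenerate : ∀ x v, (∀ w, toFun x v w = 0) → v = 0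
  closed : ∀ (X Y Z : ∀ x : M, TangentSpace 𝓘(ℝ, E) x) (x : M),
    SmoothFieldAt X x → SmoothFieldAt Y x → SmoothFieldAt Z x →
    dirDeriv (fun y => toFun y (Y y) (Z y)) x (X x)
      + dirDeriv (fun y => toFun y (Z y) (X y)) x (Y x)
      + dirDeriv (fun y => toFun y (X y) (Y y)) x (Z x)
      - toFun x (VectorField.mlieBracket 𝓘(ℝ, E) X Y x) (Z x)
      - toFun x (VectorField.mlieBracket 𝓘(ℝ, E) Y Z x) (X x)
      - toFun x (VectorField.mlieBracket 𝓘(ℝ, E) Z X x) (Y x) = 0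

namespace SymplecticForm

variable (σ : SymplecticForm E M)

/-- The symplectic form at the point `x`, as a bilinear form on the tangent space. -/
noncomputable def form (x : M) : LinearMap.BilinForm ℝ (TangentSpace 𝓘(ℝ, E) x) :=
  LinearMap.mk₂ ℝ (fun v w => σ.toFun x v w) (by simp) (by simp) (by simp) (by simp)

theorem form_apply (x : M) (v w : TangentSpace 𝓘(ℝ, E) x) : σ.form x v w = σ.toFun x v w := rfl

theorem form_isAlt (x : M) : (σ.form x).IsAlt := fun v => σ.alternating x v

theorem exists_hamiltonianVector [FiniteDimensional ℝ E] (H : M → ℝ) (x : M) :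
    ∃ X : TangentSpace 𝓘(ℝ, E) x, ∀ v, σ.form x X v = -dirDeriv H x v := by
  have : FiniteDimensional ℝ (TangentSpace 𝓘(ℝ, E) x) := inferInstanceAs (FiniteDimensional ℝ E)
  have hinj : Function.Injective (σ.form x) := by
    rw [injective_iff_map_eq_zero]
    intro v hv
    exact σ.nondegenerate x v fun w => by
      have := LinearMap.congr_fun hv w
      simpa [form_apply] using this
  have hsurj : Function.Surjective (σ.form x) :=
    (LinearMap.injective_iff_surjective_of_finrank_eq_finrank
      (Subspace.dual_finrank_eq (K := ℝ) (V := TangentSpace 𝓘(ℝ, E) x)).symm).1 hinj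
  obtain ⟨X, hX⟩ := hsurj
    (-(mfderiv 𝓘(ℝ, E) 𝓘(ℝ, ℝ) H x : TangentSpace 𝓘(ℝ, E) x →L[ℝ] ℝ).toLinearMap)
  exact ⟨X, fun v => by rw [hX]; rfl⟩

/-- The Hamiltonian vector field of `H`, determined by `σ(X_H, ·) = -dH`. -/
noncomputable def hamiltonianField [FiniteDimensional ℝ E] (H : M → ℝ) (x : M) :
    TangentSpace 𝓘(ℝ, E) x :=
  (σ.exists_hamiltonianVector H x).choose

theorem hamiltonianField_spec [FiniteDimensional ℝ E] (H : M → ℝ) (x : M)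
    (v : TangentSpace 𝓘(ℝ, E) x) :
    σ.form x (σ.hamiltonianField H x) v = -dirDeriv H x v :=
  (σ.exists_hamiltonianVector H x).choose_spec v

end SymplecticForm

open Classical in
/-- The (maximal) flow of the vector field `X`: `flow X t x = γ t` for an integral curve `γ` of `X`
with `γ 0 = x` on an open interval containing `0` and `t`, if there is one (and `x` if the
integral curve through `x` does not exist up to time `t`). -/
noncomputable def flow (X : ∀ x : M, TangentSpace 𝓘(ℝ, E) x) (t : ℝ) (x : M) : M :=
  if h : ∃ γ : ℝ → M, γ 0 = x ∧ ∃ a b : ℝ, 0 ∈ Ioo a b ∧ t ∈ Ioo a b ∧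
      IsMIntegralCurveOn γ X (Ioo a b) then h.choose t else x

/-- A Lagrangian distribution: a smooth field of Lagrangian subspaces of the tangent spaces. -/
structure LagrangianDistribution (σ : SymplecticForm E M) where
  toFun : ∀ x : M, Submodule ℝ (TangentSpace 𝓘(ℝ, E) x)
  lagrangian : ∀ x, IsLagrangianSubspace (σ.form x) (toFun x)
  smooth : ∀ x, ∃ (k : ℕ) (V : Fin k → ∀ y : M, TangentSpace 𝓘(ℝ, E) y) (U : Set M),
    IsOpen U ∧ x ∈ U ∧ (∀ i, ∀ y ∈ U, SmoothFieldAt (V i) y) ∧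
    ∀ y ∈ U, LinearIndependent ℝ (fun i => V i y) ∧
      Submodule.span ℝ (range fun i => V i y) = toFun y

variable [FiniteDimensional ℝ E]

/-- The Hamiltonian vector field `X_H` is monotone: the canonical symmetric bilinear form
`⟨V(x), W(x)⟩ = σ([X_H, V], W)(x)` (`V`, `W` local sections of `Λ`) is positive definite on `Λ`. -/
def IsMonotoneHamiltonian (σ : SymplecticForm E M) (Λ : LagrangianDistribution σ) (H : M → ℝ) :
    Prop :=
  ∀ (x : M) (V : ∀ y : M, TangentSpace 𝓘(ℝ, E) y), SmoothFieldAt V x →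
    (∀ᶠ y in 𝓝 x, V y ∈ Λ.toFun y) → V x ≠ 0 →
    0 < σ.form x (VectorField.mlieBracket 𝓘(ℝ, E) (σ.hamiltonianField H) V x) (V x)

/-- `c` is a regular value of `H`. -/
def IsRegularValueOf (H : M → ℝ) (c : ℝ) : Prop :=
  ∀ x : M, H x = c → mfderiv 𝓘(ℝ, E) 𝓘(ℝ, ℝ) H x ≠ 0

/-- The differential at `x` of the time `t` map of the Hamiltonian flow. -/
noncomputable def flowDeriv (σ : SymplecticForm E M) (H : M → ℝ) (t : ℝ) (x : M) :
    TangentSpace 𝓘(ℝ, E) x →ₗ[ℝ] TangentSpace 𝓘(ℝ, E) (flow (σ.hamiltonianField H) t x) :=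
  (mfderiv 𝓘(ℝ, E) 𝓘(ℝ, E) (flow (σ.hamiltonianField H) t) x).toLinearMap

/-- The Jacobi curve at `x`: `J(t) = (dφ_t)⁻¹ (Λ_{φ_t(x)})`, a subspace of the tangent space
at `x`. -/
noncomputable def jacobiCurve (σ : SymplecticForm E M) (Λ : LagrangianDistribution σ) (H : M → ℝ)
    (x : M) (t : ℝ) : Submodule ℝ (TangentSpace 𝓘(ℝ, E) x) :=
  (Λ.toFun (flow (σ.hamiltonianField H) t x)).comap (flowDeriv σ H t x)

/-- The Hamiltonian flow has no conjugate points on the set `S`: for `x ∈ S` and `t > 0` the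
subspaces `dφ_t(Λ_x)` and `Λ_{φ_t(x)}` intersect transversely. -/
def HasNoConjugatePointsOn (σ : SymplecticForm E M) (Λ : LagrangianDistribution σ) (H : M → ℝ)
    (S : Set M) : Prop :=
  ∀ x ∈ S, ∀ t : ℝ, 0 < t →
    (Λ.toFun x).map (flowDeriv σ H t x) ⊔ Λ.toFun (flow (σ.hamiltonianField H) t x) = ⊤

/-- The reduced Jacobi curve at `x`: the curve induced by the Jacobi curve in the symplectic
reduction of the tangent space at `x` by the vector `X_H(x)`. -/
noncomputable def reducedJacobiCurve (σ : SymplecticForm E M) (Λ : LagrangianDistribution σ)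
    (H : M → ℝ) (x : M) (t : ℝ) :
    Submodule ℝ (ReducedSpace (σ.form x) (σ.hamiltonianField H x)) :=
  reducedSubspace (σ.form x) (σ.hamiltonianField H x) (jacobiCurve σ Λ H x t)

/-- The reduced curvature operator at `x`: the curvature operator at time `0` of the reduced
Jacobi curve at `x`. -/
noncomputable def reducedCurvature (σ : SymplecticForm E M) (Λ : LagrangianDistribution σ)
    (H : M → ℝ) (x : M) :
    reducedJacobiCurve σ Λ H x 0 →ₗ[ℝ] reducedJacobiCurve σ Λ H x 0 :=
  curvatureOperator (reducedForm (σ.form x) (σ.form_isAlt x) (σ.hamiltonianField H x))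
    (reducedJacobiCurve σ Λ H x) 0

/-- The trace of the reduced curvature operator at `x`. -/
noncomputable def reducedCurvatureTrace (σ : SymplecticForm E M) (Λ : LagrangianDistribution σ)
    (H : M → ℝ) (x : M) : ℝ :=
  LinearMap.trace ℝ (reducedJacobiCurve σ Λ H x 0) (reducedCurvature σ Λ H x)

/-- The measure `μ` on the subset `S` is invariant under the flow of `X`:
`μ(φ_t⁻¹(A)) = μ(A)` for all `t` and all Borel sets `A`. -/
def IsFlowInvariant [MeasurableSpace M] (X : ∀ x : M, TangentSpace 𝓘(ℝ, E) x) {S : Set M}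
    (μ : Measure S) : Prop :=
  ∀ (t : ℝ) (A : Set M), MeasurableSet A →
    μ {x : S | flow X t x ∈ A} = μ {x : S | (x : M) ∈ A}

end Manifold

/-! Take a point `x` of the level and its Jacobi curve `J(t)`, a curve of Lagrangian subspaces of
one fixed symplectic space. Absence of conjugate points makes `J(s)` and `J(t)` transversal for `s <
t`. Hence, for a curve `ξ` with `ξ' ∈ J` which vanishes at both ends of an interval, `∫ B(ξ, ξ') ≥
0`: splitting `ξ` along `J(t)` and one later, fixed `J(T+1)` turns the integrand into a square plus
an exact derivative (`IsMonotoneCurve.integral_form_nonneg`).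

The theorem concerns the reduced curve, obtained by cutting `J` with the skew-complement of `h =
X_H(x)` and dividing by `h`. Its canonical frame lifts to vectors `e_k(t)` of the original space
(`IsMonotoneCurve.exists_reduced_normalFrame`), but upstairs the structural equation acquires a term
along `h`: `e_k'' = c_k h - ∑ R_kl e_l`. A variation with coefficients `a_k` therefore closes up
only if `∫ ∑ a_k c_k = 0`, and the reduced index form is known to be nonnegative only under this one
linear condition (`IsMonotoneCurve.reduced_index_nonneg`). Consequently two variations with disjoint
supports cannot both be negative, since some nonzero combination of them satisfies the condition and
the cross terms vanish. After averaging over the frame this says that `∫ (m ψ'² - ψ² r)` cannot be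
negative for two disjointly supported functions `ψ` along one orbit, where `r` is the trace of the
reduced curvature (`IsMonotoneCurve.reduced_index_alternative`).

The missing direction is recovered by dynamics. If the index over `[0, L]` were negative on a set of
positive measure, Poincaré recurrence would bring almost every orbit from this set back to it and
produce a second, disjoint negative variation. So for almost every orbit the index is nonnegative
(`IsIndexFlow.ae_index_nonneg`). Testing with `ψ(t) = b(t/L) g(φ_t x)`, integrating over the level
and letting `L → ∞` gives `∫ g² r dμ ≤ 2m ∫ (g')² dμ` for every `g` smooth along the flow, `g'`
being its derivative along the flow (`IsIndexFlow.integral_sq_mul_curvature_le`). The choice `g = 1`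
is the inequality. In the case of equality the choice `1 + s g` with small `s` gives `∫ g r dμ = 0`
for all smooth `g`, so `r = 0` almost everywhere.

Regularity of `r` needs care where `X_H ∈ Λ`, since the intersection with the skew-complement jumps
in dimension there. Along each orbit the reduced frame passes smoothly through such times, which are
isolated, so `r` is continuous along orbits. At all other points `r` is continuous on the level,
being given by a formula in iterated brackets with `X_H`. This suffices for measurability and for
the passage from almost everywhere to the support. A uniform lower bound, needed for integrability,
comes from comparison with the unreduced curvature (`normalFrame_trace_ge`). All of this is
condensed in `IsIndexFlow`, after which no symplectic geometry is used. -/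

open scoped Matrix

/-! ### Calculus of bilinear forms along curves -/

section BilinearCurves

variable {V : Type*} [NormedAddCommGroup V] [NormedSpace ℝ V] [FiniteDimensional ℝ V]

theorem HasDerivAt.bilinForm (B : LinearMap.BilinForm ℝ V) {γ δ : ℝ → V} {γ' δ' : V} {t : ℝ}
    (hγ : HasDerivAt γ γ' t) (hδ : HasDerivAt δ δ' t) :
    HasDerivAt (fun s => B (γ s) (δ s)) (B γ' (δ t) + B (γ t) δ') t := by
  have h := B.toContinuousBilinearMap.hasFDerivAt_of_bilinear hγ.hasFDerivAt hδ.hasFDerivAt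
  have h2 := h.hasDerivAt
  refine h2.congr_deriv ?_
  simp [ContinuousLinearMap.precompR_apply, ContinuousLinearMap.precompL_apply, add_comm]

theorem ContDiffAt.bilinForm (B : LinearMap.BilinForm ℝ V) {F : Type*} [NormedAddCommGroup F]
    [NormedSpace ℝ F] {n : WithTop ℕ∞} {γ δ : F → V} {t : F}
    (hγ : ContDiffAt ℝ n γ t) (hδ : ContDiffAt ℝ n δ t) :
    ContDiffAt ℝ n (fun s => B (γ s) (δ s)) t :=
  (B.toContinuousBilinearMap.contDiff.contDiffAt.comp t hγ).clm_apply hδ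

theorem Continuous.bilinForm (B : LinearMap.BilinForm ℝ V) {F : Type*} [TopologicalSpace F]
    {γ δ : F → V} (hγ : Continuous γ) (hδ : Continuous δ) :
    Continuous (fun s => B (γ s) (δ s)) :=
  B.toContinuousBilinearMap.continuous₂.comp (hγ.prodMk hδ)

omit [FiniteDimensional ℝ V] in
theorem ContDiffAt.deriv_smooth {γ : ℝ → V} {t : ℝ} (h : ContDiffAt ℝ ∞ γ t) :
    ContDiffAt ℝ ∞ (deriv γ) t := by
  have : ContDiffAt ℝ ∞ (fun s => fderiv ℝ γ s 1) t :=
    (h.fderiv_right (m := ∞) (by simp)).clm_apply contDiffAt_const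
  exact this

omit [FiniteDimensional ℝ V] in
theorem ContDiffAt.hasDerivAt_deriv {γ : ℝ → V} {t : ℝ} (h : ContDiffAt ℝ ∞ γ t) :
    HasDerivAt γ (deriv γ t) t :=
  (h.differentiableAt (by simp)).hasDerivAt

end BilinearCurves

/-! ### Smooth matrix functions -/

section MatrixFunctions

variable {E : Type*} [NormedAddCommGroup E] [NormedSpace ℝ E]
  {M : Type*} [TopologicalSpace M] [ChartedSpace E M]

theorem ContMDiffAt.matrix_det {m : ℕ} {n : WithTop ℕ∞} {G : M → Matrix (Fin m) (Fin m) ℝ} {x : M}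
    (hG : ∀ i j, ContMDiffAt 𝓘(ℝ, E) 𝓘(ℝ, ℝ) n (fun y => G y i j) x) :
    ContMDiffAt 𝓘(ℝ, E) 𝓘(ℝ, ℝ) n (fun y => (G y).det) x := by
  simp only [Matrix.det_apply']
  refine ContMDiffAt.sum fun p _ => ?_
  exact contMDiffAt_const.mul (ContMDiffAt.prod fun i _ => hG _ _)

/-- The entries of the inverse of a smooth invertible matrix function are smooth. -/
theorem ContMDiffAt.matrix_inv {m : ℕ} {n : WithTop ℕ∞} {G : M → Matrix (Fin m) (Fin m) ℝ} {x : M}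
    (hG : ∀ i j, ContMDiffAt 𝓘(ℝ, E) 𝓘(ℝ, ℝ) n (fun y => G y i j) x) (hdet : (G x).det ≠ 0)
    (i j : Fin m) :
    ContMDiffAt 𝓘(ℝ, E) 𝓘(ℝ, ℝ) n (fun y => (G y)⁻¹ i j) x := by
  have h : (fun y => (G y)⁻¹ i j) = fun y => ((G y).det)⁻¹ * (G y).adjugate i j := by
    funext y
    rw [Matrix.inv_def, Ring.inverse_eq_inv', Matrix.smul_apply, smul_eq_mul]
  rw [h]
  have hinv : ContDiffAt ℝ n (fun r : ℝ => r⁻¹) (G x).det := contDiffAt_inv ℝ hdet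
  refine (hinv.contMDiffAt.comp x (ContMDiffAt.matrix_det hG)).mul ?_
  simp only [Matrix.adjugate_apply]
  refine ContMDiffAt.matrix_det fun k l => ?_
  by_cases hk : k = j
  · subst hk; simpa using contMDiffAt_const
  · simpa [Matrix.updateRow_ne hk] using hG k l

theorem ContDiffAt.matrix_inv {m : ℕ} {n : WithTop ℕ∞} {G : E → Matrix (Fin m) (Fin m) ℝ} {x : E}
    (hG : ∀ i j, ContDiffAt ℝ n (fun y => G y i j) x) (hdet : (G x).det ≠ 0) (i j : Fin m) :
    ContDiffAt ℝ n (fun y => (G y)⁻¹ i j) x :=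
  contMDiffAt_iff_contDiffAt.1
    (ContMDiffAt.matrix_inv (fun i j => contMDiffAt_iff_contDiffAt.2 (hG i j)) hdet i j)

end MatrixFunctions

open scoped MatrixOrder in
/-- A positive definite symmetric matrix is congruent to the identity. -/
theorem exists_mul_mul_transpose_eq_one {m : ℕ} {G : Matrix (Fin m) (Fin m) ℝ} (hs : Gᵀ = G)
    (hp : ∀ y : Fin m → ℝ, y ≠ 0 → 0 < y ⬝ᵥ G.mulVec y) :
    ∃ C : Matrix (Fin m) (Fin m) ℝ, C * G * Cᵀ = 1 := by
  have hG : G.PosDef := Matrix.PosDef.of_dotProduct_mulVec_pos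
    (by rw [Matrix.IsHermitian, Matrix.conjTranspose_eq_transpose_of_trivial, hs])
    (fun x hx => by simpa using hp x hx)
  obtain ⟨D, hD⟩ := CStarAlgebra.nonneg_iff_eq_star_mul_self.1 (Matrix.PosSemidef.nonneg hG.posSemidef)
  rw [Matrix.star_eq_conjTranspose, Matrix.conjTranspose_eq_transpose_of_trivial] at hD
  -- With `G = Dᵀ D`, the required congruence is by the inverse of `Dᵀ`.
  have hdet : IsUnit D.det := by
    have h1 := hG.det_pos
    rw [hD, Matrix.det_mul, Matrix.det_transpose] at h1
    exact isUnit_iff_ne_zero.2 fun h => by simp [h] at h1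
  refine ⟨(Dᵀ)⁻¹, ?_⟩
  rw [hD, ← Matrix.transpose_nonsing_inv, Matrix.transpose_transpose, Matrix.mul_assoc,
    Matrix.mul_assoc, Matrix.mul_nonsing_inv _ hdet, Matrix.mul_one, ← Matrix.transpose_mul,
    Matrix.mul_nonsing_inv _ hdet, Matrix.transpose_one]

/-! ### Linear matrix differential equations -/

section MatrixODE

/-- The equation `C' = C K(t)` becomes autonomous once time is adjoined as an unknown with velocity
1, so Picard–Lindelöf applies. Smoothness of the solution is inherited from `K` on a smaller
interval. -/
theorem exists_local_matrix_ode {m : ℕ} (K : ℝ → Fin m → Fin m → ℝ) (t₀ : ℝ)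
    (hK : ∀ᶠ t in 𝓝 t₀, ContDiffAt ℝ ∞ K t) (C₀ : Fin m → Fin m → ℝ) :
    ∃ C : ℝ → Fin m → Fin m → ℝ, C t₀ = C₀ ∧ ∀ᶠ t in 𝓝 t₀, ContDiffAt ℝ ∞ C t ∧
      HasDerivAt C (fun i j => ∑ k, C t i k * K t k j) t := by
  let f : (Fin m → Fin m → ℝ) × ℝ → (Fin m → Fin m → ℝ) × ℝ :=
    fun p => (fun i j => ∑ k, p.1 i k * K p.2 k j, 1)
  have hf1 : ∀ p : (Fin m → Fin m → ℝ) × ℝ, ContDiffAt ℝ ∞ K p.2 →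
      ContDiffAt ℝ ∞ (fun p : (Fin m → Fin m → ℝ) × ℝ => (fun i j => ∑ k, p.1 i k * K p.2 k j)) p := by
    intro p hp
    have hKp : ContDiffAt ℝ ∞ (fun p : (Fin m → Fin m → ℝ) × ℝ => K p.2) p :=
      hp.comp p contDiffAt_snd
    have h1 : ContDiffAt ℝ ∞ (fun p : (Fin m → Fin m → ℝ) × ℝ => p.1) p := contDiffAt_fst
    refine contDiffAt_pi.2 fun i => contDiffAt_pi.2 fun j => ContDiffAt.sum fun k _ => ?_
    exact (contDiffAt_pi.1 (contDiffAt_pi.1 h1 i) k).mul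
      (contDiffAt_pi.1 (contDiffAt_pi.1 hKp k) j)
  have hf : ContDiffAt ℝ 1 f (C₀, t₀) :=
    ((hf1 (C₀, t₀) hK.self_of_nhds).of_le (by simp)).prodMk contDiffAt_const
  obtain ⟨α, hα0, ε, hε, hα⟩ :=
    hf.exists_forall_mem_closedBall_exists_eq_forall_mem_Ioo_hasDerivAt₀ t₀
  -- The adjoined unknown has velocity 1 and starts at `t₀`, so it is the time itself.
  have hα2 : ∀ t ∈ Ioo (t₀ - ε) (t₀ + ε), (α t).2 = t := by
    have hd : ∀ t ∈ Ioo (t₀ - ε) (t₀ + ε), HasDerivAt (fun s => (α s).2 - s) 0 t := by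
      intro t ht
      have h := ((ContinuousLinearMap.snd ℝ (Fin m → Fin m → ℝ) ℝ).hasFDerivAt.comp_hasDerivAt t
        (hα t ht)).sub (hasDerivAt_id t)
      exact h.congr_deriv (by simp [f])
    intro t ht
    have h0 : t₀ ∈ Ioo (t₀ - ε) (t₀ + ε) := ⟨by linarith, by linarith⟩
    have := (convex_Ioo (t₀ - ε) (t₀ + ε)).is_const_of_fderivWithin_eq_zero (𝕜 := ℝ)
      (f := fun s => (α s).2 - s)
      (fun s hs => (hd s hs).differentiableAt.differentiableWithinAt)
      (fun s hs => by
        rw [fderivWithin_of_isOpen isOpen_Ioo hs]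
        ext; simpa using (hd s hs).deriv) ht h0
    simp only [hα0, sub_self] at this
    linarith
  have hC : ∀ t ∈ Ioo (t₀ - ε) (t₀ + ε),
      HasDerivAt (fun s => (α s).1) (fun i j => ∑ k, (α t).1 i k * K t k j) t := by
    intro t ht
    have h := (ContinuousLinearMap.fst ℝ (Fin m → Fin m → ℝ) ℝ).hasFDerivAt.comp_hasDerivAt t
      (hα t ht)
    exact h.congr_deriv (by simp [f, hα2 t ht])
  refine ⟨fun t => (α t).1, by simp [hα0], ?_⟩
  obtain ⟨δ, hδ, hKδ⟩ := Metric.eventually_nhds_iff_ball.1 hK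
  set η := min ε δ / 2 with hη
  have hη0 : 0 < η := by positivity
  have hηε : η < ε := by have := min_le_left ε δ; have : 0 < min ε δ := by positivity
                         rw [hη]; linarith [min_le_left ε δ]
  have hηδ : η < δ := by have : 0 < min ε δ := by positivity
                         rw [hη]; linarith [min_le_right ε δ]
  have hsub : Icc (t₀ - η) (t₀ + η) ⊆ Ioo (t₀ - ε) (t₀ + ε) := fun t ht =>
    ⟨by linarith [ht.1], by linarith [ht.2]⟩
  have hsm : ContDiffOn ℝ ((⊤ : ℕ∞) : WithTop ℕ∞) (fun t => (α t).1) (Icc (t₀ - η) (t₀ + η)) := by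
    refine ODE.contDiffOn_enat_Icc_of_hasDerivWithinAt (u := univ)
      (f := fun t C i j => ∑ k, C i k * K t k j) ?_ (fun t ht => (hC t (hsub ht)).hasDerivWithinAt)
      (fun _ _ => mem_univ _)
    rintro ⟨t, C⟩ ⟨ht, -⟩
    have hKt : ContDiffAt ℝ ∞ K t := hKδ t (by
      rw [Metric.mem_ball, Real.dist_eq, abs_lt]; constructor <;> linarith [ht.1, ht.2])
    have := (hf1 (C, t) hKt).comp (t, C) (f := fun p : ℝ × (Fin m → Fin m → ℝ) => (p.2, p.1))
      (contDiffAt_snd.prodMk contDiffAt_fst)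
    exact this.contDiffWithinAt
  filter_upwards [Ioo_mem_nhds (show t₀ - η < t₀ by linarith) (show t₀ < t₀ + η by linarith)] with t ht
  exact ⟨(hsm t (Ioo_subset_Icc_self ht)).contDiffAt (Icc_mem_nhds ht.1 ht.2),
    hC t (hsub (Ioo_subset_Icc_self ht))⟩

end MatrixODE

/-! ### Continuation of local objects to the whole line -/

section Gluing

/-- A local object on `ℝ` which can be continued locally, uniformly, can be extended to the right. -/
theorem exists_extension_right {X : Type*} (P : (ℝ → X) → ℝ → Prop)
    (congr : ∀ γ γ' t, γ =ᶠ[𝓝 t] γ' → P γ t → P γ' t)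
    (ext : ∀ t₀, ∃ ε > 0, ∀ s ∈ Ioo (t₀ - ε) (t₀ + ε), ∀ γ, (∀ᶠ r in 𝓝 s, P γ r) →
      ∃ γ', γ' s = γ s ∧ ∀ t ∈ Ioo (t₀ - ε) (t₀ + ε), P γ' t)
    (uniq : ∀ a b γ γ', (∀ t ∈ Ioo a b, P γ t) → (∀ t ∈ Ioo a b, P γ' t) →
      ∀ s ∈ Ioo a b, γ s = γ' s → EqOn γ γ' (Ioo a b))
    (γ₀ : ℝ → X) {a b : ℝ} (ha : a < 0) (hb : 0 < b) (h₀ : ∀ t ∈ Ioo a b, P γ₀ t) (c : ℝ) :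
    ∃ γ, γ 0 = γ₀ 0 ∧ ∀ t ∈ Ioo a c, P γ t := by
  by_contra hc
  let S : Set ℝ := {b | 0 < b ∧ ∃ γ, γ 0 = γ₀ 0 ∧ ∀ t ∈ Ioo a b, P γ t}
  have hbS : b ∈ S := ⟨hb, γ₀, rfl, h₀⟩
  have hbdd : BddAbove S := ⟨c, fun d hd => by
    by_contra hdc
    obtain ⟨-, γ, h1, h2⟩ := hd
    exact hc ⟨γ, h1, fun t ht => h2 t ⟨ht.1, by linarith [ht.2]⟩⟩⟩
  set b' := sSup S with hb'
  have hb'0 : 0 < b' := hb.trans_le (le_csSup hbdd hbS)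
  obtain ⟨ε, hε, hext⟩ := ext b'
  obtain ⟨d, ⟨hd0, γ, hγ0, hγ⟩, hd⟩ := exists_lt_of_lt_csSup ⟨b, hbS⟩
    (show max 0 (b' - ε) < b' from max_lt hb'0 (by linarith))
  have hdb : d ≤ b' := le_csSup hbdd ⟨hd0, γ, hγ0, hγ⟩
  obtain ⟨s, hs1, hs2⟩ := exists_between hd
  have hs0 : 0 < s := (le_max_left _ _).trans_lt hs1
  have hsε : b' - ε < s := (le_max_right _ _).trans_lt hs1
  obtain ⟨γ', hγ's, hγ'⟩ := hext s ⟨hsε, by linarith⟩ γ (by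
    filter_upwards [Ioo_mem_nhds (show a < s by linarith) hs2] with r hr using hγ r hr)
  have hE : EqOn γ γ' (Ioo (max a (b' - ε)) d) :=
    uniq _ _ _ _ (fun t ht => hγ t ⟨(le_max_left _ _).trans_lt ht.1, ht.2⟩)
      (fun t ht => hγ' t ⟨(le_max_right _ _).trans_lt ht.1, by linarith [ht.2]⟩) s
      ⟨max_lt (by linarith) hsε, hs2⟩ hγ's.symm
  -- The two curves agree between `s` and `d`, so the curve glued at `s` has at every time the germ
  -- of one of them. It reaches beyond the supremum.
  have : b' + ε ∈ S := by
    refine ⟨by linarith, fun t => if t < s then γ t else γ' t, by simp [hs0, hγ0], fun t ht => ?_⟩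
    by_cases htd : t < d
    · refine congr γ _ t ?_ (hγ t ⟨ht.1, htd⟩)
      filter_upwards [Iio_mem_nhds htd] with r hr
      by_cases hrs : r < s
      · simp [hrs]
      · simp only [hrs, if_false]
        push Not at hrs
        exact hE ⟨max_lt (by linarith) (by linarith), hr⟩
    · push Not at htd
      refine congr γ' _ t ?_ (hγ' t ⟨by linarith, ht.2⟩)
      filter_upwards [Ioi_mem_nhds (show s < t by linarith)] with r hr
      simp [not_lt.2 (le_of_lt (show s < r from hr))]
  linarith [le_csSup hbdd this]

/-- A local object on `ℝ` which can be continued locally, uniformly and uniquely, extends to `ℝ`. -/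
theorem exists_global_extension {X : Type*} (P : (ℝ → X) → ℝ → Prop)
    (congr : ∀ γ γ' t, γ =ᶠ[𝓝 t] γ' → P γ t → P γ' t)
    (ext : ∀ t₀, ∃ ε > 0, ∀ s ∈ Ioo (t₀ - ε) (t₀ + ε), ∀ γ, (∀ᶠ r in 𝓝 s, P γ r) →
      ∃ γ', γ' s = γ s ∧ ∀ t ∈ Ioo (t₀ - ε) (t₀ + ε), P γ' t)
    (uniq : ∀ a b γ γ', (∀ t ∈ Ioo a b, P γ t) → (∀ t ∈ Ioo a b, P γ' t) →
      ∀ s ∈ Ioo a b, γ s = γ' s → EqOn γ γ' (Ioo a b))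
    (γ₀ : ℝ → X) (h₀ : ∀ᶠ t in 𝓝 0, P γ₀ t) :
    ∃ γ, γ 0 = γ₀ 0 ∧ ∀ t, P γ t := by
  obtain ⟨δ, hδ, hP⟩ := Metric.eventually_nhds_iff_ball.1 h₀
  have hP' : ∀ t ∈ Ioo (-δ) δ, P γ₀ t := fun t ht => hP t (by
    rw [Metric.mem_ball, Real.dist_eq, abs_lt]; constructor <;> linarith [ht.1, ht.2])
  have key : ∀ n : ℕ, ∃ γ, γ 0 = γ₀ 0 ∧ ∀ t ∈ Ioo (-(n + 1 : ℝ)) (n + 1), P γ t := by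
    intro n
    obtain ⟨γ, hγ0, hγ⟩ := exists_extension_right P congr ext uniq γ₀ (neg_lt_zero.2 hδ) hδ hP'
      (n + 1)
    have hcn : ∀ (γ γ' : ℝ → X) (t : ℝ), γ =ᶠ[𝓝 t] γ' →
        (fun r => γ (-r)) =ᶠ[𝓝 (-t)] fun r => γ' (-r) := by
      intro γ γ' t h
      have : Tendsto (fun r : ℝ => -r) (𝓝 (-t)) (𝓝 t) := by
        simpa using (continuous_neg.tendsto (-t))
      exact this.eventually h
    -- Extension to the left is extension to the right after reversal of time.
    obtain ⟨γ', hγ'0, hγ'⟩ := exists_extension_right (fun γ t => P (fun r => γ (-r)) (-t))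
      (fun γ γ' t h hP => congr _ _ _ (hcn _ _ _ h) hP)
      (fun t₀ => by
        obtain ⟨ε, hε, h⟩ := ext (-t₀)
        refine ⟨ε, hε, fun s hs γ hγ => ?_⟩
        obtain ⟨γ', h1, h2⟩ := h (-s) ⟨by linarith [hs.2], by linarith [hs.1]⟩ (fun r => γ (-r)) (by
          have : Tendsto (fun r : ℝ => -r) (𝓝 (-s)) (𝓝 s) := by
            simpa using (continuous_neg.tendsto (-s))
          filter_upwards [this.eventually hγ] with r hr
          simpa using hr)
        refine ⟨fun r => γ' (-r), by simpa using h1, fun t ht => ?_⟩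
        simpa using h2 (-t) ⟨by linarith [ht.2], by linarith [ht.1]⟩)
      (fun a b γ γ' h1 h2 s hs hss t ht => by
        have := uniq (-b) (-a) (fun r => γ (-r)) (fun r => γ' (-r))
          (fun t ht => by simpa using h1 (-t) ⟨by linarith [ht.2], by linarith [ht.1]⟩)
          (fun t ht => by simpa using h2 (-t) ⟨by linarith [ht.2], by linarith [ht.1]⟩)
          (-s) ⟨by linarith [hs.2], by linarith [hs.1]⟩ (by simpa using hss)
          (show -t ∈ Ioo (-b) (-a) from ⟨by linarith [ht.2], by linarith [ht.1]⟩)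
        simpa using this)
      (fun r => γ (-r)) (a := -(n + 1 : ℝ)) (b := δ) (by
        have : (0 : ℝ) ≤ n := n.cast_nonneg
        linarith) hδ
      (fun t ht => by simpa using hγ (-t) ⟨by linarith [ht.2], by linarith [ht.1]⟩) (n + 1)
    refine ⟨fun r => γ' (-r), by simp [hγ'0, hγ0], fun t ht => ?_⟩
    simpa using hγ' (-t) ⟨by linarith [ht.2], by linarith [ht.1]⟩
  choose γ hγ0 hγ using key
  have hagree : ∀ n k : ℕ, n ≤ k → ∀ t ∈ Ioo (-(n + 1 : ℝ)) (n + 1), γ n t = γ k t := by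
    intro n k hnk t ht
    have hnk' : (n : ℝ) ≤ k := by exact_mod_cast hnk
    have hn : (0 : ℝ) ≤ n := n.cast_nonneg
    exact uniq _ _ _ _ (hγ n)
      (fun t ht => hγ k t ⟨by linarith [ht.1], by linarith [ht.2]⟩) 0
      ⟨by linarith, by linarith⟩ (by rw [hγ0, hγ0]) ht
  -- The `n`-th extension lives on `(-(n+1), n+1)`, so the index `⌈|t|⌉` always leaves room for a
  -- neighbourhood of `t`, and `hagree` removes the dependence on the index.
  refine ⟨fun t => γ ⌈|t|⌉₊ t, by simp [hγ0], fun t => ?_⟩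
  set N := ⌈|t|⌉₊ with hN
  have hbig : ∀ t : ℝ, t ∈ Ioo (-((⌈|t|⌉₊ : ℝ) + 1)) (⌈|t|⌉₊ + 1) := fun t => by
    have := Nat.le_ceil |t|
    rw [mem_Ioo, ← abs_lt]; linarith
  refine congr (γ N) _ t ?_ (hγ N t (hbig t))
  filter_upwards [Ioo_mem_nhds (hbig t).1 (hbig t).2] with r hr
  rcases le_total N ⌈|r|⌉₊ with h | h
  · exact hagree N _ h r hr
  · exact (hagree _ N h r (hbig r)).symm

end Gluing

/-! ### Functions with zero derivative, products of matrix curves -/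

section Constancy

variable {F : Type*} [NormedAddCommGroup F] [NormedSpace ℝ F]

theorem eq_of_hasDerivAt_zero_Ioo {f : ℝ → F} {a b : ℝ} (h : ∀ t ∈ Ioo a b, HasDerivAt f 0 t)
    {s t : ℝ} (hs : s ∈ Ioo a b) (ht : t ∈ Ioo a b) : f s = f t :=
  (convex_Ioo a b).is_const_of_fderivWithin_eq_zero (𝕜 := ℝ)
    (fun s hs => (h s hs).differentiableAt.differentiableWithinAt)
    (fun s hs => by
      rw [fderivWithin_of_isOpen isOpen_Ioo hs]
      ext; simpa using (h s hs).deriv) hs ht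

theorem eventually_eq_of_hasDerivAt_zero {f : ℝ → F} {t₀ : ℝ}
    (h : ∀ᶠ t in 𝓝 t₀, HasDerivAt f 0 t) : ∀ᶠ t in 𝓝 t₀, f t = f t₀ := by
  obtain ⟨δ, hδ, hP⟩ := Metric.eventually_nhds_iff_ball.1 h
  filter_upwards [Metric.ball_mem_nhds t₀ hδ] with t ht
  rw [Real.ball_eq_Ioo] at hP ht
  exact eq_of_hasDerivAt_zero_Ioo hP ht ⟨by linarith, by linarith⟩

theorem HasDerivAt.matrix_mul {l m n : Type*} [Fintype m] {A : ℝ → Matrix l m ℝ}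
    {C : ℝ → Matrix m n ℝ} {A' : Matrix l m ℝ} {C' : Matrix m n ℝ} {t : ℝ}
    (hA : ∀ i j, HasDerivAt (fun s => A s i j) (A' i j) t)
    (hC : ∀ i j, HasDerivAt (fun s => C s i j) (C' i j) t) (i : l) (j : n) :
    HasDerivAt (fun s => (A s * C s) i j) ((A' * C t + A t * C') i j) t := by
  simp only [Matrix.mul_apply, Matrix.add_apply]
  rw [← Finset.sum_add_distrib]
  exact HasDerivAt.fun_sum fun k _ => (hA i k).mul (hC k j)

end Constancy

/-! ### Gram matrices of a bilinear form -/

section GramMatrices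

variable {V : Type*} [AddCommGroup V] [Module ℝ V]

/-- The matrix of the values of a bilinear form on two families of vectors. -/
def bilinGram (B : LinearMap.BilinForm ℝ V) {m n : ℕ} (a : Fin m → V) (b : Fin n → V) :
    Matrix (Fin m) (Fin n) ℝ :=
  Matrix.of fun i j => B (a i) (b j)

/-- The family of linear combinations of `a` with coefficients the rows of `P`. -/
def matComb {k m : ℕ} (P : Matrix (Fin k) (Fin m) ℝ) (a : Fin m → V) (i : Fin k) : V :=
  ∑ j, P i j • a j

variable (B : LinearMap.BilinForm ℝ V) {k l m n : ℕ}

theorem bilinGram_matComb (P : Matrix (Fin k) (Fin m) ℝ) (Q : Matrix (Fin l) (Fin n) ℝ)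
    (a : Fin m → V) (b : Fin n → V) :
    bilinGram B (matComb P a) (matComb Q b) = P * bilinGram B a b * Qᵀ := by
  ext i j
  simp only [bilinGram, matComb, Matrix.of_apply, map_sum, LinearMap.sum_apply, map_smul,
    LinearMap.smul_apply, smul_eq_mul, Matrix.mul_apply, Matrix.transpose_apply, Finset.mul_sum,
    Finset.sum_mul]
  exact Finset.sum_congr rfl fun _ _ => Finset.sum_congr rfl fun _ _ => by ring

theorem bilinGram_add_left (a a' : Fin m → V) (b : Fin n → V) :
    bilinGram B (a + a') b = bilinGram B a b + bilinGram B a' b := by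
  ext i j; simp [bilinGram]

theorem bilinGram_add_right (a : Fin m → V) (b b' : Fin n → V) :
    bilinGram B a (b + b') = bilinGram B a b + bilinGram B a b' := by
  ext i j; simp [bilinGram]

theorem bilinGram_transpose (hB : B.IsAlt) (a : Fin m → V) (b : Fin n → V) :
    (bilinGram B a b)ᵀ = -bilinGram B b a := by
  ext i j; simp [bilinGram, ← LinearMap.IsAlt.neg hB (b i) (a j)]

theorem matComb_one (a : Fin m → V) : matComb 1 a = a := by
  funext i; simp [matComb, Matrix.one_apply]

theorem matComb_matComb (P : Matrix (Fin k) (Fin l) ℝ) (Q : Matrix (Fin l) (Fin m) ℝ)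
    (a : Fin m → V) : matComb P (matComb Q a) = matComb (P * Q) a := by
  funext i
  simp only [matComb, Matrix.mul_apply, Finset.smul_sum, Finset.sum_smul, smul_smul]
  exact Finset.sum_comm

theorem matComb_add (P Q : Matrix (Fin k) (Fin m) ℝ) (a : Fin m → V) :
    matComb (P + Q) a = matComb P a + matComb Q a := by
  funext i; simp [matComb, add_smul, Finset.sum_add_distrib]

theorem matComb_mem {S : Submodule ℝ V} (P : Matrix (Fin k) (Fin m) ℝ) {a : Fin m → V}
    (ha : ∀ i, a i ∈ S) (i : Fin k) : matComb P a i ∈ S :=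
  S.sum_mem fun j _ => S.smul_mem _ (ha j)

end GramMatrices

theorem HasDerivAt.matComb {V : Type*} [NormedAddCommGroup V] [NormedSpace ℝ V] {k m : ℕ}
    {P : ℝ → Matrix (Fin k) (Fin m) ℝ} {P' : Matrix (Fin k) (Fin m) ℝ} {a : Fin m → ℝ → V}
    {a' : Fin m → V} {t : ℝ} (hP : ∀ i j, HasDerivAt (fun s => P s i j) (P' i j) t)
    (ha : ∀ j, HasDerivAt (a j) (a' j) t) (i : Fin k) :
    HasDerivAt (fun s => _root_.matComb (P s) (fun j => a j s) i)
      (_root_.matComb P' (fun j => a j t) i + _root_.matComb (P t) a' i) t := by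
  simp only [_root_.matComb]
  rw [← Finset.sum_add_distrib]
  refine HasDerivAt.fun_sum fun j _ => ?_
  have := (hP i j).smul (ha j)
  rwa [add_comm] at this

theorem ContDiffAt.matComb {V : Type*} [NormedAddCommGroup V] [NormedSpace ℝ V] {k m : ℕ}
    {n : WithTop ℕ∞} {P : ℝ → Matrix (Fin k) (Fin m) ℝ} {a : Fin m → ℝ → V} {t : ℝ}
    (hP : ∀ i j, ContDiffAt ℝ n (fun s => P s i j) t) (ha : ∀ j, ContDiffAt ℝ n (a j) t)
    (i : Fin k) :
    ContDiffAt ℝ n (fun s => _root_.matComb (P s) (fun j => a j s) i) t := by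
  simp only [_root_.matComb]
  exact ContDiffAt.sum fun j _ => (hP i j).smul (ha j)

/-! ### Normal frames: existence, rigidity, global continuation -/

section NormalFrames

variable {V : Type*} [NormedAddCommGroup V] [NormedSpace ℝ V]

/-- `e` is, at the time `t`, a smooth frame of vectors in `S` such that `e` and the velocities of
`e` satisfy the Darboux relations. -/
structure IsNormalFrameAt (B : LinearMap.BilinForm ℝ V) (S : ℝ → Submodule ℝ V) {m : ℕ}
    (e : Fin m → ℝ → V) (t : ℝ) : Prop where
  smooth : ∀ k, ContDiffAt ℝ ∞ (e k) t
  mem : ∀ k, e k t ∈ S t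
  e_e : bilinGram B (fun k => e k t) (fun k => e k t) = 0
  f_e : bilinGram B (fun k => deriv (e k) t) (fun k => e k t) = 1
  f_f : bilinGram B (fun k => deriv (e k) t) (fun k => deriv (e k) t) = 0

variable {B : LinearMap.BilinForm ℝ V} {S : ℝ → Submodule ℝ V} {m : ℕ}

theorem IsNormalFrameAt.congr {e e' : Fin m → ℝ → V} {t : ℝ} (h : IsNormalFrameAt B S e t)
    (he : ∀ k, e k =ᶠ[𝓝 t] e' k) : IsNormalFrameAt B S e' t := by
  have h1 : (fun k => e' k t) = fun k => e k t := funext fun k => (he k).self_of_nhds.symm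
  have h2 : (fun k => deriv (e' k) t) = fun k => deriv (e k) t :=
    funext fun k => (he k).symm.deriv_eq
  refine ⟨fun k => (h.smooth k).congr_of_eventuallyEq (he k).symm, fun k => ?_, ?_, ?_, ?_⟩
  · rw [← (he k).self_of_nhds]; exact h.mem k
  · rw [h1]; exact h.e_e
  · rw [h1, h2]; exact h.f_e
  · rw [h2]; exact h.f_f

theorem IsNormalFrameAt.hasDerivAt {e : Fin m → ℝ → V} {t : ℝ} (h : IsNormalFrameAt B S e t)
    (k : Fin m) : HasDerivAt (e k) (deriv (e k) t) t :=
  (h.smooth k).hasDerivAt_deriv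

theorem IsNormalFrameAt.e_f (hB : B.IsAlt) {e : Fin m → ℝ → V} {t : ℝ}
    (h : IsNormalFrameAt B S e t) :
    bilinGram B (fun k => e k t) (fun k => deriv (e k) t) = -1 := by
  have := bilinGram_transpose B hB (fun k => deriv (e k) t) (fun k => e k t)
  rw [h.f_e, Matrix.transpose_one] at this
  rw [this, neg_neg]

theorem IsNormalFrameAt.linearIndependent {e : Fin m → ℝ → V} {t : ℝ}
    (h : IsNormalFrameAt B S e t) : LinearIndependent ℝ (fun k => e k t) := by
  rw [Fintype.linearIndependent_iff]
  intro g hg i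
  have h1 : B (deriv (e i) t) (∑ k, g k • e k t) = g i := by
    have h2 : ∀ k, B (deriv (e i) t) (e k t) = if i = k then 1 else 0 := fun k => by
      have := congr_fun (congr_fun h.f_e i) k
      simpa [bilinGram, Matrix.one_apply] using this
    simp [h2]
  rw [← h1, hg, map_zero]

theorem IsNormalFrameAt.matComb {e : Fin m → ℝ → V} {t : ℝ} (h : IsNormalFrameAt B S e t)
    {O : Matrix (Fin m) (Fin m) ℝ} (hO : O * Oᵀ = 1) :
    IsNormalFrameAt B S (fun k s => matComb O (fun j => e j s) k) t := by
  have hd : ∀ k, HasDerivAt (fun s => _root_.matComb O (fun j => e j s) k)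
      (_root_.matComb O (fun j => deriv (e j) t) k) t := fun k => by
    have := HasDerivAt.matComb (P := fun _ => O) (P' := 0) (t := t)
      (fun i j => hasDerivAt_const t (O i j)) h.hasDerivAt k
    refine this.congr_deriv ?_
    simp [_root_.matComb]
  have hd' : (fun k => deriv (fun s => _root_.matComb O (fun j => e j s) k) t) =
      _root_.matComb O (fun j => deriv (e j) t) := funext fun k => (hd k).deriv
  refine ⟨fun k => ContDiffAt.matComb (P := fun _ => O) (fun i j => contDiffAt_const) h.smooth k,
    fun k => matComb_mem O h.mem k, ?_, ?_, ?_⟩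
  · change bilinGram B (_root_.matComb O fun j => e j t) (_root_.matComb O fun j => e j t) = 0
    rw [bilinGram_matComb, h.e_e, Matrix.mul_zero, Matrix.zero_mul]
  · rw [hd']
    change bilinGram B (_root_.matComb O _) (_root_.matComb O fun j => e j t) = 1
    rw [bilinGram_matComb, h.f_e, Matrix.mul_one, hO]
  · rw [hd', bilinGram_matComb, h.f_f, Matrix.mul_zero, Matrix.zero_mul]

/-- The velocities are dual to the frame, so they read off the coefficients. Spanning is a dimension
count; it needs the bound on the dimension of `S t`, which for reduced curves fails at isolated
times. -/
theorem IsNormalFrameAt.mem_span {e : Fin m → ℝ → V} {t : ℝ} [FiniteDimensional ℝ V]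
    (h : IsNormalFrameAt B S e t) (hS : Module.finrank ℝ (S t) ≤ m) {v : V} (hv : v ∈ S t) :
    v = ∑ k, B (deriv (e k) t) v • e k t := by
  have hle : Submodule.span ℝ (range fun k => e k t) ≤ S t :=
    Submodule.span_le.2 (by rintro _ ⟨k, rfl⟩; exact h.mem k)
  have heq : Submodule.span ℝ (range fun k => e k t) = S t := by
    refine Submodule.eq_of_le_of_finrank_le hle ?_
    rw [finrank_span_eq_card h.linearIndependent, Fintype.card_fin]
    exact hS
  rw [← heq] at hv
  obtain ⟨c, rfl⟩ := (Submodule.mem_span_range_iff_exists_fun ℝ).1 hv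
  have h2 : ∀ i k, B (deriv (e i) t) (e k t) = if i = k then 1 else 0 := fun i k => by
    have := congr_fun (congr_fun h.f_e i) k
    simpa [bilinGram, Matrix.one_apply] using this
  simp [h2]

variable [FiniteDimensional ℝ V]

/-- A smooth frame of an isotropic curve with positive definite velocity form can be corrected to
a normal frame. -/
theorem exists_normalFrame_near (hB : B.IsAlt) (a : Fin m → ℝ → V) (t₀ : ℝ)
    (ha : ∀ᶠ t in 𝓝 t₀, ∀ i, ContDiffAt ℝ ∞ (a i) t) (hmem : ∀ᶠ t in 𝓝 t₀, ∀ i, a i t ∈ S t)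
    (hiso : ∀ᶠ t in 𝓝 t₀, bilinGram B (fun i => a i t) (fun i => a i t) = 0)
    (hpos : ∀ y : Fin m → ℝ, y ≠ 0 →
      0 < y ⬝ᵥ (bilinGram B (fun i => deriv (a i) t₀) (fun i => a i t₀)).mulVec y) :
    ∃ e : Fin m → ℝ → V, ∀ᶠ t in 𝓝 t₀, IsNormalFrameAt B S e t := by
  let G : ℝ → Matrix (Fin m) (Fin m) ℝ := fun t =>
    bilinGram B (fun i => deriv (a i) t) (fun i => a i t)
  let Ω : ℝ → Matrix (Fin m) (Fin m) ℝ := fun t =>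
    bilinGram B (fun i => deriv (a i) t) (fun i => deriv (a i) t)
  let G' : ℝ → Matrix (Fin m) (Fin m) ℝ := fun t => Matrix.of fun i j => deriv (fun s => G s i j) t
  -- Look for the frame as `D a` with `D' = D K`. Constancy of `D G Dᵀ` requires `K G + G Kᵀ = -G'`,
  -- and isotropy of the velocities requires `K G - G Kᵀ = Ω`. Adding gives `K G = (Ω - G') / 2`,
  -- and symmetry of `G`, `G'` and skewness of `Ω` make this consistent with both conditions.
  let K : ℝ → Matrix (Fin m) (Fin m) ℝ := fun t => (1 / 2 : ℝ) • (Ω t - G' t) * (G t)⁻¹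
  have hGsm : ∀ᶠ t in 𝓝 t₀, ∀ i j, ContDiffAt ℝ ∞ (fun s => G s i j) t := by
    filter_upwards [ha] with t ht i j
    exact ContDiffAt.bilinForm B (ht i).deriv_smooth (ht j)
  have hΩsm : ∀ᶠ t in 𝓝 t₀, ∀ i j, ContDiffAt ℝ ∞ (fun s => Ω s i j) t := by
    filter_upwards [ha] with t ht i j
    exact ContDiffAt.bilinForm B (ht i).deriv_smooth (ht j).deriv_smooth
  have hGsymm : ∀ᶠ t in 𝓝 t₀, (G t)ᵀ = G t := by
    filter_upwards [ha, hiso.eventually_nhds] with t ht hi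
    ext i j
    have h1 := HasDerivAt.bilinForm B (ht i).hasDerivAt_deriv (ht j).hasDerivAt_deriv
    have h2 : HasDerivAt (fun s => B (a i s) (a j s)) 0 t :=
      (hasDerivAt_const t (0 : ℝ)).congr_of_eventuallyEq (by
        filter_upwards [hi] with s hs
        exact congr_fun (congr_fun hs i) j)
    have h3 := h1.unique h2
    rw [← LinearMap.IsAlt.neg hB (deriv (a j) t) (a i t)] at h3
    change B (deriv (a j) t) (a i t) = B (deriv (a i) t) (a j t)
    linarith
  have hdet0 : (G t₀).det ≠ 0 := by
    intro h
    obtain ⟨y, hy, hy0⟩ := Matrix.exists_mulVec_eq_zero_iff.2 h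
    have := hpos y hy
    change 0 < y ⬝ᵥ (G t₀).mulVec y at this
    rw [hy0, dotProduct_zero] at this
    exact this.false
  have hdet : ∀ᶠ t in 𝓝 t₀, (G t).det ≠ 0 := by
    have hc : ContinuousAt (fun t => (G t).det) t₀ := by
      have : ContMDiffAt 𝓘(ℝ, ℝ) 𝓘(ℝ, ℝ) ∞ (fun t => (G t).det) t₀ :=
        ContMDiffAt.matrix_det fun i j =>
          contMDiffAt_iff_contDiffAt.2 (hGsm.self_of_nhds i j)
      exact this.continuousAt
    exact hc.eventually_ne hdet0
  have hKsm : ∀ᶠ t in 𝓝 t₀, ContDiffAt ℝ ∞ (fun s => (fun i j => K s i j : Fin m → Fin m → ℝ)) t := by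
    filter_upwards [hGsm, hΩsm, hdet] with t h1 h2 h3
    refine contDiffAt_pi.2 fun i => contDiffAt_pi.2 fun j => ?_
    simp only [K, Matrix.mul_apply, Matrix.smul_apply, Matrix.sub_apply, smul_eq_mul]
    refine ContDiffAt.sum fun k _ => ContDiffAt.mul (contDiffAt_const.mul
      ((h2 i k).sub ?_)) (ContDiffAt.matrix_inv h1 h3 k j)
    exact (h1 i k).deriv_smooth
  -- Positivity of the velocity form enters twice: it makes `G` invertible and it normalizes the
  -- initial value, `C₀ G(t₀) C₀ᵀ = 1`.
  obtain ⟨C₀, hC₀⟩ := exists_mul_mul_transpose_eq_one hGsymm.self_of_nhds hpos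
  obtain ⟨C, hCt₀, hC⟩ := exists_local_matrix_ode (fun t i j => K t i j) t₀ hKsm (fun i j => C₀ i j)
  let D : ℝ → Matrix (Fin m) (Fin m) ℝ := fun t => Matrix.of (C t)
  have hDt₀ : D t₀ = C₀ := by ext i j; simp [D, hCt₀]
  have hD : ∀ᶠ t in 𝓝 t₀, (∀ i j, ContDiffAt ℝ ∞ (fun s => D s i j) t) ∧
      ∀ i j, HasDerivAt (fun s => D s i j) ((D t * K t) i j) t := by
    filter_upwards [hC] with t ht
    refine ⟨fun i j => contDiffAt_pi.1 (contDiffAt_pi.1 ht.1 i) j, fun i j => ?_⟩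
    have := hasDerivAt_pi.1 (hasDerivAt_pi.1 ht.2 i) j
    simpa [D, Matrix.mul_apply] using this
  have hKG : ∀ᶠ t in 𝓝 t₀, K t * G t = (1 / 2 : ℝ) • (Ω t - G' t) := by
    filter_upwards [hdet] with t ht
    rw [Matrix.mul_assoc, Matrix.nonsing_inv_mul _ (isUnit_iff_ne_zero.2 ht), Matrix.mul_one]
  have hGsymm' : ∀ᶠ t in 𝓝 t₀, (G' t)ᵀ = G' t := by
    filter_upwards [hGsymm.eventually_nhds] with t ht
    ext i j
    refine Filter.EventuallyEq.deriv_eq ?_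
    filter_upwards [ht] with s hs
    exact congr_fun (congr_fun hs i) j
  have hΩt : ∀ t, (Ω t)ᵀ = -Ω t := fun t => bilinGram_transpose B hB _ _
  have hGK : ∀ᶠ t in 𝓝 t₀, G t * (K t)ᵀ = (1 / 2 : ℝ) • (-Ω t - G' t) := by
    filter_upwards [hKG, hGsymm, hGsymm'] with t h1 h2 h3
    have := congr_arg Matrix.transpose h1
    rwa [Matrix.transpose_mul, h2, Matrix.transpose_smul, Matrix.transpose_sub, h3, hΩt] at this
  have hDG : ∀ᶠ t in 𝓝 t₀, D t * G t * (D t)ᵀ = 1 := by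
    have hz : ∀ᶠ t in 𝓝 t₀, ∀ i j, HasDerivAt (fun s => (D s * G s * (D s)ᵀ) i j) 0 t := by
      filter_upwards [hD, hKG, hGK, hGsm] with t h1 h2 h3 h4 i j
      have hGd : ∀ i j, HasDerivAt (fun s => G s i j) (G' t i j) t :=
        fun i j => (h4 i j).hasDerivAt_deriv
      have h5 := HasDerivAt.matrix_mul (fun i j => HasDerivAt.matrix_mul h1.2 hGd i j)
        (C := fun s => (D s)ᵀ) (C' := (D t * K t)ᵀ) (fun i j => h1.2 j i) i j
      refine h5.congr_deriv ?_
      have : (D t * K t * G t + D t * G' t) * (D t)ᵀ + D t * G t * (D t * K t)ᵀ = 0 := by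
        rw [Matrix.transpose_mul, Matrix.mul_assoc (D t) (K t), h2,
          Matrix.mul_assoc (D t) (G t), ← Matrix.mul_assoc (G t), h3, ← Matrix.mul_add,
          Matrix.mul_assoc (D t), ← Matrix.mul_add, ← Matrix.add_mul]
        have : (1 / 2 : ℝ) • (Ω t - G' t) + G' t + (1 / 2 : ℝ) • (-Ω t - G' t) = 0 := by
          module
        rw [this, Matrix.zero_mul, Matrix.mul_zero]
      rw [this]; rfl
    have hz' : ∀ i j, ∀ᶠ t in 𝓝 t₀, (D t * G t * (D t)ᵀ) i j = (D t₀ * G t₀ * (D t₀)ᵀ) i j :=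
      fun i j => eventually_eq_of_hasDerivAt_zero (hz.mono fun t ht => ht i j)
    filter_upwards [eventually_all.2 fun i => eventually_all.2 fun j => hz' i j] with t ht
    rw [← hC₀, ← hDt₀]
    ext i j; exact ht i j
  refine ⟨fun k s => matComb (D s) (fun j => a j s) k, ?_⟩
  filter_upwards [hDG, hD, hKG, hGK, ha, hmem, hiso, hGsymm] with t h1 h2 h3 h4 h5 h6 h7 h8
  have hd : (fun k => deriv (fun s => matComb (D s) (fun j => a j s) k) t) =
      matComb (D t * K t) (fun j => a j t) + matComb (D t) (fun j => deriv (a j) t) := by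
    funext k
    exact (HasDerivAt.matComb h2.2 (fun j => (h5 j).hasDerivAt_deriv) k).deriv
  have haG : bilinGram B (fun i => a i t) (fun i => deriv (a i) t) = -G t := by
    rw [← h8, bilinGram_transpose B hB, neg_neg]
  refine ⟨fun k => ContDiffAt.matComb h2.1 h5 k, fun k => matComb_mem _ h6 k, ?_, ?_, ?_⟩
  · change bilinGram B (matComb (D t) fun j => a j t) (matComb (D t) fun j => a j t) = 0
    rw [bilinGram_matComb, h7, Matrix.mul_zero, Matrix.zero_mul]
  · rw [hd]
    change bilinGram B _ (matComb (D t) fun j => a j t) = 1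
    rw [bilinGram_add_left, bilinGram_matComb, bilinGram_matComb, h7, Matrix.mul_zero,
      Matrix.zero_mul, zero_add]
    exact h1
  · rw [hd]
    simp only [bilinGram_add_left, bilinGram_add_right, bilinGram_matComb, h7, haG]
    change D t * K t * 0 * (D t * K t)ᵀ + D t * G t * (D t * K t)ᵀ +
      (D t * K t * -G t * (D t)ᵀ + D t * Ω t * (D t)ᵀ) = 0
    rw [Matrix.mul_zero, Matrix.zero_mul, zero_add, Matrix.transpose_mul, Matrix.mul_assoc (D t) (G t),
      ← Matrix.mul_assoc (G t), h4, Matrix.mul_assoc (D t) (K t), Matrix.mul_neg (K t), h3,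
      ← Matrix.mul_assoc, ← Matrix.add_mul, ← Matrix.add_mul, ← Matrix.mul_add, ← Matrix.mul_add]
    have : (1 / 2 : ℝ) • (-Ω t - G' t) + (-((1 / 2 : ℝ) • (Ω t - G' t)) + Ω t) = 0 := by
      module
    rw [this, Matrix.mul_zero, Matrix.zero_mul]

/-- Two normal frames of the same curve differ by a constant orthogonal matrix. -/
theorem exists_orthogonal_of_normalFrames (hB : B.IsAlt) {e e' : Fin m → ℝ → V} {a b : ℝ}
    (hab : a < b)
    (he : ∀ t ∈ Ioo a b, IsNormalFrameAt B S e t) (he' : ∀ t ∈ Ioo a b, IsNormalFrameAt B S e' t)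
    (hS : ∀ t ∈ Ioo a b, ∀ᶠ s in 𝓝[≠] t, Module.finrank ℝ (S s) ≤ m) :
    ∃ O : Matrix (Fin m) (Fin m) ℝ, O * Oᵀ = 1 ∧
      ∀ t ∈ Ioo a b, ∀ k, e k t = matComb O (fun j => e' j t) k := by
  let O : ℝ → Matrix (Fin m) (Fin m) ℝ := fun t => Matrix.of fun k l => B (deriv (e' l) t) (e k t)
  have hOsm : ∀ t ∈ Ioo a b, ∀ k l, ContDiffAt ℝ ∞ (fun s => O s k l) t := fun t ht k l =>
    ContDiffAt.bilinForm B ((he' t ht).smooth l).deriv_smooth ((he t ht).smooth k)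
  -- The dimension bound is available only on punctured neighbourhoods. The relation is proved there
  -- and extends to the exceptional time by continuity of both sides.
  have hO : ∀ t ∈ Ioo a b, ∀ k, e k t = matComb (O t) (fun j => e' j t) k := by
    intro t ht k
    have h1 : Tendsto (e k) (𝓝[≠] t) (𝓝 (e k t)) :=
      ((he t ht).smooth k).continuousAt.tendsto.mono_left nhdsWithin_le_nhds
    have h2 : Tendsto (fun s => matComb (O s) (fun j => e' j s) k) (𝓝[≠] t)
        (𝓝 (matComb (O t) (fun j => e' j t) k)) :=
      (ContDiffAt.matComb (hOsm t ht) (he' t ht).smooth k).continuousAt.tendsto.mono_left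
        nhdsWithin_le_nhds
    refine tendsto_nhds_unique_of_eventuallyEq h1 h2 ?_
    filter_upwards [hS t ht, nhdsWithin_le_nhds (Ioo_mem_nhds ht.1 ht.2)] with s hs hs'
    exact (he' s hs').mem_span hs ((he s hs').mem k)
  let O' : ℝ → Matrix (Fin m) (Fin m) ℝ := fun t => Matrix.of fun i j => deriv (fun s => O s i j) t
  have hO' : ∀ t ∈ Ioo a b, ∀ i j, HasDerivAt (fun s => O s i j) (O' t i j) t :=
    fun t ht i j => (hOsm t ht i j).hasDerivAt_deriv
  have hf : ∀ t ∈ Ioo a b, (fun k => deriv (e k) t) =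
      matComb (O' t) (fun j => e' j t) + matComb (O t) (fun j => deriv (e' j) t) := by
    intro t ht
    funext k
    have h1 : e k =ᶠ[𝓝 t] fun s => matComb (O s) (fun j => e' j s) k := by
      filter_upwards [Ioo_mem_nhds ht.1 ht.2] with s hs using hO s hs k
    rw [h1.deriv_eq]
    exact (HasDerivAt.matComb (hO' t ht) (he' t ht).hasDerivAt k).deriv
  have he_eq : ∀ t ∈ Ioo a b, (fun k => e k t) = matComb (O t) (fun j => e' j t) :=
    fun t ht => funext (hO t ht)
  have hOO : ∀ t ∈ Ioo a b, O t * (O t)ᵀ = 1 := by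
    intro t ht
    have h1 := (he t ht).f_e
    rw [hf t ht, he_eq t ht, bilinGram_add_left, bilinGram_matComb, bilinGram_matComb,
      (he' t ht).e_e, (he' t ht).f_e] at h1
    simpa using h1
  -- Isotropy of the velocities of both frames makes `O' Oᵀ` symmetric, orthogonality of `O` makes
  -- it skew. Hence it vanishes.
  have hOz : ∀ t ∈ Ioo a b, O' t = 0 := by
    intro t ht
    have h1 := (he t ht).f_f
    rw [hf t ht] at h1
    simp only [bilinGram_add_left, bilinGram_add_right, bilinGram_matComb, (he' t ht).e_e,
      (he' t ht).f_e, (he' t ht).f_f, (he' t ht).e_f hB] at h1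
    have h2 : O' t * (O t)ᵀ + O t * (O' t)ᵀ = 0 := by
      ext i j
      have h3 := HasDerivAt.matrix_mul (hO' t ht) (C := fun s => (O s)ᵀ) (C' := (O' t)ᵀ)
        (fun i j => hO' t ht j i) i j
      have h4 : HasDerivAt (fun s => (O s * (O s)ᵀ) i j) 0 t :=
        (hasDerivAt_const t ((1 : Matrix (Fin m) (Fin m) ℝ) i j)).congr_of_eventuallyEq (by
          filter_upwards [Ioo_mem_nhds ht.1 ht.2] with s hs
          rw [hOO s hs])
      exact h3.unique h4
    have h5 : O' t * (O t)ᵀ = 0 := by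
      simp only [Matrix.mul_zero, Matrix.zero_mul, zero_add, add_zero, Matrix.mul_one,
        Matrix.mul_neg, Matrix.neg_mul] at h1
      have h6 : O t * (O' t)ᵀ = O' t * (O t)ᵀ := by
        rw [← sub_eq_zero, ← h1]; abel
      rw [h6, ← two_smul ℝ] at h2
      exact (smul_eq_zero.1 h2).resolve_left two_ne_zero
    have h7 := mul_eq_one_comm.1 (hOO t ht)
    calc O' t = O' t * ((O t)ᵀ * O t) := by rw [h7, Matrix.mul_one]
      _ = 0 := by rw [← Matrix.mul_assoc, h5, Matrix.zero_mul]
  have hmid : (a + b) / 2 ∈ Ioo a b := ⟨by linarith, by linarith⟩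
  refine ⟨O ((a + b) / 2), hOO _ hmid, fun t ht k => ?_⟩
  have : O t = O ((a + b) / 2) := by
    ext i j
    refine eq_of_hasDerivAt_zero_Ioo (f := fun s => O s i j) (fun s hs => ?_) ht hmid
    have := hO' s hs i j
    rwa [hOz s hs] at this
  rw [← this]
  exact hO t ht k

/-- Local normal frames give a global one. -/
theorem exists_global_normalFrame (hB : B.IsAlt)
    (hS : ∀ t, ∀ᶠ s in 𝓝[≠] t, Module.finrank ℝ (S s) ≤ m)
    (hloc : ∀ t, ∃ e : Fin m → ℝ → V, ∀ᶠ s in 𝓝 t, IsNormalFrameAt B S e s) :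
    ∃ e : Fin m → ℝ → V, ∀ t, IsNormalFrameAt B S e t := by
  have heqf : ∀ {γ γ' : ℝ → Fin m → V} {t : ℝ}, γ =ᶠ[𝓝 t] γ' → ∀ k,
      (fun r => γ r k) =ᶠ[𝓝 t] fun r => γ' r k := fun h k => by
    filter_upwards [h] with r hr
    rw [hr]
  obtain ⟨e₀, he₀⟩ := hloc 0
  obtain ⟨γ, -, hγ⟩ := exists_global_extension (X := Fin m → V)
    (fun γ t => IsNormalFrameAt B S (fun k r => γ r k) t)
    (fun γ γ' t h hP => hP.congr (heqf h))
    (fun t₀ => by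
      obtain ⟨e, he⟩ := hloc t₀
      obtain ⟨ε, hε, hP⟩ := Metric.eventually_nhds_iff_ball.1 he
      rw [Real.ball_eq_Ioo] at hP
      refine ⟨ε, hε, fun s hs γ hγ => ?_⟩
      obtain ⟨δ, hδ, hQ⟩ := Metric.eventually_nhds_iff_ball.1 hγ
      rw [Real.ball_eq_Ioo] at hQ
      have hlt : max (t₀ - ε) (s - δ) < min (t₀ + ε) (s + δ) :=
        max_lt (lt_min (by linarith) (by linarith [hs.1])) (lt_min (by linarith [hs.2]) (by linarith))
      -- On the overlap the given frame is a constant orthogonal multiple of the local one. The same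
      -- multiple, taken on the whole interval, is the continuation.
      obtain ⟨O, hO, hOe⟩ := exists_orthogonal_of_normalFrames hB hlt
        (e := fun k r => γ r k) (e' := e)
        (fun t ht => hQ t ⟨(le_max_right _ _).trans_lt ht.1, ht.2.trans_le (min_le_right _ _)⟩)
        (fun t ht => hP t ⟨(le_max_left _ _).trans_lt ht.1, ht.2.trans_le (min_le_left _ _)⟩)
        (fun t _ => hS t)
      refine ⟨fun r => matComb O (fun j => e j r), ?_, fun t ht => (hP t ht).matComb hO⟩
      funext k
      exact (hOe s ⟨max_lt hs.1 (by linarith), lt_min hs.2 (by linarith)⟩ k).symm)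
    (fun a b γ γ' h1 h2 s hs hss t ht => by
      obtain ⟨O, hO, hOe⟩ := exists_orthogonal_of_normalFrames hB (hs.1.trans hs.2) h1 h2
        (fun t _ => hS t)
      -- The two frames coincide at `s` and are linearly independent, which determines the constant
      -- matrix.
      have hO1 : O = 1 := by
        have h3 : (fun k => γ s k) = matComb O (fun j => γ' s j) := funext (hOe s hs)
        have h4 := (h1 s hs).linearIndependent
        ext i j
        have h5 := hOe s hs i
        rw [← hss] at h5
        have h6 := (Fintype.linearIndependent_iff.1 h4) (fun j => O i j - (1 : Matrix _ _ ℝ) i j) (by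
          simp only [sub_smul, Finset.sum_sub_distrib, Matrix.one_apply, ite_smul, one_smul,
            zero_smul, Finset.sum_ite_eq, Finset.mem_univ, if_true]
          rw [sub_eq_zero]; exact h5.symm) j
        linarith
      funext k
      have := hOe t ht k
      rw [hO1, matComb_one] at this
      exact this)
    (fun r k => e₀ k r) he₀
  exact ⟨fun k r => γ r k, hγ⟩

end NormalFrames

/-! ### Division of smooth functions by a linear factor -/

section DividedDifference

/-- Differentiation under the integral raises `k` by one and replaces `u` by its derivative, so an
induction on the order of smoothness runs over all `k` and `u` at once. -/
theorem contDiff_integral_mul_comp (c : ℝ) (N : ℕ) : ∀ (k : ℕ) (u : ℝ → ℝ), ContDiff ℝ ∞ u →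
    ContDiff ℝ N (fun t => ∫ s in (0 : ℝ)..1, s ^ k * u (c + s * (t - c))) := by
  have hder : ∀ (k : ℕ) (u : ℝ → ℝ), ContDiff ℝ ∞ u → ∀ t,
      HasDerivAt (fun t => ∫ s in (0 : ℝ)..1, s ^ k * u (c + s * (t - c)))
        (∫ s in (0 : ℝ)..1, s ^ (k + 1) * deriv u (c + s * (t - c))) t := by
    intro k u hu t
    have hu' : ContDiff ℝ ∞ (deriv u) := (contDiff_infty_iff_deriv.1 hu).2
    have hcont : Continuous fun p : ℝ × ℝ => p.2 ^ (k + 1) * deriv u (c + p.2 * (p.1 - c)) := by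
      have := hu'.continuous
      fun_prop
    obtain ⟨C, hC⟩ := ((isCompact_closedBall t 1).prod (isCompact_Icc (a := (0 : ℝ)) (b := 1))
      ).exists_bound_of_continuousOn hcont.continuousOn
    refine (intervalIntegral.hasDerivAt_integral_of_dominated_loc_of_deriv_le
      (F' := fun t s => s ^ (k + 1) * deriv u (c + s * (t - c))) (bound := fun _ => C)
      (s := Metric.closedBall t 1) (Metric.closedBall_mem_nhds t one_pos) ?_ ?_ ?_ ?_ ?_ ?_).2
    · refine Eventually.of_forall fun x => ?_
      have := hu.continuous
      exact Continuous.aestronglyMeasurable (by fun_prop)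
    · have := hu.continuous
      exact Continuous.intervalIntegrable (by fun_prop) _ _
    · have := hu'.continuous
      exact Continuous.aestronglyMeasurable (by fun_prop)
    · refine Eventually.of_forall fun s hs x hx => ?_
      rw [uIoc_of_le zero_le_one] at hs
      exact hC (x, s) ⟨hx, hs.1.le, hs.2⟩
    · exact intervalIntegrable_const
    · refine Eventually.of_forall fun s hs x hx => ?_
      have h1 : HasDerivAt (fun x => c + s * (x - c)) s x := by
        simpa using (((hasDerivAt_id x).sub_const c).const_mul s).const_add c
      have h2 : HasDerivAt u (deriv u (c + s * (x - c))) (c + s * (x - c)) :=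
        (hu.differentiable (by simp) _).hasDerivAt
      refine ((h2.comp x h1).const_mul (s ^ k)).congr_deriv ?_
      ring
  induction N with
  | zero =>
    intro k u hu
    exact contDiff_zero.2 (continuous_iff_continuousAt.2 fun t => (hder k u hu t).continuousAt)
  | succ N ih =>
    intro k u hu
    have h1 : ((N + 1 : ℕ) : WithTop ℕ∞) = (N : WithTop ℕ∞) + 1 := by norm_cast
    rw [h1, contDiff_succ_iff_deriv]
    refine ⟨fun t => (hder k u hu t).differentiableAt, by simp, ?_⟩
    have h2 : deriv (fun t => ∫ s in (0 : ℝ)..1, s ^ k * u (c + s * (t - c))) =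
        fun t => ∫ s in (0 : ℝ)..1, s ^ (k + 1) * deriv u (c + s * (t - c)) :=
      funext fun t => (hder k u hu t).deriv
    rw [h2]
    exact ih (k + 1) _ (contDiff_infty_iff_deriv.1 hu).2

/-- A smooth function vanishing at `c` is divisible by `t - c`. -/
theorem exists_smooth_eq_sub_mul {g : ℝ → ℝ} (hg : ContDiff ℝ ∞ g) {c : ℝ} (h0 : g c = 0) :
    ∃ q : ℝ → ℝ, ContDiff ℝ ∞ q ∧ (∀ t, g t = (t - c) * q t) ∧ q c = deriv g c := by
  have hg' : ContDiff ℝ ∞ (deriv g) := (contDiff_infty_iff_deriv.1 hg).2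
  refine ⟨fun t => ∫ s in (0 : ℝ)..1, s ^ 0 * deriv g (c + s * (t - c)),
    contDiff_infty.2 fun N => contDiff_integral_mul_comp c N 0 _ hg', fun t => ?_, by simp⟩
  have h1 : ∀ s, HasDerivAt (fun s => g (c + s * (t - c))) ((t - c) * (s ^ 0 * deriv g (c + s * (t - c)))) s := by
    intro s
    have h1 : HasDerivAt (fun s => c + s * (t - c)) (t - c) s := by
      simpa using ((hasDerivAt_id s).mul_const (t - c)).const_add c
    have h2 : HasDerivAt g (deriv g (c + s * (t - c))) (c + s * (t - c)) :=
      (hg.differentiable (by simp) _).hasDerivAt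
    refine (h2.comp s h1).congr_deriv ?_
    ring
  have h2 := intervalIntegral.integral_eq_sub_of_hasDerivAt (a := 0) (b := 1) (fun s _ => h1 s) (by
    have := hg'.continuous
    exact Continuous.intervalIntegrable (by fun_prop) _ _)
  rw [intervalIntegral.integral_const_mul] at h2
  rw [h2]; simp [h0]

end DividedDifference

/-! ### Lagrangian subspaces -/

section Lagrangian

variable {V : Type*} [AddCommGroup V] [Module ℝ V] [FiniteDimensional ℝ V]

/-- By nondegeneracy the skew-orthogonal complement of a Lagrangian subspace has the same dimension
as the subspace it contains, so the two agree. -/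
theorem IsLagrangianSubspace.mem_of_forall {B : LinearMap.BilinForm ℝ V} (hB : B.IsAlt)
    (hnd : ∀ v, (∀ w, B v w = 0) → v = 0) {L : Submodule ℝ V} (hL : IsLagrangianSubspace B L)
    {v : V} (hv : ∀ w ∈ L, B w v = 0) : v ∈ L := by
  have hnd' : B.Nondegenerate := by
    exact hB.isRefl.nondegenerate_iff_separatingLeft.2 hnd
  have h1 : L ≤ B.orthogonal L := fun v hv w hw => hL.1 w hw v hv
  have h2 := LinearMap.BilinForm.finrank_orthogonal hnd' L
  have h3 : L = B.orthogonal L := Submodule.eq_of_le_of_finrank_le h1 (by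
    have := hL.2; omega)
  rw [h3]
  exact hv

end Lagrangian

/-! ### Monotone Lagrangian curves and their intersection with a hyperplane -/

section JacobiCurves

variable {V : Type*} [NormedAddCommGroup V] [NormedSpace ℝ V] 

/-- A monotone smooth curve of Lagrangian subspaces of a symplectic vector space. -/
structure IsMonotoneCurve (B : LinearMap.BilinForm ℝ V) (J : ℝ → Submodule ℝ V) (n : ℕ) : Prop where
  alt : B.IsAlt
  nondeg : ∀ v, (∀ w, B v w = 0) → v = 0
  finrank_eq : Module.finrank ℝ V = 2 * n
  lagrangian : ∀ t, IsLagrangianSubspace B (J t)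
  frame : ∀ t, ∃ a : Fin n → ℝ → V, (∀ᶠ s in 𝓝 t, ∀ i, ContDiffAt ℝ ∞ (a i) s) ∧
    (∀ᶠ s in 𝓝 t, ∀ i, a i s ∈ J s) ∧
    ∀ y : Fin n → ℝ, y ≠ 0 →
      0 < y ⬝ᵥ (bilinGram B (fun i => deriv (a i) t) (fun i => a i t)).mulVec y

variable [FiniteDimensional ℝ V] {B : LinearMap.BilinForm ℝ V} {J : ℝ → Submodule ℝ V}

theorem IsMonotoneCurve.exists_normalFrame {n : ℕ} (h : IsMonotoneCurve B J n) :
    ∃ e : Fin n → ℝ → V, ∀ t, IsNormalFrameAt B J e t := by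
  refine exists_global_normalFrame h.alt (fun t => Eventually.of_forall fun s => ?_) fun t => ?_
  · have := (h.lagrangian s).2; have := h.finrank_eq; omega
  · obtain ⟨a, h1, h2, h3⟩ := h.frame t
    refine exists_normalFrame_near h.alt a t h1 h2 ?_ h3
    filter_upwards [h2] with s hs
    ext i j
    exact (h.lagrangian s).1 _ (hs i) _ (hs j)

variable {m : ℕ} {h : V}

/-- If `h` is skew-orthogonal to the frame, it lies in the Lagrangian subspace `J t`, and its
coefficients in the frame are, up to sign, the pairings with the velocities. They cannot all vanish.
-/
theorem IsMonotoneCurve.pairing_ne_zero (hJ : IsMonotoneCurve B J (m + 1)) (hh : h ≠ 0)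
    {E : Fin (m + 1) → ℝ → V} {t : ℝ} (hE : IsNormalFrameAt B J E t)
    (h0 : ∀ i, B h (E i t) = 0) : ∃ i, B h (deriv (E i) t) ≠ 0 := by
  by_contra! hc
  apply hh
  have hfr : Module.finrank ℝ (J t) ≤ m + 1 := by
    have := (hJ.lagrangian t).2; have := hJ.finrank_eq; omega
  have hmem : h ∈ J t := by
    refine (hJ.lagrangian t).mem_of_forall hJ.alt hJ.nondeg fun w hw => ?_
    rw [hE.mem_span hfr hw]
    simp only [map_sum, map_smul, LinearMap.sum_apply, LinearMap.smul_apply, smul_eq_mul]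
    refine Finset.sum_eq_zero fun k _ => ?_
    rw [← LinearMap.IsAlt.neg hJ.alt h, h0]; simp
  rw [hE.mem_span hfr hmem]
  refine Finset.sum_eq_zero fun k _ => ?_
  rw [← LinearMap.IsAlt.neg hJ.alt h, hc]; simp

/-- If `h ∈ J s`, all functions `B h (E i s)` vanish. At `t` some of them is nonzero or has nonzero
derivative, so simultaneous zeros are isolated. -/
theorem IsMonotoneCurve.eventually_not_mem (hJ : IsMonotoneCurve B J (m + 1)) (hh : h ≠ 0) (t : ℝ) :
    ∀ᶠ s in 𝓝[≠] t, h ∉ J s := by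
  obtain ⟨E, hE⟩ := hJ.exists_normalFrame
  have hα : ∀ i, HasDerivAt (fun s => B h (E i s)) (B h (deriv (E i) t)) t := fun i => by
    simpa using HasDerivAt.bilinForm B (hasDerivAt_const t h) ((hE t).hasDerivAt i)
  have : ∃ i, ∀ᶠ s in 𝓝[≠] t, B h (E i s) ≠ 0 := by
    by_cases h0 : ∀ i, B h (E i t) = 0
    · obtain ⟨i, hi⟩ := hJ.pairing_ne_zero hh (hE t) h0
      exact ⟨i, (hα i).eventually_ne hi⟩
    · push Not at h0
      obtain ⟨i, hi⟩ := h0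
      exact ⟨i, ((hα i).continuousAt.eventually_ne hi).filter_mono nhdsWithin_le_nhds⟩
  obtain ⟨i, hi⟩ := this
  filter_upwards [hi] with s hs hmem
  exact hs ((hJ.lagrangian s).1 _ hmem _ ((hE s).mem i))

/-- If the hyperplane contained `J t`, then `h` would be skew-orthogonal to the Lagrangian subspace
`J t` and so belong to it. Otherwise the intersection is proper. -/
theorem IsMonotoneCurve.finrank_inf_le (hJ : IsMonotoneCurve B J (m + 1)) {t : ℝ} (ht : h ∉ J t) :
    Module.finrank ℝ ↥(J t ⊓ skewComplement B h) ≤ m := by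
  have hlt : J t ⊓ skewComplement B h < J t := by
    refine lt_of_le_of_ne inf_le_left fun heq => ht ?_
    refine (hJ.lagrangian t).mem_of_forall hJ.alt hJ.nondeg fun w hw => ?_
    rw [← heq] at hw
    rw [← LinearMap.IsAlt.neg hJ.alt h w, show B h w = 0 from hw.2, neg_zero]
  have := Submodule.finrank_lt_finrank_of_lt hlt
  have := (hJ.lagrangian t).2; have := hJ.finrank_eq; omega

/-- A monotone curve has a global normal frame in the skew-orthogonal complement of a vector. -/
theorem IsMonotoneCurve.exists_reduced_normalFrame (hJ : IsMonotoneCurve B J (m + 1)) (hh : h ≠ 0) :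
    ∃ e : Fin m → ℝ → V, ∀ t, IsNormalFrameAt B (fun t => J t ⊓ skewComplement B h) e t := by
  obtain ⟨E, hE⟩ := hJ.exists_normalFrame
  refine exists_global_normalFrame hJ.alt
    (fun t => (hJ.eventually_not_mem hh t).mono fun s hs => hJ.finrank_inf_le hs) fun t => ?_
  have hαsm : ∀ i, ContDiff ℝ ∞ (fun s => B h (E i s)) := fun i =>
    contDiff_iff_contDiffAt.2 fun s => ContDiffAt.bilinForm B contDiffAt_const ((hE s).smooth i)
  have hα : ∀ i, HasDerivAt (fun s => B h (E i s)) (B h (deriv (E i) t)) t := fun i => by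
    simpa using HasDerivAt.bilinForm B (hasDerivAt_const t h) ((hE t).hasDerivAt i)
  -- The pairings of `h` with the frame may vanish simultaneously at `t`, but only to first order.
  -- Dividing by `s - t` leaves functions `θ` which do not all vanish at `t` and define the same
  -- hyperplane away from the zeros of `κ`.
  obtain ⟨θ, κ, hθ, hακ, p, hp⟩ : ∃ (θ : Fin (m + 1) → ℝ → ℝ) (κ : ℝ → ℝ),
      (∀ i, ContDiff ℝ ∞ (θ i)) ∧ (∀ i s, B h (E i s) = κ s * θ i s) ∧ ∃ p, θ p t ≠ 0 := by
    by_cases h0 : ∀ i, B h (E i t) = 0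
    · obtain ⟨p, hp⟩ := hJ.pairing_ne_zero hh (hE t) h0
      choose q hq1 hq2 hq3 using fun i => exists_smooth_eq_sub_mul (hαsm i) (h0 i)
      exact ⟨q, fun s => s - t, hq1, hq2, p, by rw [hq3, (hα p).deriv]; exact hp⟩
    · push Not at h0
      exact ⟨fun i s => B h (E i s), fun _ => 1, hαsm, fun i s => (one_mul _).symm, h0⟩
  -- The rows are the vectors `θ_p E_j - θ_j E_p` for `j ≠ p`, which annihilate `θ`. They form a
  -- smooth family of rank `m` near `t`, also when `h ∈ J t`.
  let X : ℝ → Matrix (Fin m) (Fin (m + 1)) ℝ := fun s => Matrix.of fun i k =>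
    (if k = p.succAbove i then θ p s else 0) - (if k = p then θ (p.succAbove i) s else 0)
  have hX : ∀ s i k, ContDiffAt ℝ ∞ (fun s => X s i k) s := fun s i k => by
    simp only [X, Matrix.of_apply]
    refine ContDiffAt.sub ?_ ?_ <;> split_ifs
    · exact (hθ _).contDiffAt
    · exact contDiffAt_const
    · exact (hθ _).contDiffAt
    · exact contDiffAt_const
  have hXsum : ∀ s i (g : Fin (m + 1) → ℝ), ∑ k, X s i k * g k =
      θ p s * g (p.succAbove i) - θ (p.succAbove i) s * g p := fun s i g => by
    simp [X, sub_mul, Finset.sum_sub_distrib]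
  refine exists_normalFrame_near hJ.alt (fun i s => matComb (X s) (fun k => E k s) i) t
    (Eventually.of_forall fun s i => ContDiffAt.matComb (hX s) (hE s).smooth i)
    (Eventually.of_forall fun s i => ⟨matComb_mem _ (hE s).mem i, ?_⟩)
    (Eventually.of_forall fun s => ?_) fun y hy => ?_
  · change B h (matComb (X s) (fun k => E k s) i) = 0
    simp only [matComb, map_sum, map_smul, smul_eq_mul, hακ]
    rw [hXsum s i (fun k => κ s * θ k s)]
    ring
  · change bilinGram B (matComb (X s) fun k => E k s) (matComb (X s) fun k => E k s) = 0
    rw [bilinGram_matComb, (hE s).e_e, Matrix.mul_zero, Matrix.zero_mul]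
  · have hd : (fun i => deriv (fun s => matComb (X s) (fun k => E k s) i) t) =
        matComb (Matrix.of fun i k => deriv (fun s => X s i k) t) (fun k => E k t) +
          matComb (X t) (fun k => deriv (E k) t) := by
      funext i
      exact (HasDerivAt.matComb (fun i k => (hX t i k).hasDerivAt_deriv) (hE t).hasDerivAt i).deriv
    rw [hd]
    change 0 < y ⬝ᵥ (bilinGram B _ (matComb (X t) fun k => E k t)).mulVec y
    rw [bilinGram_add_left, bilinGram_matComb, bilinGram_matComb, (hE t).e_e, (hE t).f_e,
      Matrix.mul_zero, Matrix.zero_mul, zero_add, Matrix.mul_one, ← Matrix.mulVec_mulVec,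
      Matrix.dotProduct_mulVec, ← Matrix.mulVec_transpose]
    -- Since `E` is normal, the velocity form of the new frame at `t` is `X Xᵀ`, so positivity is
    -- injectivity of `Xᵀ`. This is seen in the coordinates other than `p`, where `Xᵀ y` equals `θ_p
    -- y_i`.
    have hne : (X t)ᵀ.mulVec y ≠ 0 := by
      intro h0
      refine hy (funext fun i => ?_)
      have := congr_fun h0 (p.succAbove i)
      simp only [Matrix.mulVec, dotProduct, Matrix.transpose_apply, X, Matrix.of_apply,
        Fin.succAbove_ne, if_false, sub_zero, Fin.succAbove_right_inj, ite_mul, zero_mul,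
        Finset.sum_ite_eq, Finset.mem_univ, if_true, Pi.zero_apply] at this
      exact (mul_eq_zero.1 this).resolve_left hp
    have := Matrix.dotProduct_star_self_pos_iff.2 hne
    simpa using this

end JacobiCurves

/-! ### Darboux bases and existence of curvature operators -/

section CanonicalFrames

variable {W : Type*} [AddCommGroup W] [Module ℝ W] {B : LinearMap.BilinForm ℝ W} {m : ℕ}

theorem IsDarbouxBasis.eq_sum (hB : B.IsAlt) {e f : Fin m → W} (h : IsDarbouxBasis B e f) (v : W) :
    v = ∑ k, B (f k) v • e k + ∑ k, B v (e k) • f k := by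
  have hv : v ∈ Submodule.span ℝ (range (Sum.elim e f)) := by
    rw [Sum.elim_range, h.span_eq_top]; trivial
  obtain ⟨c, rfl⟩ := (Submodule.mem_span_range_iff_exists_fun ℝ).1 hv
  have h1 : ∀ i j, B (e i) (f j) = -if j = i then 1 else 0 := fun i j => by
    rw [← LinearMap.IsAlt.neg hB, h.f_e]
  simp [Fintype.sum_sum_type, h.e_e, h.f_f, h.f_e]

theorem IsDarbouxBasis.mem_of_forall (hB : B.IsAlt) {e f : Fin m → W} (h : IsDarbouxBasis B e f)
    {L : Submodule ℝ W} (he : ∀ k, e k ∈ L) {v : W} (hv : ∀ k, B v (e k) = 0) : v ∈ L := by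
  rw [h.eq_sum hB v]
  simp only [hv, zero_smul, Finset.sum_const_zero, add_zero]
  exact L.sum_mem fun k _ => L.smul_mem _ (he k)

theorem IsDarbouxBasis.eq_sum_of_mem (hB : B.IsAlt) {e f : Fin m → W} (h : IsDarbouxBasis B e f)
    {L : Submodule ℝ W} (he : ∀ k, e k ∈ L) (hL : ∀ v ∈ L, ∀ w ∈ L, B v w = 0) {v : W}
    (hv : v ∈ L) : v = ∑ k, B (f k) v • e k := by
  conv_lhs => rw [h.eq_sum hB v]
  simp [hL v hv _ (he _)]

/-- A canonical frame whose second velocities pair trivially with the frame defines curvature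
operators. -/
theorem IsCanonicalFrame.exists_curvatureOperator (hB : B.IsAlt) {J : ℝ → Submodule ℝ W}
    {e f g : Fin m → ℝ → W} (h : IsCanonicalFrame B J e f) (hg : ∀ i, HasVelocity (f i) (g i))
    (hge : ∀ i k t, B (g i t) (e k t) = 0) :
    ∃ R : ∀ t, J t →ₗ[ℝ] J t, IsCurvatureOperator B J R := by
  have hmem : ∀ k t, g k t ∈ J t := fun k t =>
    (h.darboux t).mem_of_forall hB (fun k => h.mem k t) fun j => hge k j t
  -- The functional `B (f k t)` is dual to the frame, so this operator sends `e_k` to `-g_k`, as the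
  -- structural equation demands.
  let R : ∀ t, J t →ₗ[ℝ] J t := fun t =>
    -∑ k, ((B (f k t)).comp (J t).subtype).smulRight (⟨g k t, hmem k t⟩ : J t)
  refine ⟨R, m, e, f, h, fun i => ?_⟩
  have : (fun t => -(R t ⟨e i t, h.mem i t⟩ : W)) = g i := by
    funext t
    simp [R, (h.darboux t).f_e]
  rw [this]
  exact hg i

end CanonicalFrames

/-! ### Independence of the curvature trace from the canonical frame -/

section Uniqueness

variable {W : Type*} [NormedAddCommGroup W] [NormedSpace ℝ W] [FiniteDimensional ℝ W]

theorem HasVelocity.hasDerivAt {γ γ' : ℝ → W} (h : HasVelocity γ γ') (t : ℝ) :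
    HasDerivAt γ (γ' t) t := by
  let b := Module.finBasis ℝ W
  have h1 : HasDerivAt (fun s => b.equivFunL (γ s)) (b.equivFunL (γ' t)) t :=
    hasDerivAt_pi.2 fun i => h (b.coord i) t
  have h2 := (b.equivFunL.symm : _ →L[ℝ] W).hasFDerivAt.comp_hasDerivAt t h1
  have h3 : (fun s => b.equivFunL.symm (b.equivFunL (γ s))) = γ := by funext s; simp
  have h4 : HasDerivAt (fun s => b.equivFunL.symm (b.equivFunL (γ s)))
    (b.equivFunL.symm (b.equivFunL (γ' t))) t := h2
  rw [h3] at h4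
  simpa using h4

theorem IsSmoothCurve.contDiff {γ : ℝ → W} (h : IsSmoothCurve γ) : ContDiff ℝ ∞ γ := by
  let b := Module.finBasis ℝ W
  have h1 : ContDiff ℝ ∞ (fun s => b.equivFunL (γ s)) := contDiff_pi.2 fun i => h (b.coord i)
  have h3 : (fun s => b.equivFunL.symm (b.equivFunL (γ s))) = γ := by funext s; simp
  rw [← h3]
  exact (b.equivFunL.symm : _ →L[ℝ] W).contDiff.comp h1

variable {B : LinearMap.BilinForm ℝ W} {J : ℝ → Submodule ℝ W} {m : ℕ}

theorem IsCanonicalFrame.isNormalFrameAt {e f : Fin m → ℝ → W} (h : IsCanonicalFrame B J e f)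
    (t : ℝ) : IsNormalFrameAt B J e t := by
  have hd : (fun k => deriv (e k) t) = fun k => f k t :=
    funext fun k => ((h.velocity k).hasDerivAt t).deriv
  refine ⟨fun k => (h.smooth k).contDiff.contDiffAt, fun k => h.mem k t, ?_, ?_, ?_⟩
  · ext i j; exact (h.darboux t).e_e i j
  · rw [hd]; ext i j; simp [bilinGram, (h.darboux t).f_e, Matrix.one_apply]
  · rw [hd]; ext i j; exact (h.darboux t).f_f i j

/-- The coordinate of `v ∈ J` along `e_k` is `B(f_k, v)`. Hence the diagonal entries of `R` are
`B(f_k, R e_k) = -B(f_k, f_k') = B(f_k', f_k)`. -/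
theorem IsCanonicalFrame.trace_eq (hB : B.IsAlt) (hJ : ∀ t, ∀ v ∈ J t, ∀ w ∈ J t, B v w = 0)
    {e f : Fin m → ℝ → W} (h : IsCanonicalFrame B J e f) {R : ∀ t, J t →ₗ[ℝ] J t}
    (hR : ∀ i, HasVelocity (f i) (fun t => -(R t ⟨e i t, h.mem i t⟩ : W))) (t : ℝ) :
    LinearMap.trace ℝ (J t) (R t) =
      (bilinGram B (fun k => deriv (deriv (e k)) t) (fun k => deriv (e k) t)).trace := by
  have hli : LinearIndependent ℝ (fun k => (⟨e k t, h.mem k t⟩ : J t)) :=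
    LinearIndependent.of_comp (J t).subtype (h.isNormalFrameAt t).linearIndependent
  have hsp : ⊤ ≤ Submodule.span ℝ (range fun k => (⟨e k t, h.mem k t⟩ : J t)) := by
    rintro ⟨v, hv⟩ -
    have hv' := (h.darboux t).eq_sum_of_mem hB (fun k => h.mem k t) (hJ t) hv
    refine (Submodule.mem_span_range_iff_exists_fun ℝ).2 ⟨fun k => B (f k t) v, ?_⟩
    ext
    simpa using hv'.symm
  let b := Module.Basis.mk hli hsp
  have hb : ∀ k, b k = ⟨e k t, h.mem k t⟩ := fun k => Module.Basis.mk_apply hli hsp k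
  have hrepr : ∀ (v : J t) k, b.repr v k = B (f k t) v := by
    intro v k
    conv_rhs => rw [← b.sum_repr v]
    simp [hb, (h.darboux t).f_e]
  have hd : ∀ k, deriv (e k) = f k := fun k => funext fun s => ((h.velocity k).hasDerivAt s).deriv
  rw [LinearMap.trace_eq_matrix_trace ℝ b, Matrix.trace, Matrix.trace]
  refine Finset.sum_congr rfl fun k _ => ?_
  simp only [Matrix.diag_apply, LinearMap.toMatrix_apply, hrepr, hb, hd, bilinGram, Matrix.of_apply]
  rw [((hR k).hasDerivAt t).deriv, ← LinearMap.IsAlt.neg hB]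
  simp

/-- The trace of a curvature operator may be computed with any canonical frame. -/
theorem IsCurvatureOperator.trace_eq (hB : B.IsAlt) (hJ : ∀ t, ∀ v ∈ J t, ∀ w ∈ J t, B v w = 0)
    (hfr : ∀ t, Module.finrank ℝ (J t) ≤ m)
    {R : ∀ t, J t →ₗ[ℝ] J t} (hR : IsCurvatureOperator B J R) {e : Fin m → ℝ → W}
    (he : ∀ t, IsNormalFrameAt B J e t) (t : ℝ) :
    LinearMap.trace ℝ (J t) (R t) =
      (bilinGram B (fun k => deriv (deriv (e k)) t) (fun k => deriv (e k) t)).trace := by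
  obtain ⟨m', e', f', h', hR'⟩ := hR
  -- The canonical frame hidden in the curvature operator has a length of its own. It is at most the
  -- dimension of `J t`, and conversely it spans `J t`, which contains the `m` independent vectors
  -- of `e`.
  have hle : m' ≤ m := by
    have hli : LinearIndependent ℝ (fun k => (⟨e' k t, h'.mem k t⟩ : J t)) :=
      LinearIndependent.of_comp (J t).subtype (h'.isNormalFrameAt t).linearIndependent
    have := hli.fintype_card_le_finrank
    rw [Fintype.card_fin] at this
    exact this.trans (hfr t)
  have hge : m ≤ m' := by
    have hli := (he t).linearIndependent
    have hmem : ∀ k, e k t ∈ Submodule.span ℝ (range fun k => e' k t) := fun k => by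
      rw [(h'.darboux t).eq_sum_of_mem hB (fun k => h'.mem k t) (hJ t) ((he t).mem k)]
      exact Submodule.sum_mem _ fun j _ => Submodule.smul_mem _ _ (Submodule.subset_span ⟨j, rfl⟩)
    have hli2 : LinearIndependent ℝ (fun k => (⟨e k t, hmem k⟩ :
        Submodule.span ℝ (range fun k => e' k t))) := LinearIndependent.of_comp (Submodule.subtype _) hli
    have h1 := hli2.fintype_card_le_finrank
    have h2 := finrank_range_le_card (R := ℝ) (fun k => e' k t)
    rw [Fintype.card_fin] at h1 h2
    exact h1.trans h2
  obtain rfl : m' = m := le_antisymm hle hge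
  rw [h'.trace_eq hB hJ hR' t]
  obtain ⟨O, hO, hOe⟩ := exists_orthogonal_of_normalFrames hB (show t - 1 < t + 1 by linarith)
    (fun s _ => he s) (fun s _ => h'.isNormalFrameAt s) (fun s _ => Eventually.of_forall hfr)
  have ht : t ∈ Ioo (t - 1) (t + 1) := ⟨by linarith, by linarith⟩
  have hsm : ∀ k, ContDiff ℝ ∞ (e' k) := fun k => (h'.smooth k).contDiff
  have hd : ∀ s ∈ Ioo (t - 1) (t + 1), ∀ k,
      deriv (e k) s = matComb O (fun j => deriv (e' j) s) k := by
    intro s hs k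
    have h1 : e k =ᶠ[𝓝 s] fun s => matComb O (fun j => e' j s) k := by
      filter_upwards [Ioo_mem_nhds hs.1 hs.2] with r hr using hOe r hr k
    rw [h1.deriv_eq]
    have := HasDerivAt.matComb (P := fun _ => O) (P' := 0) (t := s)
      (fun i j => hasDerivAt_const s (O i j)) (fun j => (hsm j).contDiffAt.hasDerivAt_deriv) k
    rw [this.deriv]; simp [matComb]
  have hdd : ∀ k, deriv (deriv (e k)) t = matComb O (fun j => deriv (deriv (e' j)) t) k := by
    intro k
    have h1 : deriv (e k) =ᶠ[𝓝 t] fun s => matComb O (fun j => deriv (e' j) s) k := by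
      filter_upwards [Ioo_mem_nhds ht.1 ht.2] with r hr using hd r hr k
    rw [h1.deriv_eq]
    have := HasDerivAt.matComb (P := fun _ => O) (P' := 0) (t := t)
      (fun i j => hasDerivAt_const t (O i j))
      (fun j => (hsm j).contDiffAt.deriv_smooth.hasDerivAt_deriv) k
    rw [this.deriv]; simp [matComb]
  rw [funext hdd, funext (hd t ht)]
  rw [bilinGram_matComb, Matrix.trace_mul_cycle, mul_eq_one_comm.1 hO, Matrix.one_mul]

end Uniqueness

/-! ### Curvature of the reduced curve, computed upstairs -/

section ReducedCurves

variable {V : Type*} [NormedAddCommGroup V] [NormedSpace ℝ V] [FiniteDimensional ℝ V]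
  {B : LinearMap.BilinForm ℝ V} {h : V}

/-- Smoothness and velocity of curves in the quotient are tested by linear functionals. This lifts
every test to the ambient space. -/
theorem exists_extend_reduced (l : Module.Dual ℝ (ReducedSpace B h)) :
    ∃ L : V →L[ℝ] ℝ, ∀ w : skewComplement B h, l (Submodule.Quotient.mk w) = L w := by
  obtain ⟨L, hL⟩ := LinearMap.exists_extend (l.comp (lineInSkewComplement B h).mkQ)
  exact ⟨L.toContinuousLinearMap, fun w => (LinearMap.congr_fun hL w).symm⟩

theorem hasVelocity_mk {γ γ' : ℝ → V} (hd : ∀ t, HasDerivAt γ (γ' t) t)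
    (hγ : ∀ t, γ t ∈ skewComplement B h) (hγ' : ∀ t, γ' t ∈ skewComplement B h) :
    HasVelocity (V := ReducedSpace B h) (fun t => Submodule.Quotient.mk ⟨γ t, hγ t⟩)
      (fun t => Submodule.Quotient.mk ⟨γ' t, hγ' t⟩) := by
  intro l t
  obtain ⟨L, hL⟩ := exists_extend_reduced l
  simp only [hL]
  exact L.hasFDerivAt.comp_hasDerivAt t (hd t)

theorem isSmoothCurve_mk {γ : ℝ → V} (hd : ContDiff ℝ ∞ γ) (hγ : ∀ t, γ t ∈ skewComplement B h) :
    IsSmoothCurve (V := ReducedSpace B h) (fun t => Submodule.Quotient.mk ⟨γ t, hγ t⟩) := by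
  intro l
  obtain ⟨L, hL⟩ := exists_extend_reduced l
  simp only [hL]
  exact L.contDiff.comp hd

theorem finrank_reducedSpace (hB : B.IsAlt) (hnd : ∀ v, (∀ w, B v w = 0) → v = 0) {m : ℕ}
    (hV : Module.finrank ℝ V = 2 * (m + 1)) (hh : h ≠ 0) :
    Module.finrank ℝ (ReducedSpace B h) = 2 * m := by
  have h0 : B h ≠ 0 := fun h0 => hh (hnd h fun w => by rw [h0]; rfl)
  have h1 : Module.finrank ℝ (skewComplement B h) + 1 = Module.finrank ℝ V :=
    Module.Dual.finrank_ker_add_one_of_ne_zero h0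
  have hle : Submodule.span ℝ {h} ≤ skewComplement B h := by
    rw [Submodule.span_singleton_le_iff_mem]
    exact hB h
  have h2 : Module.finrank ℝ (lineInSkewComplement B h) = 1 := by
    rw [(Submodule.comapSubtypeEquivOfLe hle).finrank_eq, finrank_span_singleton hh]
  have h3 := Submodule.finrank_quotient_add_finrank (lineInSkewComplement B h)
  change Module.finrank ℝ (ReducedSpace B h) + _ = _ at h3
  omega

omit [FiniteDimensional ℝ V] in
theorem reducedForm_isAlt (hB : B.IsAlt) : (reducedForm B hB h).IsAlt := by
  intro v
  obtain ⟨w, rfl⟩ := Submodule.Quotient.mk_surjective _ v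
  rw [reducedForm_mk]
  exact hB w

omit [FiniteDimensional ℝ V] in
theorem mem_reducedSubspace {L : Submodule ℝ V} {w : skewComplement B h} (hw : (w : V) ∈ L) :
    (Submodule.Quotient.mk w : ReducedSpace B h) ∈ reducedSubspace B h L :=
  Submodule.mem_map_of_mem (f := (lineInSkewComplement B h).mkQ)
    (show w ∈ L.comap (skewComplement B h).subtype from hw)

omit [FiniteDimensional ℝ V] in
theorem reducedForm_eq_zero (hB : B.IsAlt) {L : Submodule ℝ V} (hL : ∀ v ∈ L, ∀ w ∈ L, B v w = 0)
    {v w : ReducedSpace B h} (hv : v ∈ reducedSubspace B h L) (hw : w ∈ reducedSubspace B h L) :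
    reducedForm B hB h v w = 0 := by
  obtain ⟨v, hv, rfl⟩ := hv
  obtain ⟨w, hw, rfl⟩ := hw
  exact hL _ hv _ hw

variable {J : ℝ → Submodule ℝ V} {m : ℕ}

/-- The vector `h` does not depend on time, so the equation `B h (e k s) = 0` can be differentiated
twice. -/
theorem IsMonotoneCurve.deriv_mem_skewComplement {e : Fin m → ℝ → V}
    (he : ∀ t, IsNormalFrameAt B (fun t => J t ⊓ skewComplement B h) e t) (k : Fin m) (t : ℝ) :
    deriv (e k) t ∈ skewComplement B h ∧ deriv (deriv (e k)) t ∈ skewComplement B h := by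
  have hmem : ∀ {γ : ℝ → V} {γ' : V} {t : ℝ}, (∀ s, B h (γ s) = 0) → HasDerivAt γ γ' t → B h γ' = 0 := by
    intro γ γ' t h0 hd
    have h1 := HasDerivAt.bilinForm B (hasDerivAt_const t h) hd
    have h2 : HasDerivAt (fun s => B h (γ s)) 0 t := by
      simp only [h0]; exact hasDerivAt_const t 0
    simpa using h1.unique h2
  have h1 : ∀ t, B h (deriv (e k) t) = 0 := fun t =>
    hmem (fun s => ((he s).mem k).2) ((he t).hasDerivAt k)
  exact ⟨h1 t, hmem h1 ((he t).smooth k).deriv_smooth.hasDerivAt_deriv⟩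

/-- The trace of the curvature operator of the reduction of a monotone curve, in terms of a normal
frame. -/
theorem IsMonotoneCurve.trace_curvatureOperator_reduced (hJ : IsMonotoneCurve B J (m + 1))
    (hB : B.IsAlt) (hh : h ≠ 0) {e : Fin m → ℝ → V}
    (he : ∀ t, IsNormalFrameAt B (fun t => J t ⊓ skewComplement B h) e t) (t : ℝ) :
    LinearMap.trace ℝ (reducedSubspace B h (J t))
      (curvatureOperator (reducedForm B hB h) (fun t => reducedSubspace B h (J t)) t) =
      (bilinGram B (fun k => deriv (deriv (e k)) t) (fun k => deriv (e k) t)).trace := by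
  have hf : ∀ k t, deriv (e k) t ∈ skewComplement B h := fun k t =>
    (IsMonotoneCurve.deriv_mem_skewComplement he k t).1
  have hg : ∀ k t, deriv (deriv (e k)) t ∈ skewComplement B h := fun k t =>
    (IsMonotoneCurve.deriv_mem_skewComplement he k t).2
  have hsm : ∀ k, ContDiff ℝ ∞ (e k) := fun k => contDiff_iff_contDiffAt.2 fun t => (he t).smooth k
  have hsm' : ∀ k, ContDiff ℝ ∞ (deriv (e k)) := fun k => (contDiff_infty_iff_deriv.1 (hsm k)).2
  let e' : Fin m → ℝ → ReducedSpace B h := fun k t =>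
    Submodule.Quotient.mk ⟨e k t, ((he t).mem k).2⟩
  let f' : Fin m → ℝ → ReducedSpace B h := fun k t => Submodule.Quotient.mk ⟨deriv (e k) t, hf k t⟩
  let g' : Fin m → ℝ → ReducedSpace B h := fun k t =>
    Submodule.Quotient.mk ⟨deriv (deriv (e k)) t, hg k t⟩
  have hvel : ∀ k, HasVelocity (e' k) (f' k) := fun k =>
    hasVelocity_mk (fun t => (he t).hasDerivAt k) _ _
  have hvel' : ∀ k, HasVelocity (f' k) (g' k) := fun k =>
    hasVelocity_mk (fun t => (hsm' k).contDiffAt.hasDerivAt_deriv) _ _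
  have hfe : ∀ t i j, B (deriv (e i) t) (e j t) = if i = j then 1 else 0 := fun t i j => by
    have := congr_fun (congr_fun (he t).f_e i) j
    simpa [bilinGram, Matrix.one_apply] using this
  have hfin := finrank_reducedSpace (h := h) hB hJ.nondeg hJ.finrank_eq hh
  have hdar : ∀ t, IsDarbouxBasis (reducedForm B hB h) (fun k => e' k t) (fun k => f' k t) := by
    intro t
    have hee : ∀ i j, reducedForm B hB h (e' i t) (e' j t) = 0 := fun i j =>
      congr_fun (congr_fun (he t).e_e i) j
    have hff : ∀ i j, reducedForm B hB h (f' i t) (f' j t) = 0 := fun i j =>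
      congr_fun (congr_fun (he t).f_f i) j
    have hfe' : ∀ i j, reducedForm B hB h (f' i t) (e' j t) = if i = j then 1 else 0 := hfe t
    have hef' : ∀ i j, reducedForm B hB h (e' i t) (f' j t) = if i = j then -1 else 0 := fun i j => by
      rw [← LinearMap.IsAlt.neg (reducedForm_isAlt hB), hfe']
      simp only [eq_comm (a := j)]; split_ifs <;> simp
    have hli : LinearIndependent ℝ (Sum.elim (fun k => e' k t) (fun k => f' k t)) := by
      rw [Fintype.linearIndependent_iff]
      intro c hc
      rw [Fintype.sum_sum_type] at hc
      simp only [Sum.elim_inl, Sum.elim_inr] at hc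
      rintro (i | i)
      · have := congr_arg (fun v => reducedForm B hB h (f' i t) v) hc
        simpa [hfe', hff] using this
      · have := congr_arg (fun v => reducedForm B hB h (e' i t) v) hc
        simpa [hef', hee] using this
    refine ⟨hli, ?_, hee, hff, hfe'⟩
    rw [← Sum.elim_range]
    -- The reduced space has dimension `2m`, the number of vectors of the frame; this holds also at
    -- times with `h ∈ J t`.
    refine hli.span_eq_top_of_card_eq_finrank' ?_
    rw [hfin, Fintype.card_sum, Fintype.card_fin]; ring
  have hcan : IsCanonicalFrame (reducedForm B hB h) (fun t => reducedSubspace B h (J t)) e' f' :=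
    ⟨fun k => isSmoothCurve_mk (hsm k) _, fun k t => mem_reducedSubspace ((he t).mem k).1, hvel, hdar⟩
  have hge : ∀ i k t, reducedForm B hB h (g' i t) (e' k t) = 0 := by
    intro i k t
    change B (deriv (deriv (e i)) t) (e k t) = 0
    have h1 := HasDerivAt.bilinForm B ((hsm' i).contDiffAt.hasDerivAt_deriv (t := t))
      ((he t).hasDerivAt k)
    have h2 : HasDerivAt (fun s => B (deriv (e i) s) (e k s)) 0 t := by
      simp only [hfe]; exact hasDerivAt_const t _
    have h3 := h1.unique h2
    have h4 : B (deriv (e i) t) (deriv (e k) t) = 0 := congr_fun (congr_fun (he t).f_f i) k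
    rwa [h4, add_zero] at h3
  have hiso : ∀ t, ∀ v ∈ reducedSubspace B h (J t), ∀ w ∈ reducedSubspace B h (J t),
      reducedForm B hB h v w = 0 := fun t v hv w hw =>
    reducedForm_eq_zero hB (hJ.lagrangian t).1 hv hw
  have hex := hcan.exists_curvatureOperator (reducedForm_isAlt hB) hvel' hge
  have hspec : IsCurvatureOperator (reducedForm B hB h) (fun t => reducedSubspace B h (J t))
      (curvatureOperator (reducedForm B hB h) (fun t => reducedSubspace B h (J t))) := by
    have : curvatureOperator (reducedForm B hB h) (fun t => reducedSubspace B h (J t)) =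
        hex.choose := by
      funext t; rw [curvatureOperator, dif_pos hex]
    rw [this]
    exact hex.choose_spec
  -- Closedness of the line turns the quotient seminorm into a norm, so the results on normal frames
  -- apply in the reduced space.
  have : IsClosed (lineInSkewComplement B h : Set (skewComplement B h)) :=
    Submodule.closed_of_finiteDimensional _
  have hfr : ∀ t, Module.finrank ℝ (reducedSubspace B h (J t)) ≤ m := by
    intro t
    have hle : reducedSubspace B h (J t) ≤ Submodule.span ℝ (range fun k => e' k t) := by
      intro v hv
      rw [(hdar t).eq_sum_of_mem (reducedForm_isAlt hB) (fun k => hcan.mem k t) (hiso t) hv]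
      exact Submodule.sum_mem _ fun j _ => Submodule.smul_mem _ _ (Submodule.subset_span ⟨j, rfl⟩)
    refine (Submodule.finrank_mono hle).trans ?_
    have := finrank_range_le_card (R := ℝ) (fun k => e' k t)
    rwa [Fintype.card_fin] at this
  rw [hspec.trace_eq (reducedForm_isAlt hB) hiso hfr (fun t => hcan.isNormalFrameAt t) t]
  have hd : ∀ k, deriv (e' k) = f' k := fun k => funext fun s => ((hvel k).hasDerivAt s).deriv
  have hd' : ∀ k, deriv (f' k) = g' k := fun k => funext fun s => ((hvel' k).hasDerivAt s).deriv
  simp only [hd, hd']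
  rfl

end ReducedCurves

/-! ### The index form and its reduction -/

section IndexForm

variable {V : Type*} [NormedAddCommGroup V] [NormedSpace ℝ V] [FiniteDimensional ℝ V]
  {B : LinearMap.BilinForm ℝ V} {J : ℝ → Submodule ℝ V}

/-- Along a monotone curve which stays transversal to a fixed Lagrangian subspace, the index form
is nonnegative. -/
theorem IsMonotoneCurve.integral_form_nonneg {n : ℕ} (hJ : IsMonotoneCurve B J n) {T : ℝ}
    (hT : 0 ≤ T) {D : Submodule ℝ V} (hD : IsLagrangianSubspace B D)
    (htr : ∀ t ∈ Icc 0 T, J t ⊓ D = ⊥) {ξ ξ' : ℝ → V} (hξ : ∀ t, HasDerivAt ξ (ξ' t) t)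
    (hξc : Continuous ξ') (hmem : ∀ t ∈ Icc 0 T, ξ' t ∈ J t) (h0 : ξ 0 = 0) (h1 : ξ T = 0) :
    0 ≤ ∫ t in (0 : ℝ)..T, B (ξ t) (ξ' t) := by
  have hB := hJ.alt
  obtain ⟨E, hE⟩ := hJ.exists_normalFrame
  have hDn : Module.finrank ℝ D = n := by have := hD.2; have := hJ.finrank_eq; omega
  let d : Module.Basis (Fin n) ℝ D := Module.finBasisOfFinrankEq ℝ D hDn
  have hmemD : ∀ v : V, (∀ j, B v (d j) = 0) → v ∈ D := by
    intro v hv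
    refine hD.mem_of_forall hB hJ.nondeg fun w hw => ?_
    have : B v w = 0 := by
      have hw' : ((∑ i, d.repr ⟨w, hw⟩ i • d i : D) : V) = w :=
        congr_arg (Subtype.val) (d.sum_repr ⟨w, hw⟩)
      rw [← hw']
      simp only [Submodule.coe_sum, Submodule.coe_smul, map_sum, map_smul, hv, smul_zero,
        Finset.sum_const_zero]
    rw [← LinearMap.IsAlt.neg hB, this, neg_zero]
  let N : ℝ → Matrix (Fin n) (Fin n) ℝ := fun t => Matrix.of fun i j => B (E i t) (d j)
  have hNsm : ∀ t i j, ContDiffAt ℝ ∞ (fun s => N s i j) t := fun t i j =>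
    ContDiffAt.bilinForm B ((hE t).smooth i) contDiffAt_const
  have hNdet : ∀ t ∈ Icc 0 T, (N t).det ≠ 0 := by
    intro t ht hdet
    obtain ⟨x, hx, hx0⟩ := Matrix.exists_vecMul_eq_zero_iff.2 hdet
    have hu : ∑ i, x i • E i t ∈ J t ⊓ D := by
      refine ⟨(J t).sum_mem fun i _ => (J t).smul_mem _ ((hE t).mem i), hmemD _ fun j => ?_⟩
      have := congr_fun hx0 j
      simpa [Matrix.vecMul, dotProduct, N] using this
    rw [htr t ht, Submodule.mem_bot] at hu
    exact hx (funext (Fintype.linearIndependent_iff.1 (hE t).linearIndependent x hu))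
  have hNdet' : ∀ t ∈ Icc 0 T, ∀ᶠ s in 𝓝 t, (N s).det ≠ 0 := by
    intro t ht
    have : ContMDiffAt 𝓘(ℝ, ℝ) 𝓘(ℝ, ℝ) ∞ (fun t => (N t).det) t :=
      ContMDiffAt.matrix_det fun i j => contMDiffAt_iff_contDiffAt.2 (hNsm t i j)
    exact this.continuousAt.eventually_ne (hNdet t ht)
  -- Coordinates, in the normal frame, of the projection `u` of `ξ` to `J t` along `D`. Since `N` is
  -- the pairing of the frame with a basis of `D`, `ξ - u` is skew-orthogonal to `D`, hence lies in
  -- `D`.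
  let x : Fin n → ℝ → ℝ := fun i t => ∑ j, B (ξ t) (d j) * (N t)⁻¹ j i
  let u : ℝ → V := fun t => ∑ i, x i t • E i t
  have hδ : ∀ t, (N t).det ≠ 0 → ∀ j, B (ξ t - u t) (d j) = 0 := by
    intro t ht j
    have h2 : B (u t) (d j) = ∑ k, B (ξ t) (d k) * ((N t)⁻¹ * N t) k j := by
      simp only [u, x, map_sum, map_smul, LinearMap.sum_apply, LinearMap.smul_apply, smul_eq_mul,
        Matrix.mul_apply, Finset.sum_mul, Finset.mul_sum]
      rw [Finset.sum_comm]
      exact Finset.sum_congr rfl fun _ _ => Finset.sum_congr rfl fun _ _ => by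
        simp only [N, Matrix.of_apply]; ring
    rw [map_sub, LinearMap.sub_apply, h2, Matrix.nonsing_inv_mul _ (isUnit_iff_ne_zero.2 ht)]
    simp [Matrix.one_apply]
  have hder : ∀ t ∈ Icc 0 T, HasDerivAt (fun s => B (u s) (ξ s))
      ((∑ i, x i t * x i t) - B (ξ t) (ξ' t)) t := by
    intro t ht
    have hx : ∀ i, ∃ x', HasDerivAt (x i) x' t := by
      intro i
      have : DifferentiableAt ℝ (x i) t := by
        refine DifferentiableAt.fun_sum fun j _ => ?_
        refine DifferentiableAt.mul ?_ ?_
        · exact (HasDerivAt.bilinForm B (hξ t) (hasDerivAt_const t _)).differentiableAt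
        · exact (ContDiffAt.matrix_inv (hNsm t) (hNdet t ht) j i).differentiableAt (by simp)
      exact ⟨_, this.hasDerivAt⟩
    choose x' hx' using hx
    let u' : V := ∑ i, (x i t • deriv (E i) t + x' i • E i t)
    have hu : HasDerivAt u u' t :=
      HasDerivAt.fun_sum fun i _ => (hx' i).smul ((hE t).hasDerivAt i)
    have huJ : u t ∈ J t := (J t).sum_mem fun i _ => (J t).smul_mem _ ((hE t).mem i)
    have hEJ : ∀ i, B (E i t) (u t) = 0 := fun i => (hJ.lagrangian t).1 _ ((hE t).mem i) _ huJ
    have hfE : ∀ i j, B (deriv (E i) t) (E j t) = if i = j then 1 else 0 := fun i j => by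
      have := congr_fun (congr_fun (hE t).f_e i) j
      simpa [bilinGram, Matrix.one_apply] using this
    have hu'u : B u' (u t) = ∑ i, x i t * x i t := by
      simp only [u', map_sum, map_add, map_smul, LinearMap.sum_apply, LinearMap.add_apply,
        LinearMap.smul_apply, smul_eq_mul, hEJ, mul_zero, add_zero]
      refine Finset.sum_congr rfl fun i _ => ?_
      simp [u, hfE]
    have hδt : ξ t - u t ∈ D := hmemD _ (hδ t (hNdet t ht))
    have hδ' : ξ' t - u' ∈ D := by
      refine hmemD _ fun j => ?_
      have h3 := HasDerivAt.bilinForm B ((hξ t).sub hu) (hasDerivAt_const t (d j : V))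
      have h4 : HasDerivAt (fun s => B ((ξ - u) s) (d j)) 0 t :=
        (hasDerivAt_const t (0 : ℝ)).congr_of_eventuallyEq (by
          filter_upwards [hNdet' t ht] with s hs using hδ s hs j)
      simpa using h3.unique h4
    -- Three cancellations: `B(u, ξ') = 0` because both vectors lie in `J t`; `B(ξ - u, ξ' - u') =
    -- 0` because `D` is isotropic and constant in time; and `B(u', u)` is the sum of squares of the
    -- coordinates, since the frame is normal.
    refine (HasDerivAt.bilinForm B hu (hξ t)).congr_deriv ?_
    have e1 : B (u t) (ξ' t) = 0 := (hJ.lagrangian t).1 _ huJ _ (hmem t ht)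
    have e2 : B (ξ t - u t) (ξ' t - u') = 0 := hD.1 _ hδt _ hδ'
    have e3 : B (ξ t) u' = - B u' (ξ t) := by rw [LinearMap.IsAlt.neg hB]
    have e4 : B (u t) u' = - B u' (u t) := by rw [LinearMap.IsAlt.neg hB]
    simp only [map_sub, LinearMap.sub_apply] at e2
    rw [e1] at e2 ⊢
    rw [e3, e4, hu'u] at e2
    linarith
  have hcont : Continuous fun t => B (ξ t) (ξ' t) := by
    have : Continuous ξ := continuous_iff_continuousAt.2 fun t => (hξ t).continuousAt
    exact Continuous.bilinForm B this hξc
  have hΨ : ∀ t ∈ Icc 0 T, HasDerivAt (fun s => B (u s) (ξ s) + ∫ r in (0 : ℝ)..s, B (ξ r) (ξ' r))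
      (∑ i, x i t * x i t) t := by
    intro t ht
    have h2 : HasDerivAt (fun s => ∫ r in (0 : ℝ)..s, B (ξ r) (ξ' r)) (B (ξ t) (ξ' t)) t :=
      intervalIntegral.integral_hasDerivAt_right (hcont.intervalIntegrable _ _)
        (hcont.stronglyMeasurableAtFilter _ _) hcont.continuousAt
    exact ((hder t ht).add h2).congr_deriv (by ring)
  -- The boundary terms `B(u, ξ)` vanish with `ξ`, so monotonicity of this function between `0` and
  -- `T` is the claim.
  have hmono := monotoneOn_of_deriv_nonneg (convex_Icc 0 T)
    (f := fun s => B (u s) (ξ s) + ∫ r in (0 : ℝ)..s, B (ξ r) (ξ' r))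
    (fun t ht => (hΨ t ht).continuousAt.continuousWithinAt)
    (fun t ht => (hΨ t (interior_subset ht)).differentiableAt.differentiableWithinAt)
    (fun t ht => by
      rw [(hΨ t (interior_subset ht)).deriv]
      exact Finset.sum_nonneg fun i _ => mul_self_nonneg _)
  have := hmono (left_mem_Icc.2 hT) (right_mem_Icc.2 hT) hT
  simpa [h0, h1] using this

variable {m : ℕ} {h : V}

/-- The vectors `h, e_1, …, e_m` are independent, since the velocities detect the `e_k` and
annihilate `h`. They span a Lagrangian subspace, which therefore contains every vector
skew-orthogonal to all of them. -/
theorem IsMonotoneCurve.eq_sum_add_smul (hJ : IsMonotoneCurve B J (m + 1)) (hh : h ≠ 0)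
    {e : Fin m → ℝ → V} {t : ℝ}
    (he : IsNormalFrameAt B (fun t => J t ⊓ skewComplement B h) e t)
    (hf : ∀ k, B h (deriv (e k) t) = 0) {v : V}
    (hv : B h v = 0) (hve : ∀ k, B v (e k t) = 0) :
    ∃ c : ℝ, v = c • h + ∑ k, B (deriv (e k) t) v • e k t := by
  have hB := hJ.alt
  have hfe : ∀ i j, B (deriv (e i) t) (e j t) = if i = j then 1 else 0 := fun i j => by
    have := congr_fun (congr_fun he.f_e i) j
    simpa [bilinGram, Matrix.one_apply] using this
  have hfh : ∀ k, B (deriv (e k) t) h = 0 := fun k => by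
    rw [← LinearMap.IsAlt.neg hB, hf, neg_zero]
  let w : Fin (m + 1) → V := Fin.cons h fun k => e k t
  have hli : LinearIndependent ℝ w := by
    refine linearIndependent_finCons.2 ⟨he.linearIndependent, fun hmem => hh ?_⟩
    obtain ⟨c, hc⟩ := (Submodule.mem_span_range_iff_exists_fun ℝ).1 hmem
    have hc0 : ∀ k, c k = 0 := fun k => by
      have := congr_arg (B (deriv (e k) t)) hc
      simpa [hfe, hfh] using this
    rw [← hc]; simp [hc0]
  have hiso : ∀ i j, B (w i) (w j) = 0 := by
    have hhe : ∀ k, B h (e k t) = 0 := fun k => (he.mem k).2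
    intro i j
    refine Fin.cases ?_ (fun i => ?_) i <;> refine Fin.cases ?_ (fun j => ?_) j
    · exact hB h
    · exact hhe j
    · change B (e i t) h = 0
      rw [← LinearMap.IsAlt.neg hB, hhe, neg_zero]
    · exact congr_fun (congr_fun he.e_e i) j
  have hL : IsLagrangianSubspace B (Submodule.span ℝ (range w)) := by
    refine ⟨fun v hv v' hv' => ?_, ?_⟩
    · obtain ⟨c, rfl⟩ := (Submodule.mem_span_range_iff_exists_fun ℝ).1 hv
      obtain ⟨c', rfl⟩ := (Submodule.mem_span_range_iff_exists_fun ℝ).1 hv'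
      simp [hiso]
    · rw [finrank_span_eq_card hli, Fintype.card_fin, hJ.finrank_eq]
  have hmem : v ∈ Submodule.span ℝ (range w) := by
    refine hL.mem_of_forall hB hJ.nondeg fun v' hv' => ?_
    obtain ⟨c, rfl⟩ := (Submodule.mem_span_range_iff_exists_fun ℝ).1 hv'
    have : ∀ i, B (w i) v = 0 := by
      intro i
      refine Fin.cases ?_ (fun i => ?_) i
      · exact hv
      · change B (e i t) v = 0
        rw [← LinearMap.IsAlt.neg hB, hve, neg_zero]
    simp [this]
  obtain ⟨c, rfl⟩ := (Submodule.mem_span_range_iff_exists_fun ℝ).1 hmem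
  refine ⟨c 0, ?_⟩
  simp [Fin.sum_univ_succ, w, hfe, hfh]

/-- The curvature coefficients of a reduced normal frame, and the component of the second
velocity along the reduced direction. -/
theorem IsMonotoneCurve.exists_deriv_deriv_eq (hJ : IsMonotoneCurve B J (m + 1)) (hh : h ≠ 0)
    {e : Fin m → ℝ → V}
    (he : ∀ t, IsNormalFrameAt B (fun t => J t ⊓ skewComplement B h) e t) :
    ∃ c : Fin m → ℝ → ℝ, (∀ k, Continuous (c k)) ∧ ∀ k t, deriv (deriv (e k)) t =
      c k t • h - ∑ l, B (deriv (deriv (e k)) t) (deriv (e l) t) • e l t := by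
  have hB := hJ.alt
  have hsm : ∀ k, ContDiff ℝ ∞ (e k) := fun k => contDiff_iff_contDiffAt.2 fun t => (he t).smooth k
  have hsm' : ∀ k, ContDiff ℝ ∞ (deriv (e k)) := fun k => (contDiff_infty_iff_deriv.1 (hsm k)).2
  have hsm'' : ∀ k, ContDiff ℝ ∞ (deriv (deriv (e k))) :=
    fun k => (contDiff_infty_iff_deriv.1 (hsm' k)).2
  have key : ∀ k t, ∃ c : ℝ, deriv (deriv (e k)) t =
      c • h - ∑ l, B (deriv (deriv (e k)) t) (deriv (e l) t) • e l t := by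
    intro k t
    have hge : ∀ l, B (deriv (deriv (e k)) t) (e l t) = 0 := by
      intro l
      have h1 := HasDerivAt.bilinForm B ((hsm' k).contDiffAt.hasDerivAt_deriv (t := t))
        ((he t).hasDerivAt l)
      have h2 : HasDerivAt (fun s => B (deriv (e k) s) (e l s)) 0 t := by
        have : (fun s => B (deriv (e k) s) (e l s)) = fun _ => (1 : Matrix _ _ ℝ) k l := by
          funext s; exact congr_fun (congr_fun (he s).f_e k) l
        rw [this]; exact hasDerivAt_const t _
      have h3 := h1.unique h2
      have h4 : B (deriv (e k) t) (deriv (e l) t) = 0 := congr_fun (congr_fun (he t).f_f k) l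
      rwa [h4, add_zero] at h3
    obtain ⟨c, hc⟩ := hJ.eq_sum_add_smul hh (he t)
      (fun k => (IsMonotoneCurve.deriv_mem_skewComplement he k t).1)
      (IsMonotoneCurve.deriv_mem_skewComplement he k t).2 hge
    refine ⟨c, ?_⟩
    conv_lhs => rw [hc]
    rw [sub_eq_add_neg, ← Finset.sum_neg_distrib]
    refine congr_arg _ (Finset.sum_congr rfl fun l _ => ?_)
    rw [← neg_smul, LinearMap.IsAlt.neg hB]
  choose c hc using key
  refine ⟨c, fun k => ?_, hc⟩
  -- The coefficient along `h` was only chosen pointwise. A functional equal to 1 at `h` expresses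
  -- it by continuous quantities.
  obtain ⟨L, hL⟩ := SeparatingDual.exists_eq_one (R := ℝ) hh
  have : c k = fun t => L (deriv (deriv (e k)) t) +
      ∑ l, B (deriv (deriv (e k)) t) (deriv (e l) t) * L (e l t) := by
    funext t
    have h1 := congr_arg L (hc k t)
    simp only [map_sub, map_smul, map_sum, hL, smul_eq_mul, mul_one] at h1
    linarith
  rw [this]
  refine (L.continuous.comp (hsm'' k).continuous).add (continuous_finsetSum _ fun l _ => ?_)
  exact (Continuous.bilinForm B (hsm'' k).continuous (hsm' l).continuous).mul
    (L.continuous.comp (hsm l).continuous)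

/-- A variation of the reduced curve is lifted to a curve `ξ` with `ξ' ∈ J`. The structural equation
upstairs has an additional component along `h`, which must be integrated away. The lift returns to
zero at `T` exactly because of the condition on `∫ ∑ a_k c_k`. -/
theorem IsMonotoneCurve.reduced_index_nonneg (hJ : IsMonotoneCurve B J (m + 1))
    (htr : ∀ s t, 0 ≤ s → s < t → J s ⊔ J t = ⊤) {e : Fin m → ℝ → V}
    (he : ∀ t, IsNormalFrameAt B (fun t => J t ⊓ skewComplement B h) e t) {c : Fin m → ℝ → ℝ}
    (hc : ∀ k, Continuous (c k)) (hce : ∀ k t, deriv (deriv (e k)) t =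
      c k t • h - ∑ l, B (deriv (deriv (e k)) t) (deriv (e l) t) • e l t) {T : ℝ} (hT : 0 ≤ T)
    {a : Fin m → ℝ → ℝ} (ha : ∀ k, ContDiff ℝ ∞ (a k)) (ha0 : ∀ k, a k 0 = 0 ∧ deriv (a k) 0 = 0)
    (haT : ∀ k, a k T = 0 ∧ deriv (a k) T = 0) (hac : ∫ t in (0 : ℝ)..T, ∑ k, a k t * c k t = 0) :
    0 ≤ ∫ t in (0 : ℝ)..T, -∑ k, a k t * (deriv (deriv (a k)) t +
      ∑ l, a l t * B (deriv (deriv (e l)) t) (deriv (e k) t)) := by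
  have hB := hJ.alt
  have hsm : ∀ k, ContDiff ℝ ∞ (e k) := fun k => contDiff_iff_contDiffAt.2 fun t => (he t).smooth k
  have hsm' : ∀ k, ContDiff ℝ ∞ (deriv (e k)) := fun k => (contDiff_infty_iff_deriv.1 (hsm k)).2
  have hsm'' : ∀ k, ContDiff ℝ ∞ (deriv (deriv (e k))) :=
    fun k => (contDiff_infty_iff_deriv.1 (hsm' k)).2
  have ha' : ∀ k, ContDiff ℝ ∞ (deriv (a k)) := fun k => (contDiff_infty_iff_deriv.1 (ha k)).2
  have ha'' : ∀ k, ContDiff ℝ ∞ (deriv (deriv (a k))) :=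
    fun k => (contDiff_infty_iff_deriv.1 (ha' k)).2
  have hacc : Continuous fun t => ∑ k, a k t * c k t :=
    continuous_finsetSum _ fun k _ => (ha k).continuous.mul (hc k)
  let R : Fin m → Fin m → ℝ → ℝ := fun l k t => B (deriv (deriv (e l)) t) (deriv (e k) t)
  have hR : ∀ l k, Continuous (R l k) := fun l k =>
    Continuous.bilinForm B (hsm'' l).continuous (hsm' k).continuous
  -- In the first sum the terms `a_k' e_k'` cancel on differentiation, and the last term removes the
  -- components `a_k c_k h`. What remains is a combination of the `e_k`.
  let ξ : ℝ → V := fun t => (∑ k, (a k t • deriv (e k) t - deriv (a k) t • e k t)) -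
    (∫ s in (0 : ℝ)..t, ∑ k, a k s * c k s) • h
  let p : Fin m → ℝ → ℝ := fun k t => deriv (deriv (a k)) t + ∑ l, a l t * R l k t
  let ξ' : ℝ → V := fun t => -∑ k, p k t • e k t
  have hp : ∀ k, Continuous (p k) := fun k =>
    (ha'' k).continuous.add (continuous_finsetSum _ fun l _ => (ha l).continuous.mul (hR l k))
  have hξ : ∀ t, HasDerivAt ξ (ξ' t) t := by
    intro t
    have h1 : HasDerivAt (fun s => ∫ r in (0 : ℝ)..s, ∑ k, a k r * c k r) (∑ k, a k t * c k t) t :=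
      intervalIntegral.integral_hasDerivAt_right (hacc.intervalIntegrable _ _)
        (hacc.stronglyMeasurableAtFilter _ _) hacc.continuousAt
    have h2 : ∀ k, HasDerivAt (fun s => a k s • deriv (e k) s - deriv (a k) s • e k s)
        ((a k t • deriv (deriv (e k)) t + deriv (a k) t • deriv (e k) t) -
          (deriv (a k) t • deriv (e k) t + deriv (deriv (a k)) t • e k t)) t := fun k =>
      ((ha k).contDiffAt.hasDerivAt_deriv.smul (hsm' k).contDiffAt.hasDerivAt_deriv).sub
        ((ha' k).contDiffAt.hasDerivAt_deriv.smul (hsm k).contDiffAt.hasDerivAt_deriv)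
    refine ((HasDerivAt.fun_sum fun k _ => h2 k).sub (h1.smul_const h)).congr_deriv ?_
    have h3 : ∀ k, (a k t • deriv (deriv (e k)) t + deriv (a k) t • deriv (e k) t) -
          (deriv (a k) t • deriv (e k) t + deriv (deriv (a k)) t • e k t) =
        (a k t * c k t) • h - ∑ l, (a k t * R k l t) • e l t - deriv (deriv (a k)) t • e k t := by
      intro k
      conv_lhs => rw [hce k t]
      simp only [smul_sub, Finset.smul_sum, smul_smul, R]
      abel
    rw [Finset.sum_congr rfl fun k _ => h3 k]
    simp only [ξ', p, add_smul, Finset.sum_smul, Finset.sum_sub_distrib, Finset.sum_add_distrib]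
    rw [Finset.sum_comm (f := fun k l => (a k t * R k l t) • e l t)]
    abel
  have hξc : Continuous ξ' :=
    (continuous_finsetSum _ fun k _ => (hp k).smul (hsm k).continuous).neg
  have hmem : ∀ t, ξ' t ∈ J t := fun t =>
    (J t).neg_mem ((J t).sum_mem fun k _ => (J t).smul_mem _ ((he t).mem k).1)
  have h0 : ξ 0 = 0 := by simp [ξ, ha0]
  have h1 : ξ T = 0 := by simp [ξ, haT, hac]
  -- Any time after `T` gives a Lagrangian subspace transversal to `J t` for all `t ∈ [0, T]`.
  have hD := hJ.lagrangian (T + 1)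
  have htr' : ∀ t ∈ Icc 0 T, J t ⊓ J (T + 1) = ⊥ := by
    intro t ht
    have h2 := htr t (T + 1) ht.1 (by linarith [ht.2])
    have h3 := Submodule.finrank_sup_add_finrank_inf_eq (J t) (J (T + 1))
    rw [h2, finrank_top] at h3
    have h4 := (hJ.lagrangian t).2
    have h5 := hD.2
    exact Submodule.finrank_eq_zero.1 (by omega)
  have hfe : ∀ t i j, B (deriv (e i) t) (e j t) = if i = j then 1 else 0 := fun t i j => by
    have := congr_fun (congr_fun (he t).f_e i) j
    simpa [bilinGram, Matrix.one_apply] using this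
  have hee : ∀ t i j, B (e i t) (e j t) = 0 := fun t i j => congr_fun (congr_fun (he t).e_e i) j
  have hhe : ∀ t k, B h (e k t) = 0 := fun t k => ((he t).mem k).2
  have key := hJ.integral_form_nonneg hT hD htr' hξ hξc (fun t _ => hmem t) h0 h1
  have heq : ∀ t, B (ξ t) (ξ' t) = -∑ k, a k t * p k t := by
    intro t
    have h2 : ∀ j, B (ξ t) (e j t) = a j t := fun j => by
      simp [ξ, hhe, hee, hfe]
    simp only [ξ', map_neg, map_sum, map_smul, h2, smul_eq_mul, neg_inj]
    exact Finset.sum_congr rfl fun k _ => mul_comm _ _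
  simpa only [heq] using key

/-- For two test functions with disjoint supports, the averaged reduced index form cannot be
negative on both. -/
theorem IsMonotoneCurve.reduced_index_alternative (hJ : IsMonotoneCurve B J (m + 1)) (hh : h ≠ 0)
    (htr : ∀ s t, 0 ≤ s → s < t → J s ⊔ J t = ⊤) {e : Fin m → ℝ → V}
    (he : ∀ t, IsNormalFrameAt B (fun t => J t ⊓ skewComplement B h) e t) {T : ℝ} (hT : 0 ≤ T)
    {ψ : Fin 2 → ℝ → ℝ} (hψ : ∀ i, ContDiff ℝ ∞ (ψ i)) (hψ0 : ∀ i, ψ i 0 = 0 ∧ deriv (ψ i) 0 = 0)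
    (hψT : ∀ i, ψ i T = 0 ∧ deriv (ψ i) T = 0) (hdisj : ∀ t, ψ 0 t * ψ 1 t = 0) :
    ∃ i, 0 ≤ ∫ t in (0 : ℝ)..T, (m * deriv (ψ i) t ^ 2 - ψ i t ^ 2 *
      (bilinGram B (fun k => deriv (deriv (e k)) t) (fun k => deriv (e k) t)).trace) := by
  by_contra! hneg
  have hsm : ∀ k, ContDiff ℝ ∞ (e k) := fun k => contDiff_iff_contDiffAt.2 fun t => (he t).smooth k
  have hsm' : ∀ k, ContDiff ℝ ∞ (deriv (e k)) := fun k => (contDiff_infty_iff_deriv.1 (hsm k)).2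
  have hsm'' : ∀ k, ContDiff ℝ ∞ (deriv (deriv (e k))) :=
    fun k => (contDiff_infty_iff_deriv.1 (hsm' k)).2
  have hψ' : ∀ i, ContDiff ℝ ∞ (deriv (ψ i)) := fun i => (contDiff_infty_iff_deriv.1 (hψ i)).2
  have hψ'' : ∀ i, ContDiff ℝ ∞ (deriv (deriv (ψ i))) :=
    fun i => (contDiff_infty_iff_deriv.1 (hψ' i)).2
  let R : Fin m → Fin m → ℝ → ℝ := fun l k t => B (deriv (deriv (e l)) t) (deriv (e k) t)
  have hR : ∀ l k, Continuous (R l k) := fun l k =>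
    Continuous.bilinForm B (hsm'' l).continuous (hsm' k).continuous
  let q : Fin 2 → Fin m → ℝ → ℝ := fun i k t =>
    -(ψ i t * deriv (deriv (ψ i)) t) - ψ i t ^ 2 * R k k t
  have hq : ∀ i k, Continuous (q i k) := fun i k =>
    ((hψ i).continuous.mul (hψ'' i).continuous).neg.sub (((hψ i).continuous.pow 2).mul (hR k k))
  -- The averaged form is, after integration by parts, the sum over `k` of the forms of the
  -- variations `ψ_i` in the direction `k`. If it is negative, so is one summand.
  have hex : ∀ i, ∃ k, ∫ t in (0 : ℝ)..T, q i k t < 0 := by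
    intro i
    by_contra! hc
    have hsum : 0 ≤ ∑ k, ∫ t in (0 : ℝ)..T, q i k t := Finset.sum_nonneg fun k _ => hc k
    rw [← intervalIntegral.integral_finsetSum fun k _ => (hq i k).intervalIntegrable _ _] at hsum
    have hparts : ∫ t in (0 : ℝ)..T, (deriv (ψ i) t ^ 2 + ψ i t * deriv (deriv (ψ i)) t) = 0 := by
      have h1 : ∀ t, HasDerivAt (fun s => ψ i s * deriv (ψ i) s)
          (deriv (ψ i) t ^ 2 + ψ i t * deriv (deriv (ψ i)) t) t := fun t =>
        ((hψ i).contDiffAt.hasDerivAt_deriv.mul (hψ' i).contDiffAt.hasDerivAt_deriv).congr_deriv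
          (by ring)
      rw [intervalIntegral.integral_eq_sub_of_hasDerivAt (fun t _ => h1 t)]
      · simp [hψ0, hψT]
      · exact (((hψ' i).continuous.pow 2).add
          ((hψ i).continuous.mul (hψ'' i).continuous)).intervalIntegrable _ _
    have hlt := hneg i
    have hcongr : ∀ t, (m * deriv (ψ i) t ^ 2 - ψ i t ^ 2 *
        (bilinGram B (fun k => deriv (deriv (e k)) t) (fun k => deriv (e k) t)).trace) =
        ∑ k, q i k t + m * (deriv (ψ i) t ^ 2 + ψ i t * deriv (deriv (ψ i)) t) := by
      intro t
      have : (bilinGram B (fun k => deriv (deriv (e k)) t) (fun k => deriv (e k) t)).trace =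
        ∑ k, R k k t := rfl
      rw [this]
      simp only [q, Finset.sum_sub_distrib, Finset.sum_const, Finset.card_univ, Fintype.card_fin,
        nsmul_eq_mul, ← Finset.mul_sum]
      ring
    simp only [hcongr] at hlt
    rw [intervalIntegral.integral_add, intervalIntegral.integral_const_mul, hparts] at hlt
    · linarith
    · exact (continuous_finsetSum _ fun k _ => hq i k).intervalIntegrable _ _
    · exact (continuous_const.mul (((hψ' i).continuous.pow 2).add
          ((hψ i).continuous.mul (hψ'' i).continuous))).intervalIntegrable _ _
  choose κ hκ using hex
  obtain ⟨c, hc, hce⟩ := hJ.exists_deriv_deriv_eq hh he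
  let p : Fin 2 → ℝ := fun i => ∫ t in (0 : ℝ)..T, ψ i t * c (κ i) t
  -- A nonzero solution of the single closing condition in the two-dimensional space of
  -- combinations.
  obtain ⟨s, hs, hs0⟩ : ∃ s : Fin 2 → ℝ, s 0 * p 0 + s 1 * p 1 = 0 ∧ s ≠ 0 := by
    by_cases hp : p 0 = 0
    · exact ⟨![1, 0], by simp [hp], fun h => by simpa using congr_fun h 0⟩
    · refine ⟨![p 1, -p 0], by simp; ring, fun h => hp ?_⟩
      simpa using congr_fun h 1
  let a : Fin m → ℝ → ℝ := fun k t =>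
    (if k = κ 0 then s 0 else 0) * ψ 0 t + (if k = κ 1 then s 1 else 0) * ψ 1 t
  have hac : ∀ k t, a k t =
    (if k = κ 0 then s 0 else 0) * ψ 0 t + (if k = κ 1 then s 1 else 0) * ψ 1 t := fun _ _ => rfl
  have ha : ∀ k, ContDiff ℝ ∞ (a k) := fun k =>
    (contDiff_const.mul (hψ 0)).add (contDiff_const.mul (hψ 1))
  have had : ∀ k t, deriv (a k) t = (if k = κ 0 then s 0 else 0) * deriv (ψ 0) t +
      (if k = κ 1 then s 1 else 0) * deriv (ψ 1) t := fun k t =>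
    (((hψ 0).contDiffAt.hasDerivAt_deriv.const_mul _).add
      ((hψ 1).contDiffAt.hasDerivAt_deriv.const_mul _)).deriv
  have hadd : ∀ k t, deriv (deriv (a k)) t = (if k = κ 0 then s 0 else 0) * deriv (deriv (ψ 0)) t +
      (if k = κ 1 then s 1 else 0) * deriv (deriv (ψ 1)) t := fun k t => by
    rw [show deriv (a k) = _ from funext (had k)]
    exact (((hψ' 0).contDiffAt.hasDerivAt_deriv.const_mul _).add
      ((hψ' 1).contDiffAt.hasDerivAt_deriv.const_mul _)).deriv
  -- Where `ψ_i` is nonzero, it is so nearby, hence `ψ_j` vanishes nearby together with its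
  -- derivatives.
  have hcross : ∀ i j : Fin 2, (∀ t, ψ i t * ψ j t = 0) → ∀ t, ψ i t * deriv (deriv (ψ j)) t = 0 := by
    intro i j hij t
    by_cases h0 : ψ i t = 0
    · rw [h0, zero_mul]
    · have h1 : ψ j =ᶠ[𝓝 t] fun _ => 0 := by
        filter_upwards [(hψ i).continuous.continuousAt.eventually_ne h0] with r hr
        exact (mul_eq_zero.1 (hij r)).resolve_left hr
      have h2 : deriv (ψ j) =ᶠ[𝓝 t] fun _ => 0 := by
        filter_upwards [h1.deriv] with r hr
        rw [hr]; simp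
      rw [h2.deriv_eq]; simp
  have hdisj' : ∀ t, ψ 1 t * ψ 0 t = 0 := fun t => by rw [mul_comm]; exact hdisj t
  have key := hJ.reduced_index_nonneg htr he hc hce hT ha
    (fun k => by rw [had, hac]; simp [hψ0]) (fun k => by rw [had, hac]; simp [hψT]) (by
      have : ∀ t, ∑ k, a k t * c k t = s 0 * (ψ 0 t * c (κ 0) t) + s 1 * (ψ 1 t * c (κ 1) t) := by
        intro t
        simp only [hac, add_mul, Finset.sum_add_distrib, ite_mul, zero_mul, Finset.sum_ite_eq',
          Finset.mem_univ, if_true]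
        ring
      simp only [this]
      rw [intervalIntegral.integral_add, intervalIntegral.integral_const_mul,
        intervalIntegral.integral_const_mul]
      · exact hs
      · exact (continuous_const.mul ((hψ 0).continuous.mul (hc _))).intervalIntegrable _ _
      · exact (continuous_const.mul ((hψ 1).continuous.mul (hc _))).intervalIntegrable _ _)
  have hval : ∀ t, (-∑ k, a k t * (deriv (deriv (a k)) t +
      ∑ l, a l t * B (deriv (deriv (e l)) t) (deriv (e k) t))) =
      s 0 ^ 2 * q 0 (κ 0) t + s 1 ^ 2 * q 1 (κ 1) t := by
    intro t
    have e1 := hcross 0 1 hdisj t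
    have e2 := hcross 1 0 hdisj' t
    have e3 := hdisj t
    have hl : ∀ k, ∑ l, a l t * B (deriv (deriv (e l)) t) (deriv (e k) t) =
        s 0 * ψ 0 t * R (κ 0) k t + s 1 * ψ 1 t * R (κ 1) k t := fun k => by
      simp only [hac, add_mul, Finset.sum_add_distrib, ite_mul, zero_mul, Finset.sum_ite_eq',
        Finset.mem_univ, if_true, R]
    simp only [hl]
    have hk : ∀ g : Fin m → ℝ, ∑ k, a k t * g k = s 0 * ψ 0 t * g (κ 0) + s 1 * ψ 1 t * g (κ 1) :=
      fun g => by
        simp only [hac, add_mul, Finset.sum_add_distrib, ite_mul, zero_mul, Finset.sum_ite_eq',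
          Finset.mem_univ, if_true]
    rw [hk]
    simp only [hadd, if_true, q]
    -- If the two directions coincide, the second derivatives also contribute cross terms; otherwise
    -- only the off-diagonal curvature entries do. In each case disjointness of the supports kills
    -- them.
    by_cases hkk : κ 0 = κ 1
    · simp only [hkk, if_true]
      linear_combination (-(s 0 * s 1)) * e1 - s 0 * s 1 * e2 - 2 * s 0 * s 1 * R (κ 1) (κ 1) t * e3
    · have hkk' : κ 1 ≠ κ 0 := fun h => hkk h.symm
      simp only [hkk, hkk', if_false]
      linear_combination (-(s 0 * s 1 * R (κ 1) (κ 0) t)) * e3 - s 0 * s 1 * R (κ 0) (κ 1) t * e3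
  simp only [hval] at key
  rw [intervalIntegral.integral_add, intervalIntegral.integral_const_mul,
    intervalIntegral.integral_const_mul] at key
  · have h1 := hκ 0
    have h2 := hκ 1
    by_cases hs1 : s 0 = 0
    · have hs2 : s 1 ≠ 0 := fun h => hs0 (by funext i; fin_cases i <;> simp [hs1, h])
      have : 0 < s 1 ^ 2 := by positivity
      rw [hs1] at key
      nlinarith
    · have h3 : 0 < s 0 ^ 2 := by positivity
      have h4 : 0 ≤ s 1 ^ 2 := by positivity
      nlinarith
  · exact (continuous_const.mul (hq _ _)).intervalIntegrable _ _
  · exact (continuous_const.mul (hq _ _)).intervalIntegrable _ _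

end IndexForm

/-! ### Curvature in arbitrary frames and a lower bound for subframes -/

section CurvatureFormulas

variable {V : Type*} [NormedAddCommGroup V] [NormedSpace ℝ V] [FiniteDimensional ℝ V]
  {B : LinearMap.BilinForm ℝ V} {m : ℕ}

/-- If `a` is a frame of the curve and `F` its velocity corrected by `K a` so as to be isotropic
and parallel, then `F` and its derivative compute the curvature matrix. -/
theorem exists_change_of_normalFrame (hB : B.IsAlt) {S : ℝ → Submodule ℝ V}
    {e : Fin m → ℝ → V} {t : ℝ} (he : ∀ᶠ s in 𝓝 t, IsNormalFrameAt B S e s)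
    (hS : ∀ᶠ s in 𝓝 t, Module.finrank ℝ (S s) ≤ m)
    {a F : Fin m → ℝ → V} {K : ℝ → Matrix (Fin m) (Fin m) ℝ}
    (haS : ∀ᶠ s in 𝓝 t, ∀ i, a i s ∈ S s)
    (had : ∀ᶠ s in 𝓝 t, ∀ i, HasDerivAt (a i) (F i s - matComb (K s) (fun j => a j s) i) s)
    (hFF : ∀ᶠ s in 𝓝 t, bilinGram B (fun i => F i s) (fun i => F i s) = 0)
    (hG : ∀ᶠ s in 𝓝 t, ∀ i j, HasDerivAt (fun r => B (F i r) (a j r))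
      (-(K s * bilinGram B (fun i => F i s) (fun i => a i s) +
        bilinGram B (fun i => F i s) (fun i => a i s) * (K s)ᵀ) i j) s)
    (hdet : ∀ᶠ s in 𝓝 t, (bilinGram B (fun i => F i s) (fun i => a i s)).det ≠ 0)
    {F' : Fin m → V} (hF' : ∀ i, HasDerivAt (F i) (F' i) t) :
    ∃ D : Matrix (Fin m) (Fin m) ℝ, bilinGram B (fun i => F i t) (fun i => a i t) = D * Dᵀ ∧
      bilinGram B F' (fun i => F i t) =
        D * bilinGram B (fun k => deriv (deriv (e k)) t) (fun k => deriv (e k) t) * Dᵀ := by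
  let D : ℝ → Matrix (Fin m) (Fin m) ℝ := fun s => Matrix.of fun i j => B (deriv (e j) s) (a i s)
  have haD : ∀ᶠ s in 𝓝 t, ∀ i, a i s = matComb (D s) (fun j => e j s) i := by
    filter_upwards [he, hS, haS] with s h1 h2 h3 i
    exact h1.mem_span h2 (h3 i)
  have base : ∀ᶠ s in 𝓝 t, ∃ D' : Matrix (Fin m) (Fin m) ℝ,
      (∀ i j, HasDerivAt (fun r => D r i j) (D' i j) s) ∧
      (fun i => F i s) = matComb (D' + K s * D s) (fun j => e j s) +
        matComb (D s) (fun j => deriv (e j) s) ∧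
      bilinGram B (fun i => F i s) (fun i => a i s) = D s * (D s)ᵀ := by
    filter_upwards [he, haD, haD.eventually_nhds, had] with s h1 h2 h2' h3
    let D' : Matrix (Fin m) (Fin m) ℝ := Matrix.of fun i j =>
      B (deriv (deriv (e j)) s) (a i s) + B (deriv (e j) s) (F i s - matComb (K s) (fun j => a j s) i)
    have hD' : ∀ i j, HasDerivAt (fun r => D r i j) (D' i j) s := fun i j =>
      HasDerivAt.bilinForm B (h1.smooth j).deriv_smooth.hasDerivAt_deriv (h3 i)
    have hae : (fun i => a i s) = matComb (D s) (fun j => e j s) := funext h2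
    have hF : (fun i => F i s) = matComb (D' + K s * D s) (fun j => e j s) +
        matComb (D s) (fun j => deriv (e j) s) := by
      funext i
      have e1 : HasDerivAt (a i) (matComb D' (fun j => e j s) i +
          matComb (D s) (fun j => deriv (e j) s) i) s :=
        (HasDerivAt.matComb hD' h1.hasDerivAt i).congr_of_eventuallyEq (by
          filter_upwards [h2'] with r hr using hr i)
      have e2 := (h3 i).unique e1
      rw [hae, matComb_matComb] at e2
      simp only [matComb_add, Pi.add_apply]
      rw [sub_eq_iff_eq_add.1 e2]
      abel
    refine ⟨D', hD', hF, ?_⟩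
    rw [hF, hae, bilinGram_add_left, bilinGram_matComb, bilinGram_matComb, h1.e_e, h1.f_e]
    simp
  have key : ∀ᶠ s in 𝓝 t, (∃ D' : Matrix (Fin m) (Fin m) ℝ,
      ∀ i j, HasDerivAt (fun r => D r i j) (D' i j) s) ∧
      (fun i => F i s) = matComb (D s) (fun j => deriv (e j) s) ∧
      bilinGram B (fun i => F i s) (fun i => a i s) = D s * (D s)ᵀ := by
    filter_upwards [he, base, base.eventually_nhds, hFF, hG, hdet]
      with s h1 ⟨D', hD', hF, hG1⟩ hbase h4 h5 h6
    have hdetD : (D s)ᵀ.det ≠ 0 := by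
      rw [hG1, Matrix.det_mul] at h6
      exact right_ne_zero_of_mul h6
    -- Isotropy of `F` makes `(D' + K D) Dᵀ` symmetric. The prescribed derivative of the Gram matrix
    -- `D Dᵀ` makes it skew in `hz2`. Hence `D' + K D = 0` and `F = D f`, where `f` are the
    -- velocities of `e`.
    have hz1 : -((D' + K s * D s) * (D s)ᵀ) + D s * (D' + K s * D s)ᵀ = 0 := by
      have := h4
      rw [hF] at this
      simp only [bilinGram_add_left, bilinGram_add_right, bilinGram_matComb, h1.e_e, h1.f_e, h1.f_f,
        h1.e_f hB] at this
      rw [← this]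
      simp only [Matrix.mul_zero, Matrix.zero_mul, Matrix.mul_one, Matrix.mul_neg, Matrix.neg_mul]
      abel
    have hz2 : (D' + K s * D s) * (D s)ᵀ + D s * (D' + K s * D s)ᵀ = 0 := by
      have e1 : D' * (D s)ᵀ + D s * D'ᵀ = -(K s * (D s * (D s)ᵀ) + D s * (D s)ᵀ * (K s)ᵀ) := by
        ext i j
        have e1 := HasDerivAt.matrix_mul hD' (C := fun s => (D s)ᵀ) (C' := D'ᵀ)
          (fun i j => hD' j i) i j
        have e2 : HasDerivAt (fun r => B (F i r) (a j r)) ((D' * (D s)ᵀ + D s * D'ᵀ) i j) s := by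
          refine e1.congr_of_eventuallyEq ?_
          filter_upwards [hbase] with r hr
          exact congr_fun (congr_fun hr.choose_spec.2.2 i) j
        have e3 := (h5 i j).unique e2
        rw [hG1] at e3
        exact e3.symm
      rw [Matrix.transpose_add, Matrix.transpose_mul, Matrix.add_mul, Matrix.mul_add]
      rw [← sub_eq_zero] at e1
      rw [← e1]
      simp only [Matrix.mul_assoc]
      abel
    have hz : (D' + K s * D s) * (D s)ᵀ = 0 := by
      have e1 : (2 : ℝ) • ((D' + K s * D s) * (D s)ᵀ) = 0 := by
        rw [two_smul]
        calc _ = ((D' + K s * D s) * (D s)ᵀ + D s * (D' + K s * D s)ᵀ) -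
              (-((D' + K s * D s) * (D s)ᵀ) + D s * (D' + K s * D s)ᵀ) := by abel
          _ = 0 := by rw [hz1, hz2, sub_zero]
      exact (smul_eq_zero.1 e1).resolve_left two_ne_zero
    have hz' : D' + K s * D s = 0 := by
      calc D' + K s * D s = (D' + K s * D s) * ((D s)ᵀ * ((D s)ᵀ)⁻¹) := by
            rw [Matrix.mul_nonsing_inv _ (isUnit_iff_ne_zero.2 hdetD), Matrix.mul_one]
        _ = 0 := by rw [← Matrix.mul_assoc, hz, Matrix.zero_mul]
    refine ⟨⟨D', hD'⟩, ?_, hG1⟩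
    rw [hF, hz']
    funext i
    simp [matComb]
  refine ⟨D t, key.self_of_nhds.2.2, ?_⟩
  obtain ⟨⟨D', hD'⟩, hF, -⟩ := key.self_of_nhds
  have het := he.self_of_nhds
  have hF'eq : F' = matComb D' (fun j => deriv (e j) t) +
      matComb (D t) (fun j => deriv (deriv (e j)) t) := by
    funext i
    have e1 : HasDerivAt (F i) (matComb D' (fun j => deriv (e j) t) i +
        matComb (D t) (fun j => deriv (deriv (e j)) t) i) t :=
      (HasDerivAt.matComb hD'
        (fun j => (het.smooth j).deriv_smooth.hasDerivAt_deriv) i).congr_of_eventuallyEq (by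
          filter_upwards [key] with r hr using congr_fun hr.2.1 i)
    exact (hF' i).unique e1
  rw [hF'eq, hF, bilinGram_add_left, bilinGram_matComb, bilinGram_matComb, het.f_f]
  simp

/-- Here `G⁻¹ M` is the conjugate of `R` by `Dᵀ`, and `G⁻¹ Mᵀ` that of `Rᵀ`. Only `G` and `M`, which
are computable from arbitrary frames, remain on the right. -/
theorem trace_eq_of_change_of_frame {D R G M : Matrix (Fin m) (Fin m) ℝ} (hG : G = D * Dᵀ)
    (hM : M = D * R * Dᵀ) (hdet : G.det ≠ 0) :
    R.trace = (G⁻¹ * M).trace ∧ (R * Rᵀ).trace = (G⁻¹ * M * (G⁻¹ * Mᵀ)).trace := by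
  have hD : D.det ≠ 0 := by
    rw [hG, Matrix.det_mul] at hdet
    exact left_ne_zero_of_mul hdet
  have hD' : (Dᵀ).det ≠ 0 := by rwa [Matrix.det_transpose]
  have h1 : ∀ X : Matrix (Fin m) (Fin m) ℝ, G⁻¹ * (D * X * Dᵀ) = (Dᵀ)⁻¹ * (X * Dᵀ) := by
    intro X
    rw [hG, Matrix.mul_inv_rev, Matrix.mul_assoc, Matrix.mul_assoc D, ← Matrix.mul_assoc D⁻¹,
      Matrix.nonsing_inv_mul _ (isUnit_iff_ne_zero.2 hD), Matrix.one_mul]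
  have h2 : Dᵀ * (Dᵀ)⁻¹ = 1 := Matrix.mul_nonsing_inv _ (isUnit_iff_ne_zero.2 hD')
  have hMt : Mᵀ = D * Rᵀ * Dᵀ := by
    rw [hM, Matrix.transpose_mul, Matrix.transpose_mul, Matrix.transpose_transpose, Matrix.mul_assoc]
  constructor
  · rw [hM, h1, Matrix.trace_mul_comm, Matrix.mul_assoc, h2, Matrix.mul_one]
  · rw [hMt, h1, hM, h1]
    have : (Dᵀ)⁻¹ * (R * Dᵀ) * ((Dᵀ)⁻¹ * (Rᵀ * Dᵀ)) = (Dᵀ)⁻¹ * (R * Rᵀ * Dᵀ) := by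
      calc _ = (Dᵀ)⁻¹ * (R * (Dᵀ * (Dᵀ)⁻¹) * (Rᵀ * Dᵀ)) := by simp only [Matrix.mul_assoc]
        _ = _ := by rw [h2, Matrix.mul_one]; simp only [Matrix.mul_assoc]
    rw [this, Matrix.trace_mul_comm (Dᵀ)⁻¹, Matrix.mul_assoc, h2, Matrix.mul_one]

/-- The trace of the curvature of a subframe is bounded below by the curvature of the full frame. -/
theorem normalFrame_trace_ge {n : ℕ} (hB : B.IsAlt) {J S : ℝ → Submodule ℝ V}
    (hSJ : ∀ t, S t ≤ J t) (hJ : ∀ t, Module.finrank ℝ (J t) ≤ n) {E : Fin n → ℝ → V}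
    (hE : ∀ t, IsNormalFrameAt B J E t) {e : Fin m → ℝ → V} (he : ∀ t, IsNormalFrameAt B S e t)
    (t : ℝ) :
    -(((bilinGram B (fun k => deriv (deriv (E k)) t) (fun k => deriv (E k) t) *
      (bilinGram B (fun k => deriv (deriv (E k)) t) (fun k => deriv (E k) t))ᵀ).trace + m) / 2) ≤
      (bilinGram B (fun k => deriv (deriv (e k)) t) (fun k => deriv (e k) t)).trace := by
  have hEsm : ∀ k, ContDiff ℝ ∞ (E k) := fun k => contDiff_iff_contDiffAt.2 fun t => (hE t).smooth k
  have hEsm' : ∀ k, ContDiff ℝ ∞ (deriv (E k)) := fun k => (contDiff_infty_iff_deriv.1 (hEsm k)).2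
  let X : ℝ → Matrix (Fin m) (Fin n) ℝ := fun s => Matrix.of fun k i => B (deriv (E i) s) (e k s)
  have hXsm : ∀ k i, ContDiff ℝ ∞ (fun s => X s k i) := fun k i =>
    contDiff_iff_contDiffAt.2 fun s =>
      ContDiffAt.bilinForm B (hEsm' i).contDiffAt ((he s).smooth k)
  let X' : ℝ → Matrix (Fin m) (Fin n) ℝ := fun s => Matrix.of fun k i => deriv (fun s => X s k i) s
  have hXsm' : ∀ k i, ContDiff ℝ ∞ (fun s => X' s k i) := fun k i =>
    (contDiff_infty_iff_deriv.1 (hXsm k i)).2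
  let X'' : ℝ → Matrix (Fin m) (Fin n) ℝ := fun s => Matrix.of fun k i => deriv (fun s => X' s k i) s
  have hX : ∀ s k i, HasDerivAt (fun s => X s k i) (X' s k i) s :=
    fun s k i => (hXsm k i).contDiffAt.hasDerivAt_deriv
  have hX' : ∀ s k i, HasDerivAt (fun s => X' s k i) (X'' s k i) s :=
    fun s k i => (hXsm' k i).contDiffAt.hasDerivAt_deriv
  have heX : ∀ s k, e k s = matComb (X s) (fun j => E j s) k := fun s k =>
    (hE s).mem_span (hJ s) (hSJ s ((he s).mem k))
  have hf : ∀ k s, deriv (e k) s = (matComb (X' s) (fun j => E j s) +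
      matComb (X s) (fun j => deriv (E j) s)) k := by
    intro k s
    rw [show e k = fun s => matComb (X s) (fun j => E j s) k from funext fun s => heX s k]
    exact (HasDerivAt.matComb (hX s) (hE s).hasDerivAt k).deriv
  have hg : ∀ k s, deriv (deriv (e k)) s = (matComb (X'' s) (fun j => E j s) +
      matComb (X' s) (fun j => deriv (E j) s) + (matComb (X' s) (fun j => deriv (E j) s) +
      matComb (X s) (fun j => deriv (deriv (E j)) s))) k := by
    intro k s
    rw [show deriv (e k) = _ from funext fun s => hf k s]
    exact ((HasDerivAt.matComb (hX' s) (hE s).hasDerivAt k).add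
      (HasDerivAt.matComb (hX s) (fun j => (hEsm' j).contDiffAt.hasDerivAt_deriv) k)).deriv
  have hEE : bilinGram B (fun j => deriv (deriv (E j)) t) (fun j => E j t) = 0 := by
    ext k l
    have h1 := HasDerivAt.bilinForm B ((hEsm' k).contDiffAt.hasDerivAt_deriv (t := t))
      ((hE t).hasDerivAt l)
    have h2 : HasDerivAt (fun s => B (deriv (E k) s) (E l s)) 0 t := by
      have : (fun s => B (deriv (E k) s) (E l s)) = fun _ => (1 : Matrix _ _ ℝ) k l := by
        funext s; exact congr_fun (congr_fun (hE s).f_e k) l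
      rw [this]; exact hasDerivAt_const t _
    have h3 := h1.unique h2
    have h4 : B (deriv (E k) t) (deriv (E l) t) = 0 := congr_fun (congr_fun (hE t).f_f k) l
    rwa [h4, add_zero] at h3
  set R := bilinGram B (fun k => deriv (deriv (E k)) t) (fun k => deriv (E k) t) with hR
  -- Writing `e = X E`, the trace of the right side is the trace of `X R Xᵀ` plus three times the
  -- squared norm of `X'`, because differentiating `X Xᵀ = 1` twice gives `htr2`. So reduction can
  -- only increase the trace of the restricted curvature.
  have hgram : bilinGram B (fun k => deriv (deriv (e k)) t) (fun k => deriv (e k) t) =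
      -(X'' t * (X t)ᵀ) + (2 : ℝ) • (X' t * (X' t)ᵀ) + X t * R * (X t)ᵀ := by
    rw [funext fun k => hg k t, funext fun k => hf k t]
    simp only [bilinGram_add_left, bilinGram_add_right, bilinGram_matComb, (hE t).e_e, (hE t).f_e,
      (hE t).f_f, (hE t).e_f hB, hEE, ← hR]
    rw [two_smul]
    simp only [Matrix.mul_zero, Matrix.zero_mul, Matrix.mul_one, Matrix.mul_neg, Matrix.neg_mul]
    abel
  have hXX : ∀ s, X s * (X s)ᵀ = 1 := by
    intro s
    have := (he s).f_e
    rw [funext fun k => hf k s, funext fun k => heX s k, bilinGram_add_left, bilinGram_matComb,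
      bilinGram_matComb, (hE s).e_e, (hE s).f_e] at this
    simpa using this
  have hXX1 : ∀ s, X' s * (X s)ᵀ + X s * (X' s)ᵀ = 0 := by
    intro s
    ext i j
    have h3 := HasDerivAt.matrix_mul (hX s) (C := fun s => (X s)ᵀ) (C' := (X' s)ᵀ)
      (fun i j => hX s j i) i j
    have h4 : HasDerivAt (fun s => (X s * (X s)ᵀ) i j) 0 s := by
      simp only [hXX]; exact hasDerivAt_const s _
    exact h3.unique h4
  have hXX2 : (X'' t * (X t)ᵀ + X' t * (X' t)ᵀ) + (X' t * (X' t)ᵀ + X t * (X'' t)ᵀ) = 0 := by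
    ext i j
    have h3 := (HasDerivAt.matrix_mul (hX' t) (C := fun s => (X s)ᵀ) (C' := (X' t)ᵀ)
      (fun i j => hX t j i) i j).add (HasDerivAt.matrix_mul (hX t) (C := fun s => (X' s)ᵀ)
        (C' := (X'' t)ᵀ) (fun i j => hX' t j i) i j)
    have h4 : HasDerivAt (fun s => (X' s * (X s)ᵀ) i j + (X s * (X' s)ᵀ) i j) 0 t := by
      have : (fun s => (X' s * (X s)ᵀ) i j + (X s * (X' s)ᵀ) i j) = fun _ => 0 := by
        funext s; exact congr_fun (congr_fun (hXX1 s) i) j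
      rw [this]; exact hasDerivAt_const t _
    exact h3.unique h4
  have htr2 : (X'' t * (X t)ᵀ).trace = -(X' t * (X' t)ᵀ).trace := by
    have h1 := congr_arg Matrix.trace hXX2
    have h2 : (X t * (X'' t)ᵀ).trace = (X'' t * (X t)ᵀ).trace := by
      rw [← Matrix.trace_transpose, Matrix.transpose_mul, Matrix.transpose_transpose]
    simp only [Matrix.trace_add, Matrix.trace_zero, h2] at h1
    linarith
  have hsq : ∀ (p q : ℕ) (A : Matrix (Fin p) (Fin q) ℝ), (A * Aᵀ).trace = ∑ i, ∑ j, A i j ^ 2 := by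
    intro p q A
    simp only [Matrix.trace, Matrix.diag_apply, Matrix.mul_apply, Matrix.transpose_apply, sq]
  have hpos : 0 ≤ (X' t * (X' t)ᵀ).trace := by
    rw [hsq]; positivity
  -- The trace is the scalar product of `R` with the orthogonal projection `Q = Xᵀ X` of rank `m`,
  -- whose squared norm is `m`. Expand `‖R + Q‖² ≥ 0`.
  have hRP : -(((R * Rᵀ).trace + m) / 2) ≤ (X t * R * (X t)ᵀ).trace := by
    set Q := (X t)ᵀ * X t with hQ
    have hQt : Qᵀ = Q := by rw [hQ, Matrix.transpose_mul, Matrix.transpose_transpose]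
    have hQQ : (Q * Qᵀ).trace = m := by
      rw [hQt, hQ, Matrix.mul_assoc, ← Matrix.mul_assoc (X t), hXX, Matrix.one_mul,
        Matrix.trace_mul_comm, hXX, Matrix.trace_one, Fintype.card_fin]
    have h1 : (X t * R * (X t)ᵀ).trace = ∑ i, ∑ j, R i j * Q i j := by
      rw [Matrix.trace_mul_comm, ← Matrix.mul_assoc, ← hQ, Matrix.trace_mul_comm, ← hQt]
      simp only [Matrix.trace, Matrix.diag_apply, Matrix.mul_apply, Matrix.transpose_apply]
      exact Finset.sum_congr rfl fun i _ => Finset.sum_congr rfl fun j _ => by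
        rw [show Q j i = Q i j from congr_fun (congr_fun hQt i) j]
    rw [h1, ← hQQ, hsq, hsq]
    have h2 : 0 ≤ ∑ i, ∑ j, (R i j + Q i j) ^ 2 := by positivity
    have h3 : ∑ i, ∑ j, (R i j + Q i j) ^ 2 = ∑ i, ∑ j, R i j ^ 2 + 2 * ∑ i, ∑ j, R i j * Q i j +
        ∑ i, ∑ j, Q i j ^ 2 := by
      simp only [Finset.mul_sum, ← Finset.sum_add_distrib]
      exact Finset.sum_congr rfl fun _ _ => Finset.sum_congr rfl fun _ _ => by ring
    linarith
  rw [hgram]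
  simp only [Matrix.trace_add, Matrix.trace_neg, Matrix.trace_smul, htr2, smul_eq_mul]
  linarith

end CurvatureFormulas

/-! ### Differentiable dependence of solutions on initial values -/

section LocalFlow

variable {E : Type*} [NormedAddCommGroup E] [NormedSpace ℝ E] [FiniteDimensional ℝ E]

/-- A Lipschitz bound for the derivative on a ball and the mean value inequality along segments give
the quadratic remainder. -/
theorem ContDiffAt.exists_ball_taylor_bound {f : E → E} {y₀ : E} (hf : ContDiffAt ℝ ∞ f y₀) {U : Set E}
    (hU : U ∈ 𝓝 y₀) :
    ∃ ρ > 0, Metric.ball y₀ ρ ⊆ U ∧ (∃ K, LipschitzOnWith K f (Metric.ball y₀ ρ)) ∧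
      ∃ L, 0 ≤ L ∧ ∀ p ∈ Metric.ball y₀ ρ, ∀ q ∈ Metric.ball y₀ ρ,
        ‖f q - f p - fderiv ℝ f p (q - p)‖ ≤ L * ‖q - p‖ ^ 2 := by
  obtain ⟨K, s, hs, hK⟩ := (hf.of_le (by simp : (1 : WithTop ℕ∞) ≤ ∞)).exists_lipschitzOnWith
  have hf' : ContDiffAt ℝ 1 (fderiv ℝ f) y₀ :=
    hf.fderiv_right (by rw [one_add_one_eq_two]; exact WithTop.coe_le_coe.2 le_top : (1 : WithTop ℕ∞) + 1 ≤ ∞)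
  obtain ⟨L, s', hs', hL⟩ := hf'.exists_lipschitzOnWith
  have hd : ∀ᶠ y in 𝓝 y₀, DifferentiableAt ℝ f y :=
    ((hf.of_le (by simp : (1 : WithTop ℕ∞) ≤ ∞)).eventually (by norm_num)).mono
      fun y hy => hy.differentiableAt one_ne_zero
  obtain ⟨ρ, hρ, hsub⟩ := Metric.mem_nhds_iff.1
    (inter_mem (inter_mem (inter_mem hs hs') hd) hU)
  refine ⟨ρ, hρ, fun y hy => (hsub hy).2, ⟨K, hK.mono fun y hy => (hsub hy).1.1.1⟩, L, L.2, ?_⟩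
  intro p hp q hq
  have hseg : segment ℝ p q ⊆ Metric.ball y₀ ρ := (convex_ball y₀ ρ).segment_subset hp hq
  have h1 := (convex_segment p q).norm_image_sub_le_of_norm_hasFDerivWithin_le'
    (f := f) (f' := fderiv ℝ f) (φ := fderiv ℝ f p) (C := L * ‖q - p‖)
    (fun x hx => (hsub (hseg hx)).1.2.hasFDerivAt.hasFDerivWithinAt)
    (fun x hx => ?_) (left_mem_segment ℝ p q) (right_mem_segment ℝ p q)
  · calc _ ≤ L * ‖q - p‖ * ‖q - p‖ := h1
      _ = _ := by ring
  · have h2 := hL.dist_le_mul x (hsub (hseg hx)).1.1.2 p (hsub hp).1.1.2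
    rw [dist_eq_norm, dist_eq_norm] at h2
    refine h2.trans (mul_le_mul_of_nonneg_left ?_ L.2)
    rw [segment_eq_image'] at hx
    obtain ⟨θ, hθ, rfl⟩ := hx
    simp only [add_sub_cancel_left, norm_smul, Real.norm_eq_abs, abs_of_nonneg hθ.1]
    exact mul_le_of_le_one_left (norm_nonneg _) hθ.2

/-- A solution of the variational equation approximates nearby trajectories to second order. -/
theorem norm_sub_sub_le_of_variational {f : E → E} {s : Set E} {K : NNReal} {L : ℝ} (hL : 0 ≤ L)
    (hK : LipschitzOnWith K f s)
    (hT : ∀ p ∈ s, ∀ q ∈ s, ‖f q - f p - fderiv ℝ f p (q - p)‖ ≤ L * ‖q - p‖ ^ 2)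
    {c T : ℝ} (hc : |c| = 1) {γ δ : ℝ → E} {W : ℝ → E →L[ℝ] E} {h : E}
    (hγ : ∀ t ∈ Icc 0 T, HasDerivAt γ (c • f (γ t)) t)
    (hδ : ∀ t ∈ Icc 0 T, HasDerivAt δ (c • f (δ t)) t)
    (hW : ∀ t ∈ Icc 0 T, HasDerivAt W (c • (fderiv ℝ f (γ t)).comp (W t)) t)
    (hγs : ∀ t ∈ Icc 0 T, γ t ∈ s) (hδs : ∀ t ∈ Icc 0 T, δ t ∈ s)
    (hWs : ∀ t ∈ Icc 0 T, γ t + W t h ∈ s) (hWb : ∀ t ∈ Icc 0 T, ‖W t‖ ≤ 2)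
    (h0 : δ 0 = γ 0 + W 0 h) :
    ∀ t ∈ Icc 0 T, ‖δ t - γ t - W t h‖ ≤ gronwallBound 0 K (4 * L) t * ‖h‖ ^ 2 := by
  have hWh : ∀ t ∈ Icc 0 T, HasDerivAt (fun t => γ t + W t h)
      (c • f (γ t) + c • fderiv ℝ f (γ t) (W t h)) t := by
    intro t ht
    have := (hγ t ht).add ((hW t ht).clm_apply (hasDerivAt_const t h))
    simpa [Pi.add_def] using this
  have hKc : ∀ t ∈ Ico 0 T, LipschitzOnWith K ((fun _ y => c • f y : ℝ → E → E) t) s := by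
    intro t _
    refine LipschitzOnWith.of_dist_le_mul fun x hx y hy => ?_
    rw [dist_eq_norm, ← smul_sub, norm_smul, Real.norm_eq_abs, hc, one_mul, ← dist_eq_norm]
    exact hK.dist_le_mul x hx y hy
  -- The curve `γ + W h` solves the equation up to the Taylor remainder `L ‖W h‖²`, which is at most
  -- `4 L ‖h‖²` as `‖W‖ ≤ 2`. Grönwall's inequality compares it with the true solution `δ`.
  have key := dist_le_of_approx_trajectories_ODE_of_mem (a := 0) (b := T) (s := fun _ => s)
    (εf := 0) (εg := 4 * L * ‖h‖ ^ 2) (δ := 0) hKc (f := δ) (g := fun t => γ t + W t h)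
    (fun t ht => (hδ t ht).continuousAt.continuousWithinAt)
    (fun t ht => (hδ t (Ico_subset_Icc_self ht)).hasDerivWithinAt)
    (fun t ht => by rw [dist_self])
    (fun t ht => hδs t (Ico_subset_Icc_self ht))
    (fun t ht => (hWh t ht).continuousAt.continuousWithinAt)
    (fun t ht => (hWh t (Ico_subset_Icc_self ht)).hasDerivWithinAt)
    (fun t ht => ?_) (fun t ht => hWs t (Ico_subset_Icc_self ht)) (by simp [h0])
  · intro t ht
    have h1 := key t ht
    rw [dist_eq_norm, sub_add_eq_sub_sub] at h1
    refine h1.trans (le_of_eq ?_)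
    simp only [zero_add, sub_zero]
    unfold gronwallBound
    split_ifs <;> ring
  · have ht' := Ico_subset_Icc_self ht
    have h1 := hT _ (hγs t ht') _ (hWs t ht')
    rw [add_sub_cancel_left] at h1
    rw [dist_eq_norm, ← smul_add, ← smul_sub, norm_smul, Real.norm_eq_abs, hc, one_mul, norm_sub_rev,
      sub_add_eq_sub_sub]
    refine h1.trans ?_
    have h2 : ‖W t h‖ ≤ 2 * ‖h‖ := (W t).le_of_opNorm_le (hWb t ht') h
    calc L * ‖W t h‖ ^ 2 ≤ L * (2 * ‖h‖) ^ 2 := by gcongr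
      _ = _ := by ring

/-- A smooth vector field has a local flow which is differentiable in the initial condition, with
derivative the solution of the variational equation. -/
theorem ContDiffAt.exists_local_flow {f : E → E} {y₀ : E} (hf : ContDiffAt ℝ ∞ f y₀) {U : Set E}
    (hU : U ∈ 𝓝 y₀) :
    ∃ (α : E → ℝ → E) (W : E → ℝ → E →L[ℝ] E), ∃ r > 0, ∃ ε > 0,
      (∀ y ∈ Metric.ball y₀ r, α y 0 = y ∧ W y 0 = ContinuousLinearMap.id ℝ E ∧
        ∀ t ∈ Ioo (-ε) ε, α y t ∈ U ∧ HasDerivAt (α y) (f (α y t)) t ∧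
          HasDerivAt (W y) ((fderiv ℝ f (α y t)).comp (W y t)) t ∧
          HasFDerivAt (fun z => α z t) (W y t) y) ∧
      ContinuousOn (fun z : E × ℝ => α z.1 z.2) (Metric.ball y₀ r ×ˢ Ioo (-ε) ε) := by
  obtain ⟨ρ, hρ, hρU, ⟨K, hK⟩, L, hL, hT⟩ := hf.exists_ball_taylor_bound hU
  -- The equation is solved together with its linearization, from the initial value `(y, id)`. The
  -- second component is the candidate for the derivative of the flow.
  let F : E × (E →L[ℝ] E) → E × (E →L[ℝ] E) := fun z => (f z.1, (fderiv ℝ f z.1).comp z.2)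
  let z₀ : E × (E →L[ℝ] E) := (y₀, ContinuousLinearMap.id ℝ E)
  have hF : ContDiffAt ℝ 1 F z₀ := by
    have h1 : ContDiffAt ℝ 1 (fun z : E × (E →L[ℝ] E) => f z.1) z₀ :=
      (hf.of_le (by simp)).comp z₀ contDiffAt_fst
    have h2 : ContDiffAt ℝ 1 (fun z : E × (E →L[ℝ] E) => fderiv ℝ f z.1) z₀ :=
      ContDiffAt.comp (g := fderiv ℝ f) z₀ (hf.fderiv_right (by rw [one_add_one_eq_two]; exact WithTop.coe_le_coe.2 le_top : (1 : WithTop ℕ∞) + 1 ≤ ∞))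
        contDiffAt_fst
    exact h1.prodMk (h2.clm_comp contDiffAt_snd)
  obtain ⟨ε, hε, a, r, L', K', hr, hpl⟩ := IsPicardLindelof.of_contDiffAt_one hF
  obtain ⟨β, hβ, hβc⟩ := (hpl 0).exists_forall_mem_closedBall_eq_hasDerivWithinAt_continuousOn
  simp only [zero_sub, zero_add] at hβ hβc
  have hz₀ : z₀ ∈ Metric.closedBall z₀ (r : ℝ) := Metric.mem_closedBall_self r.2
  have hβ0 : β (z₀, 0) = z₀ := (hβ z₀ hz₀).1
  have hcont : ContinuousAt β (z₀, 0) := hβc.continuousAt (prod_mem_nhds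
    (Metric.closedBall_mem_nhds z₀ hr) (Icc_mem_nhds (by linarith) hε))
  have hev : ∀ᶠ w in 𝓝 (z₀, (0 : ℝ)), (β w).1 ∈ Metric.ball y₀ (ρ / 2) ∧ ‖(β w).2‖ < 2 := by
    rw [ContinuousAt, hβ0] at hcont
    refine hcont.eventually (p := fun w => w.1 ∈ Metric.ball y₀ (ρ / 2) ∧ ‖w.2‖ < 2) ?_
    refine Filter.Eventually.and (continuousAt_fst.eventually (Metric.ball_mem_nhds y₀ (half_pos hρ))) ?_
    have : ‖z₀.2‖ < 2 := lt_of_le_of_lt (ContinuousLinearMap.norm_id_le) one_lt_two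
    exact (continuousAt_snd.norm).eventually_lt_const this
  obtain ⟨u, hu, v, hv, huv⟩ := mem_nhds_prod_iff.1 hev
  obtain ⟨r₁, hr₁, hr₁u⟩ := Metric.mem_nhds_iff.1 (inter_mem hu (Metric.closedBall_mem_nhds z₀ hr))
  obtain ⟨ε₁, hε₁, hε₁v⟩ := Metric.mem_nhds_iff.1
    (inter_mem hv (Icc_mem_nhds (by linarith : -ε < 0) hε))
  have hmem : ∀ y ∈ Metric.ball y₀ r₁, ((y, ContinuousLinearMap.id ℝ E) : E × (E →L[ℝ] E)) ∈
      Metric.ball z₀ r₁ := by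
    intro y hy
    rw [Metric.mem_ball, Prod.dist_eq, dist_self]
    simpa [z₀, hr₁] using hy
  have htm : ∀ t ∈ Ioo (-ε₁) ε₁, t ∈ v ∧ t ∈ Icc (-ε) ε := fun t ht =>
    hε₁v (by rw [Real.ball_eq_Ioo]; simpa using ht)
  have htI : ∀ t ∈ Ioo (-ε₁) ε₁, Icc (-ε) ε ∈ 𝓝 t := fun t ht =>
    mem_of_superset (Ioo_mem_nhds ht.1 ht.2) fun s hs => (htm s hs).2
  let α : E → ℝ → E := fun y t => (β ((y, ContinuousLinearMap.id ℝ E), t)).1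
  let W : E → ℝ → E →L[ℝ] E := fun y t => (β ((y, ContinuousLinearMap.id ℝ E), t)).2
  have hβd : ∀ y ∈ Metric.ball y₀ r₁, ∀ t ∈ Ioo (-ε₁) ε₁,
      HasDerivAt (fun t => β ((y, ContinuousLinearMap.id ℝ E), t)) (F (α y t, W y t)) t :=
    fun y hy t ht => ((hβ _ (hr₁u (hmem y hy)).2).2 t (htm t ht).2).hasDerivAt (htI t ht)
  have hαd : ∀ y ∈ Metric.ball y₀ r₁, ∀ t ∈ Ioo (-ε₁) ε₁, HasDerivAt (α y) (f (α y t)) t :=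
    fun y hy t ht => (hβd y hy t ht).fst
  have hWd : ∀ y ∈ Metric.ball y₀ r₁, ∀ t ∈ Ioo (-ε₁) ε₁,
      HasDerivAt (W y) ((fderiv ℝ f (α y t)).comp (W y t)) t :=
    fun y hy t ht => (hβd y hy t ht).snd
  have hin : ∀ y ∈ Metric.ball y₀ r₁, ∀ t ∈ Ioo (-ε₁) ε₁,
      α y t ∈ Metric.ball y₀ (ρ / 2) ∧ ‖W y t‖ < 2 := fun y hy t ht =>
    huv (mk_mem_prod (hr₁u (hmem y hy)).1 (htm t ht).1)
  have hα0 : ∀ y ∈ Metric.ball y₀ r₁, α y 0 = y := fun y hy =>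
    congr_arg Prod.fst (hβ _ (hr₁u (hmem y hy)).2).1
  have hW0 : ∀ y ∈ Metric.ball y₀ r₁, W y 0 = ContinuousLinearMap.id ℝ E := fun y hy =>
    congr_arg Prod.snd (hβ _ (hr₁u (hmem y hy)).2).1
  have hsub : Metric.ball y₀ (ρ / 2) ⊆ Metric.ball y₀ ρ := Metric.ball_subset_ball (by linarith)
  refine ⟨α, W, r₁, hr₁, ε₁, hε₁, fun y hy => ⟨hα0 y hy, hW0 y hy, fun t ht =>
    ⟨hρU (hsub (hin y hy t ht).1), hαd y hy t ht, hWd y hy t ht, ?_⟩⟩, ?_⟩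
  · have hnear : ∀ᶠ z in 𝓝 y, z ∈ Metric.ball y₀ r₁ ∧ ‖z - y‖ < ρ / 4 := by
      refine Filter.Eventually.and (Metric.isOpen_ball.mem_nhds hy) ?_
      have : ContinuousAt (fun z => ‖z - y‖) y := by fun_prop
      exact this.eventually_lt_const (by simpa using hρ)
    -- Grönwall's inequality runs forward in time. The sign `c` treats negative times by reversing
    -- the field.
    obtain ⟨c, hc, T, hT0, htc⟩ : ∃ c : ℝ, |c| = 1 ∧ ∃ T, 0 ≤ T ∧ t = c * T := by
      rcases le_total 0 t with h | h
      · exact ⟨1, by simp, t, h, by simp⟩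
      · exact ⟨-1, by simp, -t, by linarith, by simp⟩
    have hcT : ∀ s ∈ Icc 0 T, c * s ∈ Ioo (-ε₁) ε₁ := by
      intro s hs
      rw [mem_Ioo, ← abs_lt, abs_mul, hc, one_mul, abs_of_nonneg hs.1]
      rw [mem_Ioo, ← abs_lt, htc, abs_mul, hc, one_mul, abs_of_nonneg hT0] at ht
      exact hs.2.trans_lt ht
    have hsc : ∀ {G : Type _} [NormedAddCommGroup G] [NormedSpace ℝ G] {g : ℝ → G} {g' : G} {s : ℝ},
        HasDerivAt g g' (c * s) → HasDerivAt (fun s => g (c * s)) (c • g') s := by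
      intro G _ _ g g' s hg
      have h1 : HasDerivAt (fun s : ℝ => c * s) c s := by
        simpa using (hasDerivAt_id s).const_mul c
      exact HasDerivAt.scomp (h := fun s => c * s) s hg h1
    have hbound : ∀ᶠ z in 𝓝 y,
        ‖α z t - α y t - W y t (z - y)‖ ≤ gronwallBound 0 K (4 * L) T * ‖z - y‖ ^ 2 := by
      filter_upwards [hnear] with z hz
      have := norm_sub_sub_le_of_variational hL hK hT hc (T := T) (γ := fun s => α y (c * s))
        (δ := fun s => α z (c * s)) (W := fun s => W y (c * s)) (h := z - y)
        (fun s hs => hsc (hαd y hy _ (hcT s hs))) (fun s hs => hsc (hαd z hz.1 _ (hcT s hs)))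
        (fun s hs => hsc (hWd y hy _ (hcT s hs))) (fun s hs => hsub (hin y hy _ (hcT s hs)).1)
        (fun s hs => hsub (hin z hz.1 _ (hcT s hs)).1)
        (fun s hs => ?_) (fun s hs => (hin y hy _ (hcT s hs)).2.le)
        (by simp [hα0 y hy, hα0 z hz.1, hW0 y hy]) T ⟨hT0, le_rfl⟩
      · rwa [← htc] at this
      -- The radii fit: `ρ/2` for the solution and `2 · ρ/4` for the linear correction keep the
      -- approximate solution in the ball of radius `ρ`.
      · have h1 := hin y hy _ (hcT s hs)
        have h2 : ‖W y (c * s) (z - y)‖ ≤ 2 * ‖z - y‖ := (W y (c * s)).le_of_opNorm_le h1.2.le _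
        have h3 := h1.1
        rw [Metric.mem_ball, dist_eq_norm] at h3 ⊢
        calc ‖α y (c * s) + W y (c * s) (z - y) - y₀‖
            = ‖(α y (c * s) - y₀) + W y (c * s) (z - y)‖ := by congr 1; abel
          _ ≤ ‖α y (c * s) - y₀‖ + ‖W y (c * s) (z - y)‖ := norm_add_le _ _
          _ < ρ := by linarith [hz.2]
    rw [hasFDerivAt_iff_isLittleO]
    have hO : (fun z => α z t - α y t - W y t (z - y)) =O[𝓝 y] fun z => ‖z - y‖ ^ 2 :=
      Asymptotics.IsBigO.of_bound (gronwallBound 0 K (4 * L) T) (by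
        filter_upwards [hbound] with z hz
        rwa [Real.norm_eq_abs, abs_of_nonneg (by positivity)])
    refine hO.trans_isLittleO ?_
    have : Tendsto (fun z => ‖z - y‖) (𝓝 y) (𝓝 0) := by
      have : ContinuousAt (fun z => ‖z - y‖) y := by fun_prop
      simpa [ContinuousAt] using this
    have h2 := (Asymptotics.isLittleO_one_iff ℝ).2 this
    have h3 := h2.mul_isBigO (Asymptotics.isBigO_refl (fun z => ‖z - y‖) (𝓝 y))
    simp only [one_mul, ← sq] at h3
    exact h3.of_norm_right
  · have h1 : ContinuousOn (fun z : E × ℝ => β ((z.1, ContinuousLinearMap.id ℝ E), z.2))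
        (Metric.ball y₀ r₁ ×ˢ Ioo (-ε₁) ε₁) :=
      hβc.comp (by fun_prop) fun z hz => mk_mem_prod (hr₁u (hmem _ hz.1)).2 (htm _ hz.2).2
    exact h1.fst

end LocalFlow

/-! ### Vector fields in the preferred chart -/

section FieldInChart

variable {E : Type*} [NormedAddCommGroup E] [NormedSpace ℝ E]
  {M : Type*} [TopologicalSpace M] [ChartedSpace E M]

/-- The vector field `V` read in the preferred chart at `p`. -/
noncomputable def fieldInChart (p : M) (V : ∀ x : M, TangentSpace 𝓘(ℝ, E) x) : E → E :=
  VectorField.mpullbackWithin 𝓘(ℝ, E) 𝓘(ℝ, E) (extChartAt 𝓘(ℝ, E) p).symm V (range 𝓘(ℝ, E))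

variable [IsManifold 𝓘(ℝ, E) ∞ M]

theorem isManifold_one : IsManifold 𝓘(ℝ, E) 1 M :=
  IsManifold.of_le (n := ∞) (by simp)

theorem mfderiv_symm_fieldInChart (p : M) (V : ∀ x : M, TangentSpace 𝓘(ℝ, E) x) {z : E}
    (hz : z ∈ (extChartAt 𝓘(ℝ, E) p).target) :
    mfderivWithin 𝓘(ℝ, E) 𝓘(ℝ, E) (extChartAt 𝓘(ℝ, E) p).symm (range 𝓘(ℝ, E)) z
      (fieldInChart (E := E) p V z) = V ((extChartAt 𝓘(ℝ, E) p).symm z) := by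
  have := isManifold_one (E := E) (M := M)
  have h := isInvertible_mfderivWithin_extChartAt_symm (I := 𝓘(ℝ, E)) hz
  obtain ⟨e, he⟩ := h
  change mfderivWithin 𝓘(ℝ, E) 𝓘(ℝ, E) (extChartAt 𝓘(ℝ, E) p).symm (range 𝓘(ℝ, E)) z
    ((mfderivWithin 𝓘(ℝ, E) 𝓘(ℝ, E) (extChartAt 𝓘(ℝ, E) p).symm (range 𝓘(ℝ, E)) z).inverse
      (V ((extChartAt 𝓘(ℝ, E) p).symm z))) = _
  rw [← he, ContinuousLinearMap.inverse_equiv]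
  exact e.apply_symm_apply _

theorem fieldInChart_apply (p : M) (V : ∀ x : M, TangentSpace 𝓘(ℝ, E) x) {x : M}
    (hx : x ∈ (extChartAt 𝓘(ℝ, E) p).source) :
    fieldInChart p V (extChartAt 𝓘(ℝ, E) p x) =
      mfderiv 𝓘(ℝ, E) 𝓘(ℝ, E) (extChartAt 𝓘(ℝ, E) p) x (V x) := by
  have := isManifold_one (E := E) (M := M)
  have h1 := mfderiv_symm_fieldInChart p V ((extChartAt 𝓘(ℝ, E) p).map_source hx)
  have h2 := mfderiv_extChartAt_comp_mfderivWithin_extChartAt_symm (I := 𝓘(ℝ, E))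
    ((extChartAt 𝓘(ℝ, E) p).map_source hx)
  have h3 := congr_arg (mfderiv 𝓘(ℝ, E) 𝓘(ℝ, E) (extChartAt 𝓘(ℝ, E) p)
    ((extChartAt 𝓘(ℝ, E) p).symm (extChartAt 𝓘(ℝ, E) p x))) h1
  have h4 := DFunLike.congr_fun h2 (fieldInChart (E := E) p V (extChartAt 𝓘(ℝ, E) p x))
  have h5 := h4.symm.trans h3
  rw [(extChartAt 𝓘(ℝ, E) p).left_inv hx] at h5
  exact h5

theorem fieldInChart_self (p : M) (V : ∀ x : M, TangentSpace 𝓘(ℝ, E) x) :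
    fieldInChart p V (extChartAt 𝓘(ℝ, E) p p) = V p := by
  have := isManifold_one (E := E) (M := M)
  rw [fieldInChart_apply p V (mem_extChartAt_source p), mfderiv_extChartAt_self]
  rfl

theorem SmoothFieldAt.contDiffAt_fieldInChart [CompleteSpace E] {p : M}
    {V : ∀ x : M, TangentSpace 𝓘(ℝ, E) x} (hV : SmoothFieldAt V p) :
    ContDiffAt ℝ ∞ (fieldInChart p V) (extChartAt 𝓘(ℝ, E) p p) := by
  have h := VectorField.contMDiffWithinAt_mpullbackWithin_extChartAt_symm (I := 𝓘(ℝ, E)) (n := ∞)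
    (m := ∞) (s := univ) (V := V) (x := p) hV.contMDiffWithinAt uniqueMDiffOn_univ (mem_univ _)
    (by simp)
  rw [contMDiffWithinAt_vectorSpace_iff_contDiffWithinAt] at h
  exact h.contDiffAt (by
    simpa using extChartAt_target_mem_nhds (I := 𝓘(ℝ, E)) p)

/-- The preferred chart at `p` has identity differential at `p`, so the coordinate formula for the
bracket needs no conversion there. -/
theorem mlieBracket_eq_fieldInChart (p : M) (V W : ∀ x : M, TangentSpace 𝓘(ℝ, E) x) :
    VectorField.mlieBracket 𝓘(ℝ, E) V W p =
      (fderiv ℝ (fieldInChart p W) (extChartAt 𝓘(ℝ, E) p p) (V p) -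
        fderiv ℝ (fieldInChart p V) (extChartAt 𝓘(ℝ, E) p p) (W p) : E) := by
  have := isManifold_one (E := E) (M := M)
  have hid : (mfderiv 𝓘(ℝ, E) 𝓘(ℝ, E) (extChartAt 𝓘(ℝ, E) p) p : E →L[ℝ] E) =
      ContinuousLinearMap.id ℝ E := mfderiv_extChartAt_self
  have hinv : ∀ (A : E →L[ℝ] E) (v : E), A = ContinuousLinearMap.id ℝ E → A.inverse v = v := by
    rintro A v rfl
    rw [ContinuousLinearMap.inverse_id]
    rfl
  rw [← VectorField.mlieBracketWithin_univ, VectorField.mlieBracketWithin_apply]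
  refine (hinv _ _ hid).trans ?_
  change VectorField.lieBracketWithin ℝ (fieldInChart p V) (fieldInChart p W)
    (_ ⁻¹' univ ∩ range 𝓘(ℝ, E)) (extChartAt 𝓘(ℝ, E) p p) = _
  have hr : range 𝓘(ℝ, E) = univ := by simp
  rw [preimage_univ, univ_inter, hr, VectorField.lieBracketWithin_univ, VectorField.lieBracket, fieldInChart_self, fieldInChart_self]

end FieldInChart

/-! ### Local flows on manifolds -/

section LocalFlowManifold

variable {E : Type*} [NormedAddCommGroup E] [NormedSpace ℝ E] [FiniteDimensional ℝ E]
  {M : Type*} [TopologicalSpace M] [ChartedSpace E M] [IsManifold 𝓘(ℝ, E) ∞ M]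

/-- A smooth vector field on a manifold has a local flow which is differentiable in the initial
condition; its differential solves the linearized equation at the base point. -/
theorem SmoothFieldAt.exists_local_flow {Y : ∀ x : M, TangentSpace 𝓘(ℝ, E) x} {p : M}
    (hY : SmoothFieldAt Y p) :
    ∃ (γ : M → ℝ → M), ∃ U ∈ 𝓝 p, ∃ ε > 0,
      (∀ x ∈ U, γ x 0 = x ∧ IsMIntegralCurveOn (γ x) Y (Ioo (-ε) ε) ∧
        ∀ t ∈ Ioo (-ε) ε, MDifferentiableAt 𝓘(ℝ, E) 𝓘(ℝ, E) (fun y => γ y t) x) ∧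
      ContinuousAt (fun z : M × ℝ => γ z.1 z.2) (p, 0) ∧
      (∀ᶠ t in 𝓝 (0 : ℝ), γ p t ∈ (extChartAt 𝓘(ℝ, E) p).source) ∧
      HasDerivAt (fun t => ((mfderiv 𝓘(ℝ, E) 𝓘(ℝ, E) (extChartAt 𝓘(ℝ, E) p) (γ p t)).comp
        (mfderiv 𝓘(ℝ, E) 𝓘(ℝ, E) (fun y => γ y t) p) : E →L[ℝ] E))
        (fderiv ℝ (fieldInChart p Y) (extChartAt 𝓘(ℝ, E) p p)) 0 := by
  have := isManifold_one (E := E) (M := M)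
  set φ := extChartAt 𝓘(ℝ, E) p with hφ
  have hsm := hY.contDiffAt_fieldInChart
  have htgt : φ.target ∈ 𝓝 (φ p) := extChartAt_target_mem_nhds (I := 𝓘(ℝ, E)) p
  obtain ⟨α, W, r, hr, ε, hε, hα, hαc⟩ := hsm.exists_local_flow htgt
  set U := φ.source ∩ φ ⁻¹' Metric.ball (φ p) r with hU
  have hUo : IsOpen U := (continuousOn_extChartAt (I := 𝓘(ℝ, E)) p).isOpen_inter_preimage
    (isOpen_extChartAt_source p) Metric.isOpen_ball
  have hpU : p ∈ U := ⟨mem_extChartAt_source p, Metric.mem_ball_self hr⟩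
  have h0 : (0 : ℝ) ∈ Ioo (-ε) ε := ⟨by linarith, hε⟩
  have hsymm : ∀ z ∈ φ.target, HasMFDerivAt 𝓘(ℝ, E) 𝓘(ℝ, E) φ.symm z
      (mfderivWithin 𝓘(ℝ, E) 𝓘(ℝ, E) φ.symm (range 𝓘(ℝ, E)) z) := by
    intro z hz
    have h1 := (mdifferentiableWithinAt_extChartAt_symm (I := 𝓘(ℝ, E)) hz).hasMFDerivWithinAt
    exact h1.hasMFDerivAt (by simp)
  have hmd : ∀ x ∈ U, ∀ t ∈ Ioo (-ε) ε,
      HasMFDerivAt 𝓘(ℝ, E) 𝓘(ℝ, E) (fun y => α (φ y) t) x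
        ((W (φ x) t).comp (mfderiv 𝓘(ℝ, E) 𝓘(ℝ, E) φ x)) := by
    intro x hx t ht
    have h1 : HasMFDerivAt 𝓘(ℝ, E) 𝓘(ℝ, E) (fun z => α z t) (φ x) (W (φ x) t) :=
      ((hα _ hx.2).2.2 t ht).2.2.2.hasMFDerivAt
    have h2 : HasMFDerivAt 𝓘(ℝ, E) 𝓘(ℝ, E) φ x (mfderiv 𝓘(ℝ, E) 𝓘(ℝ, E) φ x) :=
      (mdifferentiableAt_extChartAt (I := 𝓘(ℝ, E)) (by simpa [φ] using hx.1)).hasMFDerivAt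
    exact h1.comp x h2
  have hγd : ∀ x ∈ U, ∀ t ∈ Ioo (-ε) ε,
      MDifferentiableAt 𝓘(ℝ, E) 𝓘(ℝ, E) (fun y => φ.symm (α (φ y) t)) x := by
    intro x hx t ht
    have h1 := (hsymm _ ((hα _ hx.2).2.2 t ht).1).mdifferentiableAt
    exact h1.comp x (hmd x hx t ht).mdifferentiableAt
  refine ⟨fun x t => φ.symm (α (φ x) t), U, hUo.mem_nhds hpU, ε, hε, fun x hx => ⟨?_, ?_, hγd x hx⟩,
    ?_, ?_, ?_⟩
  · show φ.symm (α (φ x) 0) = x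
    rw [(hα _ hx.2).1]
    exact φ.left_inv hx.1
  · intro t ht
    have h1 := hsymm _ ((hα _ hx.2).2.2 t ht).1
    have h2 : HasMFDerivAt 𝓘(ℝ, ℝ) 𝓘(ℝ, E) (α (φ x)) t
        ((1 : ℝ →L[ℝ] ℝ).smulRight (fieldInChart (E := E) p Y (α (φ x) t))) :=
      ((hα _ hx.2).2.2 t ht).2.1.hasFDerivAt.hasMFDerivAt
    have h3 := h1.comp t h2
    refine (h3.congr_mfderiv ?_).hasMFDerivWithinAt
    have h4 := mfderiv_symm_fieldInChart p Y ((hα _ hx.2).2.2 t ht).1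
    refine ContinuousLinearMap.ext fun (s : ℝ) => ?_
    exact ((mfderivWithin 𝓘(ℝ, E) 𝓘(ℝ, E) φ.symm (range 𝓘(ℝ, E)) (α (φ x) t)).map_smul s _).trans
      (congr_arg (fun v : E => s • v) h4)
  · have h1 : ContinuousAt (fun z : M × ℝ => (φ z.1, z.2)) (p, 0) :=
      ContinuousAt.prodMk ((continuousAt_extChartAt (I := 𝓘(ℝ, E)) p).comp continuousAt_fst)
        continuousAt_snd
    have h2 : ContinuousAt (fun z : E × ℝ => α z.1 z.2) (φ p, 0) :=
      hαc.continuousAt (prod_mem_nhds (Metric.ball_mem_nhds _ hr) (Ioo_mem_nhds h0.1 h0.2))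
    have h3 : ContinuousAt (fun z : M × ℝ => α (φ z.1) z.2) (p, 0) :=
      ContinuousAt.comp (g := fun z : E × ℝ => α z.1 z.2) (f := fun z : M × ℝ => (φ z.1, z.2)) h2 h1
    have h4 : ContinuousAt φ.symm (α (φ p) 0) := by
      rw [(hα _ hpU.2).1]
      exact continuousAt_extChartAt_symm (I := 𝓘(ℝ, E)) p
    exact ContinuousAt.comp (f := fun z : M × ℝ => α (φ z.1) z.2) h4 h3
  · filter_upwards [Ioo_mem_nhds h0.1 h0.2] with t ht
    exact φ.map_target ((hα _ hpU.2).2.2 t ht).1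
  · have h1 := ((hα _ hpU.2).2.2 0 h0).2.2.1
    rw [(hα _ hpU.2).1, (hα _ hpU.2).2.1, ContinuousLinearMap.comp_id] at h1
    refine h1.congr_of_eventuallyEq ?_
    filter_upwards [Ioo_mem_nhds h0.1 h0.2] with t ht
    have h2 := (hmd p hpU t ht).mfderiv
    have h3 : mfderiv 𝓘(ℝ, E) 𝓘(ℝ, E) (fun y => φ (φ.symm (α (φ y) t))) p =
        (mfderiv 𝓘(ℝ, E) 𝓘(ℝ, E) φ (φ.symm (α (φ p) t))).comp
          (mfderiv 𝓘(ℝ, E) 𝓘(ℝ, E) (fun y => φ.symm (α (φ y) t)) p) :=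
      mfderiv_comp p (g := φ) (f := fun y => φ.symm (α (φ y) t))
        (mdifferentiableAt_extChartAt (I := 𝓘(ℝ, E)) (by
          have := φ.map_target ((hα _ hpU.2).2.2 t ht).1
          simpa [φ] using this)) (hγd p hpU t ht)
    have h4 : (fun y => φ (φ.symm (α (φ y) t))) =ᶠ[𝓝 p] fun y => α (φ y) t := by
      filter_upwards [hUo.mem_nhds hpU] with y hy
      exact φ.right_inv ((hα _ hy.2).2.2 t ht).1
    have hid : (mfderiv 𝓘(ℝ, E) 𝓘(ℝ, E) φ p : E →L[ℝ] E) =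
      ContinuousLinearMap.id ℝ E := mfderiv_extChartAt_self
    have h5 := h3.symm.trans (h4.mfderiv_eq.trans h2)
    refine Eq.trans h5 ?_
    change (W (φ p) t).comp (mfderiv 𝓘(ℝ, E) 𝓘(ℝ, E) φ p : E →L[ℝ] E) = _
    have h6 : ∀ A : E →L[ℝ] E, A = ContinuousLinearMap.id ℝ E → (W (φ p) t).comp A = W (φ p) t := by
      rintro A rfl
      exact ContinuousLinearMap.comp_id _
    exact h6 _ hid

end LocalFlowManifold

/-! ### Complete flows -/

section CompleteFlow

variable {E : Type*} [NormedAddCommGroup E] [NormedSpace ℝ E]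
  {M : Type*} [TopologicalSpace M] [ChartedSpace E M] [IsManifold 𝓘(ℝ, E) ∞ M]

/-- `Θ` is the flow of the complete vector field `Y`. -/
structure IsCompleteFlow (Y : ∀ x : M, TangentSpace 𝓘(ℝ, E) x) (Θ : ℝ → M → M) : Prop where
  smooth : ∀ x, SmoothFieldAt Y x
  zero : ∀ x, Θ 0 x = x
  integral : ∀ x, IsMIntegralCurve (fun t => Θ t x) Y

theorem contMDiff_one_of_smoothFieldAt {Y : ∀ x : M, TangentSpace 𝓘(ℝ, E) x}
    (hY : ∀ x, SmoothFieldAt Y x) :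
    ContMDiff 𝓘(ℝ, E) 𝓘(ℝ, E).tangent 1 (fun y => (⟨y, Y y⟩ : TangentBundle 𝓘(ℝ, E) M)) :=
  fun x => (hY x).of_le (by simp)

theorem eq_of_isMIntegralCurveOn [FiniteDimensional ℝ E] [T2Space M]
    {Y : ∀ x : M, TangentSpace 𝓘(ℝ, E) x} (hY : ∀ x, SmoothFieldAt Y x) {γ δ : ℝ → M} {a b c d : ℝ}
    (hγ : IsMIntegralCurveOn γ Y (Ioo a b)) (hδ : IsMIntegralCurveOn δ Y (Ioo c d))
    (h0 : (0 : ℝ) ∈ Ioo a b) (h0' : (0 : ℝ) ∈ Ioo c d) (h : γ 0 = δ 0) {t : ℝ} (ht : t ∈ Ioo a b)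
    (ht' : t ∈ Ioo c d) : γ t = δ t := by
  have := isManifold_one (E := E) (M := M)
  have hsub1 : Ioo (max a c) (min b d) ⊆ Ioo a b :=
    Ioo_subset_Ioo (le_max_left _ _) (min_le_left _ _)
  have hsub2 : Ioo (max a c) (min b d) ⊆ Ioo c d :=
    Ioo_subset_Ioo (le_max_right _ _) (min_le_right _ _)
  exact isMIntegralCurveOn_Ioo_eqOn_of_contMDiff_boundaryless (t₀ := 0)
    ⟨max_lt h0.1 h0'.1, lt_min h0.2 h0'.2⟩ (contMDiff_one_of_smoothFieldAt hY)
    (hγ.mono hsub1) (hδ.mono hsub2) h ⟨max_lt ht.1 ht'.1, lt_min ht.2 ht'.2⟩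

variable [FiniteDimensional ℝ E] [T2Space M]

/-- A smooth vector field vanishing outside of a compact set is complete. -/
theorem exists_isCompleteFlow {Y : ∀ x : M, TangentSpace 𝓘(ℝ, E) x}
    (hY : ∀ x, SmoothFieldAt Y x) {K : Set M} (hK : IsCompact K) (hYK : ∀ x, x ∉ K → Y x = 0) :
    ∃ Θ : ℝ → M → M, IsCompleteFlow Y Θ := by
  have := isManifold_one (E := E) (M := M)
  classical
  choose γ U hU ε hε hγ _ using fun p => (hY p).exists_local_flow
  obtain ⟨s, -, hs⟩ := hK.elim_nhds_subcover U fun p _ => hU p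
  -- A finite cover of `K` gives a common existence time there. Outside `K` the constant curve is a
  -- solution for all time. A uniform existence time yields global integral curves.
  obtain ⟨ε₀, hε₀, hle⟩ : ∃ ε₀ > 0, ∀ p ∈ s, ε₀ ≤ ε p := by
    clear hs
    induction s using Finset.induction_on with
    | empty => exact ⟨1, one_pos, by simp⟩
    | insert a s _ ih =>
      obtain ⟨e, he, h⟩ := ih
      refine ⟨min e (ε a), lt_min he (hε a), fun p hp => ?_⟩
      rcases Finset.mem_insert.1 hp with rfl | hp
      · exact min_le_right _ _
      · exact (min_le_left _ _).trans (h p hp)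
  have key : ∀ x : M, ∃ γ : ℝ → M, γ 0 = x ∧ IsMIntegralCurve γ Y := by
    refine fun x => exists_isMIntegralCurve_of_isMIntegralCurveOn
      (contMDiff_one_of_smoothFieldAt hY) hε₀ (fun x => ?_) x
    by_cases hx : x ∈ K
    · obtain ⟨p, hp, hxp⟩ := mem_iUnion₂.1 (hs hx)
      obtain ⟨h1, h2, -⟩ := hγ p x hxp
      exact ⟨γ p x, h1, h2.mono (Ioo_subset_Ioo (neg_le_neg (hle p hp)) (hle p hp))⟩
    · exact ⟨fun _ => x, rfl, (isMIntegralCurve_const (hYK x hx)).isMIntegralCurveOn _⟩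
  choose Θ h0 hΘ using key
  exact ⟨fun t x => Θ x t, hY, h0, hΘ⟩

namespace IsCompleteFlow

variable {Y : ∀ x : M, TangentSpace 𝓘(ℝ, E) x} {Θ : ℝ → M → M}

theorem add (hΘ : IsCompleteFlow Y Θ) (s t : ℝ) (x : M) : Θ (s + t) x = Θ s (Θ t x) := by
  have := isManifold_one (E := E) (M := M)
  have h1 : IsMIntegralCurve ((fun s => Θ s x) ∘ (· + t)) Y := (hΘ.integral x).comp_add t
  have h2 := isMIntegralCurve_Ioo_eq_of_contMDiff_boundaryless (t₀ := 0)
    (contMDiff_one_of_smoothFieldAt hΘ.smooth) h1 (hΘ.integral (Θ t x)) (by simp [hΘ.zero])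
  exact congr_fun h2 s

theorem neg_apply (hΘ : IsCompleteFlow Y Θ) (t : ℝ) (x : M) : Θ (-t) (Θ t x) = x := by
  rw [← hΘ.add, neg_add_cancel, hΘ.zero]

theorem continuous_left (hΘ : IsCompleteFlow Y Θ) (x : M) : Continuous fun t => Θ t x :=
  continuous_iff_continuousAt.2 fun t => (hΘ.integral x t).continuousAt

theorem eq_local (hΘ : IsCompleteFlow Y Θ) {γ : ℝ → M} {ε : ℝ} (hε : 0 < ε)
    (hγ : IsMIntegralCurveOn γ Y (Ioo (-ε) ε)) {t : ℝ} (ht : t ∈ Ioo (-ε) ε) : Θ t (γ 0) = γ t :=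
  eq_of_isMIntegralCurveOn hΘ.smooth ((hΘ.integral _).isMIntegralCurveOn (Ioo (-ε) ε)) hγ
    ⟨by linarith, hε⟩ ⟨by linarith, hε⟩ (hΘ.zero _) ht ht

theorem exists_mdifferentiableAt_local (hΘ : IsCompleteFlow Y Θ) (p : M) :
    ∃ U ∈ 𝓝 p, ∃ ε > 0, ∀ x ∈ U, ∀ t ∈ Ioo (-ε) ε, MDifferentiableAt 𝓘(ℝ, E) 𝓘(ℝ, E) (Θ t) x := by
  obtain ⟨γ, U, hU, ε, hε, hγ, -⟩ := (hΘ.smooth p).exists_local_flow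
  refine ⟨interior U, interior_mem_nhds.2 hU, ε, hε, fun x hx t ht => ?_⟩
  refine ((hγ x (interior_subset hx)).2.2 t ht).congr_of_eventuallyEq ?_
  filter_upwards [isOpen_interior.mem_nhds hx] with y hy
  have hy' := hγ y (interior_subset hy)
  have := hΘ.eq_local hε hy'.2.1 ht
  rwa [hy'.1] at this

/-- For small times this is the local flow. By the group law differentiability of `Θ t` at `x` is
then a locally constant property of `t`, true at `t = 0`. -/
theorem mdifferentiableAt (hΘ : IsCompleteFlow Y Θ) (t : ℝ) (x : M) :
    MDifferentiableAt 𝓘(ℝ, E) 𝓘(ℝ, E) (Θ t) x := by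
  have hloc : IsLocallyConstant fun t => MDifferentiableAt 𝓘(ℝ, E) 𝓘(ℝ, E) (Θ t) x := by
    rw [IsLocallyConstant.iff_eventually_eq]
    intro t₀
    obtain ⟨U, hU, ε, hε, h⟩ := hΘ.exists_mdifferentiableAt_local (Θ t₀ x)
    filter_upwards [(hΘ.continuous_left x).continuousAt.eventually hU,
      Ioo_mem_nhds (by linarith : t₀ - ε < t₀) (by linarith : t₀ < t₀ + ε)] with s hs hs'
    refine propext ⟨fun hd => ?_, fun hd => ?_⟩
    · rw [show Θ t₀ = Θ (t₀ - s) ∘ Θ s from funext fun y => by simp [← hΘ.add]]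
      exact (h _ hs _ ⟨by linarith [hs'.2], by linarith [hs'.1]⟩).comp x hd
    · rw [show Θ s = Θ (s - t₀) ∘ Θ t₀ from funext fun y => by simp [← hΘ.add]]
      exact (h _ (mem_of_mem_nhds hU) _ ⟨by linarith [hs'.1], by linarith [hs'.2]⟩).comp x hd
  have h0 : MDifferentiableAt 𝓘(ℝ, E) 𝓘(ℝ, E) (Θ 0) x := by
    rw [show Θ 0 = id from funext hΘ.zero]
    exact mdifferentiableAt_id
  have := hloc.apply_eq_of_isPreconnected isPreconnected_univ (mem_univ t) (mem_univ 0)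
  exact this.symm ▸ h0

/-- Joint continuity is known at time 0 from the local flow. The factorization `Θ s = Θ (s - t) ∘ Θ
t` carries it to time `t`. -/
theorem continuous_uncurry (hΘ : IsCompleteFlow Y Θ) : Continuous fun z : M × ℝ => Θ z.2 z.1 := by
  have h0 : ∀ p : M, ContinuousAt (fun z : M × ℝ => Θ z.2 z.1) (p, 0) := by
    intro p
    obtain ⟨γ, U, hU, ε, hε, hγ, hc, -⟩ := (hΘ.smooth p).exists_local_flow
    refine hc.congr ?_
    filter_upwards [prod_mem_nhds hU (Ioo_mem_nhds (by linarith : -ε < 0) hε)] with z hz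
    have hy' := hγ z.1 hz.1
    have := hΘ.eq_local hε hy'.2.1 hz.2
    rw [hy'.1] at this
    exact this.symm
  rw [continuous_iff_continuousAt]
  rintro ⟨x, t⟩
  have h1 : ContinuousAt (fun z : M × ℝ => (Θ t z.1, z.2 - t)) (x, t) :=
    ContinuousAt.prodMk ((hΘ.mdifferentiableAt t x).continuousAt.comp continuousAt_fst)
      (by fun_prop)
  have h2 : ContinuousAt (fun z : M × ℝ => Θ z.2 z.1) (Θ t x, t - t) := by
    rw [sub_self]; exact h0 _
  have h3 := ContinuousAt.comp (g := fun z : M × ℝ => Θ z.2 z.1)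
    (f := fun z : M × ℝ => (Θ t z.1, z.2 - t)) h2 h1
  refine h3.congr (Eventually.of_forall fun z => ?_)
  simp [← hΘ.add]

theorem mfderiv_zero (hΘ : IsCompleteFlow Y Θ) (x : M) (v : E) :
    (mfderiv 𝓘(ℝ, E) 𝓘(ℝ, E) (Θ 0) x v : E) = v := by
  rw [show Θ 0 = id from funext hΘ.zero, mfderiv_id]
  rfl

theorem mfderiv_add (hΘ : IsCompleteFlow Y Θ) (s t : ℝ) (x : M) (v : E) :
    (mfderiv 𝓘(ℝ, E) 𝓘(ℝ, E) (Θ (s + t)) x v : E) =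
      mfderiv 𝓘(ℝ, E) 𝓘(ℝ, E) (Θ s) (Θ t x) (mfderiv 𝓘(ℝ, E) 𝓘(ℝ, E) (Θ t) x v) := by
  rw [show Θ (s + t) = Θ s ∘ Θ t from funext fun y => hΘ.add s t y,
    mfderiv_comp x (hΘ.mdifferentiableAt s _) (hΘ.mdifferentiableAt t x)]
  rfl

theorem mfderiv_neg_apply (hΘ : IsCompleteFlow Y Θ) (t : ℝ) (x : M) (v : E) :
    (mfderiv 𝓘(ℝ, E) 𝓘(ℝ, E) (Θ (-t)) (Θ t x) (mfderiv 𝓘(ℝ, E) 𝓘(ℝ, E) (Θ t) x v) : E) = v := by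
  rw [← hΘ.mfderiv_add, neg_add_cancel, hΘ.mfderiv_zero]

theorem mfderiv_apply_neg (hΘ : IsCompleteFlow Y Θ) (t : ℝ) (x : M) (v : E) :
    (mfderiv 𝓘(ℝ, E) 𝓘(ℝ, E) (Θ t) x (mfderiv 𝓘(ℝ, E) 𝓘(ℝ, E) (Θ (-t)) (Θ t x) v) : E) = v := by
  have h := hΘ.mfderiv_add t (-t) (Θ t x) v
  rw [add_neg_cancel, hΘ.mfderiv_zero] at h
  have h2 := hΘ.neg_apply t x
  rw [h2] at h
  exact h.symm

/-- The differential of the flow at time `t`, as an isomorphism of the model space. -/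
noncomputable def derivEquiv (hΘ : IsCompleteFlow Y Θ) (t : ℝ) (x : M) : E ≃L[ℝ] E :=
  ContinuousLinearEquiv.equivOfInverse
    (mfderiv 𝓘(ℝ, E) 𝓘(ℝ, E) (Θ t) x : E →L[ℝ] E)
    (mfderiv 𝓘(ℝ, E) 𝓘(ℝ, E) (Θ (-t)) (Θ t x) : E →L[ℝ] E)
    (hΘ.mfderiv_neg_apply t x) (hΘ.mfderiv_apply_neg t x)

theorem derivEquiv_zero (hΘ : IsCompleteFlow Y Θ) (x : M) (v : E) : hΘ.derivEquiv 0 x v = v :=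
  hΘ.mfderiv_zero x v

theorem derivEquiv_add (hΘ : IsCompleteFlow Y Θ) (s t : ℝ) (x : M) (v : E) :
    hΘ.derivEquiv (s + t) x v = hΘ.derivEquiv s (Θ t x) (hΘ.derivEquiv t x v) :=
  hΘ.mfderiv_add s t x v

theorem hasDerivAt_mfderiv_zero (hΘ : IsCompleteFlow Y Θ) (p : M) :
    HasDerivAt (fun t => ((mfderiv 𝓘(ℝ, E) 𝓘(ℝ, E) (extChartAt 𝓘(ℝ, E) p) (Θ t p)).comp
        (mfderiv 𝓘(ℝ, E) 𝓘(ℝ, E) (Θ t) p) : E →L[ℝ] E))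
        (fderiv ℝ (fieldInChart p Y) (extChartAt 𝓘(ℝ, E) p p)) 0 := by
  obtain ⟨γ, U, hU, ε, hε, hγ, -, -, h⟩ := (hΘ.smooth p).exists_local_flow
  refine h.congr_of_eventuallyEq ?_
  filter_upwards [Ioo_mem_nhds (by linarith : -ε < 0) hε] with t ht
  have heq : ∀ y ∈ U, Θ t y = γ y t := fun y hy => by
    have := hΘ.eq_local hε (hγ y hy).2.1 ht
    rwa [(hγ y hy).1] at this
  have h1 : Θ t =ᶠ[𝓝 p] fun y => γ y t := by
    filter_upwards [hU] with y hy using heq y hy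
  have h2 := h1.mfderiv_eq (I := 𝓘(ℝ, E)) (I' := 𝓘(ℝ, E))
  have h3 : ∀ (q : M) (_ : q = γ p t) (A B : E →L[ℝ] E), A = B →
      (mfderiv 𝓘(ℝ, E) 𝓘(ℝ, E) (extChartAt 𝓘(ℝ, E) p) q : E →L[ℝ] E).comp A =
      (mfderiv 𝓘(ℝ, E) 𝓘(ℝ, E) (extChartAt 𝓘(ℝ, E) p) (γ p t) : E →L[ℝ] E).comp B := by
    rintro q rfl A B rfl
    rfl
  exact h3 _ (heq p (mem_of_mem_nhds hU)) _ _ h2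

/-- The flow of a vector field `X` agrees with the flow of a complete vector field `Y` along orbits
on which `X = Y`. -/
theorem flow_eq (hΘ : IsCompleteFlow Y Θ) {X : ∀ x : M, TangentSpace 𝓘(ℝ, E) x}
    (hX : ∀ x, SmoothFieldAt X x) {x : M} {a b t : ℝ} (h0 : (0 : ℝ) ∈ Ioo a b) (ht : t ∈ Ioo a b)
    (hXY : ∀ s ∈ Ioo a b, X (Θ s x) = Y (Θ s x)) : flow X t x = Θ t x := by
  have h1 : IsMIntegralCurveOn (fun s => Θ s x) X (Ioo a b) := by
    intro s hs
    change HasMFDerivWithinAt 𝓘(ℝ, ℝ) 𝓘(ℝ, E) (fun s => Θ s x) (Ioo a b) s ((1 : ℝ →L[ℝ] ℝ).smulRight (X (Θ s x)))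
    rw [hXY s hs]
    exact (hΘ.integral x).isMIntegralCurveOn _ s hs
  have h : ∃ γ : ℝ → M, γ 0 = x ∧ ∃ a b : ℝ, 0 ∈ Ioo a b ∧ t ∈ Ioo a b ∧
      IsMIntegralCurveOn γ X (Ioo a b) := ⟨_, hΘ.zero x, a, b, h0, ht, h1⟩
  -- The value of `flow` uses some chosen integral curve. Uniqueness on the common interval
  -- identifies it with `Θ`.
  rw [flow, dif_pos h]
  obtain ⟨h2, c, d, h0', ht', h3⟩ := h.choose_spec
  exact eq_of_isMIntegralCurveOn hX h3 h1 h0' h0 (h2.trans (hΘ.zero x).symm) ht' ht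

end IsCompleteFlow

end CompleteFlow

/-! ### Smooth fields, directional derivatives and brackets -/

section SmoothFields

variable {E : Type*} [NormedAddCommGroup E] [NormedSpace ℝ E]
  {M : Type*} [TopologicalSpace M] [ChartedSpace E M] [IsManifold 𝓘(ℝ, E) ∞ M]
  {V W : ∀ x : M, TangentSpace 𝓘(ℝ, E) x} {p : M}

theorem SmoothFieldAt.congr (hV : SmoothFieldAt V p) (h : ∀ᶠ y in 𝓝 p, W y = V y) :
    SmoothFieldAt W p :=
  ContMDiffAt.congr_of_eventuallyEq hV (h.mono fun y hy => by simp only [hy])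

theorem SmoothFieldAt.add (hV : SmoothFieldAt V p) (hW : SmoothFieldAt W p) :
    SmoothFieldAt (fun y => V y + W y) p := by
  have := isManifold_one (E := E) (M := M)
  exact ContMDiffAt.add_section hV hW

theorem SmoothFieldAt.smul {g : M → ℝ} (hg : ContMDiffAt 𝓘(ℝ, E) 𝓘(ℝ, ℝ) ∞ g p)
    (hV : SmoothFieldAt V p) : SmoothFieldAt (fun y => g y • V y) p := by
  have := isManifold_one (E := E) (M := M)
  exact ContMDiffAt.smul_section hg hV

theorem SmoothFieldAt.sum {ι : Type*} {s : Finset ι} {V : ι → ∀ x : M, TangentSpace 𝓘(ℝ, E) x}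
    (hV : ∀ i ∈ s, SmoothFieldAt (V i) p) : SmoothFieldAt (fun y => ∑ i ∈ s, V i y) p := by
  have := isManifold_one (E := E) (M := M)
  exact ContMDiffAt.sum_section hV

theorem SmoothFieldAt.mlieBracket [CompleteSpace E] (hV : SmoothFieldAt V p)
    (hW : SmoothFieldAt W p) : SmoothFieldAt (VectorField.mlieBracket 𝓘(ℝ, E) V W) p := by
  have h : IsManifold 𝓘(ℝ, E) (((⊤ : ℕ∞) : WithTop ℕ∞) + 1) M :=
    IsManifold.of_le (n := ∞) (by simp)
  have h2 : IsManifold 𝓘(ℝ, E) (minSmoothness ℝ 2) M :=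
    IsManifold.of_le (n := ∞) (by simp only [minSmoothness_of_isRCLikeNormedField]; exact WithTop.coe_le_coe.2 le_top)
  have h3 : IsManifold 𝓘(ℝ, E) (minSmoothness ℝ 3) M :=
    IsManifold.of_le (n := ∞) (by simp only [minSmoothness_of_isRCLikeNormedField]; exact WithTop.coe_le_coe.2 le_top)
  exact ContMDiffAt.mlieBracket_vectorField (n := (⊤ : ℕ∞)) (m := (⊤ : ℕ∞)) hV hW (by simp)

/-- The vector field which is constant, equal to `v`, in the preferred chart at `p`. -/
noncomputable def constField (p : M) (v : E) : ∀ x : M, TangentSpace 𝓘(ℝ, E) x :=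
  VectorField.mpullback 𝓘(ℝ, E) 𝓘(ℝ, E) (extChartAt 𝓘(ℝ, E) p) (fun _ => v)

theorem smoothFieldAt_constField [CompleteSpace E] (v : E) {x : M}
    (hx : x ∈ (extChartAt 𝓘(ℝ, E) p).source) : SmoothFieldAt (constField p v) x := by
  have := isManifold_one (E := E) (M := M)
  refine ContMDiffAt.mpullback_vectorField_preimage (n := ∞) (m := ∞) ?_ ?_
    (isInvertible_mfderiv_extChartAt (I := 𝓘(ℝ, E)) hx) (by simp)
  · exact contMDiffAt_vectorSpace_iff_contDiffAt.2 contDiffAt_const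
  · exact contMDiffAt_extChartAt' (by simpa using hx)

theorem mfderiv_constField (v : E) {x : M} (hx : x ∈ (extChartAt 𝓘(ℝ, E) p).source) :
    (mfderiv 𝓘(ℝ, E) 𝓘(ℝ, E) (extChartAt 𝓘(ℝ, E) p) x (constField p v x) : E) = v := by
  have := isManifold_one (E := E) (M := M)
  obtain ⟨e, he⟩ := isInvertible_mfderiv_extChartAt (I := 𝓘(ℝ, E)) hx
  change (mfderiv 𝓘(ℝ, E) 𝓘(ℝ, E) (extChartAt 𝓘(ℝ, E) p) x
    ((mfderiv 𝓘(ℝ, E) 𝓘(ℝ, E) (extChartAt 𝓘(ℝ, E) p) x).inverse v) : E) = v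
  rw [← he, ContinuousLinearMap.inverse_equiv]
  exact e.apply_symm_apply _

theorem fieldInChart_constField (v : E) {z : E} (hz : z ∈ (extChartAt 𝓘(ℝ, E) p).target) :
    fieldInChart p (constField p v) z = v := by
  have h := fieldInChart_apply p (constField p v) ((extChartAt 𝓘(ℝ, E) p).map_target hz)
  rw [(extChartAt 𝓘(ℝ, E) p).right_inv hz] at h
  exact h.trans (mfderiv_constField v ((extChartAt 𝓘(ℝ, E) p).map_target hz))

theorem constField_self (v : E) : constField p v p = v := by
  rw [← fieldInChart_self p (constField p v)]
  exact fieldInChart_constField v (mem_extChartAt_target p)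

theorem eq_constField (v : E) {x : M} (hx : x ∈ (extChartAt 𝓘(ℝ, E) p).source)
    (w : TangentSpace 𝓘(ℝ, E) x)
    (h : (mfderiv 𝓘(ℝ, E) 𝓘(ℝ, E) (extChartAt 𝓘(ℝ, E) p) x w : E) = v) :
    w = constField p v x := by
  have := isManifold_one (E := E) (M := M)
  obtain ⟨e, he⟩ := isInvertible_mfderiv_extChartAt (I := 𝓘(ℝ, E)) hx
  have h2 := h.trans (mfderiv_constField v hx).symm
  rw [← he] at h2
  exact e.injective h2

theorem dirDeriv_eq_fderiv {g : M → ℝ} {x : M} (hx : x ∈ (extChartAt 𝓘(ℝ, E) p).source)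
    (hg : MDifferentiableAt 𝓘(ℝ, E) 𝓘(ℝ, ℝ) g x) (v : TangentSpace 𝓘(ℝ, E) x) :
    dirDeriv g x v = fderiv ℝ (g ∘ (extChartAt 𝓘(ℝ, E) p).symm) (extChartAt 𝓘(ℝ, E) p x)
      (mfderiv 𝓘(ℝ, E) 𝓘(ℝ, E) (extChartAt 𝓘(ℝ, E) p) x v : E) := by
  have := isManifold_one (E := E) (M := M)
  set φ := extChartAt 𝓘(ℝ, E) p with hφ
  have hd : MDifferentiableAt 𝓘(ℝ, E) 𝓘(ℝ, E) φ x :=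
    mdifferentiableAt_extChartAt (I := 𝓘(ℝ, E)) (by simpa [φ] using hx)
  have hs : MDifferentiableAt 𝓘(ℝ, E) 𝓘(ℝ, E) φ.symm (φ x) := by
    have := mdifferentiableWithinAt_extChartAt_symm (I := 𝓘(ℝ, E)) (φ.map_source hx)
    exact this.mdifferentiableAt (by simp)
  have hgs : MDifferentiableAt 𝓘(ℝ, E) 𝓘(ℝ, ℝ) (g ∘ φ.symm) (φ x) := by
    refine MDifferentiableAt.comp (φ x) (g := g) ?_ hs
    rwa [φ.left_inv hx]
  have h1 : g =ᶠ[𝓝 x] (g ∘ φ.symm) ∘ φ := by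
    filter_upwards [(isOpen_extChartAt_source p).mem_nhds hx] with y hy
    exact congr_arg g (φ.left_inv hy).symm
  have h2 := mfderiv_comp x hgs hd
  rw [← mfderiv_eq_fderiv]
  have h3 := (h1.mfderiv_eq (I := 𝓘(ℝ, E)) (I' := 𝓘(ℝ, ℝ))).trans h2
  exact DFunLike.congr_fun h3 v

theorem dirDeriv_self_eq_fderiv {g : M → ℝ}
    (hg : MDifferentiableAt 𝓘(ℝ, E) 𝓘(ℝ, ℝ) g p) (v : E) :
    dirDeriv (E := E) g p v =
      fderiv ℝ (g ∘ (extChartAt 𝓘(ℝ, E) p).symm) (extChartAt 𝓘(ℝ, E) p p) v := by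
  have := isManifold_one (E := E) (M := M)
  have h : (mfderiv 𝓘(ℝ, E) 𝓘(ℝ, E) (extChartAt 𝓘(ℝ, E) p) p : E →L[ℝ] E) =
    ContinuousLinearMap.id ℝ E := mfderiv_extChartAt_self
  exact (dirDeriv_eq_fderiv (p := p) (mem_extChartAt_source p) hg v).trans
    (congr_arg _ (DFunLike.congr_fun h v))

theorem contMDiffAt_comp_extChartAt {F : Type*} [NormedAddCommGroup F] [NormedSpace ℝ F]
    {f : E → F} (hf : ContDiffAt ℝ ∞ f (extChartAt 𝓘(ℝ, E) p p)) :
    ContMDiffAt 𝓘(ℝ, E) 𝓘(ℝ, F) ∞ (fun y => f (extChartAt 𝓘(ℝ, E) p y)) p :=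
  ContMDiffAt.comp (g := f) p hf.contMDiffAt (contMDiffAt_extChartAt (I := 𝓘(ℝ, E)))

theorem ContMDiffAt.contDiffAt_comp_symm {F : Type*} [NormedAddCommGroup F] [NormedSpace ℝ F]
    {g : M → F} (hg : ContMDiffAt 𝓘(ℝ, E) 𝓘(ℝ, F) ∞ g p) :
    ContDiffAt ℝ ∞ (g ∘ (extChartAt 𝓘(ℝ, E) p).symm) (extChartAt 𝓘(ℝ, E) p p) := by
  have h := (contMDiffAt_iff.1 hg).2
  rw [extChartAt_model_space_eq_id] at h
  simpa using! h

theorem eventually_dirDeriv_eq [CompleteSpace E] {g : M → ℝ}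
    (hg : ContMDiffAt 𝓘(ℝ, E) 𝓘(ℝ, ℝ) ∞ g p) :
    ∀ᶠ y in 𝓝 p, ∀ V : ∀ x : M, TangentSpace 𝓘(ℝ, E) x, dirDeriv g y (V y) =
      fderiv ℝ (g ∘ (extChartAt 𝓘(ℝ, E) p).symm) (extChartAt 𝓘(ℝ, E) p y)
        (fieldInChart p V (extChartAt 𝓘(ℝ, E) p y)) := by
  have := isManifold_one (E := E) (M := M)
  have h1 : ∀ᶠ y in 𝓝 p, ContMDiffAt 𝓘(ℝ, E) 𝓘(ℝ, ℝ) 1 g y :=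
    (contMDiffAt_iff_contMDiffAt_nhds (by simp)).1 (hg.of_le (by simp))
  filter_upwards [h1, extChartAt_source_mem_nhds (I := 𝓘(ℝ, E)) p] with y hy hys V
  rw [dirDeriv_eq_fderiv hys (hy.mdifferentiableAt one_ne_zero), fieldInChart_apply p V hys]

theorem contMDiffAt_dirDeriv [CompleteSpace E] {g : M → ℝ}
    (hg : ContMDiffAt 𝓘(ℝ, E) 𝓘(ℝ, ℝ) ∞ g p) (hV : SmoothFieldAt V p) :
    ContMDiffAt 𝓘(ℝ, E) 𝓘(ℝ, ℝ) ∞ (fun y => dirDeriv g y (V y)) p := by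
  have h1 : ContDiffAt ℝ ∞ (fun z => fderiv ℝ (g ∘ (extChartAt 𝓘(ℝ, E) p).symm) z
      (fieldInChart p V z)) (extChartAt 𝓘(ℝ, E) p p) :=
    (hg.contDiffAt_comp_symm.fderiv_right (by simp)).clm_apply hV.contDiffAt_fieldInChart
  exact (contMDiffAt_comp_extChartAt h1).congr_of_eventuallyEq
    ((eventually_dirDeriv_eq hg).mono fun y hy => hy V)

/-- The Lie bracket acts on functions as the commutator of derivations. -/
theorem dirDeriv_mlieBracket [CompleteSpace E] {g : M → ℝ}
    (hg : ContMDiffAt 𝓘(ℝ, E) 𝓘(ℝ, ℝ) ∞ g p) (hV : SmoothFieldAt V p) (hW : SmoothFieldAt W p) :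
    dirDeriv g p (VectorField.mlieBracket 𝓘(ℝ, E) V W p) =
      dirDeriv (fun y => dirDeriv g y (W y)) p (V p) -
        dirDeriv (fun y => dirDeriv g y (V y)) p (W p) := by
  have := isManifold_one (E := E) (M := M)
  set φ := extChartAt 𝓘(ℝ, E) p with hφ
  have hgs := hg.contDiffAt_comp_symm
  have hg1 : ∀ U : ∀ x : M, TangentSpace 𝓘(ℝ, E) x, SmoothFieldAt U p → ∀ v : TangentSpace 𝓘(ℝ, E) p,
      dirDeriv (fun y => dirDeriv g y (U y)) p v =
      fderiv ℝ (fderiv ℝ (g ∘ φ.symm)) (φ p) (v : E) (U p : E) +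
        fderiv ℝ (g ∘ φ.symm) (φ p) (fderiv ℝ (fieldInChart p U) (φ p) (v : E)) := by
    intro U hU v
    refine (dirDeriv_self_eq_fderiv
      ((contMDiffAt_dirDeriv hg hU).mdifferentiableAt (by simp)) v).trans ?_
    have h1 : (fun y => dirDeriv g y (U y)) ∘ φ.symm =ᶠ[𝓝 (φ p)]
        fun z => fderiv ℝ (g ∘ φ.symm) z (fieldInChart p U z) := by
      have h2 : Tendsto φ.symm (𝓝 (φ p)) (𝓝 p) := by
        have := continuousAt_extChartAt_symm (I := 𝓘(ℝ, E)) p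
        rwa [ContinuousAt, extChartAt_to_inv] at this
      filter_upwards [h2.eventually (eventually_dirDeriv_eq hg),
        extChartAt_target_mem_nhds (I := 𝓘(ℝ, E)) p] with z hz hzt
      have := hz U
      rwa [φ.right_inv hzt] at this
    have h3 : HasFDerivAt (fun z => fderiv ℝ (g ∘ φ.symm) z (fieldInChart p U z)) _ (φ p) :=
      HasFDerivAt.clm_apply
        (((hgs.fderiv_right (m := 1) (by rw [one_add_one_eq_two]; exact WithTop.coe_le_coe.2 le_top)
          ).differentiableAt one_ne_zero).hasFDerivAt)
        ((hU.contDiffAt_fieldInChart.differentiableAt (by simp)).hasFDerivAt)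
    rw [h1.fderiv_eq, h3.fderiv]
    change fderiv ℝ (g ∘ φ.symm) (φ p) (fderiv ℝ (fieldInChart p U) (φ p) (v : E)) +
      fderiv ℝ (fderiv ℝ (g ∘ φ.symm)) (φ p) (v : E) (fieldInChart p U (φ p)) = _
    rw [fieldInChart_self, add_comm]
  -- In the commutator the second derivatives of `g` cancel by symmetry, leaving the first
  -- derivative of `g` on the bracket.
  have hsymm : IsSymmSndFDerivAt ℝ (g ∘ φ.symm) (φ p) := hgs.isSymmSndFDerivAt
    (by simp only [minSmoothness_of_isRCLikeNormedField]; exact WithTop.coe_le_coe.2 le_top)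
  rw [hg1 V hV (W p), hg1 W hW (V p), hsymm (V p : E) (W p : E)]
  refine (dirDeriv_self_eq_fderiv (hg.mdifferentiableAt (by simp)) _).trans ?_
  rw [mlieBracket_eq_fieldInChart, map_sub]
  ring

end SmoothFields

/-! ### The Hamiltonian field: smoothness and invariance of the form -/

section HamiltonianField

variable {E : Type*} [NormedAddCommGroup E] [NormedSpace ℝ E]
  {M : Type*} [TopologicalSpace M] [ChartedSpace E M] [IsManifold 𝓘(ℝ, E) ∞ M]

theorem constField_sum_smul {ι : Type*} [Fintype ι] {p : M} (a : ι → ℝ) (b : ι → E) (y : M) :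
    constField p (∑ i, a i • b i) y = ∑ i, a i • constField p (b i) y := by
  let L : E →L[ℝ] TangentSpace 𝓘(ℝ, E) y :=
    (mfderiv 𝓘(ℝ, E) 𝓘(ℝ, E) (extChartAt 𝓘(ℝ, E) p) y).inverse
  change L (∑ i, a i • b i) = ∑ i, a i • L (b i)
  rw [map_sum]
  exact Finset.sum_congr rfl fun i _ => map_smul L _ _

namespace SymplecticForm

variable (σ : SymplecticForm E M) {V W : ∀ x : M, TangentSpace 𝓘(ℝ, E) x} {p : M}

theorem swap (x : M) (v w : TangentSpace 𝓘(ℝ, E) x) : σ.toFun x v w = -σ.toFun x w v := by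
  have h := LinearMap.IsAlt.neg (σ.form_isAlt x) w v
  exact h.symm

theorem contMDiffAt_apply (hV : SmoothFieldAt V p) (hW : SmoothFieldAt W p) :
    ContMDiffAt 𝓘(ℝ, E) 𝓘(ℝ, ℝ) ∞ (fun y => σ.toFun y (V y) (W y)) p := by
  have := isManifold_one (E := E) (M := M)
  have h := ContMDiffAt.clm_bundle_apply₂ (F₁ := E) (F₂ := E) (F₃ := ℝ)
    (E₁ := fun x : M => TangentSpace 𝓘(ℝ, E) x) (E₂ := fun x : M => TangentSpace 𝓘(ℝ, E) x)
    (E₃ := Bundle.Trivial M ℝ) (b := fun y : M => y) (ψ := σ.toFun) (v := V) (w := W)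
    (IB := 𝓘(ℝ, E)) (IM := 𝓘(ℝ, E)) (n := ∞) (x := p) (σ.smooth p) hV hW
  simp only [contMDiffAt_totalSpace] at h
  exact h.2

variable [FiniteDimensional ℝ E] {H : M → ℝ}

theorem hamiltonianField_apply (x : M) (v : TangentSpace 𝓘(ℝ, E) x) :
    σ.toFun x (σ.hamiltonianField H x) v = -dirDeriv H x v :=
  σ.hamiltonianField_spec H x v

theorem eq_hamiltonianField {x : M} {X : TangentSpace 𝓘(ℝ, E) x}
    (hX : ∀ v, σ.toFun x X v = -dirDeriv H x v) : σ.hamiltonianField H x = X := by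
  rw [← sub_eq_zero]
  refine σ.nondegenerate x _ fun w => ?_
  rw [map_sub, sub_apply, hX, hamiltonianField_apply, sub_self]

/-- The Hamiltonian field is chosen pointwise. In a local frame `A` its coefficients are obtained
from the values of `dH` by the inverse of the Gram matrix of `σ`, so they are smooth, and
nondegeneracy makes the solution unique. -/
theorem smoothFieldAt_hamiltonianField (hH : ContMDiff 𝓘(ℝ, E) 𝓘(ℝ, ℝ) ∞ H) (p : M) :
    SmoothFieldAt (σ.hamiltonianField H) p := by
  have := isManifold_one (E := E) (M := M)
  let b := Module.finBasis ℝ E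
  let A := fun i => constField p (b i)
  let S : M → Matrix _ _ ℝ := fun y => Matrix.of fun i j => σ.toFun y (A i y) (A j y)
  have hA : ∀ i, SmoothFieldAt (A i) p := fun i =>
    smoothFieldAt_constField (b i) (mem_extChartAt_source p)
  have hS : ∀ i j, ContMDiffAt 𝓘(ℝ, E) 𝓘(ℝ, ℝ) ∞ (fun y => S y i j) p := fun i j =>
    σ.contMDiffAt_apply (hA i) (hA j)
  have hspan : ∀ y ∈ (extChartAt 𝓘(ℝ, E) p).source, ∀ v : TangentSpace 𝓘(ℝ, E) y,
      ∃ a : Fin (Module.finrank ℝ E) → ℝ, v = ∑ i, a i • A i y := by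
    intro y hy v
    refine ⟨fun i => b.repr (mfderiv 𝓘(ℝ, E) 𝓘(ℝ, E) (extChartAt 𝓘(ℝ, E) p) y v : E) i, ?_⟩
    refine (eq_constField _ hy v rfl).trans ?_
    refine (congr_arg (fun u => constField p u y)
      (b.sum_repr (mfderiv 𝓘(ℝ, E) 𝓘(ℝ, E) (extChartAt 𝓘(ℝ, E) p) y v : E)).symm).trans ?_
    exact constField_sum_smul _ _ y
  have hdet : ∀ y ∈ (extChartAt 𝓘(ℝ, E) p).source, (S y).det ≠ 0 := by
    intro y hy h0
    obtain ⟨a, ha, haS⟩ := Matrix.exists_vecMul_eq_zero_iff.2 h0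
    have h1 : ∑ i, a i • A i y = 0 := by
      refine σ.nondegenerate y _ fun w => ?_
      obtain ⟨c, rfl⟩ := hspan y hy w
      rw [map_sum]
      refine Finset.sum_eq_zero fun j _ => ?_
      rw [map_smul, map_sum, sum_apply]
      have := congr_fun haS j
      simp only [Matrix.vecMul, dotProduct, Pi.zero_apply, S, Matrix.of_apply] at this
      simp only [map_smul, smul_apply, smul_eq_mul, this, mul_zero]
    have h2 : (0 : E) = ∑ i, a i • b i := by
      have h3 := mfderiv_constField (∑ i, a i • b i) hy
      rw [constField_sum_smul, h1] at h3
      exact (map_zero (mfderiv 𝓘(ℝ, E) 𝓘(ℝ, E) (extChartAt 𝓘(ℝ, E) p) y)).symm.trans h3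
    exact ha (funext (Fintype.linearIndependent_iff.1 b.linearIndependent a h2.symm))
  let g : Fin (Module.finrank ℝ E) → M → ℝ := fun i y =>
    ∑ j, -dirDeriv H y (A j y) * (S y)⁻¹ j i
  have hg : ∀ i, ContMDiffAt 𝓘(ℝ, E) 𝓘(ℝ, ℝ) ∞ (g i) p := by
    intro i
    refine ContMDiffAt.sum fun j _ => ?_
    exact (contMDiffAt_dirDeriv (hH p) (hA j)).neg.mul
      (ContMDiffAt.matrix_inv hS (hdet p (mem_extChartAt_source p)) j i)
  refine (SmoothFieldAt.sum (s := Finset.univ) fun i _ => (hA i).smul (hg i)).congr ?_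
  filter_upwards [extChartAt_source_mem_nhds (I := 𝓘(ℝ, E)) p] with y hy
  refine σ.eq_hamiltonianField fun v => ?_
  obtain ⟨c, rfl⟩ := hspan y hy v
  have hj : ∀ j, σ.toFun y (∑ i, g i y • A i y) (A j y) = -dirDeriv H y (A j y) := by
    intro j
    have h1 : (Matrix.vecMul (Matrix.vecMul (fun j => -dirDeriv H y (A j y)) (S y)⁻¹) (S y)) j =
        -dirDeriv H y (A j y) := by
      rw [Matrix.vecMul_vecMul, Matrix.nonsing_inv_mul _ (isUnit_iff_ne_zero.2 (hdet y hy)),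
        Matrix.vecMul_one]
    rw [← h1, map_sum, sum_apply]
    simp only [map_smul, smul_apply, smul_eq_mul]
    rfl
  have hd : dirDeriv H y (∑ i, c i • A i y) = ∑ i, c i * dirDeriv H y (A i y) := by
    let L : TangentSpace 𝓘(ℝ, E) y →L[ℝ] ℝ := mfderiv 𝓘(ℝ, E) 𝓘(ℝ, ℝ) H y
    change L (∑ i, c i • A i y) = ∑ i, c i * L (A i y)
    rw [map_sum]
    exact Finset.sum_congr rfl fun i _ => map_smul L _ _
  rw [hd, ← Finset.sum_neg_distrib]
  generalize (∑ i, g i y • A i y) = u at hj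
  rw [map_sum]
  exact Finset.sum_congr rfl fun j _ => by rw [map_smul, hj, smul_eq_mul, mul_neg]

/-- The Hamiltonian field preserves the symplectic form. -/
theorem dirDeriv_hamiltonianField (hH : ContMDiff 𝓘(ℝ, E) 𝓘(ℝ, ℝ) ∞ H)
    (hV : SmoothFieldAt V p) (hW : SmoothFieldAt W p) :
    dirDeriv (fun y => σ.toFun y (V y) (W y)) p (σ.hamiltonianField H p) =
      σ.toFun p (VectorField.mlieBracket 𝓘(ℝ, E) (σ.hamiltonianField H) V p) (W p) +
        σ.toFun p (V p) (VectorField.mlieBracket 𝓘(ℝ, E) (σ.hamiltonianField H) W p) := by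
  have hX := σ.smoothFieldAt_hamiltonianField hH p
  have h := σ.closed (σ.hamiltonianField H) V W p hX hV hW
  have hneg : ∀ g : M → ℝ, ∀ v : TangentSpace 𝓘(ℝ, E) p,
      dirDeriv (fun y => -g y) p v = -dirDeriv g p v := by
    intro g v
    have : (fun y => -g y) = -g := rfl
    rw [dirDeriv, this, mfderiv_neg]
    rfl
  have h1 : (fun y => σ.toFun y (W y) (σ.hamiltonianField H y)) = fun y => dirDeriv H y (W y) := by
    funext y
    rw [σ.swap, hamiltonianField_apply, neg_neg]
  have h2 : (fun y => σ.toFun y (σ.hamiltonianField H y) (V y)) = fun y => -dirDeriv H y (V y) := by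
    funext y
    rw [hamiltonianField_apply]
  -- In the closedness identity the three terms which contain `H` add up to `V(W H) - W(V H) - [V,
  -- W] H = 0`. The remaining ones are the Lie derivative of `σ`.
  rw [h1, h2, hneg, σ.swap p (VectorField.mlieBracket 𝓘(ℝ, E) V W p), hamiltonianField_apply,
    dirDeriv_mlieBracket (hH p) hV hW, VectorField.mlieBracket_swap_apply (V := W),
    map_neg, neg_apply] at h
  rw [σ.swap p (V p)]
  linarith

theorem dirDeriv_self (x : M) : dirDeriv H x (σ.hamiltonianField H x) = 0 := by
  have := σ.hamiltonianField_apply (H := H) x (σ.hamiltonianField H x)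
  rw [σ.alternating] at this
  linarith

end SymplecticForm

end HamiltonianField

/-! ### Pulling back fields and the symplectic form by the flow -/

section Transport

variable {E : Type*} [NormedAddCommGroup E] [NormedSpace ℝ E] [FiniteDimensional ℝ E]
  {M : Type*} [TopologicalSpace M] [ChartedSpace E M] [IsManifold 𝓘(ℝ, E) ∞ M]

theorem bilinForm_eq_sum {F ι : Type*} [AddCommGroup F] [Module ℝ F] [Fintype ι]
    (b : Module.Basis ι ℝ F) (B : LinearMap.BilinForm ℝ F) (u v : F) :
    B u v = ∑ i, ∑ j, b.repr u i * b.repr v j * B (b i) (b j) := by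
  conv_lhs => rw [← b.sum_repr u, ← b.sum_repr v]
  simp only [map_sum, LinearMap.sum_apply, map_smul, LinearMap.smul_apply, smul_eq_mul,
    Finset.mul_sum, mul_assoc]
  rw [Finset.sum_comm]
  exact Finset.sum_congr rfl fun i _ => Finset.sum_congr rfl fun j _ => by ring

set_option synthInstance.maxHeartbeats 200000 in
theorem HasDerivAt.ringInverse_of_eq_one {R : Type*} [NormedRing R] [NormedAlgebra ℝ R]
    [HasSummableGeomSeries R] {T : ℝ → R} {A : R} {t : ℝ} (hT : HasDerivAt T A t) (h : T t = 1) :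
    HasDerivAt (fun t => Ring.inverse (T t)) (-A) t := by
  have h1 := hasFDerivAt_ringInverse (𝕜 := ℝ) (1 : Rˣ)
  rw [Units.val_one, ← h] at h1
  refine (h1.comp_hasDerivAt t hT).congr_deriv ?_
  simp

variable [T2Space M]

namespace IsCompleteFlow

variable {Y : ∀ x : M, TangentSpace 𝓘(ℝ, E) x} {Θ : ℝ → M → M}

/-- The pullback of the vector field `V` by the flow at time `t`, evaluated at `x`. -/
noncomputable def pullField (hΘ : IsCompleteFlow Y Θ) (V : ∀ x : M, TangentSpace 𝓘(ℝ, E) x) (x : M)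
    (t : ℝ) : E :=
  (hΘ.derivEquiv t x).symm (V (Θ t x) : E)

variable {V W : ∀ x : M, TangentSpace 𝓘(ℝ, E) x}

theorem hasDerivAt_comp (hΘ : IsCompleteFlow Y Θ) {g : M → ℝ} {x : M} {t : ℝ}
    (hg : MDifferentiableAt 𝓘(ℝ, E) 𝓘(ℝ, ℝ) g (Θ t x)) :
    HasDerivAt (fun t => g (Θ t x)) (dirDeriv g (Θ t x) (Y (Θ t x))) t := by
  have h := hg.hasMFDerivAt.comp t (hΘ.integral x t)
  obtain ⟨D, hD, hD1⟩ : ∃ D : ℝ →L[ℝ] ℝ, HasFDerivAt (fun t => g (Θ t x)) D t ∧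
      D 1 = dirDeriv g (Θ t x) (Y (Θ t x)) := by
    refine ⟨_, hasMFDerivAt_iff_hasFDerivAt.1 h, ?_⟩
    change (mfderiv 𝓘(ℝ, E) 𝓘(ℝ, ℝ) g (Θ t x)) ((1 : ℝ) • Y (Θ t x)) = _
    rw [one_smul]
    rfl
  rw [← hD1]
  exact hD.hasDerivAt

theorem hasDerivAt_extChartAt (hΘ : IsCompleteFlow Y Θ) (p : M) :
    HasDerivAt (fun t => extChartAt 𝓘(ℝ, E) p (Θ t p)) (Y p : E) 0 := by
  have := isManifold_one (E := E) (M := M)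
  have h1 : MDifferentiableAt 𝓘(ℝ, E) 𝓘(ℝ, E) (extChartAt 𝓘(ℝ, E) p) (Θ 0 p) := by
    rw [hΘ.zero]
    exact mdifferentiableAt_extChartAt (I := 𝓘(ℝ, E)) (by simp)
  have h := h1.hasMFDerivAt.comp 0 (hΘ.integral p 0)
  have h3 : ∀ q : M, q = p → (mfderiv 𝓘(ℝ, E) 𝓘(ℝ, E) (extChartAt 𝓘(ℝ, E) p) q
      ((1 : ℝ) • Y q) : E) = (Y p : E) := by
    rintro q rfl
    have hid : (mfderiv 𝓘(ℝ, E) 𝓘(ℝ, E) (extChartAt 𝓘(ℝ, E) q) q : E →L[ℝ] E) =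
      ContinuousLinearMap.id ℝ E := mfderiv_extChartAt_self
    refine (DFunLike.congr_fun hid ((1 : ℝ) • (Y q : E))).trans ?_
    exact one_smul ℝ (Y q : E)
  obtain ⟨D, hD, hD1⟩ : ∃ D : ℝ →L[ℝ] E, HasFDerivAt
      (fun t => extChartAt 𝓘(ℝ, E) p (Θ t p)) D 0 ∧ D 1 = (Y p : E) :=
    ⟨_, hasMFDerivAt_iff_hasFDerivAt.1 h, h3 _ (hΘ.zero p)⟩
  rw [← hD1]
  exact hD.hasDerivAt

theorem eventually_mem_source (hΘ : IsCompleteFlow Y Θ) (p : M) :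
    ∀ᶠ t in 𝓝 (0 : ℝ), Θ t p ∈ (extChartAt 𝓘(ℝ, E) p).source := by
  have h := (hΘ.continuous_left p).continuousAt (x := 0)
  rw [ContinuousAt, hΘ.zero] at h
  exact h.eventually (extChartAt_source_mem_nhds (I := 𝓘(ℝ, E)) p)

theorem pullField_zero (hΘ : IsCompleteFlow Y Θ) (x : M) : hΘ.pullField V x 0 = V x := by
  have h : ∀ q : M, q = x → (V q : E) = V x := by rintro q rfl; rfl
  exact ((hΘ.derivEquiv 0 x).symm_apply_eq).2 ((h _ (hΘ.zero x)).trans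
    (hΘ.derivEquiv_zero x (V x)).symm)

theorem pullField_add (hΘ : IsCompleteFlow Y Θ) (x : M) (s t : ℝ) :
    hΘ.pullField V x (s + t) = (hΘ.derivEquiv t x).symm (hΘ.pullField V (Θ t x) s) := by
  have h : ∀ q r : M, q = r → (V q : E) = V r := by rintro q _ rfl; rfl
  refine ((hΘ.derivEquiv (s + t) x).symm_apply_eq).2 ((h _ _ (hΘ.add s t x)).trans ?_)
  refine Eq.trans ?_ (hΘ.derivEquiv_add s t x _).symm
  refine Eq.trans ?_ (congr_arg (hΘ.derivEquiv s (Θ t x))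
    ((hΘ.derivEquiv t x).apply_symm_apply _).symm)
  exact ((hΘ.derivEquiv s (Θ t x)).apply_symm_apply _).symm

theorem pullField_congr (hΘ : IsCompleteFlow Y Θ) {x : M} {t : ℝ} (h : V (Θ t x) = W (Θ t x)) :
    hΘ.pullField V x t = hΘ.pullField W x t := by
  rw [pullField, pullField, h]

/-- In the chart the pullback is `T(t)⁻¹` applied to the field along the orbit, where `T` is the
linearized flow with `T(0) = 1` and `T'(0) = DY`. The product rule gives `DV·Y - DY·V`. -/
theorem hasDerivAt_pullField_zero (hΘ : IsCompleteFlow Y Θ) {p : M} (hV : SmoothFieldAt V p) :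
    HasDerivAt (hΘ.pullField V p) (VectorField.mlieBracket 𝓘(ℝ, E) Y V p : E) 0 := by
  have := isManifold_one (E := E) (M := M)
  set A : E →L[ℝ] E := fderiv ℝ (fieldInChart p Y) (extChartAt 𝓘(ℝ, E) p p) with hA
  let T : ℝ → E →L[ℝ] E := fun t =>
    ((mfderiv 𝓘(ℝ, E) 𝓘(ℝ, E) (extChartAt 𝓘(ℝ, E) p) (Θ t p)).comp
        (mfderiv 𝓘(ℝ, E) 𝓘(ℝ, E) (Θ t) p) : E →L[ℝ] E)
  have hT : HasDerivAt T A 0 := hΘ.hasDerivAt_mfderiv_zero p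
  have hT0 : T 0 = 1 := by
    ext v
    have h3 : ∀ q : M, q = p → ∀ v : E, (mfderiv 𝓘(ℝ, E) 𝓘(ℝ, E) (extChartAt 𝓘(ℝ, E) p) q :
        E →L[ℝ] E) v = v := by
      rintro q rfl v
      have hid : (mfderiv 𝓘(ℝ, E) 𝓘(ℝ, E) (extChartAt 𝓘(ℝ, E) q) q : E →L[ℝ] E) =
        ContinuousLinearMap.id ℝ E := mfderiv_extChartAt_self
      exact DFunLike.congr_fun hid v
    exact (h3 _ (hΘ.zero p) _).trans (hΘ.mfderiv_zero p v)
  have hinv : HasDerivAt (fun t => Ring.inverse (T t)) (-A) 0 := hT.ringInverse_of_eq_one hT0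
  have hVd : HasDerivAt (fun t => fieldInChart p V (extChartAt 𝓘(ℝ, E) p (Θ t p)))
      (fderiv ℝ (fieldInChart p V) (extChartAt 𝓘(ℝ, E) p p) (Y p)) 0 := by
    have h1 : HasFDerivAt (fieldInChart p V) (fderiv ℝ (fieldInChart p V) (extChartAt 𝓘(ℝ, E) p p))
        (extChartAt 𝓘(ℝ, E) p (Θ 0 p)) := by
      rw [hΘ.zero]
      exact (hV.contDiffAt_fieldInChart.differentiableAt (by simp)).hasFDerivAt
    exact h1.comp_hasDerivAt (0 : ℝ) (hΘ.hasDerivAt_extChartAt p)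
  have h := hinv.clm_apply hVd
  rw [hΘ.zero, hT0, Ring.inverse_one, fieldInChart_self] at h
  have heq : (-A) (V p) + (1 : E →L[ℝ] E) (fderiv ℝ (fieldInChart p V) (extChartAt 𝓘(ℝ, E) p p) (Y p))
      = (VectorField.mlieBracket 𝓘(ℝ, E) Y V p : E) := by
    rw [mlieBracket_eq_fieldInChart, sub_eq_neg_add]
    rfl
  rw [← heq]
  refine h.congr_of_eventuallyEq ?_
  have hunit : ∀ᶠ t in 𝓝 (0 : ℝ), IsUnit (T t) := by
    have h1 : {a : E →L[ℝ] E | IsUnit a} ∈ 𝓝 (T 0) := by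
      rw [hT0]; exact (1 : (E →L[ℝ] E)ˣ).nhds
    exact hT.continuousAt.eventually h1
  filter_upwards [hunit, hΘ.eventually_mem_source p] with t htu hts
  have h1 : fieldInChart p V (extChartAt 𝓘(ℝ, E) p (Θ t p)) = T t (hΘ.pullField V p t) := by
    refine (fieldInChart_apply p V hts).trans ?_
    exact congr_arg (mfderiv 𝓘(ℝ, E) 𝓘(ℝ, E) (extChartAt 𝓘(ℝ, E) p) (Θ t p))
      ((hΘ.derivEquiv t p).apply_symm_apply (V (Θ t p) : E)).symm
  rw [h1]
  have h2 := Ring.inverse_mul_cancel (T t) htu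
  exact (DFunLike.congr_fun h2 (hΘ.pullField V p t)).symm

theorem hasDerivAt_pullField (hΘ : IsCompleteFlow Y Θ) {x : M} {t : ℝ} (hV : SmoothFieldAt V (Θ t x)) :
    HasDerivAt (hΘ.pullField V x) (hΘ.pullField (VectorField.mlieBracket 𝓘(ℝ, E) Y V) x t) t := by
  have h1 := hΘ.hasDerivAt_pullField_zero hV
  have h2 : HasDerivAt (fun s => hΘ.pullField V (Θ t x) (s - t))
      (VectorField.mlieBracket 𝓘(ℝ, E) Y V (Θ t x) : E) t := by
    have : HasDerivAt (hΘ.pullField V (Θ t x)) (VectorField.mlieBracket 𝓘(ℝ, E) Y V (Θ t x) : E)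
      (t - t) := by rwa [sub_self]
    exact this.comp_sub_const t t
  have h3 := ((hΘ.derivEquiv t x).symm : E →L[ℝ] E).hasFDerivAt.comp_hasDerivAt t h2
  refine h3.congr_of_eventuallyEq (Eventually.of_forall fun s => ?_)
  have := hΘ.pullField_add (V := V) x (s - t) t
  rwa [sub_add_cancel] at this

/-- Differentiating a pulled back field pulls back its bracket with `Y`, again a smooth field.
Induction gives all orders, and joint smoothness of the flow is not needed. -/
theorem contDiffAt_pullField (hΘ : IsCompleteFlow Y Θ) {x : M} {t : ℝ} (hV : ∀ᶠ y in 𝓝 (Θ t x), SmoothFieldAt V y) :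
    ContDiffAt ℝ ∞ (hΘ.pullField V x) t := by
  rw [contDiffAt_infty]
  intro n
  induction n generalizing V with
  | zero =>
    have h : ∀ᶠ s in 𝓝 t, SmoothFieldAt V (Θ s x) :=
      (hΘ.continuous_left x).continuousAt.eventually hV
    exact contDiffAt_zero.2 ⟨_, h, fun s hs =>
      (hΘ.hasDerivAt_pullField hs).continuousAt.continuousWithinAt⟩
  | succ n ih =>
    have h : ∀ᶠ s in 𝓝 t, SmoothFieldAt V (Θ s x) :=
      (hΘ.continuous_left x).continuousAt.eventually hV
    push_cast
    refine contDiffAt_succ_iff_hasFDerivAt.2 ⟨fun s => (1 : ℝ →L[ℝ] ℝ).smulRight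
      (hΘ.pullField (VectorField.mlieBracket 𝓘(ℝ, E) Y V) x s), ⟨_, h, fun s hs =>
        (hΘ.hasDerivAt_pullField hs).hasFDerivAt⟩, ?_⟩
    exact contDiffAt_const.smulRight (ih (hV.mono fun y hy => (hΘ.smooth y).mlieBracket hy))

/-- The flow of a Hamiltonian field preserves the symplectic form. -/
theorem hasDerivAt_form_zero (hΘ : IsCompleteFlow Y Θ) (σ : SymplecticForm E M) {H : M → ℝ}
    (hH : ContMDiff 𝓘(ℝ, E) 𝓘(ℝ, ℝ) ∞ H) {p : M}
    (hY : ∀ᶠ y in 𝓝 p, Y y = σ.hamiltonianField H y) (u v : E) :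
    HasDerivAt (fun t => σ.toFun (Θ t p) (hΘ.derivEquiv t p u) (hΘ.derivEquiv t p v)) 0 0 := by
  have := isManifold_one (E := E) (M := M)
  set A : E →L[ℝ] E := fderiv ℝ (fieldInChart p Y) (extChartAt 𝓘(ℝ, E) p p) with hA
  let b := Module.finBasis ℝ E
  let C := fun i => constField p (b i)
  have hC : ∀ i, SmoothFieldAt (C i) p := fun i =>
    smoothFieldAt_constField (b i) (mem_extChartAt_source p)
  let T : ℝ → E →L[ℝ] E := fun t =>
    ((mfderiv 𝓘(ℝ, E) 𝓘(ℝ, E) (extChartAt 𝓘(ℝ, E) p) (Θ t p)).comp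
        (mfderiv 𝓘(ℝ, E) 𝓘(ℝ, E) (Θ t) p) : E →L[ℝ] E)
  have hT : HasDerivAt T A 0 := hΘ.hasDerivAt_mfderiv_zero p
  let B : LinearMap.BilinForm ℝ E := σ.form p
  have hCp : ∀ i, C i p = b i := fun i => constField_self (b i)
  -- For fields constant in the chart the bracket is minus the linearization `A`. Invariance of `σ`
  -- makes the change of its coefficients cancel the change of the transported vectors.
  have hbr : ∀ i, VectorField.mlieBracket 𝓘(ℝ, E) (σ.hamiltonianField H) (C i) p = (-A (b i) : E) := by
    intro i
    have h1 : VectorField.mlieBracket 𝓘(ℝ, E) (σ.hamiltonianField H) (C i) p =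
        VectorField.mlieBracket 𝓘(ℝ, E) Y (C i) p :=
      Filter.EventuallyEq.mlieBracket_vectorField_eq (hY.mono fun y hy => hy.symm)
        EventuallyEq.rfl
    rw [h1, mlieBracket_eq_fieldInChart, hCp]
    have h2 : fieldInChart p (C i) =ᶠ[𝓝 (extChartAt 𝓘(ℝ, E) p p)] fun _ => b i := by
      filter_upwards [extChartAt_target_mem_nhds (I := 𝓘(ℝ, E)) p] with z hz
      exact fieldInChart_constField (b i) hz
    have h3 : fderiv ℝ (fieldInChart p (C i)) (extChartAt 𝓘(ℝ, E) p p) = 0 := by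
      rw [h2.fderiv_eq, fderiv_fun_const]; rfl
    rw [h3]
    exact zero_sub _
  have hS : ∀ i j, HasDerivAt (fun t => σ.toFun (Θ t p) (C i (Θ t p)) (C j (Θ t p)))
      (-(B (A (b i)) (b j) + B (b i) (A (b j)))) 0 := by
    intro i j
    have h1 := hΘ.hasDerivAt_comp (x := p) (t := 0)
      (g := fun y => σ.toFun y (C i y) (C j y)) (by
        rw [hΘ.zero]
        exact (σ.contMDiffAt_apply (hC i) (hC j)).mdifferentiableAt (by simp))
    rw [hΘ.zero, hY.self_of_nhds, σ.dirDeriv_hamiltonianField hH (hC i) (hC j), hbr, hbr, hCp, hCp] at h1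
    have h2 : σ.toFun p (-A (b i) : E) (b j : E) + σ.toFun p (b i : E) (-A (b j) : E) =
        -(B (A (b i)) (b j) + B (b i) (A (b j))) := by
      change B (-A (b i)) (b j) + B (b i) (-A (b j)) = _
      rw [map_neg, map_neg, LinearMap.neg_apply]
      ring
    rw [← h2]
    exact h1
  have hcoord : ∀ (w : E) (i), HasDerivAt (fun t => b.repr (T t w) i) (b.repr (A w) i) 0 := by
    intro w i
    have h1 : HasDerivAt (fun t => T t w) (A w) 0 := by
      simpa using hT.clm_apply (hasDerivAt_const (0 : ℝ) w)
    exact ((b.coord i).toContinuousLinearMap.hasFDerivAt.comp_hasDerivAt (0 : ℝ) h1)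
  have hT0 : ∀ w, T 0 w = w := by
    intro w
    have h3 : ∀ q : M, q = p → ∀ v : E, (mfderiv 𝓘(ℝ, E) 𝓘(ℝ, E) (extChartAt 𝓘(ℝ, E) p) q :
        E →L[ℝ] E) v = v := by
      rintro q rfl v
      have hid : (mfderiv 𝓘(ℝ, E) 𝓘(ℝ, E) (extChartAt 𝓘(ℝ, E) q) q : E →L[ℝ] E) =
        ContinuousLinearMap.id ℝ E := mfderiv_extChartAt_self
      exact DFunLike.congr_fun hid v
    exact (h3 _ (hΘ.zero p) _).trans (hΘ.mfderiv_zero p w)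
  have hsum := HasDerivAt.fun_sum (u := Finset.univ) fun i _ =>
    HasDerivAt.fun_sum (u := Finset.univ) fun j _ =>
      ((hcoord u i).mul (hcoord v j)).mul (hS i j)
  have hval : (∑ i, ∑ j, ((b.repr (A u) i * b.repr (T 0 v) j + b.repr (T 0 u) i * b.repr (A v) j) *
      σ.toFun (Θ 0 p) (C i (Θ 0 p)) (C j (Θ 0 p)) + b.repr (T 0 u) i * b.repr (T 0 v) j *
      (-(B (A (b i)) (b j) + B (b i) (A (b j)))))) = 0 := by
    have e0 : ∀ i j, σ.toFun (Θ 0 p) (C i (Θ 0 p)) (C j (Θ 0 p)) = B (b i) (b j) := by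
      intro i j
      have : ∀ q : M, q = p → σ.toFun q (C i q) (C j q) = B (b i) (b j) := by
        rintro q rfl
        rw [hCp, hCp]
        rfl
      exact this _ (hΘ.zero p)
    have e1 := bilinForm_eq_sum b B (A u) v
    have e2 := bilinForm_eq_sum b B u (A v)
    have e3 := bilinForm_eq_sum b (B.compl₁₂ A.toLinearMap LinearMap.id) u v
    have e4 := bilinForm_eq_sum b (B.compl₁₂ LinearMap.id A.toLinearMap) u v
    simp only [LinearMap.compl₁₂_apply, LinearMap.id_apply, ContinuousLinearMap.coe_coe] at e3 e4
    simp only [e0, hT0]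
    simp only [add_mul, mul_neg, mul_add, neg_add, Finset.sum_add_distrib, Finset.sum_neg_distrib]
    rw [← e1, ← e2, ← e3, ← e4]
    ring
  have hsum2 := hsum.congr_deriv hval
  refine hsum2.congr_of_eventuallyEq ?_
  filter_upwards [hΘ.eventually_mem_source p] with t ht
  have hw : ∀ w : E, (hΘ.derivEquiv t p w : TangentSpace 𝓘(ℝ, E) (Θ t p)) =
      ∑ i, b.repr (T t w) i • C i (Θ t p) := by
    intro w
    refine (eq_constField (p := p) _ ht (hΘ.derivEquiv t p w : E) rfl).trans ?_
    refine (congr_arg (fun u => constField p u (Θ t p)) (b.sum_repr (T t w)).symm).trans ?_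
    exact constField_sum_smul _ _ _
  have hbil : ∀ (q : M) (a a' : _ → ℝ), σ.toFun q (∑ i, a i • C i q) (∑ j, a' j • C j q) =
      ∑ i, ∑ j, a i * a' j * σ.toFun q (C i q) (C j q) := by
    intro q a a'
    simp only [map_sum, sum_apply, map_smul, smul_apply, smul_eq_mul, Finset.mul_sum, mul_assoc]
    rw [Finset.sum_comm]
    exact Finset.sum_congr rfl fun i _ => Finset.sum_congr rfl fun j _ => by ring
  refine Eq.trans ?_ (hbil (Θ t p) _ _)
  rw [← hw u, ← hw v]

end IsCompleteFlow

end Transport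

/-! ### The flow near a compact energy level -/

section EnergyLevel

variable {E : Type*} [NormedAddCommGroup E] [NormedSpace ℝ E] [FiniteDimensional ℝ E]
  {M : Type*} [TopologicalSpace M] [ChartedSpace E M] [IsManifold 𝓘(ℝ, E) ∞ M]

/-- `Θ` is the complete flow of a vector field `Y` which coincides with the Hamiltonian field of
`H` near the energy level `H = c`. -/
structure IsHamiltonianFlowNear (σ : SymplecticForm E M) (H : M → ℝ) (c : ℝ)
    (Y : ∀ x : M, TangentSpace 𝓘(ℝ, E) x) (Θ : ℝ → M → M) : Prop where
  isCompleteFlow : IsCompleteFlow Y Θ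
  smooth : ContMDiff 𝓘(ℝ, E) 𝓘(ℝ, ℝ) ∞ H
  eventually_eq : ∀ x, H x = c → ∀ᶠ y in 𝓝 x, Y y = σ.hamiltonianField H y

variable [T2Space M]

/-- Multiplying the Hamiltonian field by a bump function equal to 1 near the level gives a compactly
supported, hence complete, field. The Hamiltonian flow itself need not be complete off the level. -/
theorem exists_isHamiltonianFlowNear [SecondCountableTopology M] (σ : SymplecticForm E M)
    {H : M → ℝ} (hH : ContMDiff 𝓘(ℝ, E) 𝓘(ℝ, ℝ) ∞ H) {c : ℝ} (hc : IsCompact (H ⁻¹' {c})) :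
    ∃ Y Θ, IsHamiltonianFlowNear σ H c Y Θ := by
  have : LocallyCompactSpace M := ChartedSpace.locallyCompactSpace E M
  obtain ⟨K, hK, hcK⟩ := exists_compact_superset hc
  obtain ⟨f, hf1, hf0, -⟩ := exists_contMDiffMap_one_nhds_of_subset_interior 𝓘(ℝ, E) (n := ⊤)
    hc.isClosed hcK
  have hY : ∀ x, SmoothFieldAt (fun y => f y • σ.hamiltonianField H y) x := fun x =>
    SmoothFieldAt.smul f.contMDiff.contMDiffAt (σ.smoothFieldAt_hamiltonianField hH x)
  obtain ⟨Θ, hΘ⟩ := exists_isCompleteFlow hY hK fun x hx => by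
    rw [hf0 x hx, zero_smul]
  refine ⟨_, Θ, hΘ, hH, fun x hx => ?_⟩
  filter_upwards [mem_nhdsSet_iff_forall.1 hf1 x hx] with y hy
  have hy : f y = 1 := hy
  rw [hy, one_smul]

namespace IsHamiltonianFlowNear

variable {σ : SymplecticForm E M} {H : M → ℝ} {c : ℝ}
  {Y : ∀ x : M, TangentSpace 𝓘(ℝ, E) x} {Θ : ℝ → M → M}

/-- Conservation of `H` is known only where `Y` is Hamiltonian. The times spent on the level form a
closed set, which is open because near the level `Y = X_H`. -/
theorem energy_eq (h : IsHamiltonianFlowNear σ H c Y Θ) {x : M} (hx : H x = c) (t : ℝ) :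
    H (Θ t x) = c := by
  have hcont := h.isCompleteFlow.continuous_left x
  have hclopen : IsClopen {t : ℝ | H (Θ t x) = c} := by
    refine ⟨isClosed_eq (h.smooth.continuous.comp hcont) continuous_const, ?_⟩
    rw [isOpen_iff_mem_nhds]
    intro t ht
    have h1 := hcont.continuousAt.eventually (h.eventually_eq _ ht)
    have h2 : ∀ᶠ s in 𝓝 t, HasDerivAt (fun s => H (Θ s x)) 0 s := by
      filter_upwards [h1] with s hs
      have h3 := h.isCompleteFlow.hasDerivAt_comp (x := x) (t := s) (g := H)
        (h.smooth.mdifferentiable (by simp) _)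
      rwa [hs, σ.dirDeriv_self] at h3
    filter_upwards [eventually_eq_of_hasDerivAt_zero h2] with s hs
    exact hs.trans ht
  have h0 : (0 : ℝ) ∈ {t : ℝ | H (Θ t x) = c} := by
    change H (Θ 0 x) = c
    rw [h.isCompleteFlow.zero, hx]
  have := hclopen.eq_univ ⟨0, h0⟩
  exact (Set.eq_univ_iff_forall.1 this) t

/-- The orbit of `x` up to time `|t| + 1` is compact and lies where `Y = X_H`, so nearby orbits do
as well, including those off the level. Agreement on a neighbourhood is what makes the differentials
agree. -/
theorem eventually_flow_eq (h : IsHamiltonianFlowNear σ H c Y Θ) {x : M} (hx : H x = c) (t : ℝ) :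
    ∀ᶠ y in 𝓝 x, flow (σ.hamiltonianField H) t y = Θ t y := by
  have h1 : ∀ s ∈ Icc (-(|t| + 1)) (|t| + 1), ∀ᶠ z : M × ℝ in 𝓝 (x, s),
      Y (Θ z.2 z.1) = σ.hamiltonianField H (Θ z.2 z.1) := fun s _ =>
    h.isCompleteFlow.continuous_uncurry.continuousAt.eventually
      (h.eventually_eq _ (h.energy_eq hx s))
  have h2 := isCompact_Icc.eventually_forall_of_forall_eventually (x₀ := x)
    (P := fun y s => Y (Θ s y) = σ.hamiltonianField H (Θ s y)) h1
  filter_upwards [h2] with y hy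
  have ht := abs_lt.1 (lt_add_one |t|)
  exact h.isCompleteFlow.flow_eq (fun x => σ.smoothFieldAt_hamiltonianField h.smooth x)
    (a := -(|t| + 1)) (b := |t| + 1) ⟨by linarith [abs_nonneg t], by linarith [abs_nonneg t]⟩
    ⟨ht.1, ht.2⟩ fun s hs => (hy s ⟨hs.1.le, hs.2.le⟩).symm

theorem flow_eq (h : IsHamiltonianFlowNear σ H c Y Θ) {x : M} (hx : H x = c) (t : ℝ) :
    flow (σ.hamiltonianField H) t x = Θ t x :=
  (h.eventually_flow_eq hx t).self_of_nhds

theorem flowDeriv_apply (h : IsHamiltonianFlowNear σ H c Y Θ) {x : M} (hx : H x = c) (t : ℝ)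
    (v : E) : (flowDeriv σ H t x v : E) = h.isCompleteFlow.derivEquiv t x v := by
  have h1 : mfderiv 𝓘(ℝ, E) 𝓘(ℝ, E) (flow (σ.hamiltonianField H) t) x =
      mfderiv 𝓘(ℝ, E) 𝓘(ℝ, E) (Θ t) x := Filter.EventuallyEq.mfderiv_eq (h.eventually_flow_eq hx t)
  exact DFunLike.congr_fun h1 v

/-- The derivative of `Θ_t^* σ` at time 0 vanishes at every point of the level. The group law moves
this to all times. -/
theorem form_derivEquiv (h : IsHamiltonianFlowNear σ H c Y Θ) {x : M} (hx : H x = c) (t : ℝ)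
    (u v : E) : σ.toFun (Θ t x) (h.isCompleteFlow.derivEquiv t x u)
      (h.isCompleteFlow.derivEquiv t x v) = σ.toFun x u v := by
  set hΘ := h.isCompleteFlow with hΘ_def
  let k : ℝ → ℝ := fun t => σ.toFun (Θ t x) (hΘ.derivEquiv t x u) (hΘ.derivEquiv t x v)
  have hk : ∀ t, HasDerivAt k 0 t := by
    intro t
    have h1 : HasDerivAt (fun s => σ.toFun (Θ s (Θ t x)) (hΘ.derivEquiv s (Θ t x)
      (hΘ.derivEquiv t x u)) (hΘ.derivEquiv s (Θ t x) (hΘ.derivEquiv t x v))) 0 (t - t) := by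
      rw [sub_self]
      exact hΘ.hasDerivAt_form_zero σ h.smooth (h.eventually_eq _ (h.energy_eq hx t)) _ _
    refine (h1.comp_sub_const t t).congr_of_eventuallyEq (Eventually.of_forall fun s => ?_)
    have e0 : ∀ q r : M, q = r → ∀ a b a' b' : E, a = a' → b = b' →
      σ.toFun q a b = σ.toFun r a' b' := by rintro q _ rfl a b _ _ rfl rfl; rfl
    have e1 : ∀ w, hΘ.derivEquiv s x w = hΘ.derivEquiv (s - t) (Θ t x) (hΘ.derivEquiv t x w) := by
      intro w
      rw [← hΘ.derivEquiv_add, sub_add_cancel]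
    refine e0 _ _ ?_ _ _ _ _ (e1 u) (e1 v)
    rw [← hΘ.add, sub_add_cancel]
  have h2 := is_const_of_deriv_eq_zero (fun t => (hk t).differentiableAt) (fun t => (hk t).deriv)
    t 0
  have e0 : ∀ q : M, q = x → ∀ a b : E, a = u → b = v →
    σ.toFun q a b = σ.toFun x u v := by rintro q rfl a b rfl rfl; rfl
  exact h2.trans (e0 _ (hΘ.zero x) _ _ (hΘ.derivEquiv_zero x u) (hΘ.derivEquiv_zero x v))

theorem mlieBracket_eq (h : IsHamiltonianFlowNear σ H c Y Θ) {x : M} (hx : H x = c)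
    (V : ∀ x : M, TangentSpace 𝓘(ℝ, E) x) :
    VectorField.mlieBracket 𝓘(ℝ, E) Y V x =
      VectorField.mlieBracket 𝓘(ℝ, E) (σ.hamiltonianField H) V x :=
  Filter.EventuallyEq.mlieBracket_vectorField_eq (h.eventually_eq x hx) EventuallyEq.rfl

/-- The pullback of `X_H` has derivative the pullback of `[X_H, X_H] = 0`, hence is constant. -/
theorem derivEquiv_hamiltonianField (h : IsHamiltonianFlowNear σ H c Y Θ) {x : M} (hx : H x = c)
    (t : ℝ) : h.isCompleteFlow.derivEquiv t x (σ.hamiltonianField H x) =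
      (σ.hamiltonianField H (Θ t x) : E) := by
  set hΘ := h.isCompleteFlow with hΘ_def
  have hk : ∀ t, HasDerivAt (hΘ.pullField (σ.hamiltonianField H) x) 0 t := by
    intro t
    have h1 := hΘ.hasDerivAt_pullField (x := x) (t := t)
      (σ.smoothFieldAt_hamiltonianField h.smooth (Θ t x))
    refine h1.congr_deriv ?_
    have h2 := h.mlieBracket_eq (h.energy_eq hx t) (σ.hamiltonianField H)
    rw [VectorField.mlieBracket_self] at h2
    exact (congr_arg (hΘ.derivEquiv t x).symm h2).trans (map_zero _)
  have h2 := is_const_of_deriv_eq_zero (fun t => (hk t).differentiableAt) (fun t => (hk t).deriv)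
    t 0
  have h3 := h2.trans (hΘ.pullField_zero x)
  exact (((hΘ.derivEquiv t x).symm_apply_eq).1 h3).symm

theorem form_pullField (h : IsHamiltonianFlowNear σ H c Y Θ) {x : M} (hx : H x = c) (t : ℝ)
    (V W : ∀ x : M, TangentSpace 𝓘(ℝ, E) x) :
    σ.toFun x (h.isCompleteFlow.pullField V x t) (h.isCompleteFlow.pullField W x t) =
      σ.toFun (Θ t x) (V (Θ t x)) (W (Θ t x)) := by
  refine (h.form_derivEquiv hx t _ _).symm.trans ?_
  have e0 : ∀ a b a' b' : E, a = a' → b = b' →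
    σ.toFun (Θ t x) a b = σ.toFun (Θ t x) a' b' := by rintro a b _ _ rfl rfl; rfl
  exact e0 _ _ _ _ ((h.isCompleteFlow.derivEquiv t x).apply_symm_apply (V (Θ t x) : E))
    ((h.isCompleteFlow.derivEquiv t x).apply_symm_apply (W (Θ t x) : E))

end IsHamiltonianFlowNear

end EnergyLevel

/-! ### Jacobi curves are monotone Lagrangian curves -/

section JacobiCurve

variable {E : Type*} [NormedAddCommGroup E] [NormedSpace ℝ E] [FiniteDimensional ℝ E]
  {M : Type*} [TopologicalSpace M] [ChartedSpace E M] [IsManifold 𝓘(ℝ, E) ∞ M]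

theorem mlieBracket_sum_smul {ι : Type*} (s : Finset ι) (X : ∀ x : M, TangentSpace 𝓘(ℝ, E) x)
    {V : ι → ∀ x : M, TangentSpace 𝓘(ℝ, E) x} {p : M} (hV : ∀ i, SmoothFieldAt (V i) p)
    (y : ι → ℝ) :
    VectorField.mlieBracket 𝓘(ℝ, E) X (fun x => ∑ i ∈ s, y i • V i x) p =
      ∑ i ∈ s, y i • VectorField.mlieBracket 𝓘(ℝ, E) X (V i) p := by
  classical
  have := isManifold_one (E := E) (M := M)
  have h2 : IsManifold 𝓘(ℝ, E) (minSmoothness ℝ 2) M :=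
    IsManifold.of_le (n := ∞)
      (by simp only [minSmoothness_of_isRCLikeNormedField]; exact WithTop.coe_le_coe.2 le_top)
  have hsm : ∀ i, SmoothFieldAt (fun x => y i • V i x) p := fun i =>
    SmoothFieldAt.smul contMDiffAt_const (hV i)
  induction s using Finset.induction_on with
  | empty => exact congr_fun (VectorField.mlieBracket_zero_right (I := 𝓘(ℝ, E))) p
  | insert a s ha ih =>
    simp only [Finset.sum_insert ha]
    refine (VectorField.mlieBracket_add_right (I := 𝓘(ℝ, E)) (V := X) (x := p)
      (W := fun x => y a • V a x) (W₁ := fun x => ∑ i ∈ s, y i • V i x) ?_ ?_).trans ?_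
    · exact ContMDiffAt.mdifferentiableAt (hsm a) (by simp)
    · exact ContMDiffAt.mdifferentiableAt (SmoothFieldAt.sum fun i _ => hsm i) (by simp)
    · rw [ih]
      congr 1
      exact VectorField.mlieBracket_const_smul_right (I := 𝓘(ℝ, E)) (V := X) (W := V a) (c := y a)
        (ContMDiffAt.mdifferentiableAt (hV a) (by simp))

variable {σ : SymplecticForm E M} {Λ : LagrangianDistribution σ} {H : M → ℝ}

theorem LagrangianDistribution.exists_frame (Λ : LagrangianDistribution σ) {n : ℕ}
    (hn : Module.finrank ℝ E = 2 * n) (x : M) :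
    ∃ V : Fin n → ∀ y : M, TangentSpace 𝓘(ℝ, E) y, ∀ᶠ y in 𝓝 x, (∀ i, SmoothFieldAt (V i) y) ∧
      (∀ i, V i y ∈ Λ.toFun y) ∧ LinearIndependent ℝ (fun i => V i y) := by
  obtain ⟨k, V, U, hU, hx, hV, hVU⟩ := Λ.smooth x
  have hk : k = n := by
    have h1 := finrank_span_eq_card (hVU x hx).1
    rw [(hVU x hx).2, Fintype.card_fin] at h1
    have h2 : 2 * Module.finrank ℝ (Λ.toFun x) = Module.finrank ℝ E := (Λ.lagrangian x).2
    omega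
  subst hk
  refine ⟨V, ?_⟩
  filter_upwards [hU.mem_nhds hx] with y hy
  refine ⟨fun i => hV i y hy, fun i => ?_, (hVU y hy).1⟩
  rw [← (hVU y hy).2]
  exact Submodule.subset_span (mem_range_self i)

/-- The monotonicity form of a Hamiltonian field is positive on every frame. -/
theorem IsMonotoneHamiltonian.pos (hmono : IsMonotoneHamiltonian σ Λ H) {k : ℕ} {q : M}
    {V : Fin k → ∀ y : M, TangentSpace 𝓘(ℝ, E) y} (hV : ∀ i, SmoothFieldAt (V i) q)
    (hΛ : ∀ᶠ y in 𝓝 q, ∀ i, V i y ∈ Λ.toFun y) (hli : LinearIndependent ℝ (fun i => V i q))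
    {y : Fin k → ℝ} (hy : y ≠ 0) :
    0 < y ⬝ᵥ (bilinGram (σ.form q)
      (fun i => VectorField.mlieBracket 𝓘(ℝ, E) (σ.hamiltonianField H) (V i) q)
      (fun i => V i q)).mulVec y := by
  have h := hmono q (fun x => ∑ i, y i • V i x)
    (SmoothFieldAt.sum fun i _ => SmoothFieldAt.smul contMDiffAt_const (hV i)) ?_ ?_
  · rw [mlieBracket_sum_smul _ _ hV] at h
    refine h.trans_eq ?_
    simp only [map_sum, LinearMap.sum_apply, map_smul, LinearMap.smul_apply, smul_eq_mul,
      dotProduct, Matrix.mulVec, bilinGram, Matrix.of_apply, Finset.mul_sum]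
    rw [Finset.sum_comm]
    exact Finset.sum_congr rfl fun i _ => Finset.sum_congr rfl fun j _ => by ring
  · filter_upwards [hΛ] with z hz
    exact Submodule.sum_mem _ fun i _ => Submodule.smul_mem _ _ (hz i)
  · intro h0
    exact hy (funext (Fintype.linearIndependent_iff.1 hli y h0))

theorem bilinGram_det_ne_zero_of_pos {k : ℕ} {G : Matrix (Fin k) (Fin k) ℝ}
    (hG : ∀ y : Fin k → ℝ, y ≠ 0 → 0 < y ⬝ᵥ G.mulVec y) : G.det ≠ 0 := by
  intro h0
  obtain ⟨y, hy, h⟩ := Matrix.exists_mulVec_eq_zero_iff.2 h0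
  have := hG y hy
  rw [h, dotProduct_zero] at this
  exact lt_irrefl _ this

variable [T2Space M]

namespace IsHamiltonianFlowNear

variable {c : ℝ} {Y : ∀ x : M, TangentSpace 𝓘(ℝ, E) x} {Θ : ℝ → M → M}

theorem mem_jacobiCurve (h : IsHamiltonianFlowNear σ H c Y Θ) {x : M} (hx : H x = c) {t : ℝ}
    {v : E} : v ∈ (jacobiCurve σ Λ H x t : Submodule ℝ E) ↔
      (h.isCompleteFlow.derivEquiv t x v : TangentSpace 𝓘(ℝ, E) (Θ t x)) ∈ Λ.toFun (Θ t x) := by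
  have e0 : ∀ q : M, q = Θ t x → ∀ w w' : E, w = w' → ((w : TangentSpace 𝓘(ℝ, E) q) ∈ Λ.toFun q ↔
      (w' : TangentSpace 𝓘(ℝ, E) (Θ t x)) ∈ Λ.toFun (Θ t x)) := by
    rintro q rfl w _ rfl; rfl
  exact e0 _ (h.flow_eq hx t) _ _ (h.flowDeriv_apply hx t v)

theorem pullField_mem_jacobiCurve (h : IsHamiltonianFlowNear σ H c Y Θ) {x : M} (hx : H x = c)
    {t : ℝ} {V : ∀ y : M, TangentSpace 𝓘(ℝ, E) y} (hV : V (Θ t x) ∈ Λ.toFun (Θ t x)) :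
    h.isCompleteFlow.pullField V x t ∈ (jacobiCurve σ Λ H x t : Submodule ℝ E) := by
  rw [h.mem_jacobiCurve hx]
  have e0 : ∀ w w' : TangentSpace 𝓘(ℝ, E) (Θ t x), w = w' → w' ∈ Λ.toFun (Θ t x) →
    w ∈ Λ.toFun (Θ t x) := by rintro w _ rfl h; exact h
  exact e0 _ _ ((h.isCompleteFlow.derivEquiv t x).apply_symm_apply (V (Θ t x) : E)) hV

theorem hasDerivAt_pullField (h : IsHamiltonianFlowNear σ H c Y Θ) {x : M} (hx : H x = c) {t : ℝ}
    {V : ∀ y : M, TangentSpace 𝓘(ℝ, E) y} (hV : SmoothFieldAt V (Θ t x)) :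
    HasDerivAt (h.isCompleteFlow.pullField V x) (h.isCompleteFlow.pullField
      (VectorField.mlieBracket 𝓘(ℝ, E) (σ.hamiltonianField H) V) x t) t := by
  rw [← h.isCompleteFlow.pullField_congr (h.mlieBracket_eq (h.energy_eq hx t) V)]
  exact h.isCompleteFlow.hasDerivAt_pullField hV

theorem isLagrangianSubspace_jacobiCurve (h : IsHamiltonianFlowNear σ H c Y Θ) {x : M}
    (hx : H x = c) (t : ℝ) :
    IsLagrangianSubspace (V := E) (σ.form x) (jacobiCurve σ Λ H x t) := by
  constructor
  · intro v hv w hw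
    have h1 := (Λ.lagrangian (Θ t x)).1 _ ((h.mem_jacobiCurve hx).1 hv) _
      ((h.mem_jacobiCurve hx).1 hw)
    exact (h.form_derivEquiv hx t v w).symm.trans h1
  · have h2 : 2 * Module.finrank ℝ (Λ.toFun (Θ t x)) = Module.finrank ℝ E :=
      (Λ.lagrangian (Θ t x)).2
    refine (congr_arg (2 * ·) ?_).trans h2
    let L : Submodule ℝ E := Λ.toFun (Θ t x)
    have h3 : (jacobiCurve σ Λ H x t : Submodule ℝ E) =
        L.map ((h.isCompleteFlow.derivEquiv t x).toLinearEquiv.symm : E →ₗ[ℝ] E) := by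
      refine Submodule.ext fun v => (h.mem_jacobiCurve hx).trans ?_
      exact (Submodule.mem_map_equiv (e := (h.isCompleteFlow.derivEquiv t x).toLinearEquiv.symm)
        (p := L) (x := v)).symm
    exact (congr_arg (fun S : Submodule ℝ E => Module.finrank ℝ S) h3).trans
      (LinearEquiv.finrank_map_eq _ L)

/-- Pulled back local sections of `Λ` frame the Jacobi curve, and their velocities are the pulled
back brackets with `X_H`. As the flow is symplectic, the velocity form is the monotonicity form at
the moving point. -/
theorem isMonotoneCurve_jacobiCurve (h : IsHamiltonianFlowNear σ H c Y Θ)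
    (hmono : IsMonotoneHamiltonian σ Λ H) {n : ℕ} (hn : Module.finrank ℝ E = 2 * n) {x : M}
    (hx : H x = c) :
    IsMonotoneCurve (V := E) (σ.form x) (jacobiCurve σ Λ H x) n where
  alt := σ.form_isAlt x
  nondeg := σ.nondegenerate x
  finrank_eq := hn
  lagrangian := h.isLagrangianSubspace_jacobiCurve hx
  frame t := by
    obtain ⟨V, hV⟩ := Λ.exists_frame hn (Θ t x)
    have hcont := (h.isCompleteFlow.continuous_left x).continuousAt (x := t)
    refine ⟨fun i => h.isCompleteFlow.pullField (V i) x, ?_, ?_, fun y hy => ?_⟩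
    · filter_upwards [hcont.eventually hV.eventually_nhds] with s hs i
      exact h.isCompleteFlow.contDiffAt_pullField (hs.mono fun y hy => hy.1 i)
    · filter_upwards [hcont.eventually hV] with s hs i
      exact h.pullField_mem_jacobiCurve hx (hs.2.1 i)
    · have h1 := hmono.pos (q := Θ t x) (V := V) hV.self_of_nhds.1 (hV.mono fun y hy => hy.2.1)
        hV.self_of_nhds.2.2 hy
      refine h1.trans_eq ?_
      congr 2
      ext i j
      have h2 : deriv (h.isCompleteFlow.pullField (V i) x) t = _ :=
        (h.hasDerivAt_pullField hx (hV.self_of_nhds.1 i)).deriv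
      simp only [bilinGram, Matrix.of_apply]
      rw [h2]
      exact (h.form_pullField hx t _ _).symm

end IsHamiltonianFlowNear

end JacobiCurve

/-! ### Normal frames under symplectic maps and time shifts -/

section Transport

variable {V W : Type*} [NormedAddCommGroup V] [NormedSpace ℝ V] [NormedAddCommGroup W]
  [NormedSpace ℝ W]

theorem HasDerivAt.clm_comp_add_const (L : V →L[ℝ] W) {γ : ℝ → V} {v : V} {t s : ℝ}
    (hγ : HasDerivAt γ v (t + s)) : HasDerivAt (fun r => L (γ (r + s))) (L v) t :=
  L.hasFDerivAt.comp_hasDerivAt t (hγ.comp_add_const t s)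

/-- Normal frames are carried to normal frames by symplectic maps and translations of time. -/
theorem IsNormalFrameAt.map_translate {B : LinearMap.BilinForm ℝ V} {B' : LinearMap.BilinForm ℝ W}
    {S : ℝ → Submodule ℝ V} {S' : ℝ → Submodule ℝ W} {m : ℕ} {e : Fin m → ℝ → V} {s t : ℝ}
    (he : IsNormalFrameAt B S e (t + s)) (L : V →L[ℝ] W) (hL : ∀ u v, B' (L u) (L v) = B u v)
    (hS : ∀ v ∈ S (t + s), L v ∈ S' t) :
    IsNormalFrameAt B' S' (fun k r => L (e k (r + s))) t := by
  have hd : ∀ k, deriv (fun r => L (e k (r + s))) t = L (deriv (e k) (t + s)) := fun k =>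
    ((he.hasDerivAt k).clm_comp_add_const L).deriv
  refine ⟨fun k => ?_, fun k => hS _ (he.mem k), ?_, ?_, ?_⟩
  · have h1 : ContDiffAt ℝ ∞ (fun r : ℝ => r + s) t := contDiffAt_id.add contDiffAt_const
    exact L.contDiff.contDiffAt.comp t (ContDiffAt.comp t (he.smooth k) h1)
  · rw [← he.e_e]; ext i j; simp only [bilinGram, Matrix.of_apply, hL]
  · rw [← he.f_e]; ext i j; simp only [bilinGram, Matrix.of_apply, hd, hL]
  · rw [← he.f_f]; ext i j; simp only [bilinGram, Matrix.of_apply, hd, hL]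

end Transport

/-! ### Reduced curvature along an orbit -/

section CurvatureAlongFlow

variable {E : Type*} [NormedAddCommGroup E] [NormedSpace ℝ E] [FiniteDimensional ℝ E]
  {M : Type*} [TopologicalSpace M] [ChartedSpace E M] [IsManifold 𝓘(ℝ, E) ∞ M]
  {σ : SymplecticForm E M} {Λ : LagrangianDistribution σ} {H : M → ℝ} [T2Space M]

variable (σ) in
/-- The symplectic form at `x`, as a bilinear form on the model space. -/
noncomputable def SymplecticForm.modelForm (x : M) : LinearMap.BilinForm ℝ E := σ.form x

variable (σ H) in
/-- The Hamiltonian field at `x`, as a vector of the model space. -/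
noncomputable def SymplecticForm.modelField (x : M) : E := σ.hamiltonianField H x

variable (σ Λ H) in
/-- The Jacobi curve at `x`, as a curve of subspaces of the model space. -/
noncomputable def modelJacobiCurve (x : M) (t : ℝ) : Submodule ℝ E := jacobiCurve σ Λ H x t

variable (σ Λ H) in
/-- The intersection of the Jacobi curve at `x` with the skew-orthogonal complement of the
Hamiltonian field. -/
noncomputable def modelReducedCurve (x : M) (t : ℝ) : Submodule ℝ E :=
  modelJacobiCurve σ Λ H x t ⊓ skewComplement (σ.modelForm x) (σ.modelField H x)

namespace IsHamiltonianFlowNear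

variable {c : ℝ} {Y : ∀ x : M, TangentSpace 𝓘(ℝ, E) x} {Θ : ℝ → M → M}

/-- The hypothesis at the point `Θ s x` and time `t - s`, pulled back to `x` by the differential at
time `t`. It is needed for all pairs of times, not only for `s = 0`. -/
theorem jacobiCurve_sup_eq_top (h : IsHamiltonianFlowNear σ H c Y Θ)
    (hconj : HasNoConjugatePointsOn σ Λ H (H ⁻¹' {c})) {x : M} (hx : H x = c) {s t : ℝ}
    (hst : s < t) :
    modelJacobiCurve σ Λ H x s ⊔ modelJacobiCurve σ Λ H x t = ⊤ := by
  set hΘ := h.isCompleteFlow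
  have hs := h.energy_eq hx s
  have h1 := hconj (Θ s x) hs (t - s) (sub_pos.2 hst)
  have hsum : ∀ b : E, ∃ w : E, ∃ z : E, (w : TangentSpace 𝓘(ℝ, E) (Θ s x)) ∈ Λ.toFun (Θ s x) ∧
      (z : TangentSpace 𝓘(ℝ, E) (Θ t x)) ∈ Λ.toFun (Θ t x) ∧
      hΘ.derivEquiv (t - s) (Θ s x) w + z = b := by
    intro b
    have hq : flow (σ.hamiltonianField H) (t - s) (Θ s x) = Θ t x := by
      rw [h.flow_eq hs, ← hΘ.add, sub_add_cancel]
    let b' : TangentSpace 𝓘(ℝ, E) (flow (σ.hamiltonianField H) (t - s) (Θ s x)) := b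
    have hb : b' ∈ (Λ.toFun (Θ s x)).map (flowDeriv σ H (t - s) (Θ s x)) ⊔
        Λ.toFun (flow (σ.hamiltonianField H) (t - s) (Θ s x)) :=
      h1.symm ▸ (Submodule.mem_top (x := b'))
    obtain ⟨a, ha, z, hz, haz⟩ := Submodule.mem_sup.1 hb
    obtain ⟨w, hw, rfl⟩ := Submodule.mem_map.1 ha
    have e0 : ∀ q : M, q = Θ t x → ∀ z : E, (z : TangentSpace 𝓘(ℝ, E) q) ∈ Λ.toFun q →
      (z : TangentSpace 𝓘(ℝ, E) (Θ t x)) ∈ Λ.toFun (Θ t x) := by rintro q rfl z hz; exact hz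
    refine ⟨w, z, hw, e0 _ hq _ hz, ?_⟩
    exact (congr_arg (fun u : E => u + @id E z) (h.flowDeriv_apply hs (t - s) w).symm).trans haz
  refine Submodule.eq_top_iff'.2 fun v => ?_
  obtain ⟨w, z, hw, hz, hwz⟩ := hsum (hΘ.derivEquiv t x v)
  refine Submodule.mem_sup.2 ⟨(hΘ.derivEquiv s x).symm w, ?_, (hΘ.derivEquiv t x).symm z, ?_, ?_⟩
  · refine (h.mem_jacobiCurve hx).2 ?_
    have e0 : ∀ w' : E, w' = w →
      (w' : TangentSpace 𝓘(ℝ, E) (Θ s x)) ∈ Λ.toFun (Θ s x) := by rintro _ rfl; exact hw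
    exact e0 _ ((hΘ.derivEquiv s x).apply_symm_apply w)
  · refine (h.mem_jacobiCurve hx).2 ?_
    have e0 : ∀ w' : E, w' = z →
      (w' : TangentSpace 𝓘(ℝ, E) (Θ t x)) ∈ Λ.toFun (Θ t x) := by rintro _ rfl; exact hz
    exact e0 _ ((hΘ.derivEquiv t x).apply_symm_apply z)
  · apply (hΘ.derivEquiv t x).injective
    rw [← hwz]
    refine (map_add (hΘ.derivEquiv t x) _ _).trans ?_
    have h2 := hΘ.derivEquiv_add (t - s) s x ((hΘ.derivEquiv s x).symm w)
    rw [sub_add_cancel, (hΘ.derivEquiv s x).apply_symm_apply] at h2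
    rw [h2, (hΘ.derivEquiv t x).apply_symm_apply]

theorem derivEquiv_mem_jacobiCurve (h : IsHamiltonianFlowNear σ H c Y Θ) {x : M} (hx : H x = c)
    {s t : ℝ} {v : E} (hv : v ∈ modelJacobiCurve σ Λ H x (t + s)) :
    h.isCompleteFlow.derivEquiv s x v ∈ modelJacobiCurve σ Λ H (Θ s x) t := by
  refine (h.mem_jacobiCurve (h.energy_eq hx s)).2 ?_
  have h1 := (h.mem_jacobiCurve hx).1 hv
  have e0 : ∀ q r : M, q = r → ∀ z z' : E, z = z' → (z : TangentSpace 𝓘(ℝ, E) q) ∈ Λ.toFun q →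
      (z' : TangentSpace 𝓘(ℝ, E) r) ∈ Λ.toFun r := by rintro q _ rfl z _ rfl hz; exact hz
  exact e0 _ _ (h.isCompleteFlow.add t s x) _ _ (h.isCompleteFlow.derivEquiv_add t s x v) h1

/-- The differential of the flow carries the Jacobi curve at `x`, shifted by `s`, into that at `Θ s
x`, and respects `σ` and `X_H`. So one frame at `x` computes the curvature at every point of the
orbit. -/
theorem reducedCurvatureTrace_eq (h : IsHamiltonianFlowNear σ H c Y Θ)
    (hmono : IsMonotoneHamiltonian σ Λ H) {m : ℕ} (hn : Module.finrank ℝ E = 2 * (m + 1)) {x : M}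
    (hx : H x = c) (h0 : σ.modelField H x ≠ 0) {e : Fin m → ℝ → E}
    (he : ∀ t, IsNormalFrameAt (σ.modelForm x) (modelReducedCurve σ Λ H x) e t)
    (s : ℝ) :
    reducedCurvatureTrace σ Λ H (Θ s x) = (bilinGram (σ.modelForm x)
      (fun k => deriv (deriv (e k)) s) (fun k => deriv (e k) s)).trace := by
  set hΘ := h.isCompleteFlow
  have hs := h.energy_eq hx s
  have hX := h.derivEquiv_hamiltonianField hx s
  have h0s : σ.modelField H (Θ s x) ≠ 0 := by
    intro h1
    exact h0 ((hΘ.derivEquiv s x).map_eq_zero_iff.1 (hX.trans h1))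
  have hJ : IsMonotoneCurve (σ.modelForm (Θ s x)) (modelJacobiCurve σ Λ H (Θ s x)) (m + 1) :=
    h.isMonotoneCurve_jacobiCurve hmono hn hs
  let L : E →L[ℝ] E := (hΘ.derivEquiv s x : E →L[ℝ] E)
  have hL : ∀ u v, σ.modelForm (Θ s x) (L u) (L v) = σ.modelForm x u v := h.form_derivEquiv hx s
  have hL0 : L (σ.modelField H x) = σ.modelField H (Θ s x) := hX
  have he' : ∀ t, IsNormalFrameAt (σ.modelForm (Θ s x)) (modelReducedCurve σ Λ H (Θ s x))
      (fun k r => L (e k (r + s))) t := by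
    intro t
    refine (he (t + s)).map_translate L hL fun v hv => ?_
    refine Submodule.mem_inf.2 ⟨h.derivEquiv_mem_jacobiCurve hx hv.1, ?_⟩
    rw [LinearMap.mem_ker, ← hL0, hL]
    exact hv.2
  have h1 := hJ.trace_curvatureOperator_reduced (σ.form_isAlt (Θ s x)) h0s he' 0
  refine Eq.trans h1 ?_
  have hsm : ∀ k, ContDiff ℝ ∞ (e k) := fun k => contDiff_iff_contDiffAt.2 fun t => (he t).smooth k
  have hd1 : ∀ k, deriv (fun r => L (e k (r + s))) = fun r => L (deriv (e k) (r + s)) := fun k =>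
    funext fun r => (((he (r + s)).hasDerivAt k).clm_comp_add_const L).deriv
  have hd2 : ∀ k, deriv (fun r => L (deriv (e k) (r + s))) 0 = L (deriv (deriv (e k)) (0 + s)) :=
    fun k => (HasDerivAt.clm_comp_add_const L
      ((contDiff_infty_iff_deriv.1 (hsm k)).2.contDiffAt.hasDerivAt_deriv)).deriv
  congr 1
  ext i j
  simp only [bilinGram, Matrix.of_apply]
  rw [hd1, hd1, hd2]
  refine (hL _ _).trans ?_
  rw [zero_add]

end IsHamiltonianFlowNear

end CurvatureAlongFlow

/-! ### Gram matrices of shifted frames -/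

section ShiftedFrames

variable {V : Type*} [AddCommGroup V] [Module ℝ V] {B : LinearMap.BilinForm ℝ V} {k : ℕ}
  {w w' : Fin k → V}

theorem bilinGram_add_matComb_left (hw : bilinGram B w w = 0) (K : Matrix (Fin k) (Fin k) ℝ) :
    bilinGram B (w' + matComb K w) w = bilinGram B w' w := by
  have h1 := bilinGram_matComb B K (1 : Matrix (Fin k) (Fin k) ℝ) w w
  rw [matComb_one] at h1
  rw [bilinGram_add_left, h1, hw, mul_zero, zero_mul, add_zero]

theorem bilinGram_add_matComb_self (hB : B.IsAlt) (hw : bilinGram B w w = 0)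
    (K : Matrix (Fin k) (Fin k) ℝ) :
    bilinGram B (w' + matComb K w) (w' + matComb K w) =
      bilinGram B w' w' + bilinGram B w' w * Kᵀ - K * (bilinGram B w' w)ᵀ := by
  have h2 := bilinGram_matComb B (1 : Matrix (Fin k) (Fin k) ℝ) K w' w
  have h1 := bilinGram_matComb B K (1 : Matrix (Fin k) (Fin k) ℝ) w w'
  rw [matComb_one] at h1 h2
  rw [bilinGram_add_left, bilinGram_add_right, bilinGram_add_right, bilinGram_matComb, hw, h1, h2,
    bilinGram_transpose B hB, Matrix.transpose_one, mul_zero, zero_mul, add_zero, mul_one, one_mul,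
    mul_neg, sub_neg_eq_add]

end ShiftedFrames

/-! ### Curvature through brackets of adapted fields -/

section AdaptedFields

variable {E : Type*} [NormedAddCommGroup E] [NormedSpace ℝ E] [FiniteDimensional ℝ E]
  {M : Type*} [TopologicalSpace M] [ChartedSpace E M] [IsManifold 𝓘(ℝ, E) ∞ M]
  (σ : SymplecticForm E M) (H : M → ℝ) {k : ℕ} (W : Fin k → ∀ x : M, TangentSpace 𝓘(ℝ, E) x)

/-- The Lie derivatives of the fields `W` along the Hamiltonian field. -/
noncomputable def lieFields (i : Fin k) (x : M) : TangentSpace 𝓘(ℝ, E) x :=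
  VectorField.mlieBracket 𝓘(ℝ, E) (σ.hamiltonianField H) (W i) x

/-- The values of two families of fields under the symplectic form. -/
noncomputable def fieldGram (σ : SymplecticForm E M) (V W : Fin k → ∀ x : M, TangentSpace 𝓘(ℝ, E) x)
    (x : M) : Matrix (Fin k) (Fin k) ℝ :=
  bilinGram (σ.modelForm x) (fun i => (V i x : E)) (fun i => (W i x : E))

/-- The coefficients which make `lieFields` isotropic modulo `W`. -/
noncomputable def shiftMatrix (x : M) : Matrix (Fin k) (Fin k) ℝ :=
  (-(1 / 2) : ℝ) • (fieldGram σ (lieFields σ H (lieFields σ H W)) W x *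
    (fieldGram σ (lieFields σ H W) W x)⁻¹)

/-- The isotropic modification of `lieFields`. -/
noncomputable def darbouxFields (i : Fin k) (x : M) : TangentSpace 𝓘(ℝ, E) x :=
  lieFields σ H W i x + ∑ j, shiftMatrix σ H W x i j • W j x

/-- The curvature matrix of the fields `W`. -/
noncomputable def curvatureMatrix (x : M) : Matrix (Fin k) (Fin k) ℝ :=
  fieldGram σ (lieFields σ H (darbouxFields σ H W)) (darbouxFields σ H W) x

/-- The fields `W` are smooth and isotropic near `x` and the Gram matrix of their Lie derivatives
along the Hamiltonian field is invertible. -/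
def IsAdaptedAt (x : M) : Prop :=
  ∀ᶠ y in 𝓝 x, (∀ i, SmoothFieldAt (W i) y) ∧ fieldGram σ W W y = 0 ∧
    (fieldGram σ (lieFields σ H W) W y).det ≠ 0

variable {σ H W} {x : M}

theorem contMDiffAt_fieldGram {V W : Fin k → ∀ x : M, TangentSpace 𝓘(ℝ, E) x}
    (hV : ∀ i, SmoothFieldAt (V i) x) (hW : ∀ i, SmoothFieldAt (W i) x) (i j : Fin k) :
    ContMDiffAt 𝓘(ℝ, E) 𝓘(ℝ, ℝ) ∞ (fun y => fieldGram σ V W y i j) x :=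
  σ.contMDiffAt_apply (hV i) (hW j)

theorem dirDeriv_fieldGram (hH : ContMDiff 𝓘(ℝ, E) 𝓘(ℝ, ℝ) ∞ H)
    {V W : Fin k → ∀ x : M, TangentSpace 𝓘(ℝ, E) x}
    (hV : ∀ i, SmoothFieldAt (V i) x) (hW : ∀ i, SmoothFieldAt (W i) x) (i j : Fin k) :
    dirDeriv (fun y => fieldGram σ V W y i j) x (σ.hamiltonianField H x) =
      fieldGram σ (lieFields σ H V) W x i j + fieldGram σ V (lieFields σ H W) x i j :=
  σ.dirDeriv_hamiltonianField hH (hV i) (hW j)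

theorem dirDeriv_congr {g g' : M → ℝ} (h : g =ᶠ[𝓝 x] g') (v : TangentSpace 𝓘(ℝ, E) x) :
    dirDeriv g x v = dirDeriv g' x v := by
  rw [dirDeriv, dirDeriv, h.mfderiv_eq]
  rfl

theorem fieldGram_transpose (V W : Fin k → ∀ x : M, TangentSpace 𝓘(ℝ, E) x) :
    (fieldGram σ V W x)ᵀ = -fieldGram σ W V x :=
  bilinGram_transpose (σ.modelForm x) (σ.form_isAlt x) _ _

theorem smoothFieldAt_lieFields (hH : ContMDiff 𝓘(ℝ, E) 𝓘(ℝ, ℝ) ∞ H)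
    (hW : ∀ i, SmoothFieldAt (W i) x) (i : Fin k) : SmoothFieldAt (lieFields σ H W i) x :=
  (σ.smoothFieldAt_hamiltonianField hH x).mlieBracket (hW i)

namespace IsAdaptedAt

theorem eventually (h : IsAdaptedAt σ H W x) : ∀ᶠ y in 𝓝 x, IsAdaptedAt σ H W y :=
  h.eventually_nhds

theorem smooth (h : IsAdaptedAt σ H W x) (i : Fin k) : SmoothFieldAt (W i) x :=
  h.self_of_nhds.1 i

theorem gram_self (h : IsAdaptedAt σ H W x) : fieldGram σ W W x = 0 := h.self_of_nhds.2.1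

theorem det_ne_zero (h : IsAdaptedAt σ H W x) : (fieldGram σ (lieFields σ H W) W x).det ≠ 0 :=
  h.self_of_nhds.2.2

theorem gram_symm (h : IsAdaptedAt σ H W x) (hH : ContMDiff 𝓘(ℝ, E) 𝓘(ℝ, ℝ) ∞ H) :
    (fieldGram σ (lieFields σ H W) W x)ᵀ = fieldGram σ (lieFields σ H W) W x := by
  ext i j
  have h1 := dirDeriv_fieldGram (σ := σ) hH h.smooth h.smooth i j
  have h2 : (fun y => fieldGram σ W W y i j) =ᶠ[𝓝 x] fun _ => 0 :=
    h.mono fun y hy => congr_fun (congr_fun hy.2.1 i) j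
  rw [dirDeriv_congr h2, dirDeriv, mfderiv_const] at h1
  have h3 := congr_fun (congr_fun (fieldGram_transpose (σ := σ) (x := x) (lieFields σ H W) W) i) j
  rw [h3, Matrix.neg_apply]
  have h4 : (0 : ℝ) = fieldGram σ (lieFields σ H W) W x i j +
    fieldGram σ W (lieFields σ H W) x i j := h1
  linarith

/-- The derivative of the symmetric Gram matrix along `X_H` is symmetric, and it is the sum of the
matrix on the left before transposition and the skew Gram matrix of the first brackets. -/
theorem dirDeriv_gram_symm (h : IsAdaptedAt σ H W x) (hH : ContMDiff 𝓘(ℝ, E) 𝓘(ℝ, ℝ) ∞ H) :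
    (fieldGram σ (lieFields σ H (lieFields σ H W)) W x)ᵀ =
      fieldGram σ (lieFields σ H (lieFields σ H W)) W x +
        (2 : ℝ) • fieldGram σ (lieFields σ H W) (lieFields σ H W) x := by
  have hW' := smoothFieldAt_lieFields (σ := σ) hH h.smooth
  ext i j
  have h1 := dirDeriv_fieldGram (σ := σ) hH hW' h.smooth i j
  have h2 := dirDeriv_fieldGram (σ := σ) hH hW' h.smooth j i
  have h3 : (fun y => fieldGram σ (lieFields σ H W) W y i j) =ᶠ[𝓝 x]
      fun y => fieldGram σ (lieFields σ H W) W y j i :=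
    h.eventually.mono fun y hy => (congr_fun (congr_fun (hy.gram_symm hH) j) i)
  rw [dirDeriv_congr h3, h2] at h1
  have h4 := congr_fun (congr_fun (fieldGram_transpose (σ := σ) (x := x) (lieFields σ H W)
    (lieFields σ H W)) i) j
  rw [Matrix.transpose_apply, Matrix.neg_apply] at h4
  simp only [Matrix.transpose_apply, Matrix.add_apply, Matrix.smul_apply, smul_eq_mul]
  linarith

theorem shiftMatrix_mul_gram (h : IsAdaptedAt σ H W x) :
    shiftMatrix σ H W x * fieldGram σ (lieFields σ H W) W x =
      (-(1 / 2) : ℝ) • fieldGram σ (lieFields σ H (lieFields σ H W)) W x := by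
  rw [shiftMatrix, Matrix.smul_mul, Matrix.mul_assoc,
    Matrix.nonsing_inv_mul _ (isUnit_iff_ne_zero.2 h.det_ne_zero), Matrix.mul_one]

theorem gram_mul_shiftMatrix (h : IsAdaptedAt σ H W x) (hH : ContMDiff 𝓘(ℝ, E) 𝓘(ℝ, ℝ) ∞ H) :
    fieldGram σ (lieFields σ H W) W x * (shiftMatrix σ H W x)ᵀ =
      (-(1 / 2) : ℝ) • fieldGram σ (lieFields σ H (lieFields σ H W)) W x -
        fieldGram σ (lieFields σ H W) (lieFields σ H W) x := by
  have h1 := congr_arg Matrix.transpose h.shiftMatrix_mul_gram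
  rw [Matrix.transpose_mul, h.gram_symm hH, Matrix.transpose_smul, h.dirDeriv_gram_symm hH] at h1
  rw [h1, smul_add, smul_smul, sub_eq_add_neg]
  norm_num

theorem gram_darbouxFields (h : IsAdaptedAt σ H W x) :
    fieldGram σ (darbouxFields σ H W) W x = fieldGram σ (lieFields σ H W) W x := by
  exact bilinGram_add_matComb_left (B := σ.modelForm x) h.gram_self _

/-- The shift is half of (Gram matrix of the first brackets minus derivative of `G`) times `G⁻¹`,
the same correction that produces normal frames, now expressed without derivatives along an orbit.
This choice cancels the Gram matrix of the first brackets. -/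
theorem gram_darbouxFields_self (h : IsAdaptedAt σ H W x)
    (hH : ContMDiff 𝓘(ℝ, E) 𝓘(ℝ, ℝ) ∞ H) :
    fieldGram σ (darbouxFields σ H W) (darbouxFields σ H W) x = 0 := by
  refine (bilinGram_add_matComb_self (B := σ.modelForm x) (σ.form_isAlt x) h.gram_self _).trans ?_
  have h6 := h.gram_mul_shiftMatrix hH
  have h7 := h.shiftMatrix_mul_gram
  have h8 := h.gram_symm hH
  change fieldGram σ (lieFields σ H W) (lieFields σ H W) x +
    fieldGram σ (lieFields σ H W) W x * (shiftMatrix σ H W x)ᵀ -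
    shiftMatrix σ H W x * (fieldGram σ (lieFields σ H W) W x)ᵀ = 0
  rw [h6, h8, h7]
  abel

theorem contMDiffAt_shiftMatrix (h : IsAdaptedAt σ H W x) (hH : ContMDiff 𝓘(ℝ, E) 𝓘(ℝ, ℝ) ∞ H)
    (i j : Fin k) : ContMDiffAt 𝓘(ℝ, E) 𝓘(ℝ, ℝ) ∞ (fun y => shiftMatrix σ H W y i j) x := by
  have hW' := smoothFieldAt_lieFields (σ := σ) hH h.smooth
  have hW'' := smoothFieldAt_lieFields (σ := σ) hH hW'
  have hinv := ContMDiffAt.matrix_inv (contMDiffAt_fieldGram (σ := σ) hW' h.smooth) h.det_ne_zero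
  simp only [shiftMatrix, Matrix.smul_apply, Matrix.mul_apply, smul_eq_mul]
  exact contMDiffAt_const.mul (ContMDiffAt.sum fun l _ =>
    (contMDiffAt_fieldGram (σ := σ) hW'' h.smooth i l).mul (hinv l j))

theorem smoothFieldAt_darbouxFields (h : IsAdaptedAt σ H W x)
    (hH : ContMDiff 𝓘(ℝ, E) 𝓘(ℝ, ℝ) ∞ H) (i : Fin k) :
    SmoothFieldAt (darbouxFields σ H W i) x :=
  (smoothFieldAt_lieFields hH h.smooth i).add (SmoothFieldAt.sum fun j _ =>
    SmoothFieldAt.smul (h.contMDiffAt_shiftMatrix hH i j) (h.smooth j))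

theorem contMDiffAt_gram_inv (h : IsAdaptedAt σ H W x) (hH : ContMDiff 𝓘(ℝ, E) 𝓘(ℝ, ℝ) ∞ H)
    (i j : Fin k) :
    ContMDiffAt 𝓘(ℝ, E) 𝓘(ℝ, ℝ) ∞ (fun y => (fieldGram σ (lieFields σ H W) W y)⁻¹ i j) x :=
  ContMDiffAt.matrix_inv (contMDiffAt_fieldGram (smoothFieldAt_lieFields hH h.smooth) h.smooth)
    h.det_ne_zero i j

theorem contMDiffAt_curvatureMatrix (h : IsAdaptedAt σ H W x)
    (hH : ContMDiff 𝓘(ℝ, E) 𝓘(ℝ, ℝ) ∞ H) (i j : Fin k) :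
    ContMDiffAt 𝓘(ℝ, E) 𝓘(ℝ, ℝ) ∞ (fun y => curvatureMatrix σ H W y i j) x :=
  contMDiffAt_fieldGram (smoothFieldAt_lieFields hH (h.smoothFieldAt_darbouxFields hH))
    (h.smoothFieldAt_darbouxFields hH) i j

theorem continuousAt_gram_inv (h : IsAdaptedAt σ H W x) (hH : ContMDiff 𝓘(ℝ, E) 𝓘(ℝ, ℝ) ∞ H) :
    ContinuousAt (fun y => (fieldGram σ (lieFields σ H W) W y)⁻¹) x :=
  continuousAt_pi.2 fun i => continuousAt_pi.2 fun j => (h.contMDiffAt_gram_inv hH i j).continuousAt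

theorem continuousAt_curvatureMatrix (h : IsAdaptedAt σ H W x)
    (hH : ContMDiff 𝓘(ℝ, E) 𝓘(ℝ, ℝ) ∞ H) : ContinuousAt (curvatureMatrix σ H W) x :=
  continuousAt_pi.2 fun i => continuousAt_pi.2 fun j =>
    (h.contMDiffAt_curvatureMatrix hH i j).continuousAt

end IsAdaptedAt

end AdaptedFields

/-! ### Comparison of adapted fields with normal frames -/

section AdaptedFields

variable {E : Type*} [NormedAddCommGroup E] [NormedSpace ℝ E] [FiniteDimensional ℝ E]
  {M : Type*} [TopologicalSpace M] [ChartedSpace E M] [IsManifold 𝓘(ℝ, E) ∞ M]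
  {σ : SymplecticForm E M} {Λ : LagrangianDistribution σ} {H : M → ℝ} [T2Space M]

theorem IsCompleteFlow.pullField_add_sum_smul {Y : ∀ x : M, TangentSpace 𝓘(ℝ, E) x}
    {Θ : ℝ → M → M} (hΘ : IsCompleteFlow Y Θ) {k : ℕ} (V : ∀ x : M, TangentSpace 𝓘(ℝ, E) x)
    (W : Fin k → ∀ x : M, TangentSpace 𝓘(ℝ, E) x) (a : Fin k → M → ℝ) (x : M) (t : ℝ) :
    hΘ.pullField (fun y => V y + ∑ j, a j y • W j y) x t =
      hΘ.pullField V x t + ∑ j, a j (Θ t x) • hΘ.pullField (W j) x t := by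
  have h : ∀ (L : E ≃L[ℝ] E) (v : E) (b : Fin k → ℝ) (w : Fin k → E),
      L (v + ∑ j, b j • w j) = L v + ∑ j, b j • L (w j) := by
    intro L v b w
    simp only [map_add, map_sum, map_smul]
  exact h (hΘ.derivEquiv t x).symm (V (Θ t x)) (fun j => a j (Θ t x)) (fun j => W j (Θ t x))

namespace IsHamiltonianFlowNear

variable {c : ℝ} {Y : ∀ x : M, TangentSpace 𝓘(ℝ, E) x} {Θ : ℝ → M → M}

theorem fieldGram_eq (h : IsHamiltonianFlowNear σ H c Y Θ) {x : M} (hx : H x = c) (t : ℝ) {k : ℕ}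
    (V W : Fin k → ∀ x : M, TangentSpace 𝓘(ℝ, E) x) :
    bilinGram (σ.modelForm x) (fun i => h.isCompleteFlow.pullField (V i) x t)
      (fun i => h.isCompleteFlow.pullField (W i) x t) = fieldGram σ V W (Θ t x) := by
  ext i j
  exact h.form_pullField hx t (V i) (W j)

/-- The curvature of a normal frame, in terms of adapted fields spanning the same subspaces. -/
theorem trace_eq_of_isAdaptedAt (h : IsHamiltonianFlowNear σ H c Y Θ) {x : M} (hx : H x = c)
    {k : ℕ} {W : Fin k → ∀ x : M, TangentSpace 𝓘(ℝ, E) x} (hW : IsAdaptedAt σ H W x)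
    {S : ℝ → Submodule ℝ E} {e : Fin k → ℝ → E}
    (he : ∀ t, IsNormalFrameAt (σ.modelForm x) S e t)
    (hS : ∀ᶠ s in 𝓝 (0 : ℝ), Module.finrank ℝ (S s) ≤ k)
    (hWS : ∀ᶠ s in 𝓝 (0 : ℝ), ∀ i, h.isCompleteFlow.pullField (W i) x s ∈ S s)
    {R : Matrix (Fin k) (Fin k) ℝ} (hR : R = bilinGram (σ.modelForm x)
      (fun k => deriv (deriv (e k)) 0) (fun k => deriv (e k) 0)) :
    R.trace = ((fieldGram σ (lieFields σ H W) W x)⁻¹ * curvatureMatrix σ H W x).trace ∧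
      (R * Rᵀ).trace = ((fieldGram σ (lieFields σ H W) W x)⁻¹ * curvatureMatrix σ H W x *
        ((fieldGram σ (lieFields σ H W) W x)⁻¹ * (curvatureMatrix σ H W x)ᵀ)).trace := by
  set hΘ := h.isCompleteFlow
  have hH := h.smooth
  have h0 : Θ 0 x = x := hΘ.zero x
  have hcont := (hΘ.continuous_left x).continuousAt (x := 0)
  rw [ContinuousAt, h0] at hcont
  have had : ∀ᶠ s in 𝓝 (0 : ℝ), IsAdaptedAt σ H W (Θ s x) := hcont.eventually hW.eventually
  let a : Fin k → ℝ → E := fun i => hΘ.pullField (W i) x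
  let F : Fin k → ℝ → E := fun i => hΘ.pullField (darbouxFields σ H W i) x
  have hFa : ∀ᶠ s in 𝓝 (0 : ℝ), bilinGram (σ.modelForm x) (fun i => F i s) (fun i => a i s) =
      fieldGram σ (lieFields σ H W) W (Θ s x) := by
    filter_upwards [had] with s hs
    exact (h.fieldGram_eq hx s _ _).trans hs.gram_darbouxFields
  -- Pulled back along the orbit, `W` becomes a frame of the curve and `darbouxFields` its isotropic
  -- velocity. This expresses the curvature at time 0 by fields defined near the point, whereas
  -- normal frames depend on the orbit.
  have key := exists_change_of_normalFrame (B := σ.modelForm x) (σ.form_isAlt x) (S := S) (e := e)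
    (t := 0) (Eventually.of_forall he) hS (a := a) (F := F)
    (K := fun s => shiftMatrix σ H W (Θ s x)) hWS ?_ ?_ ?_ ?_
    (F' := fun i => hΘ.pullField (lieFields σ H (darbouxFields σ H W) i) x 0) ?_
  · obtain ⟨D, hD1, hD2⟩ := key
    rw [hFa.self_of_nhds, h0] at hD1
    rw [← hR] at hD2
    have h1 : curvatureMatrix σ H W x = D * R * Dᵀ := by
      rw [← hD2]
      have := h.fieldGram_eq hx 0 (lieFields σ H (darbouxFields σ H W)) (darbouxFields σ H W)
      rw [h0] at this
      exact this.symm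
    exact trace_eq_of_change_of_frame hD1 h1 hW.det_ne_zero
  · filter_upwards [had] with s hs i
    refine (h.hasDerivAt_pullField hx (hs.smooth i)).congr_deriv ?_
    have h1 : F i s = hΘ.pullField (lieFields σ H W i) x s +
        matComb (shiftMatrix σ H W (Θ s x)) (fun j => a j s) i :=
      hΘ.pullField_add_sum_smul (lieFields σ H W i) W (fun j y => shiftMatrix σ H W y i j) x s
    rw [h1, add_sub_cancel_right]
    rfl
  · filter_upwards [had] with s hs
    exact (h.fieldGram_eq hx s _ _).trans (hs.gram_darbouxFields_self hH)
  · filter_upwards [had, hFa.eventually_nhds] with s hs hFs i j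
    have hW' := smoothFieldAt_lieFields (σ := σ) hH hs.smooth
    have h1 := hΘ.hasDerivAt_comp (x := x) (t := s)
      (g := fun y => fieldGram σ (lieFields σ H W) W y i j)
      ((contMDiffAt_fieldGram hW' hs.smooth i j).mdifferentiableAt (by simp))
    have h2 : (fun r => σ.modelForm x (F i r) (a j r)) =ᶠ[𝓝 s]
        fun r => fieldGram σ (lieFields σ H W) W (Θ r x) i j :=
      hFs.mono fun r hr => congr_fun (congr_fun hr i) j
    refine (h1.congr_of_eventuallyEq h2).congr_deriv ?_
    rw [(h.eventually_eq _ (h.energy_eq hx s)).self_of_nhds,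
      dirDeriv_fieldGram hH hW' hs.smooth, hFs.self_of_nhds, hs.shiftMatrix_mul_gram,
      hs.gram_mul_shiftMatrix hH]
    simp only [Matrix.add_apply, Matrix.sub_apply, Matrix.smul_apply, smul_eq_mul]
    ring
  · filter_upwards [had, hFa] with s hs hFs
    rw [hFs]
    exact hs.det_ne_zero
  · intro i
    have h1 := had.self_of_nhds
    exact h.hasDerivAt_pullField hx (h1.smoothFieldAt_darbouxFields hH i)

end IsHamiltonianFlowNear

end AdaptedFields

/-! ### Lower bound and continuity of the reduced curvature -/

section LocalBounds

variable {E : Type*} [NormedAddCommGroup E] [NormedSpace ℝ E] [FiniteDimensional ℝ E]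
  {M : Type*} [TopologicalSpace M] [ChartedSpace E M] [IsManifold 𝓘(ℝ, E) ∞ M]
  {σ : SymplecticForm E M} {Λ : LagrangianDistribution σ} {H : M → ℝ}

theorem isAdaptedAt_of_frame (hmono : IsMonotoneHamiltonian σ Λ H) {k : ℕ}
    {W : Fin k → ∀ x : M, TangentSpace 𝓘(ℝ, E) x} {x : M}
    (hW : ∀ᶠ y in 𝓝 x, (∀ i, SmoothFieldAt (W i) y) ∧ (∀ i, W i y ∈ Λ.toFun y) ∧
      LinearIndependent ℝ (fun i => W i y)) : IsAdaptedAt σ H W x := by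
  filter_upwards [hW, hW.eventually_nhds] with y hy hys
  refine ⟨hy.1, ?_, ?_⟩
  · ext i j
    exact (Λ.lagrangian y).1 _ (hy.2.1 i) _ (hy.2.1 j)
  · exact bilinGram_det_ne_zero_of_pos fun z hz =>
      hmono.pos hy.1 (hys.mono fun w hw => hw.2.1) hy.2.2 hz

/-- The combinations of a frame `V` which are skew-orthogonal to the Hamiltonian field. -/
noncomputable def reducedFields (σ : SymplecticForm E M) (H : M → ℝ) {m : ℕ}
    (V : Fin (m + 1) → ∀ x : M, TangentSpace 𝓘(ℝ, E) x) (p : Fin (m + 1)) (i : Fin m) (x : M) :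
    TangentSpace 𝓘(ℝ, E) x :=
  σ.toFun x (σ.hamiltonianField H x) (V p x) • V (p.succAbove i) x +
    (-σ.toFun x (σ.hamiltonianField H x) (V (p.succAbove i) x)) • V p x

theorem reducedFields_spec (hH : ContMDiff 𝓘(ℝ, E) 𝓘(ℝ, ℝ) ∞ H) {m : ℕ}
    {V : Fin (m + 1) → ∀ x : M, TangentSpace 𝓘(ℝ, E) x} {p : Fin (m + 1)} {x : M}
    (hV : (∀ i, SmoothFieldAt (V i) x) ∧ (∀ i, V i x ∈ Λ.toFun x) ∧
      LinearIndependent ℝ (fun i => V i x))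
    (hp : σ.toFun x (σ.hamiltonianField H x) (V p x) ≠ 0) :
    ((∀ i, SmoothFieldAt (reducedFields σ H V p i) x) ∧
      (∀ i, reducedFields σ H V p i x ∈ Λ.toFun x) ∧
      LinearIndependent ℝ (fun i => reducedFields σ H V p i x)) ∧
      ∀ i, σ.toFun x (σ.hamiltonianField H x) (reducedFields σ H V p i x) = 0 := by
  have hX := σ.smoothFieldAt_hamiltonianField hH x
  refine ⟨⟨fun i => ?_, fun i => ?_, ?_⟩, fun i => ?_⟩
  · exact (SmoothFieldAt.smul (σ.contMDiffAt_apply hX (hV.1 p)) (hV.1 _)).add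
      (SmoothFieldAt.smul (σ.contMDiffAt_apply hX (hV.1 _)).neg (hV.1 p))
  · exact Submodule.add_mem _ (Submodule.smul_mem _ _ (hV.2.1 _))
      (Submodule.smul_mem _ _ (hV.2.1 _))
  · rw [Fintype.linearIndependent_iff]
    intro g hg i
    set η := σ.toFun x (σ.hamiltonianField H x) (V p x)
    let θ : Fin m → ℝ := fun i => σ.toFun x (σ.hamiltonianField H x) (V (p.succAbove i) x)
    -- The combination with coefficients `g` has, in the frame `V`, the coefficients `g_i η` away
    -- from `p` and `-∑ g_i θ_i` at `p`; since `η ≠ 0`, the former determine `g`.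
    have h1 := Fintype.linearIndependent_iff.1 hV.2.2
      (p.insertNth (-∑ i, g i * θ i) (fun i => g i * η)) ?_ (p.succAbove i)
    · rw [Fin.insertNth_apply_succAbove] at h1
      exact (mul_eq_zero.1 h1).resolve_right hp
    · rw [Fin.sum_univ_succAbove _ p]
      simp only [Fin.insertNth_apply_same, Fin.insertNth_apply_succAbove]
      rw [← hg]
      simp only [reducedFields, smul_add, Finset.sum_add_distrib, smul_smul, neg_smul,
        smul_neg, Finset.sum_neg_distrib, ← Finset.sum_smul]
      exact add_comm _ _
  · simp only [reducedFields, map_add, map_smul, smul_eq_mul]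
    ring

variable [T2Space M]

namespace IsHamiltonianFlowNear

variable {c : ℝ} {Y : ∀ x : M, TangentSpace 𝓘(ℝ, E) x} {Θ : ℝ → M → M}

theorem exists_modelReducedFrame (h : IsHamiltonianFlowNear σ H c Y Θ)
    (hmono : IsMonotoneHamiltonian σ Λ H) {m : ℕ} (hn : Module.finrank ℝ E = 2 * (m + 1)) {x : M}
    (hx : H x = c) (h0 : σ.modelField H x ≠ 0) :
    ∃ e : Fin m → ℝ → E, ∀ t, IsNormalFrameAt (σ.modelForm x) (modelReducedCurve σ Λ H x) e t :=
  IsMonotoneCurve.exists_reduced_normalFrame (B := σ.modelForm x)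
    (J := modelJacobiCurve σ Λ H x) (h.isMonotoneCurve_jacobiCurve hmono hn hx) h0

/-- A frame of `Λ` exists near every point, including those with `X_H ∈ Λ`, so the norm of the
unreduced curvature is locally bounded. It bounds the reduced trace from below. -/
theorem reducedCurvatureTrace_ge_near (h : IsHamiltonianFlowNear σ H c Y Θ)
    (hmono : IsMonotoneHamiltonian σ Λ H) {m : ℕ} (hn : Module.finrank ℝ E = 2 * (m + 1))
    (h0 : ∀ x, H x = c → σ.modelField H x ≠ 0) (p : M) :
    ∃ C : ℝ, ∀ᶠ x in 𝓝 p, H x = c → -C ≤ reducedCurvatureTrace σ Λ H x := by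
  obtain ⟨V, hV⟩ := Λ.exists_frame hn p
  have hA : IsAdaptedAt σ H V p := isAdaptedAt_of_frame hmono hV
  have hcont : ContinuousAt (fun x => ((fieldGram σ (lieFields σ H V) V x)⁻¹ *
      curvatureMatrix σ H V x * ((fieldGram σ (lieFields σ H V) V x)⁻¹ *
      (curvatureMatrix σ H V x)ᵀ)).trace) p := by
    have h1 := hA.continuousAt_gram_inv h.smooth
    have h2 := hA.continuousAt_curvatureMatrix h.smooth
    have h3 : ContinuousAt (fun x => (curvatureMatrix σ H V x)ᵀ) p :=
      continuous_id.matrix_transpose.continuousAt.comp h2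
    exact continuous_id.matrix_trace.continuousAt.comp ((h1.mul h2).mul (h1.mul h3))
  obtain ⟨C, hC⟩ : ∃ C, ∀ᶠ x in 𝓝 p, ((fieldGram σ (lieFields σ H V) V x)⁻¹ *
      curvatureMatrix σ H V x * ((fieldGram σ (lieFields σ H V) V x)⁻¹ *
      (curvatureMatrix σ H V x)ᵀ)).trace < C :=
    ⟨_, hcont.eventually_lt_const (lt_add_one _)⟩
  refine ⟨(C + m) / 2, ?_⟩
  filter_upwards [hC, hA.eventually, hV.eventually_nhds] with x hxC hxA hxV hx
  have hJ : IsMonotoneCurve (σ.modelForm x) (modelJacobiCurve σ Λ H x) (m + 1) :=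
    h.isMonotoneCurve_jacobiCurve hmono hn hx
  have hfin : ∀ t, Module.finrank ℝ (modelJacobiCurve σ Λ H x t) ≤ m + 1 := by
    intro t
    have h1 := (hJ.lagrangian t).2
    have h2 := hJ.finrank_eq
    omega
  obtain ⟨F, hF⟩ := hJ.exists_normalFrame
  obtain ⟨e, he⟩ := h.exists_modelReducedFrame hmono hn hx (h0 x hx)
  have hcx := (h.isCompleteFlow.continuous_left x).continuousAt (x := 0)
  rw [ContinuousAt, h.isCompleteFlow.zero] at hcx
  have h1 := (h.trace_eq_of_isAdaptedAt hx hxA hF (Eventually.of_forall hfin)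
    ((hcx.eventually hxV).mono fun s hs i =>
      h.pullField_mem_jacobiCurve hx (hs.2.1 i)) rfl).2
  have h2 := normalFrame_trace_ge (B := σ.modelForm x) (σ.form_isAlt x)
    (S := modelReducedCurve σ Λ H x) (fun t => inf_le_left) hfin hF he 0
  have h3 := h.reducedCurvatureTrace_eq hmono hn hx (h0 x hx) he 0
  rw [h.isCompleteFlow.zero] at h3
  rw [h3]
  refine le_trans ?_ h2
  rw [h1]
  linarith

theorem exists_reducedCurvatureTrace_ge (h : IsHamiltonianFlowNear σ H c Y Θ)
    (hmono : IsMonotoneHamiltonian σ Λ H) {m : ℕ} (hn : Module.finrank ℝ E = 2 * (m + 1))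
    (h0 : ∀ x, H x = c → σ.modelField H x ≠ 0) (hc : IsCompact (H ⁻¹' {c})) :
    ∃ C : ℝ, ∀ x, H x = c → -C ≤ reducedCurvatureTrace σ Λ H x := by
  choose C hC using h.reducedCurvatureTrace_ge_near hmono hn h0 (Λ := Λ)
  obtain ⟨s, -, hs⟩ := hc.elim_nhds_subcover
    (fun p => {x | H x = c → -C p ≤ reducedCurvatureTrace σ Λ H x}) fun p _ => hC p
  obtain ⟨D, hD⟩ := (s.finite_toSet.image C).bddAbove
  refine ⟨D, fun x hx => ?_⟩
  obtain ⟨p, hp, hxp⟩ := mem_iUnion₂.1 (hs hx)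
  have h1 := hxp hx
  have h2 := hD (mem_image_of_mem C hp)
  linarith

/-- If `X_H ∉ Λ` at `p`, then nearby the sections of `Λ` tangent to the levels of `H` have a smooth
frame `reducedFields`. The bracket formula in this frame is continuous and computes the trace. -/
theorem continuousWithinAt_reducedCurvatureTrace (h : IsHamiltonianFlowNear σ H c Y Θ)
    (hmono : IsMonotoneHamiltonian σ Λ H) {m : ℕ} (hn : Module.finrank ℝ E = 2 * (m + 1))
    (h0 : ∀ x, H x = c → σ.modelField H x ≠ 0) {p : M} (hp : H p = c)
    (hgood : σ.hamiltonianField H p ∉ Λ.toFun p) :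
    ContinuousWithinAt (reducedCurvatureTrace σ Λ H) (H ⁻¹' {c}) p := by
  obtain ⟨V, hV⟩ := Λ.exists_frame hn p
  have hX := fun x => σ.smoothFieldAt_hamiltonianField h.smooth x
  obtain ⟨i, hi⟩ : ∃ i, σ.toFun p (σ.hamiltonianField H p) (V i p) ≠ 0 := by
    by_contra! hcon
    have hspan : Submodule.span ℝ (range fun i => V i p) = Λ.toFun p := by
      have : FiniteDimensional ℝ (TangentSpace 𝓘(ℝ, E) p) :=
        inferInstanceAs (FiniteDimensional ℝ E)
      refine Submodule.eq_of_le_of_finrank_eq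
        (Submodule.span_le.2 (range_subset_iff.2 hV.self_of_nhds.2.1)) ?_
      rw [finrank_span_eq_card hV.self_of_nhds.2.2, Fintype.card_fin]
      have h1 : 2 * Module.finrank ℝ (Λ.toFun p) = Module.finrank ℝ E := (Λ.lagrangian p).2
      omega
    refine hgood (IsLagrangianSubspace.mem_of_forall (V := E) (B := σ.modelForm p)
      (σ.form_isAlt p) (σ.nondegenerate p) (Λ.lagrangian p) fun w hw => ?_)
    have hw' : (w : TangentSpace 𝓘(ℝ, E) p) ∈ Submodule.span ℝ (range fun i => V i p) :=
      hspan.symm ▸ hw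
    have h2 : ∀ w ∈ Submodule.span ℝ (range fun i => V i p),
        σ.toFun p (σ.hamiltonianField H p) w = 0 := by
      intro w hw
      induction hw using Submodule.span_induction with
      | mem x hx => obtain ⟨i, rfl⟩ := hx; exact hcon i
      | zero => exact map_zero _
      | add x y _ _ hx hy => rw [map_add, hx, hy, add_zero]
      | smul a x _ hx => rw [map_smul, hx, smul_zero]
    have h3 := h2 _ hw'
    have h4 := σ.swap p (w : TangentSpace 𝓘(ℝ, E) p) (σ.hamiltonianField H p)
    rw [h3, neg_zero] at h4
    exact h4
  have hη : ∀ᶠ x in 𝓝 p, σ.toFun x (σ.hamiltonianField H x) (V i x) ≠ 0 :=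
    (σ.contMDiffAt_apply (hX p) (hV.self_of_nhds.1 i)).continuousAt.eventually_ne hi
  have hW : ∀ᶠ x in 𝓝 p, _ :=
    (hV.and hη).mono fun x hx => reducedFields_spec h.smooth hx.1 hx.2
  have hA : IsAdaptedAt σ H (reducedFields σ H V i) p :=
    isAdaptedAt_of_frame hmono (hW.mono fun x hx => hx.1)
  have hcont : ContinuousAt (fun x => ((fieldGram σ (lieFields σ H (reducedFields σ H V i))
      (reducedFields σ H V i) x)⁻¹ * curvatureMatrix σ H (reducedFields σ H V i) x).trace) p :=
    continuous_id.matrix_trace.continuousAt.comp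
      ((hA.continuousAt_gram_inv h.smooth).mul (hA.continuousAt_curvatureMatrix h.smooth))
  have heq : ∀ᶠ x in 𝓝 p, H x = c → reducedCurvatureTrace σ Λ H x =
      ((fieldGram σ (lieFields σ H (reducedFields σ H V i)) (reducedFields σ H V i) x)⁻¹ *
        curvatureMatrix σ H (reducedFields σ H V i) x).trace := by
    filter_upwards [hA.eventually, hW.eventually_nhds, hη.eventually_nhds, hV.eventually_nhds]
      with x hxA hxW hxη hxV hx
    have hJ : IsMonotoneCurve (σ.modelForm x) (modelJacobiCurve σ Λ H x) (m + 1) :=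
      h.isMonotoneCurve_jacobiCurve hmono hn hx
    obtain ⟨e, he⟩ := h.exists_modelReducedFrame hmono hn hx (h0 x hx)
    have hcx := (h.isCompleteFlow.continuous_left x).continuousAt (x := 0)
    rw [ContinuousAt, h.isCompleteFlow.zero] at hcx
    have hpullX : ∀ s, h.isCompleteFlow.pullField (σ.hamiltonianField H) x s = σ.modelField H x :=
      fun s => ((h.isCompleteFlow.derivEquiv s x).symm_apply_eq).2
        (h.derivEquiv_hamiltonianField hx s).symm
    have hform : ∀ s (W : ∀ x : M, TangentSpace 𝓘(ℝ, E) x),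
        σ.modelForm x (σ.modelField H x) (h.isCompleteFlow.pullField W x s) =
        σ.toFun (Θ s x) (σ.hamiltonianField H (Θ s x)) (W (Θ s x)) := by
      intro s W
      rw [← hpullX s]
      exact h.form_pullField hx s _ _
    have h1 := (h.trace_eq_of_isAdaptedAt hx hxA he ?_ ?_ rfl).1
    · have h3 := h.reducedCurvatureTrace_eq hmono hn hx (h0 x hx) he 0
      rw [h.isCompleteFlow.zero] at h3
      rw [h3, h1]
    -- If `X_H` lay in the Jacobi subspace, its pairing with the pulled back section `V i` would
    -- vanish, contrary to the choice of `i`.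
    · filter_upwards [hcx.eventually hxη, hcx.eventually hxV] with s hs hsV
      refine hJ.finrank_inf_le fun hmem => hs (Eq.trans ?_ ((hJ.lagrangian s).1 _ hmem _
        (h.pullField_mem_jacobiCurve hx (hsV.2.1 i))))
      exact (hform s (V i)).symm
    · filter_upwards [hcx.eventually hxW] with s hs j
      refine Submodule.mem_inf.2
        ⟨h.pullField_mem_jacobiCurve hx (hs.1.2.1 j), ?_⟩
      rw [LinearMap.mem_ker, hform]
      exact hs.2 j
  refine hcont.continuousWithinAt.congr_of_eventuallyEq ?_ (heq.self_of_nhds hp)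
  filter_upwards [mem_nhdsWithin_of_mem_nhds heq, self_mem_nhdsWithin] with x hx hxc
  exact hx hxc

theorem eventually_hamiltonianField_not_mem (h : IsHamiltonianFlowNear σ H c Y Θ)
    (hmono : IsMonotoneHamiltonian σ Λ H) {m : ℕ} (hn : Module.finrank ℝ E = 2 * (m + 1)) {x : M}
    (hx : H x = c) (h0 : σ.modelField H x ≠ 0) (t : ℝ) :
    ∀ᶠ s in 𝓝[≠] t, σ.hamiltonianField H (Θ s x) ∉ Λ.toFun (Θ s x) := by
  have hJ : IsMonotoneCurve (σ.modelForm x) (modelJacobiCurve σ Λ H x) (m + 1) :=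
    h.isMonotoneCurve_jacobiCurve hmono hn hx
  filter_upwards [hJ.eventually_not_mem h0 t] with s hs hmem
  refine hs ((h.mem_jacobiCurve hx).2 ?_)
  have e0 : ∀ w : E, w = σ.modelField H (Θ s x) →
    (w : TangentSpace 𝓘(ℝ, E) (Θ s x)) ∈ Λ.toFun (Θ s x) := by rintro _ rfl; exact hmem
  exact e0 _ (h.derivEquiv_hamiltonianField hx s)

end IsHamiltonianFlowNear

end LocalBounds

/-! ### The abstract setting: flows with an index alternative -/

section IndexFlow

/-- A continuous flow `φ` with a function `r`, the curvature, which is bounded below, continuous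
along the orbits and at almost all points of each orbit, and for which two variations with disjoint
supports cannot both have negative index. -/
structure IsIndexFlow {S : Type*} [TopologicalSpace S] (φ : ℝ → S → S) (r : S → ℝ) (m : ℕ) :
    Prop where
  zero : ∀ x, φ 0 x = x
  add : ∀ s t x, φ (s + t) x = φ s (φ t x)
  continuous : Continuous fun z : ℝ × S => φ z.1 z.2
  continuous_curvature : ∀ x, Continuous fun t => r (φ t x)
  continuousAt_curvature : ∀ x, ∀ᶠ t in 𝓝[≠] (0 : ℝ), ContinuousAt r (φ t x)
  curvature_ge : ∃ C, ∀ x, -C ≤ r x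
  index : ∀ x (T : ℝ), 0 ≤ T → ∀ ψ : Fin 2 → ℝ → ℝ, (∀ i, ContDiff ℝ ∞ (ψ i)) →
    (∀ i, ψ i 0 = 0 ∧ deriv (ψ i) 0 = 0) → (∀ i, ψ i T = 0 ∧ deriv (ψ i) T = 0) →
    (∀ t, ψ 0 t * ψ 1 t = 0) →
    ∃ i, 0 ≤ ∫ t in (0 : ℝ)..T, (m * deriv (ψ i) t ^ 2 - ψ i t ^ 2 * r (φ t x))

end IndexFlow

/-! ### The level flow as an index flow -/

section EnergyLevelFlow

variable {E : Type*} [NormedAddCommGroup E] [NormedSpace ℝ E] [FiniteDimensional ℝ E]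
  {M : Type*} [TopologicalSpace M] [ChartedSpace E M] [IsManifold 𝓘(ℝ, E) ∞ M]
  {σ : SymplecticForm E M} {Λ : LagrangianDistribution σ} {H : M → ℝ} [T2Space M]
  {c : ℝ} {Y : ∀ x : M, TangentSpace 𝓘(ℝ, E) x} {Θ : ℝ → M → M}

namespace IsHamiltonianFlowNear

/-- The restriction of the flow to the energy level. -/
def levelFlow (h : IsHamiltonianFlowNear σ H c Y Θ) (t : ℝ) (x : H ⁻¹' {c}) : H ⁻¹' {c} :=
  ⟨Θ t x, h.energy_eq x.2 t⟩

theorem isIndexFlow_levelFlow (h : IsHamiltonianFlowNear σ H c Y Θ)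
    (hmono : IsMonotoneHamiltonian σ Λ H) {m : ℕ} (hn : Module.finrank ℝ E = 2 * (m + 1))
    (h0 : ∀ x, H x = c → σ.modelField H x ≠ 0) (hc : IsCompact (H ⁻¹' {c}))
    (hconj : HasNoConjugatePointsOn σ Λ H (H ⁻¹' {c})) :
    IsIndexFlow h.levelFlow (fun x => reducedCurvatureTrace σ Λ H x) m where
  zero x := Subtype.ext (h.isCompleteFlow.zero x)
  add s t x := Subtype.ext (h.isCompleteFlow.add s t x)
  continuous := by
    refine Continuous.subtype_mk ?_ _
    exact h.isCompleteFlow.continuous_uncurry.comp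
      ((continuous_subtype_val.comp continuous_snd).prodMk continuous_fst)
  -- A single frame of the reduced Jacobi curve at `x` serves the whole orbit, so continuity in `t`
  -- also holds through the points with `X_H ∈ Λ`.
  continuous_curvature x := by
    obtain ⟨e, he⟩ := h.exists_modelReducedFrame hmono hn x.2 (h0 x x.2)
    have hsm : ∀ k, ContDiff ℝ ∞ (e k) :=
      fun k => contDiff_iff_contDiffAt.2 fun t => (he t).smooth k
    have hsm' : ∀ k, ContDiff ℝ ∞ (deriv (e k)) := fun k => (contDiff_infty_iff_deriv.1 (hsm k)).2
    have hsm'' : ∀ k, ContDiff ℝ ∞ (deriv (deriv (e k))) :=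
      fun k => (contDiff_infty_iff_deriv.1 (hsm' k)).2
    refine Continuous.congr ?_ fun t => (h.reducedCurvatureTrace_eq hmono hn x.2 (h0 x x.2) he t).symm
    exact continuous_finsetSum _ fun i _ =>
      Continuous.bilinForm (σ.modelForm x.1) (hsm'' i).continuous (hsm' i).continuous
  continuousAt_curvature x := by
    have h1 := h.eventually_hamiltonianField_not_mem hmono hn x.2 (h0 x x.2) (Λ := Λ) 0
    filter_upwards [h1] with t ht
    have h2 := h.continuousWithinAt_reducedCurvatureTrace hmono hn h0 (h.energy_eq x.2 t) ht
    have h3 : Θ t x ∈ H ⁻¹' {c} := h.energy_eq x.2 t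
    exact (continuousWithinAt_iff_continuousAt_domRestrict _ h3).1 h2
  curvature_ge := by
    obtain ⟨C, hC⟩ := h.exists_reducedCurvatureTrace_ge hmono hn h0 hc
    exact ⟨C, fun x => hC x x.2⟩
  index x T hT ψ hψ hψ0 hψT hdisj := by
    obtain ⟨e, he⟩ := h.exists_modelReducedFrame hmono hn x.2 (h0 x x.2)
    have hJ : IsMonotoneCurve (σ.modelForm x.1) (modelJacobiCurve σ Λ H x) (m + 1) :=
      h.isMonotoneCurve_jacobiCurve hmono hn x.2
    obtain ⟨i, hi⟩ := hJ.reduced_index_alternative (h0 x x.2)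
      (fun s t _ hst => h.jacobiCurve_sup_eq_top hconj x.2 hst) he hT hψ hψ0 hψT hdisj
    refine ⟨i, hi.trans_eq ?_⟩
    refine intervalIntegral.integral_congr fun t _ => ?_
    have := h.reducedCurvatureTrace_eq hmono hn x.2 (h0 x x.2) he t
    simp only [levelFlow, this]

end IsHamiltonianFlowNear

end EnergyLevelFlow

/-! ### Poincaré recurrence and measurability of the curvature -/

section Recurrence

variable {S : Type*} [TopologicalSpace S] {φ : ℝ → S → S} {r : S → ℝ} {m : ℕ}

/-- The integrand of the index form of the variation `ψ` along the orbit of `x`. -/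
noncomputable def indexIntegrand (φ : ℝ → S → S) (r : S → ℝ) (m : ℕ) (ψ : ℝ → ℝ) (x : S) (t : ℝ) :
    ℝ :=
  m * deriv ψ t ^ 2 - ψ t ^ 2 * r (φ t x)

theorem deriv_eq_zero_of_eqOn_compl {ψ : ℝ → ℝ} {a b : ℝ} (h : ∀ t, t ∉ Icc a b → ψ t = 0) {t : ℝ}
    (ht : t ∉ Icc a b) : deriv ψ t = 0 := by
  have h1 : ψ =ᶠ[𝓝 t] fun _ => 0 := by
    filter_upwards [isClosed_Icc.isOpen_compl.mem_nhds ht] with s hs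
    exact h s hs
  rw [h1.deriv_eq, deriv_const]

theorem indexIntegrand_eq_zero {ψ : ℝ → ℝ} {a b : ℝ} (h : ∀ t, t ∉ Icc a b → ψ t = 0) {t : ℝ}
    (ht : t ∉ Icc a b) (x : S) : indexIntegrand φ r m ψ x t = 0 := by
  rw [indexIntegrand, h t ht, deriv_eq_zero_of_eqOn_compl h ht]
  ring

theorem intervalIntegral_eq_of_eq_zero {f : ℝ → ℝ} {a b c d : ℝ} (hca : c ≤ a) (hab : a ≤ b)
    (hbd : b ≤ d) (hf : ∀ t, t ∉ Ioc a b → f t = 0) : ∫ t in c..d, f t = ∫ t in a..b, f t := by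
  rw [intervalIntegral.integral_of_le (hca.trans (hab.trans hbd)),
    intervalIntegral.integral_of_le hab]
  exact setIntegral_eq_of_subset_of_forall_sdiff_eq_zero measurableSet_Ioc
    (Ioc_subset_Ioc hca hbd) fun t ht => hf t ht.2

namespace IsIndexFlow

theorem continuous_indexIntegrand (h : IsIndexFlow φ r m) {ψ : ℝ → ℝ} (hψ : ContDiff ℝ ∞ ψ) (x : S) :
    Continuous (indexIntegrand φ r m ψ x) := by
  have h1 : Continuous (deriv ψ) := (contDiff_infty_iff_deriv.1 hψ).2.continuous
  exact (continuous_const.mul (h1.pow 2)).sub ((hψ.continuous.pow 2).mul (h.continuous_curvature x))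

theorem iterate_eq (h : IsIndexFlow φ r m) (L : ℝ) (n : ℕ) (x : S) :
    (φ L)^[n] x = φ (n * L) x := by
  induction n with
  | zero => simp [h.zero]
  | succ n ih =>
    rw [Function.iterate_succ_apply', ih, ← h.add]
    push_cast
    ring_nf

/-- Along recurrent orbits the index of compactly supported variations is nonnegative. -/
theorem ae_index_nonneg [MeasurableSpace S] (h : IsIndexFlow φ r m) {μ : Measure S}
    [IsFiniteMeasure μ] {L : ℝ} (hL : 0 < L) (hφ : MeasurePreserving (φ L) μ μ)
    {ψ : S → ℝ → ℝ} (hψ : ∀ x, ContDiff ℝ ∞ (ψ x)) {a b : ℝ} (ha : 0 < a) (hab : a ≤ b) (hb : b < L)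
    (hψ0 : ∀ x t, t ∉ Icc a b → ψ x t = 0)
    (hQ : Measurable fun x => ∫ t in (0 : ℝ)..L, indexIntegrand φ r m (ψ x) x t) :
    ∀ᵐ x ∂μ, 0 ≤ ∫ t in (0 : ℝ)..L, indexIntegrand φ r m (ψ x) x t := by
  set Q : S → ℝ := fun x => ∫ t in (0 : ℝ)..L, indexIntegrand φ r m (ψ x) x t
  have hA : MeasurableSet {x | Q x < 0} := measurableSet_lt hQ measurable_const
  -- Almost every point with negative index returns infinitely often, under iterates of the time-`L`
  -- map, to the set of points with negative index.
  have hrec := hφ.conservative.ae_mem_imp_frequently_image_mem hA.nullMeasurableSet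
  filter_upwards [hrec] with x hx
  by_contra hneg
  obtain ⟨n, hn, hxn⟩ := (frequently_atTop.1 (hx (not_le.1 hneg))) 1
  rw [h.iterate_eq] at hxn
  set y := φ (n * L) x
  have hn' : (1 : ℝ) ≤ n := by exact_mod_cast hn
  have hnL : L ≤ n * L := le_mul_of_one_le_left hL.le hn'
  -- The variation belonging to the return point, moved to the time of return. Its support lies in
  -- `(nL, nL + L)`; since `n ≥ 1`, it is disjoint from that of `ψ x`, and both indices are
  -- negative.
  let χ : ℝ → ℝ := fun t => ψ y (t - n * L)
  have hχ : ContDiff ℝ ∞ χ := (hψ y).comp (contDiff_id.sub contDiff_const)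
  have hχ0 : ∀ t, t ∉ Icc (a + n * L) (b + n * L) → χ t = 0 := fun t ht => by
    refine hψ0 y _ fun h1 => ht ⟨?_, ?_⟩
    · linarith [h1.1]
    · linarith [h1.2]
  have hT : (0 : ℝ) ≤ n * L + L := by linarith
  have hout : ∀ {a' b' t : ℝ}, t < a' ∨ b' < t → t ∉ Icc a' b' := by
    rintro a' b' t (h1 | h1) ⟨h2, h3⟩ <;> linarith
  have h1 : ∀ i t, (t ≤ 0 ∨ n * L + L ≤ t) → (![ψ x, χ] : Fin 2 → ℝ → ℝ) i t = 0 ∧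
      deriv ((![ψ x, χ] : Fin 2 → ℝ → ℝ) i) t = 0 := by
    intro i t ht
    fin_cases i
    · have : t ∉ Icc a b := hout (by rcases ht with h | h; (left; linarith); (right; linarith))
      exact ⟨hψ0 x t this, deriv_eq_zero_of_eqOn_compl (hψ0 x) this⟩
    · have : t ∉ Icc (a + n * L) (b + n * L) :=
        hout (by rcases ht with h | h; (left; linarith); (right; linarith))
      exact ⟨hχ0 t this, deriv_eq_zero_of_eqOn_compl hχ0 this⟩
  obtain ⟨i, hi⟩ := h.index x (n * L + L) hT ![ψ x, χ]
    (fun i => by fin_cases i <;> [exact hψ x; exact hχ])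
    (fun i => h1 i 0 (Or.inl le_rfl)) (fun i => h1 i _ (Or.inr le_rfl)) fun t => by
      change ψ x t * χ t = 0
      by_cases ht : t ≤ L
      · rw [hχ0 t (hout (Or.inl (by linarith))), mul_zero]
      · rw [hψ0 x t (hout (Or.inr (by linarith))), zero_mul]
  fin_cases i
  · change 0 ≤ ∫ t in (0 : ℝ)..(n * L + L), indexIntegrand φ r m (ψ x) x t at hi
    rw [intervalIntegral_eq_of_eq_zero le_rfl hL.le (by linarith) (fun t ht =>
      indexIntegrand_eq_zero (hψ0 x) (fun h2 => ht ⟨by linarith [h2.1], by linarith [h2.2]⟩) x)] at hi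
    exact hneg hi
  · change 0 ≤ ∫ t in (0 : ℝ)..(n * L + L), indexIntegrand φ r m χ x t at hi
    have h2 : ∀ t, indexIntegrand φ r m χ x t = indexIntegrand φ r m (ψ y) y (t - n * L) := by
      intro t
      have h3 : deriv χ t = deriv (ψ y) (t - n * L) := deriv_comp_sub_const _ _ _
      have h4 : φ t x = φ (t - n * L) y := by rw [← h.add, sub_add_cancel]
      rw [indexIntegrand, indexIntegrand, h3, h4]
    simp only [h2] at hi
    rw [intervalIntegral.integral_comp_sub_right (fun t => indexIntegrand φ r m (ψ y) y t),
      intervalIntegral_eq_of_eq_zero (a := 0) (b := L) (by linarith) hL.le (by linarith) (fun t ht =>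
      indexIntegrand_eq_zero (hψ0 y) (fun h2 => ht ⟨by linarith [h2.1], by linarith [h2.2]⟩) y)] at hi
    exact absurd hi (not_le.2 hxn)

variable [MeasurableSpace S] [BorelSpace S]

/-- The points of continuity of `r` form a `Gδ` set, so `r` cut off to them is measurable. For all
small nonzero times an orbit is in this set, and continuity along orbits exhibits `r` as a pointwise
limit of measurable functions. -/
theorem measurable_curvature [TopologicalSpace.PseudoMetrizableSpace S] (h : IsIndexFlow φ r m) :
    Measurable r := by
  classical
  have hG : MeasurableSet {x | ContinuousAt r x} := (IsGδ.setOfPred_continuousAt r).measurableSet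
  have hcont : ContinuousOn r {x | ContinuousAt r x} := fun x hx => ContinuousAt.continuousWithinAt hx
  let q : S → ℝ := piecewise {x | ContinuousAt r x} r 0
  have hq : Measurable q := hcont.measurable_piecewise continuousOn_const hG
  have hφ : ∀ t, Continuous (φ t) := fun t => h.continuous.comp (continuous_const.prodMk continuous_id)
  have hlim : Tendsto (fun n : ℕ => (1 : ℝ) / (n + 1)) atTop (𝓝 0) :=
    tendsto_one_div_add_atTop_nhds_zero_nat
  refine measurable_of_tendsto_metrizable (f := fun (n : ℕ) x => q (φ (1 / (n + 1)) x))
    (fun n => hq.comp (hφ _).measurable) (tendsto_pi_nhds.2 fun x => ?_)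
  have h1 := ((h.continuous_curvature x).tendsto 0).comp hlim
  rw [h.zero] at h1
  refine h1.congr' ?_
  have h2 : Tendsto (fun n : ℕ => (1 : ℝ) / (n + 1)) atTop (𝓝[≠] 0) :=
    tendsto_nhdsWithin_iff.2 ⟨hlim, Eventually.of_forall fun n =>
      (by positivity : (1 : ℝ) / (n + 1) ≠ 0)⟩
  filter_upwards [h2.eventually (h.continuousAt_curvature x)] with n hn
  have hn' : φ (1 / (n + 1)) x ∈ {x | ContinuousAt r x} := hn
  exact (piecewise_eq_of_mem _ _ _ hn').symm

end IsIndexFlow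

end Recurrence

/-! ### Averages along a measure preserving flow -/

section FlowAverages

variable {S : Type*} [MeasurableSpace S] {φ : ℝ → S → S} {μ : Measure S} [IsFiniteMeasure μ]

theorem measurePreserving_flow_prod (hm : Measurable fun z : ℝ × S => φ z.1 z.2)
    (hφ : ∀ t, MeasurePreserving (φ t) μ μ) (ν : Measure ℝ) [SFinite ν] :
    MeasurePreserving (fun z : ℝ × S => (z.1, φ z.1 z.2)) (ν.prod μ) (ν.prod μ) :=
  (MeasurePreserving.id ν).skew_product hm (Eventually.of_forall fun t => (hφ t).map_eq)

theorem integrable_flow_average (hm : Measurable fun z : ℝ × S => φ z.1 z.2)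
    (hφ : ∀ t, MeasurePreserving (φ t) μ μ) {w : ℝ → ℝ} (hw : Continuous w) {u : S → ℝ}
    (hu : Integrable u μ) (L : ℝ) :
    Integrable (fun z : ℝ × S => w z.1 * u (φ z.1 z.2))
      ((volume.restrict (Ioc 0 L)).prod μ) := by
  have h1 : Integrable w (volume.restrict (Ioc 0 L)) := hw.integrableOn_Ioc
  exact (measurePreserving_flow_prod hm hφ _).integrable_comp_of_integrable (h1.mul_prod hu)

theorem integrable_intervalIntegral_flow (hm : Measurable fun z : ℝ × S => φ z.1 z.2)
    (hφ : ∀ t, MeasurePreserving (φ t) μ μ) {w : ℝ → ℝ} (hw : Continuous w) {u : S → ℝ}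
    (hu : Integrable u μ) {L : ℝ} (hL : 0 ≤ L) :
    Integrable (fun x => ∫ t in (0 : ℝ)..L, w t * u (φ t x)) μ := by
  simp only [intervalIntegral.integral_of_le hL]
  exact (integrable_flow_average hm hφ hw hu L).integral_prod_right

/-- Fubini's theorem; for each time the inner integral is `∫ u dμ` by invariance. -/
theorem integral_flow_average (hm : Measurable fun z : ℝ × S => φ z.1 z.2)
    (hφ : ∀ t, MeasurePreserving (φ t) μ μ) {w : ℝ → ℝ} (hw : Continuous w) {u : S → ℝ}
    (hu : Integrable u μ) {L : ℝ} (hL : 0 ≤ L) :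
    ∫ x, (∫ t in (0 : ℝ)..L, w t * u (φ t x)) ∂μ = (∫ t in (0 : ℝ)..L, w t) * ∫ x, u x ∂μ := by
  simp only [intervalIntegral.integral_of_le hL]
  rw [← integral_integral_swap (integrable_flow_average hm hφ hw hu L), ← integral_mul_const]
  refine integral_congr_ae (Eventually.of_forall fun t => ?_)
  change ∫ x, w t * u (φ t x) ∂μ = w t * ∫ x, u x ∂μ
  rw [integral_const_mul]
  congr 1
  have h1 : AEStronglyMeasurable u (μ.map (φ t)) := by rw [(hφ t).map_eq]; exact hu.1
  have h2 := integral_map (hφ t).measurable.aemeasurable h1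
  rw [(hφ t).map_eq] at h2
  exact h2.symm

/-- A function which is bounded below is integrable if its averages along the flow are bounded. -/
theorem integrable_of_flow_average_le (hm : Measurable fun z : ℝ × S => φ z.1 z.2)
    (hφ : ∀ t, MeasurePreserving (φ t) μ μ) {w : ℝ → ℝ} (hw : Continuous w) (hw0 : ∀ t, 0 ≤ w t)
    {u : S → ℝ} (hu : Measurable u) (hu0 : ∀ x, 0 ≤ u x) (huc : ∀ x, Continuous fun t => u (φ t x))
    {L : ℝ} (hL : 0 ≤ L) (hwL : 0 < ∫ t in (0 : ℝ)..L, w t) {K : ℝ}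
    (hK : ∀ᵐ x ∂μ, ∫ t in (0 : ℝ)..L, w t * u (φ t x) ≤ K) : Integrable u μ := by
  have h1 : ∀ᵐ x ∂μ, ∫⁻ t in Ioc 0 L, ENNReal.ofReal (w t) * ENNReal.ofReal (u (φ t x)) ≤
      ENNReal.ofReal K := by
    filter_upwards [hK] with x hx
    have hint : Integrable (fun t => w t * u (φ t x)) (volume.restrict (Ioc 0 L)) :=
      (hw.mul (huc x)).integrableOn_Ioc
    rw [intervalIntegral.integral_of_le hL] at hx
    have h2 := ofReal_integral_eq_lintegral_ofReal hint
      (Eventually.of_forall fun t => mul_nonneg (hw0 t) (hu0 _))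
    simp only [ENNReal.ofReal_mul (hw0 _)] at h2
    rw [← h2]
    exact ENNReal.ofReal_le_ofReal hx
  have hmeas : Measurable fun z : S × ℝ =>
      ENNReal.ofReal (w z.2) * ENNReal.ofReal (u (φ z.2 z.1)) := by
    have h2 : Measurable fun z : S × ℝ => φ z.2 z.1 := hm.comp measurable_swap
    exact (hw.measurable.comp measurable_snd).ennreal_ofReal.mul (hu.comp h2).ennreal_ofReal
  have h2 := lintegral_mono_ae h1
  rw [lintegral_const, lintegral_lintegral_swap hmeas.aemeasurable] at h2
  have h3 : ∀ t, ∫⁻ x, ENNReal.ofReal (w t) * ENNReal.ofReal (u (φ t x)) ∂μ =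
      ENNReal.ofReal (w t) * ∫⁻ x, ENNReal.ofReal (u x) ∂μ := by
    intro t
    have h3 : Measurable fun x => u (φ t x) := hu.comp (hφ t).measurable
    rw [lintegral_const_mul _ h3.ennreal_ofReal]
    congr 1
    exact (hφ t).lintegral_comp hu.ennreal_ofReal
  simp only [h3] at h2
  rw [lintegral_mul_const _ hw.measurable.ennreal_ofReal] at h2
  have h4 : ∫⁻ t in Ioc 0 L, ENNReal.ofReal (w t) = ENNReal.ofReal (∫ t in (0 : ℝ)..L, w t) := by
    rw [intervalIntegral.integral_of_le hL]
    exact (ofReal_integral_eq_lintegral_ofReal hw.integrableOn_Ioc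
      (Eventually.of_forall hw0)).symm
  rw [h4] at h2
  have h5 : ∫⁻ x, ENNReal.ofReal (u x) ∂μ < ⊤ := by
    by_contra hcon
    rw [not_lt, top_le_iff] at hcon
    -- By Tonelli and invariance the left side of `h2` is `(∫ w)(∫ u dμ)`. The bound on the right is
    -- finite because `μ` is.
    rw [hcon, ENNReal.mul_top (by simpa using hwL)] at h2
    exact absurd h2 (not_le.2 (ENNReal.mul_lt_top ENNReal.ofReal_lt_top (measure_lt_top μ _)))
  refine ⟨hu.aestronglyMeasurable, ?_⟩
  rw [hasFiniteIntegral_iff_ofReal (Eventually.of_forall hu0)]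
  exact h5

end FlowAverages

/-! ### The integral inequality and the case of equality -/

section IndexInequality

/-- A smooth function supported in the middle of the unit interval. -/
theorem exists_unit_bump : ∃ b : ℝ → ℝ, ContDiff ℝ ∞ b ∧
    (∀ t, t ∉ Icc (1 / 4 : ℝ) (3 / 4) → b t = 0) ∧ 0 < ∫ t in (0 : ℝ)..1, b t ^ 2 := by
  let f : ContDiffBump (1 / 2 : ℝ) := ⟨1 / 8, 1 / 4, by norm_num, by norm_num⟩
  refine ⟨f, f.contDiff, fun t ht => ?_, ?_⟩
  · refine f.zero_of_le_dist ?_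
    change 1 / 4 ≤ dist t (1 / 2)
    rw [Real.dist_eq]
    by_contra hcon
    have := abs_lt.1 (not_le.1 hcon)
    exact ht ⟨by linarith [this.1], by linarith [this.2]⟩
  · have hc : Continuous fun t => f t ^ 2 := f.continuous.pow 2
    refine intervalIntegral.integral_pos zero_lt_one hc.continuousOn (fun t _ => sq_nonneg _)
      ⟨1 / 2, by norm_num, ?_⟩
    have : f (1 / 2) = 1 := f.one_of_mem_closedBall (Metric.mem_closedBall_self (by norm_num))
    rw [this]
    norm_num

theorem integral_comp_div_sq (b : ℝ → ℝ) {L : ℝ} (hL : 0 < L) :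
    ∫ t in (0 : ℝ)..L, b (t / L) ^ 2 = L * ∫ t in (0 : ℝ)..1, b t ^ 2 := by
  rw [intervalIntegral.integral_comp_div (fun t => b t ^ 2) hL.ne', zero_div, div_self hL.ne',
    smul_eq_mul]

variable {S : Type*} [TopologicalSpace S] {φ : ℝ → S → S} {r : S → ℝ} {m : ℕ}

/-- `g` is a continuous function which is smooth along the flow with continuous derivative `g'`. -/
structure IsSmoothAlong (φ : ℝ → S → S) (g g' : S → ℝ) : Prop where
  continuous : Continuous g
  continuous_deriv : Continuous g'
  hasDerivAt : ∀ x t, HasDerivAt (fun t => g (φ t x)) (g' (φ t x)) t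
  contDiff : ∀ x, ContDiff ℝ ∞ fun t => g (φ t x)

theorem isSmoothAlong_one (φ : ℝ → S → S) : IsSmoothAlong φ 1 0 :=
  ⟨continuous_const, continuous_const, fun _ _ => hasDerivAt_const _ _, fun _ => contDiff_const⟩

theorem Continuous.integrable_of_compactSpace [CompactSpace S] [T2Space S] [MeasurableSpace S] [BorelSpace S]
    {μ : Measure S} [IsFiniteMeasure μ] {u : S → ℝ} (hu : Continuous u) : Integrable u μ := by
  have := hu.continuousOn.integrableOn_compact (μ := μ) isCompact_univ
  rwa [integrableOn_univ] at this

namespace IsIndexFlow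

variable [CompactSpace S] [SecondCountableTopology S] [T2Space S] [MeasurableSpace S]
  [BorelSpace S] {μ : Measure S} [IsFiniteMeasure μ]

/-- The averages of `g² r` along almost every orbit are bounded by the Dirichlet integrals. -/
theorem ae_average_le (h : IsIndexFlow φ r m) (hφ : ∀ t, MeasurePreserving (φ t) μ μ)
    {g g' : S → ℝ} (hg : IsSmoothAlong φ g g') {b : ℝ → ℝ} (hb : ContDiff ℝ ∞ b)
    (hb0 : ∀ t, t ∉ Icc (1 / 4 : ℝ) (3 / 4) → b t = 0) {L : ℝ} (hL : 0 < L) :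
    ∀ᵐ x ∂μ, ∫ t in (0 : ℝ)..L, b (t / L) ^ 2 * (g (φ t x) ^ 2 * r (φ t x)) ≤
      (∫ t in (0 : ℝ)..L, (2 * m * (deriv b (t / L) / L) ^ 2) * g (φ t x) ^ 2) +
        ∫ t in (0 : ℝ)..L, (2 * m * b (t / L) ^ 2) * g' (φ t x) ^ 2 := by
  have hr := h.measurable_curvature
  have hm : Measurable fun z : S × ℝ => φ z.2 z.1 :=
    (h.continuous.comp continuous_swap).measurable
  have hb' : Continuous (deriv b) := (contDiff_infty_iff_deriv.1 hb).2.continuous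
  have hdiv : Continuous fun t : ℝ => t / L := continuous_id.div_const L
  -- The test function varies with the orbit. Its support in time stays in `[L/4, 3L/4]`, as the
  -- recurrence argument requires.
  let ψ : S → ℝ → ℝ := fun x t => b (t / L) * g (φ t x)
  have hψ : ∀ x, ContDiff ℝ ∞ (ψ x) := fun x =>
    (hb.comp (contDiff_id.div_const L)).mul (hg.contDiff x)
  have hψd : ∀ x t, deriv (ψ x) t = deriv b (t / L) / L * g (φ t x) + b (t / L) * g' (φ t x) := by
    intro x t
    have h1 : HasDerivAt (fun t => b (t / L)) (deriv b (t / L) / L) t := by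
      have h2 := HasDerivAt.comp t (hb.differentiable (by simp) (t / L)).hasDerivAt
        ((hasDerivAt_id t).div_const L)
      refine h2.congr_deriv ?_
      rw [mul_one_div]
    exact (h1.mul (hg.hasDerivAt x t)).deriv
  have hψ0 : ∀ x t, t ∉ Icc (L / 4) (3 * L / 4) → ψ x t = 0 := by
    intro x t ht
    have : t / L ∉ Icc (1 / 4 : ℝ) (3 / 4) := by
      rintro ⟨h1, h2⟩
      rw [le_div_iff₀ hL] at h1
      rw [div_le_iff₀ hL] at h2
      exact ht ⟨by linarith, by linarith⟩
    change b (t / L) * _ = 0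
    rw [hb0 _ this, zero_mul]
  have hQ : Measurable fun x => ∫ t in (0 : ℝ)..L, indexIntegrand φ r m (ψ x) x t := by
    simp only [intervalIntegral.integral_of_le hL.le, indexIntegrand, hψd]
    refine (StronglyMeasurable.integral_prod_right (f := fun x t => _) ?_).measurable
    refine Measurable.stronglyMeasurable ?_
    have m1 : Measurable fun z : S × ℝ => z.2 / L := measurable_snd.div_const L
    have m2 : Measurable fun z : S × ℝ => g (φ z.2 z.1) := hg.continuous.measurable.comp hm
    have m3 : Measurable fun z : S × ℝ => g' (φ z.2 z.1) := hg.continuous_deriv.measurable.comp hm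
    have m4 : Measurable fun z : S × ℝ => r (φ z.2 z.1) := hr.comp hm
    have m5 : Measurable fun z : S × ℝ => b (z.2 / L) := hb.continuous.measurable.comp m1
    have m6 : Measurable fun z : S × ℝ => deriv b (z.2 / L) / L :=
      (hb'.measurable.comp m1).div_const L
    exact (measurable_const.mul (((m6.mul m2).add (m5.mul m3)).pow_const 2)).sub
      (((m5.mul m2).pow_const 2).mul m4)
  filter_upwards [h.ae_index_nonneg hL (hφ L) hψ (by linarith) (by linarith) (by linarith) hψ0 hQ]
    with x hx
  have c1 : Continuous fun t => g (φ t x) := (hg.contDiff x).continuous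
  have c2 : Continuous fun t => g' (φ t x) := hg.continuous_deriv.comp
    (h.continuous.comp (continuous_id.prodMk continuous_const))
  have c3 := h.continuous_curvature x
  have c4 : Continuous fun t => b (t / L) := hb.continuous.comp hdiv
  have c5 : Continuous fun t => deriv b (t / L) / L := (hb'.comp hdiv).div_const L
  have i1 : Continuous fun t => b (t / L) ^ 2 * (g (φ t x) ^ 2 * r (φ t x)) :=
    (c4.pow 2).mul ((c1.pow 2).mul c3)
  have i2 : Continuous fun t => (2 * m * (deriv b (t / L) / L) ^ 2) * g (φ t x) ^ 2 :=
    (continuous_const.mul (c5.pow 2)).mul (c1.pow 2)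
  have i3 : Continuous fun t => (2 * m * b (t / L) ^ 2) * g' (φ t x) ^ 2 :=
    (continuous_const.mul (c4.pow 2)).mul (c2.pow 2)
  rw [← intervalIntegral.integral_add (i2.intervalIntegrable _ _) (i3.intervalIntegrable _ _)]
  have h1 : ∫ t in (0 : ℝ)..L, indexIntegrand φ r m (ψ x) x t ≤
      ∫ t in (0 : ℝ)..L, (((2 * m * (deriv b (t / L) / L) ^ 2) * g (φ t x) ^ 2 +
        (2 * m * b (t / L) ^ 2) * g' (φ t x) ^ 2) -
        b (t / L) ^ 2 * (g (φ t x) ^ 2 * r (φ t x))) := by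
    refine intervalIntegral.integral_mono_on hL.le
      ((h.continuous_indexIntegrand (hψ x) x).intervalIntegrable _ _)
      (((i2.add i3).sub i1).intervalIntegrable _ _) fun t _ => ?_
    rw [indexIntegrand, hψd]
    change m * (deriv b (t / L) / L * g (φ t x) + b (t / L) * g' (φ t x)) ^ 2 -
      (b (t / L) * g (φ t x)) ^ 2 * r (φ t x) ≤ _
    -- This is `(u + v)² ≤ 2u² + 2v²`; the factor 2 is harmless because both terms will be made to
    -- disappear.
    have h2 : (0 : ℝ) ≤ m * (deriv b (t / L) / L * g (φ t x) - b (t / L) * g' (φ t x)) ^ 2 := by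
      positivity
    linarith
  have h2 := intervalIntegral.integral_sub (μ := volume) ((i2.add i3).intervalIntegrable 0 L)
    (i1.intervalIntegrable 0 L)
  exact sub_nonneg.1 ((hx.trans h1).trans_eq h2)

/-- With `g = 1` and `L = 1` the weighted averages of `r` over almost every orbit have a common
upper bound. Adding the lower bound of `r` makes the function nonnegative, and Tonelli gives
integrability. -/
theorem integrable_curvature (h : IsIndexFlow φ r m) (hφ : ∀ t, MeasurePreserving (φ t) μ μ) :
    Integrable r μ := by
  obtain ⟨b, hb, hb0, hbpos⟩ := exists_unit_bump
  obtain ⟨C, hC⟩ := h.curvature_ge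
  have hae := h.ae_average_le hφ (isSmoothAlong_one φ) hb hb0 one_pos
  have h1 : Integrable (fun x => r x + C) μ := by
    refine integrable_of_flow_average_le h.continuous.measurable hφ (hb.continuous.pow 2)
      (fun t => sq_nonneg _) (h.measurable_curvature.add_const C) (fun x => by linarith [hC x])
      (fun x => (h.continuous_curvature x).add continuous_const) zero_le_one hbpos
      (K := (∫ t in (0 : ℝ)..1, 2 * m * deriv b t ^ 2) + ∫ t in (0 : ℝ)..1, b t ^ 2 * C) ?_
    filter_upwards [hae] with x hx
    simp only [div_one, Pi.one_apply, one_pow, one_mul, mul_one, Pi.zero_apply, ne_eq,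
      OfNat.ofNat_ne_zero, not_false_eq_true, zero_pow, mul_zero,
      intervalIntegral.integral_zero, add_zero] at hx
    simp only [Pi.pow_apply, mul_add]
    have h2 := intervalIntegral.integral_add (μ := volume)
      (((hb.continuous.pow 2).mul (h.continuous_curvature x)).intervalIntegrable 0 1)
      (((hb.continuous.pow 2).mul (continuous_const (y := C))).intervalIntegrable 0 1)
    exact h2.trans_le (add_le_add hx le_rfl)
  have h2 := h1.sub (integrable_const C)
  refine h2.congr (Eventually.of_forall fun x => ?_)
  simp

/-- Integration of the average inequality over the space, divided by the mass of the weight, which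
grows like `L`. The term with the derivative of the cut-off is of order `1/L²` after division. -/
theorem integral_sq_mul_curvature_le (h : IsIndexFlow φ r m)
    (hφ : ∀ t, MeasurePreserving (φ t) μ μ) {g g' : S → ℝ} (hg : IsSmoothAlong φ g g') :
    ∫ x, g x ^ 2 * r x ∂μ ≤ 2 * m * ∫ x, g' x ^ 2 ∂μ := by
  obtain ⟨b, hb, hb0, hbpos⟩ := exists_unit_bump
  have hr := h.integrable_curvature hφ
  have hm : Measurable fun z : ℝ × S => φ z.1 z.2 := h.continuous.measurable
  have hb' : Continuous (deriv b) := (contDiff_infty_iff_deriv.1 hb).2.continuous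
  have u1 : Integrable (fun x => g x ^ 2 * r x) μ := by
    obtain ⟨D, hD⟩ := (isCompact_range (hg.continuous.pow 2)).isBounded.exists_norm_le
    exact hr.bdd_mul (hg.continuous.pow 2).aestronglyMeasurable
      (Eventually.of_forall fun x => hD _ (mem_range_self x))
  have u2 : Integrable (fun x => g x ^ 2) μ := (hg.continuous.pow 2).integrable_of_compactSpace
  have u3 : Integrable (fun x => g' x ^ 2) μ := (hg.continuous_deriv.pow 2).integrable_of_compactSpace
  set A := ∫ x, g x ^ 2 * r x ∂μ
  set D := ∫ x, g' x ^ 2 ∂μ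
  set G := ∫ x, g x ^ 2 ∂μ
  set β := ∫ t in (0 : ℝ)..1, b t ^ 2
  set γ := ∫ t in (0 : ℝ)..1, deriv b t ^ 2
  have key : ∀ L : ℝ, 0 < L → A ≤ 2 * m * D + (2 * m * γ * G / β) * (1 / L) ^ 2 := by
    intro L hL
    have hdiv : Continuous fun t : ℝ => t / L := continuous_id.div_const L
    have w1 : Continuous fun t => b (t / L) ^ 2 := (hb.continuous.comp hdiv).pow 2
    have w2 : Continuous fun t => 2 * m * (deriv b (t / L) / L) ^ 2 :=
      continuous_const.mul (((hb'.comp hdiv).div_const L).pow 2)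
    have w3 : Continuous fun t => 2 * m * b (t / L) ^ 2 := continuous_const.mul w1
    have h1 := integral_mono_ae (integrable_intervalIntegral_flow hm hφ w1 u1 hL.le)
      ((integrable_intervalIntegral_flow hm hφ w2 u2 hL.le).add
        (integrable_intervalIntegral_flow hm hφ w3 u3 hL.le)) (h.ae_average_le hφ hg hb hb0 hL)
    have h2 := integral_add (integrable_intervalIntegral_flow hm hφ w2 u2 hL.le)
      (integrable_intervalIntegral_flow hm hφ w3 u3 hL.le)
    have h3 := h1.trans_eq h2
    rw [integral_flow_average hm hφ w1 u1 hL.le, integral_flow_average hm hφ w2 u2 hL.le,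
      integral_flow_average hm hφ w3 u3 hL.le, intervalIntegral.integral_const_mul,
      intervalIntegral.integral_const_mul, integral_comp_div_sq b hL] at h3
    have h4 : ∫ t in (0 : ℝ)..L, (deriv b (t / L) / L) ^ 2 = γ / L := by
      simp only [div_pow]
      rw [intervalIntegral.integral_div, integral_comp_div_sq (deriv b) hL]
      field_simp
      rfl
    rw [h4] at h3
    change L * β * A ≤ 2 * m * (γ / L) * G + 2 * m * (L * β) * D at h3
    have h5 : 0 < L * β := mul_pos hL hbpos
    rw [← mul_le_mul_iff_right₀ h5]
    refine h3.trans_eq ?_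
    have : β ≠ 0 := hbpos.ne'
    field_simp
    ring
  have hlim : Tendsto (fun L : ℝ => 2 * m * D + (2 * m * γ * G / β) * (1 / L) ^ 2) atTop
      (𝓝 (2 * m * D + (2 * m * γ * G / β) * 0 ^ 2)) := by
    have h1 : Tendsto (fun L : ℝ => 1 / L) atTop (𝓝 0) := by
      simpa using tendsto_inv_atTop_zero
    exact tendsto_const_nhds.add (tendsto_const_nhds.mul (h1.pow 2))
  have := ge_of_tendsto hlim ((eventually_gt_atTop 0).mono key)
  simpa using this

theorem integral_curvature_nonpos (h : IsIndexFlow φ r m)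
    (hφ : ∀ t, MeasurePreserving (φ t) μ μ) : ∫ x, r x ∂μ ≤ 0 := by
  have := h.integral_sq_mul_curvature_le hφ (isSmoothAlong_one φ)
  simpa using this

/-- In the case of equality the curvature is orthogonal to all functions smooth along the flow. -/
theorem integral_mul_curvature_eq_zero (h : IsIndexFlow φ r m)
    (hφ : ∀ t, MeasurePreserving (φ t) μ μ) (h0 : ∫ x, r x ∂μ = 0) {g g' : S → ℝ}
    (hg : IsSmoothAlong φ g g') : ∫ x, g x * r x ∂μ = 0 := by
  have hr := h.integrable_curvature hφ
  have bdd : ∀ {f : S → ℝ}, Continuous f → Integrable (fun x => f x * r x) μ := by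
    intro f hf
    obtain ⟨D, hD⟩ := (isCompact_range hf).isBounded.exists_norm_le
    exact hr.bdd_mul hf.aestronglyMeasurable (Eventually.of_forall fun x => hD _ (mem_range_self x))
  set A := ∫ x, g x * r x ∂μ
  set B := ∫ x, g x ^ 2 * r x ∂μ
  set D := ∫ x, g' x ^ 2 ∂μ
  -- The inequality for the function `1 + s g`. The term of order 0 is `∫ r = 0`, the right side is
  -- quadratic in `s`, so the linear term must vanish.
  have key : ∀ s : ℝ, 2 * s * A + s ^ 2 * B ≤ 2 * m * (s ^ 2 * D) := by
    intro s
    have hs : IsSmoothAlong φ (fun x => 1 + s * g x) (fun x => s * g' x) :=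
      ⟨continuous_const.add (continuous_const.mul hg.continuous),
        continuous_const.mul hg.continuous_deriv,
        fun x t => ((hg.hasDerivAt x t).const_mul s).const_add 1,
        fun x => contDiff_const.add (contDiff_const.mul (hg.contDiff x))⟩
    have h1 := h.integral_sq_mul_curvature_le hφ hs
    have h2 : ∫ x, (1 + s * g x) ^ 2 * r x ∂μ = 2 * s * A + s ^ 2 * B := by
      have h3 : (fun x => (1 + s * g x) ^ 2 * r x) =
          fun x => r x + (2 * s * (g x * r x) + s ^ 2 * (g x ^ 2 * r x)) := by
        funext x; ring
      have i1 := (bdd hg.continuous).const_mul (2 * s)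
      have i2 : Integrable (fun x => s ^ 2 * (g x ^ 2 * r x)) μ :=
        (bdd (hg.continuous.pow 2)).const_mul (s ^ 2)
      have h5 := integral_add hr (i1.add i2)
      have h6 := integral_add i1 i2
      rw [integral_const_mul, integral_const_mul] at h6
      rw [h3]
      refine h5.trans ?_
      rw [h0, zero_add]
      exact h6
    have h4 : ∫ x, (s * g' x) ^ 2 ∂μ = s ^ 2 * D := by
      simp only [mul_pow]
      rw [integral_const_mul]
    rw [h2, h4] at h1
    exact h1
  set K := 2 * m * D - B
  have hK : ∀ s : ℝ, 2 * s * A ≤ s ^ 2 * K := fun s => by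
    have := key s
    simp only [K]
    linarith
  by_contra hA
  -- For this `s` the left side is `2A²/(|K|+1)` and the right side at most half of it.
  have h1 := hK (A / (|K| + 1))
  have hpos : 0 < |K| + 1 := by positivity
  have h2 : (A / (|K| + 1)) ^ 2 * K ≤ A ^ 2 / (|K| + 1) := by
    rw [div_pow, div_mul_eq_mul_div, div_le_div_iff₀ (by positivity) hpos]
    have h3 : K ≤ |K| + 1 := by linarith [le_abs_self K]
    have h4 : 0 ≤ A ^ 2 * (|K| + 1) := by positivity
    nlinarith [mul_le_mul_of_nonneg_left h3 h4]
  have h3 : 2 * (A / (|K| + 1)) * A = 2 * (A ^ 2 / (|K| + 1)) := by ring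
  have h4 : 0 < A ^ 2 / (|K| + 1) := by positivity
  linarith

end IsIndexFlow

end IndexInequality

/-! ### Vanishing on the support -/

section Support

variable {S : Type*} [TopologicalSpace S] {φ : ℝ → S → S} {r : S → ℝ} {m : ℕ}
  [MeasurableSpace S] [BorelSpace S] {μ : Measure S}

theorem MeasureTheory.MeasurePreserving.mem_support {f : S → S} (hf : MeasurePreserving f μ μ)
    (hc : Continuous f) {x : S} (hx : x ∈ μ.support) : f x ∈ μ.support := by
  rw [(nhds_basis_opens x).mem_measureSupport] at hx
  rw [(nhds_basis_opens (f x)).mem_measureSupport]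
  rintro U ⟨hU, hUo⟩
  have h1 := hx (f ⁻¹' U) ⟨hU, hUo.preimage hc⟩
  rwa [hf.measure_preimage hUo.measurableSet.nullMeasurableSet] at h1

theorem ContinuousAt.eq_zero_of_ae_eq_zero {x : S} (hr : ContinuousAt r x)
    (h0 : ∀ᵐ x ∂μ, r x = 0) (hx : x ∈ μ.support) : r x = 0 := by
  by_contra hne
  have h1 : {y | r y ≠ 0} ∈ 𝓝 x := hr.eventually_ne hne
  rw [(𝓝 x).basis_sets.mem_measureSupport] at hx
  exact (hx _ h1).ne' h0

/-- The support is invariant. For small `t ≠ 0` the point `φ t x` is a continuity point of `r` in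
the support, so `r` vanishes there. Continuity along the orbit carries this to `x`, where `r` itself
may be discontinuous. -/
theorem IsIndexFlow.curvature_eq_zero_of_ae (h : IsIndexFlow φ r m)
    (hφ : ∀ t, MeasurePreserving (φ t) μ μ) (h0 : ∀ᵐ x ∂μ, r x = 0) {x : S}
    (hx : x ∈ μ.support) : r x = 0 := by
  have hc : ∀ t, Continuous (φ t) := fun t => h.continuous.comp (continuous_const.prodMk continuous_id)
  have h1 : ∀ᶠ t in 𝓝[≠] (0 : ℝ), r (φ t x) = 0 :=
    (h.continuousAt_curvature x).mono fun t ht =>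
      ht.eq_zero_of_ae_eq_zero h0 ((hφ t).mem_support (hc t) hx)
  have h2 : Tendsto (fun t => r (φ t x)) (𝓝[≠] 0) (𝓝 (r x)) := by
    have := (h.continuous_curvature x).tendsto 0
    rw [h.zero] at this
    exact this.mono_left nhdsWithin_le_nhds
  exact tendsto_nhds_unique h2 (tendsto_const_nhds.congr' (h1.mono fun t ht => ht.symm))

end Support

/-! ### Test functions and the invariant measure on the energy level -/

section EnergyLevelFlow

variable {E : Type*} [NormedAddCommGroup E] [NormedSpace ℝ E] [FiniteDimensional ℝ E]
  {M : Type*} [TopologicalSpace M] [ChartedSpace E M] [IsManifold 𝓘(ℝ, E) ∞ M]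
  {σ : SymplecticForm E M} {Λ : LagrangianDistribution σ} {H : M → ℝ} [T2Space M]
  {c : ℝ} {Y : ∀ x : M, TangentSpace 𝓘(ℝ, E) x} {Θ : ℝ → M → M}

theorem IsCompleteFlow.contDiff_comp (hΘ : IsCompleteFlow Y Θ) {g : M → ℝ}
    (hg : ContMDiff 𝓘(ℝ, E) 𝓘(ℝ, ℝ) ∞ g) (x : M) : ContDiff ℝ ∞ fun t => g (Θ t x) := by
  rw [contDiff_infty]
  intro n
  induction n generalizing g with
  | zero => exact contDiff_zero.2 (hg.continuous.comp (hΘ.continuous_left x))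
  | succ n ih =>
    have hd : ∀ t, HasDerivAt (fun t => g (Θ t x)) (dirDeriv g (Θ t x) (Y (Θ t x))) t := fun t =>
      hΘ.hasDerivAt_comp (hg.mdifferentiable (by simp) _)
    push_cast
    refine contDiff_succ_iff_deriv.2 ⟨fun t => (hd t).differentiableAt, by simp, ?_⟩
    rw [show deriv (fun t => g (Θ t x)) = fun t => dirDeriv g (Θ t x) (Y (Θ t x)) from
      funext fun t => (hd t).deriv]
    exact ih (g := fun y => dirDeriv g y (Y y)) fun y => contMDiffAt_dirDeriv (hg y) (hΘ.smooth y)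

namespace IsHamiltonianFlowNear

theorem isSmoothAlong (h : IsHamiltonianFlowNear σ H c Y Θ) {g : M → ℝ}
    (hg : ContMDiff 𝓘(ℝ, E) 𝓘(ℝ, ℝ) ∞ g) :
    IsSmoothAlong h.levelFlow (fun x => g x) (fun x => dirDeriv g (x : M) (Y x)) where
  continuous := hg.continuous.comp continuous_subtype_val
  continuous_deriv := by
    have h1 : Continuous fun y => dirDeriv g y (Y y) := continuous_iff_continuousAt.2 fun y =>
      (contMDiffAt_dirDeriv (hg y) (h.isCompleteFlow.smooth y)).continuousAt
    exact h1.comp continuous_subtype_val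
  hasDerivAt x t := h.isCompleteFlow.hasDerivAt_comp (hg.mdifferentiable (by simp) _)
  contDiff x := h.isCompleteFlow.contDiff_comp hg x

variable [MeasurableSpace M] [BorelSpace M]

theorem measurePreserving_levelFlow (h : IsHamiltonianFlowNear σ H c Y Θ)
    {μ : Measure (H ⁻¹' {c})} (hμ : IsFlowInvariant (σ.hamiltonianField H) μ) (t : ℝ) :
    MeasurePreserving (h.levelFlow t) μ μ := by
  have hcont : Continuous (h.levelFlow t) :=
    Continuous.subtype_mk ((h.isCompleteFlow.continuous_uncurry.comp
      (continuous_id.prodMk continuous_const)).comp continuous_subtype_val) _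
  have hcl : MeasurableSet (H ⁻¹' {c}) := (isClosed_singleton.preimage h.smooth.continuous).measurableSet
  refine ⟨hcont.measurable, Measure.ext fun A hA => ?_⟩
  rw [Measure.map_apply hcont.measurable hA]
  have h1 := hμ t (Subtype.val '' A) ((MeasurableEmbedding.subtype_coe hcl).measurableSet_image.2 hA)
  have h2 : {x : H ⁻¹' {c} | flow (σ.hamiltonianField H) t x ∈ Subtype.val '' A} =
      h.levelFlow t ⁻¹' A := by
    ext x
    rw [mem_ofPred_eq, h.flow_eq x.2, mem_preimage]
    constructor
    · rintro ⟨y, hy, hyx⟩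
      have : h.levelFlow t x = y := Subtype.ext hyx.symm
      rwa [this]
    · intro hx
      exact ⟨_, hx, rfl⟩
  have h3 : {x : H ⁻¹' {c} | (x : M) ∈ Subtype.val '' A} = A := by
    ext x
    exact Subtype.val_injective.mem_set_image
  rwa [h2, h3] at h1

end IsHamiltonianFlowNear

theorem ae_eq_zero_of_integral_contMDiff [SecondCountableTopology M] [MeasurableSpace M]
    [BorelSpace M] {s : Set M} (hs : MeasurableSet s) {μ : Measure s} {f : M → ℝ}
    (hf : Integrable (fun x : s => f x) μ)
    (h : ∀ g : M → ℝ, ContMDiff 𝓘(ℝ, E) 𝓘(ℝ, ℝ) ∞ g → ∫ x : s, g x * f x ∂μ = 0) :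
    ∀ᵐ x : s ∂μ, f x = 0 := by
  have : LocallyCompactSpace M := ChartedSpace.locallyCompactSpace E M
  have hemb := MeasurableEmbedding.subtype_coe hs
  have h1 : Integrable f (μ.map Subtype.val) := hemb.integrable_map_iff.2 hf
  have h2 := ae_eq_zero_of_integral_contMDiff_smul_eq_zero 𝓘(ℝ, E) h1.locallyIntegrable
    fun g hg _ => by
      rw [hemb.integral_map]
      exact h g hg
  exact hemb.ae_map_iff.1 h2

theorem SymplecticForm.modelField_ne_zero (hc : IsRegularValueOf (E := E) H c) {x : M}
    (hx : H x = c) : σ.modelField H x ≠ 0 := by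
  intro h0
  refine hc x hx (ContinuousLinearMap.ext fun v => ?_)
  have h1 := σ.hamiltonianField_apply (H := H) x v
  have h2 : σ.hamiltonianField H x = 0 := h0
  rw [h2, map_zero] at h1
  have h3 : dirDeriv H x v = 0 := neg_eq_zero.1 h1.symm
  exact h3

end EnergyLevelFlow

theorem mainTheorem2
    {E : Type*} [NormedAddCommGroup E] [NormedSpace ℝ E] [FiniteDimensional ℝ E]
    {M : Type*} [TopologicalSpace M] [T2Space M] [SecondCountableTopology M]
    [ChartedSpace E M] [IsManifold 𝓘(ℝ, E) ∞ M] [MeasurableSpace M] [BorelSpace M]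
    (σ : SymplecticForm E M) (Λ : LagrangianDistribution σ)
    (H : M → ℝ) (hH : ContMDiff 𝓘(ℝ, E) 𝓘(ℝ, ℝ) ∞ H)
    (hmono : IsMonotoneHamiltonian σ Λ H)
    (c : ℝ) (hc : IsRegularValueOf (E := E) H c) (hcompact : IsCompact (H ⁻¹' {c}))
    (hconj : HasNoConjugatePointsOn σ Λ H (H ⁻¹' {c}))
    (μ : Measure (H ⁻¹' {c})) [IsFiniteMeasure μ]
    (hμ : IsFlowInvariant (σ.hamiltonianField H) μ) :
    Integrable (fun x : H ⁻¹' {c} => reducedCurvatureTrace σ Λ H x) μ ∧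
    ∫ x : H ⁻¹' {c}, reducedCurvatureTrace σ Λ H x ∂μ ≤ 0 ∧
    (∫ x : H ⁻¹' {c}, reducedCurvatureTrace σ Λ H x ∂μ = 0 →
      ∀ x ∈ μ.support, reducedCurvatureTrace σ Λ H x = 0) := by
  -- A point of the level is needed to read off the dimension.
  rcases isEmpty_or_nonempty (H ⁻¹' {c}) with hempty | ⟨⟨x₀, hx₀⟩⟩
  · rw [Measure.eq_zero_of_isEmpty μ]
    exact ⟨integrable_zero_measure, by simp, fun _ x => hempty.elim x⟩
  obtain ⟨Y, Θ, h⟩ := exists_isHamiltonianFlowNear σ hH hcompact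
  have h0 : ∀ x, H x = c → σ.modelField H x ≠ 0 := fun x hx => σ.modelField_ne_zero hc hx
  -- The dimension is even because `Λ` is Lagrangian and positive because `X_H ≠ 0` on a regular
  -- level; `m` is the rank of the reduced curve.
  obtain ⟨m, hn⟩ : ∃ m, Module.finrank ℝ E = 2 * (m + 1) := by
    have h1 : 2 * Module.finrank ℝ (Λ.toFun x₀) = Module.finrank ℝ E := (Λ.lagrangian x₀).2
    have h2 : 0 < Module.finrank ℝ E := Module.finrank_pos_iff_exists_ne_zero.2 ⟨_, h0 x₀ hx₀⟩
    exact ⟨Module.finrank ℝ (Λ.toFun x₀) - 1, by omega⟩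
  have : CompactSpace (H ⁻¹' {c}) := isCompact_iff_compactSpace.1 hcompact
  have hflow := h.isIndexFlow_levelFlow hmono hn h0 hcompact hconj
  have hφ := h.measurePreserving_levelFlow hμ
  have hint := hflow.integrable_curvature hφ
  refine ⟨hint, hflow.integral_curvature_nonpos hφ, fun heq x hx => ?_⟩
  have hae : ∀ᵐ x : H ⁻¹' {c} ∂μ, reducedCurvatureTrace σ Λ H x = 0 :=
    ae_eq_zero_of_integral_contMDiff hcompact.isClosed.measurableSet hint fun g hg =>
      hflow.integral_mul_curvature_eq_zero hφ heq (h.isSmoothAlong hg)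
  exact hflow.curvature_eq_zero_of_ae hφ hae hx
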